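/- **Conventions.** All graphs are finite, nonempty, simple and undirected. For a graph $\Sigma$, $\Sigma(\tau)$ is the neighbourhood of $\tau$. An $s$-arc is a sequence $(\alpha_0,\dots,\alpha_s)$ of vertices with $\alpha_i,\alpha_{i+1}$ adjacent and $\alpha_{i-1}\neq\alpha_{i+1}$; $Arc_s(\Sigma)$ is the set of $s$-arcs. If a group $X$ acts on $V(\Sigma)$, then $\Sigma$ is *$(X,s)$-arc-transitive* (*$(X,s)$-arc-regular*) if $X$ preserves adjacency, is transitive on $V(\Sigma)$ and is transitive (regular) on $Arc_s(\Sigma)$; *$X$-symmetric* means $(X,1)$-arc-transitive; *$(X,s)$-transitive* means $(X,s)$-arc-transitive but not $(X,s+1)$-arc-transitive. For $H\le X$ preserving $S$, $H^S$ is the permutation group induced by $H$ on $S$. $X_B$ is the setwise stabilizer of $B$. A set of pairs (of $3$-arcs) is *self-paired* if it is closed under swapping (reversing). Let $\Gamma$ be an $X$-symmetric graph with an $X$-invariant partition $\mathcal B$ of $V(\Gamma)$ with $1<|B|<|V(\Gamma)|$ for $B\in\mathcal B$. The quotient graph $\Gamma_{\mathcal B}$ has vertex set $\mathcal B$, distinct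 $B,C$ being adjacent iff some vertex of $B$ is adjacent to some vertex of $C$. Put $\Gamma(C)=\bigcup_{w\in C}\Gamma(w)$ and, for $u\in V(\Gamma)$, $\Gamma_{\mathcal B}(u)=\{C\in\mathcal B: u\in\Gamma(C)\}$. For $u\in B\in\mathcal B$ and $C$ adjacent to $B$ in $\Gamma_{\mathcal B}$ the numbers $v=|B|$, $k=|\Gamma(C)\cap B|$, $r=|\Gamma_{\mathcal B}(u)|$, $b=|\Gamma_{\mathcal B}(B)|$ do not depend on the choices, and $\Gamma[B,C]$, the subgraph induced on $(\Gamma(C)\cap B)\cup(\Gamma(B)\cap C)$, does not depend on the choice of adjacent $B,C$ up to isomorphism. $\Gamma$ is a multicover of $\Gamma_{\mathcal B}$ if $k=v$. Let $\mathcal G$ be the class of such triples $(\Gamma,X,\mathcal B)$ with $b\ge2$ and $k\ne v$, and $\hat{\mathcal G}$ the subclass where $\Gamma_{\mathcal B}$ is connected and $X$ is faithful on $V(\Gamma)$. **Constructions.** Let $X$ act on $\Sigma$. * For a self-paired $X$-orbit $\Delta$ on $Arc_3(\Sigma)$: $\Xi(\Sigma,\Delta)$ has the arcs of $\Sigma$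 as vertices, $(\tau,\tau_1)\sim(\sigma,\sigma_1)$ iff $(\tau_1,\tau,\sigma,\sigma_1)\in\Delta$. $\gimel(\Sigma,\Delta)$ has as vertices the $2$-paths $[\tau_1,\tau,\tau_2]=[\tau_2,\tau,\tau_1]$ of $\Sigma$, with edges $\{[\alpha_0,\alpha_1,\alpha_2],[\alpha_1,\alpha_2,\alpha_3]\}$ for $(\alpha_0,\alpha_1,\alpha_2,\alpha_3)\in\Delta$. * $J(\Sigma)$ is the set of pairs $([\tau_1,\tau,\tau_2],[\sigma_1,\sigma,\sigma_2])$ of $2$-paths with $\sigma\in\Sigma(\tau)\setminus\{\tau_1,\tau_2\}$ and $\tau\in\Sigma(\sigma)\setminus\{\sigma_1,\sigma_2\}$. For a self-paired $X$-orbit $\Lambda$ on $J(\Sigma)$, $\Psi(\Sigma,\Lambda)$ is the graph on the $2$-paths with adjacency given by $\Lambda$. * A $3$-star is $\mathfrak s(\tau,S)=\{(\tau,\sigma):\sigma\in S\}$ with $S\subseteq\Sigma(\tau)$, $|S|=3$. $DSt^3(\Sigma)$ is the set of pairs $(\mathfrak s(\tau,L),\mathfrak s(\sigma,R))$ of $3$-stars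 with $\sigma\in L$, $\tau\in R$. An $X$-orbit $\Theta$ on $DSt^3(\Sigma)$ is $X$-symmetric if $X$ is transitive on the set $St(\Theta)$ of stars occurring in members of $\Theta$ and $X_\tau\cap X_S$ is transitive on $S$ for some $\mathfrak s(\tau,S)\in St(\Theta)$. If $\Theta$ is also self-paired, $\Pi(\Sigma,\Theta)$ is the graph on $St(\Theta)$ with adjacency given by $\Theta$. * For a cycle $C$ of $\Sigma$, $X_{[C]}$ is the subgroup of $X$ preserving the adjacency of $C$ and $X_{[C]}^{[C]}$ is the group it induces on $V(C)$. $\Sigma$ is *near $n$-gonal* with respect to a set $\mathcal E$ of $n$-cycles if it is connected of girth at least $4$ and every $2$-arc lies in a unique member of $\mathcal E$. * For a set $\Delta$ of $3$-arcs of $\Sigma$ and $m,n\in\mathbb N$, let $(\ast)_{\Delta,m,n}$ be: there is an $X$-orbit $\mathcal E$ of $n$-cycles of $\Sigma$ with $|\mathcal E|=m$, $\Delta=\bigcup_{C\in\mathcal E}Arc_3(C)$, $X_{[C]}^{[C]}\cong D_{2n}$ (dihedral of order $2n$) for all $C\in\mathcal E$, $m\ge6$, $n\ge girth(\Sigma)$,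 $mn=3|E(\Sigma)|=6|V(\Sigma)|$, and either $\Sigma\cong K_5$ or $\Sigma$ is near $n$-gonal with respect to $\mathcal E$. **Theorem.** (I) Let $(\Gamma,X,\mathcal B)\in\hat{\mathcal G}$ with $k=3$, let $B\in\mathcal B$, and let $e=|E(\Gamma_{\mathcal B})|$. Then $\Gamma_{\mathcal B}$ is $(X,2)$-arc-transitive if and only if one of the following holds: (a) $(v,b,r)=(4,4,3)$ and $X_B^B\cong A_4$ or $S_4$; (b) $(v,b,r)=(6,4,2)$ and $X_B^B\cong A_4$ or $S_4$; (c) $(v,b,r)=(7,7,3)$ and $X_B^B\cong PSL(3,2)$; (d) $v=3b\ge6$, $r=1$ and $X_B$ acts $2$-transitively on $\Gamma_{\mathcal B}(B)$. If (a) holds, then $X$ is faithful on $\mathcal B$ and $\Gamma\cong\Xi(\Gamma_{\mathcal B},\Delta)$ for some self-paired $X$-orbit $\Delta$ on $Arc_3(\Gamma_{\mathcal B})$ such that one of the following holds (with $\Sigma=\Gamma_{\mathcal B}$ in $(\ast)$): (a.1) $\Gamma[B,C]\cong3K_2$, $\Gamma$ has valency $3$, $(\ast)_{\Delta,m,n}$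 holds for some $m,n$, and either $X_B\cong A_4$, $\Gamma$ is $(X,1)$-arc-regular and $\Gamma_{\mathcal B}$ is $(X,2)$-arc-regular, or $X_B\cong S_4$ and $\Gamma$ is $(X,2)$-arc-regular; (a.2) $\Gamma[B,C]\cong K_{3,3}-3K_2$, $\Gamma$ has valency $6$, $X_B\cong S_4$, $\Gamma$ is connected and $(X,1)$-arc-regular, $\Delta'=Arc_3(\Gamma_{\mathcal B})\setminus\Delta$ is a self-paired $X$-orbit, and $(\ast)_{\Delta',m,n}$ holds for some $m,n$; (a.3) $\Gamma[B,C]\cong K_{3,3}$, $\Gamma$ has valency $9$, is connected and $(X,1)$-transitive, and $\Gamma_{\mathcal B}$ is $(X,3)$-arc-transitive. If (b) holds, then $X$ is faithful on $\mathcal B$ and $\Gamma\cong\gimel(\Gamma_{\mathcal B},\Delta)\cong\Psi(\Gamma_{\mathcal B},\Lambda)$ for some self-paired $X$-orbit $\Delta$ on $Arc_3(\Gamma_{\mathcal B})$ and some self-paired $X$-orbit $\Lambda$ on $J(\Gamma_{\mathcal B})$, such that one of the following holds: (b.1) $\Gamma[B,C]\cong3K_2$, for some $m,n$ we have $\Gamma\cong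 mC_n$ and $(\ast)_{\Delta,m,n}$, and either $X_B\cong A_4$, $\Gamma$ is $(X,1)$-arc-regular and $\Gamma_{\mathcal B}$ is $(X,2)$-arc-regular, or $X_B\cong S_4$ and $\Gamma$ is not $(X,1)$-arc-regular; (b.2) as (a.2), with valency $4$ in place of $6$; (b.3) as (a.3), with valency $6$ in place of $9$. If (c) holds, then $X$ is faithful on $\mathcal B$, $\Gamma\cong\Pi(\Gamma_{\mathcal B},\Theta)$ for some self-paired $X$-symmetric orbit $\Theta$ on $DSt^3(\Gamma_{\mathcal B})$, and one of the following holds: (c.1) $\Gamma[B,C]\cong3K_2$, $\Gamma$ has valency $3$ and is $(X,2)$-arc-transitive but not $(X,2)$-arc-regular; (c.2) $\Gamma[B,C]\cong K_{3,3}-3K_2$, $\Gamma$ has valency $6$, is connected and $(X,1)$-transitive; (c.3) $\Gamma[B,C]\cong K_{3,3}$, $\Gamma$ has valency $9$, is connected and $(X,1)$-transitive. If (d) holds, then one of the following holds: (d.1) $\Gamma[B,C]\cong3K_2$ and $\Gamma\cong3e\,K_2$; (d.2) $\Gamma[B,C]\cong K_{3,3}-3K_2$ and $\Gamma\cong e(K_{3,3}-3K_2)$;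 (d.3) $\Gamma[B,C]\cong K_{3,3}$ and $\Gamma\cong e\,K_{3,3}$. (II) Say that $(\Sigma,X)$ *occurs* in a case if there is $(\Gamma,X,\mathcal B)\in\mathcal G$ with $k=3$ in that case and an isomorphism $\Gamma_{\mathcal B}\cong\Sigma$ that commutes with the actions of $X$, where moreover $(\Gamma,X,\mathcal B)\in\hat{\mathcal G}$ if $X$ is faithful on $V(\Sigma)$. Every connected $(X,2)$-arc-transitive graph of valency $4$ occurs in case (a) and in case (b). A connected $X$-symmetric graph $\Sigma$ of valency $7$ occurs in case (c) if and only if $X_\tau^{\Sigma(\tau)}\cong PSL(3,2)$ for $\tau\in V(\Sigma)$. -/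

import Mathlib

open scoped Pointwise

universe u v

namespace SymmQuot

/-! ### Arcs and arc-transitivity -/

section Arcs

variable {V : Type*}

/-- `α = (α₀, …, α_s)` is an `s`-arc of `G`. -/
def IsArc (G : SimpleGraph V) (s : ℕ) (α : Fin (s + 1) → V) : Prop :=
  (∀ i : Fin s, G.Adj (α i.castSucc) (α i.succ)) ∧
    ∀ i j : Fin (s + 1), (i : ℕ) + 2 = (j : ℕ) → α i ≠ α j

/-- `Arc_s(G)`. -/
def arcs (G : SimpleGraph V) (s : ℕ) : Set (Fin (s + 1) → V) := {α | IsArc G s α}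

/-- `G` is regular of valency `d`. -/
def HasValency (G : SimpleGraph V) (d : ℕ) : Prop := ∀ u, (G.neighborSet u).ncard = d

variable (X : Type*) [Group X] [MulAction X V]

/-- `X` preserves the adjacency of `G` and is transitive on the vertices. -/
def IsVertexTransitive (G : SimpleGraph V) : Prop :=
  (∀ (g : X) (u w : V), G.Adj (g • u) (g • w) ↔ G.Adj u w) ∧ ∀ u w : V, ∃ g : X, g • u = w

/-- `G` is `(X,s)`-arc-transitive. For `s = 1` this is being `X`-symmetric. -/
def IsArcTransitive (G : SimpleGraph V) (s : ℕ) : Prop :=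
  IsVertexTransitive X G ∧ ∀ α ∈ arcs G s, ∀ β ∈ arcs G s, ∃ g : X, g • α = β

/-- `G` is `(X,s)`-arc-regular. -/
def IsArcRegular (G : SimpleGraph V) (s : ℕ) : Prop :=
  IsVertexTransitive X G ∧ ∀ α ∈ arcs G s, ∀ β ∈ arcs G s, ∃! g : X, g • α = β

/-- `G` is `(X,s)`-transitive: `(X,s)`-arc-transitive but not `(X,s+1)`-arc-transitive. -/
def IsSTransitive (G : SimpleGraph V) (s : ℕ) : Prop :=
  IsArcTransitive X G s ∧ ¬ IsArcTransitive X G (s + 1)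

/-- The permutation group on `S` induced by those elements of the subgroup `H` that leave
`S` invariant. -/
def inducedPerm {X : Type*} [Group X] [MulAction X V] (H : Subgroup X) (S : Set V) :
    Subgroup (Equiv.Perm S) where
  carrier := {π | ∃ g ∈ H, ∀ x : S, ((π x : S) : V) = g • (x : V)}
  one_mem' := ⟨1, H.one_mem, fun x => by simp⟩
  mul_mem' := by
    rintro π ρ ⟨g, hg, hπ⟩ ⟨h, hh, hρ⟩
    exact ⟨g * h, H.mul_mem hg hh, fun x => by
      rw [Equiv.Perm.mul_apply, hπ, hρ, mul_smul]⟩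
  inv_mem' := by
    rintro π ⟨g, hg, hπ⟩
    refine ⟨g⁻¹, H.inv_mem hg, fun x => ?_⟩
    rw [eq_inv_smul_iff, ← hπ]
    exact congrArg Subtype.val (π.apply_symm_apply x)

end Arcs

/-! ### Invariant partitions and quotient graphs -/

/-- An `X`-invariant partition of `V`, given by its equivalence relation. -/
structure InvPartition (X V : Type*) [Group X] [MulAction X V] extends Setoid V where
  smul_rel : ∀ (g : X) {a b : V}, toSetoid a b → toSetoid (g • a) (g • b)

namespace InvPartition

variable {X V : Type*} [Group X] [MulAction X V] (P : InvPartition X V)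

/-- The set `𝓑` of blocks of the partition. -/
def Block : Type _ := Quotient P.toSetoid

/-- The block containing `u`. -/
def blockOf (u : V) : P.Block := Quotient.mk P.toSetoid u

/-- A block as a set of vertices. -/
def carrier (B : P.Block) : Set V := {u | P.blockOf u = B}

/-- The induced action of `X` on the set of blocks. -/
instance : MulAction X P.Block where
  smul g := Quotient.map (fun u => g • u) (fun _ _ h => P.smul_rel g h)
  one_smul B := by
    induction B using Quotient.inductionOn with
    | h u => exact congrArg (Quotient.mk P.toSetoid) (one_smul X u)
  mul_smul g h B := by
    induction B using Quotient.inductionOn with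
    | h u => exact congrArg (Quotient.mk P.toSetoid) (mul_smul g h u)

/-- The quotient graph `Γ_𝓑`. -/
def quotientGraph (Γ : SimpleGraph V) : SimpleGraph P.Block where
  Adj B C := B ≠ C ∧ ∃ u ∈ P.carrier B, ∃ w ∈ P.carrier C, Γ.Adj u w
  symm := ⟨fun _ _ ⟨hne, u, hu, w, hw, h⟩ => ⟨hne.symm, w, hw, u, hu, h.symm⟩⟩
  loopless := ⟨fun _ h => h.1 rfl⟩

/-- `Γ(C)`, the set of vertices adjacent to some vertex of the block `C`. -/
def nbhd (Γ : SimpleGraph V) (C : P.Block) : Set V := {u | ∃ w ∈ P.carrier C, Γ.Adj w u}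

/-- `Γ_𝓑(u)`, the set of blocks `C` with `u ∈ Γ(C)`. -/
def blocksAt (Γ : SimpleGraph V) (u : V) : Set P.Block := {C | u ∈ P.nbhd Γ C}

/-- `Γ(C) ∩ B`. -/
def trace (Γ : SimpleGraph V) (B C : P.Block) : Set V := P.nbhd Γ C ∩ P.carrier B

/-- `Γ[B,C]`, the subgraph induced on `(Γ(C) ∩ B) ∪ (Γ(B) ∩ C)`. -/
def between (Γ : SimpleGraph V) (B C : P.Block) :
    SimpleGraph ↥(P.trace Γ B C ∪ P.trace Γ C B) :=
  Γ.induce (P.trace Γ B C ∪ P.trace Γ C B)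

/-- `Γ[B,C] ≅ H` for all adjacent blocks `B`, `C`. -/
def BetweenIso {W : Type*} (Γ : SimpleGraph V) (H : SimpleGraph W) : Prop :=
  ∀ B C : P.Block, (P.quotientGraph Γ).Adj B C → Nonempty (P.between Γ B C ≃g H)

/-- The class `𝒢`: `Γ` is `X`-symmetric, the partition is nontrivial, `Γ_𝓑` has valency at
least two, and `Γ` is not a multicover of `Γ_𝓑`. -/
structure InG (Γ : SimpleGraph V) : Prop where
  symmetric : IsArcTransitive X Γ 1
  nontrivial : ∀ B : P.Block, 1 < (P.carrier B).ncard ∧ (P.carrier B).ncard < Nat.card V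
  two_le_valency : ∀ B : P.Block, 2 ≤ ((P.quotientGraph Γ).neighborSet B).ncard
  not_multicover : ∀ B C : P.Block, (P.quotientGraph Γ).Adj B C →
    (P.trace Γ B C).ncard ≠ (P.carrier B).ncard

/-- The subclass of `𝒢` in which `Γ_𝓑` is connected and `X` is faithful on the vertices. -/
structure InGHat (Γ : SimpleGraph V) : Prop extends P.InG Γ where
  connected : (P.quotientGraph Γ).Connected
  faithful : FaithfulSMul X V

/-- The permutation group `X_B^B`. -/
def blockGroup (B : P.Block) : Subgroup (Equiv.Perm (P.carrier B)) :=
  inducedPerm (MulAction.stabilizer X B) (P.carrier B)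

/-- Case (a): `(v,b,r) = (4,4,3)` and `X_B^B` is `A₄` or `S₄`; here `u ∈ B`. -/
def CaseA (Γ : SimpleGraph V) (B : P.Block) (u : V) : Prop :=
  (P.carrier B).ncard = 4 ∧ ((P.quotientGraph Γ).neighborSet B).ncard = 4 ∧
  (P.blocksAt Γ u).ncard = 3 ∧
  (Nonempty (P.blockGroup B ≃* alternatingGroup (Fin 4)) ∨
    Nonempty (P.blockGroup B ≃* Equiv.Perm (Fin 4)))

/-- Case (b): `(v,b,r) = (6,4,2)` and `X_B^B` is `A₄` or `S₄`; here `u ∈ B`. -/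
def CaseB (Γ : SimpleGraph V) (B : P.Block) (u : V) : Prop :=
  (P.carrier B).ncard = 6 ∧ ((P.quotientGraph Γ).neighborSet B).ncard = 4 ∧
  (P.blocksAt Γ u).ncard = 2 ∧
  (Nonempty (P.blockGroup B ≃* alternatingGroup (Fin 4)) ∨
    Nonempty (P.blockGroup B ≃* Equiv.Perm (Fin 4)))

/-- Case (c): `(v,b,r) = (7,7,3)` and `X_B^B` is `PSL(3,2)`; here `u ∈ B`. -/
def CaseC (Γ : SimpleGraph V) (B : P.Block) (u : V) : Prop :=
  (P.carrier B).ncard = 7 ∧ ((P.quotientGraph Γ).neighborSet B).ncard = 7 ∧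
  (P.blocksAt Γ u).ncard = 3 ∧
  Nonempty (P.blockGroup B ≃* Matrix.ProjectiveSpecialLinearGroup (Fin 3) (ZMod 2))

/-- Case (d): `v = 3b ≥ 6`, `r = 1` and `X_B` is `2`-transitive on the blocks of the design
`𝒟(B)`, that is, on `Γ_𝓑(B)`; here `u ∈ B`. -/
def CaseD (Γ : SimpleGraph V) (B : P.Block) (u : V) : Prop :=
  (P.carrier B).ncard = 3 * ((P.quotientGraph Γ).neighborSet B).ncard ∧
  6 ≤ (P.carrier B).ncard ∧
  (P.blocksAt Γ u).ncard = 1 ∧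
  ∀ C ∈ (P.quotientGraph Γ).neighborSet B, ∀ D ∈ (P.quotientGraph Γ).neighborSet B,
  ∀ C' ∈ (P.quotientGraph Γ).neighborSet B, ∀ D' ∈ (P.quotientGraph Γ).neighborSet B,
    C ≠ D → C' ≠ D' → ∃ g ∈ MulAction.stabilizer X B, g • C = C' ∧ g • D = D'

end InvPartition

/-! ### Graphs built from `3`-arcs, `2`-paths and double stars -/

section Constructions

variable {V : Type*}

/-- A self-paired `X`-orbit on `Arc_3(G)`. -/
def IsSelfPairedArcOrbit (X : Type*) [Group X] [MulAction X V] (G : SimpleGraph V)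
    (Δ : Set (Fin 4 → V)) : Prop :=
  (∃ α ∈ arcs G 3, Δ = MulAction.orbit X α) ∧ ∀ α ∈ Δ, α ∘ Fin.rev ∈ Δ

/-- The `3`-arc graph `Ξ(G,Δ)` on the arcs of `G`: `(τ,τ₁)` and `(σ,σ₁)` are adjacent iff
`(τ₁,τ,σ,σ₁) ∈ Δ`. (For a self-paired set `Δ` of `3`-arcs that relation is already symmetric
and irreflexive.) -/
def threeArcGraph (G : SimpleGraph V) (Δ : Set (Fin 4 → V)) :
    SimpleGraph {p : V × V // G.Adj p.1 p.2} :=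
  SimpleGraph.fromRel fun p q => ![p.1.2, p.1.1, q.1.1, q.1.2] ∈ Δ

/-- A `2`-path `[τ₁,τ,τ₂]` of `G`, recorded as its middle vertex `τ` with the unordered pair
`{τ₁,τ₂}` of its ends. -/
def IsPath2 (G : SimpleGraph V) (p : V × Sym2 V) : Prop :=
  ¬ p.2.IsDiag ∧ ∀ x ∈ p.2, G.Adj p.1 x

/-- `Path_2(G)`. -/
def Path2 (G : SimpleGraph V) : Type _ := {p : V × Sym2 V // IsPath2 G p}

/-- The graph `ℷ(G,Δ)` on the `2`-paths of `G`, with an edge joining `[α₀,α₁,α₂]` and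
`[α₁,α₂,α₃]` for every `(α₀,α₁,α₂,α₃) ∈ Δ`. -/
def gimelGraph (G : SimpleGraph V) (Δ : Set (Fin 4 → V)) : SimpleGraph (Path2 G) :=
  SimpleGraph.fromRel fun p q =>
    ∃ α ∈ Δ, p.1 = (α 1, s(α 0, α 2)) ∧ q.1 = (α 2, s(α 1, α 3))

/-- `J(G)`: the pairs `([τ₁,τ,τ₂],[σ₁,σ,σ₂])` of `2`-paths with `σ ∈ G(τ) \ {τ₁,τ₂}` and
`τ ∈ G(σ) \ {σ₁,σ₂}`. -/
def pathPairs (G : SimpleGraph V) : Set ((V × Sym2 V) × (V × Sym2 V)) :=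
  {q | IsPath2 G q.1 ∧ IsPath2 G q.2 ∧ G.Adj q.1.1 q.2.1 ∧ q.2.1 ∉ q.1.2 ∧ q.1.1 ∉ q.2.2}

/-- The image of a `2`-path under a group element. -/
def smulPath {X : Type*} [Group X] [MulAction X V] (g : X) (p : V × Sym2 V) : V × Sym2 V :=
  (g • p.1, p.2.map fun x => g • x)

/-- A self-paired `X`-orbit on `J(G)`. -/
def IsSelfPairedPathPairOrbit (X : Type*) [Group X] [MulAction X V] (G : SimpleGraph V)
    (Λ : Set ((V × Sym2 V) × (V × Sym2 V))) : Prop :=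
  (∃ q ∈ pathPairs G, Λ = {q' | ∃ g : X, q' = (smulPath g q.1, smulPath g q.2)}) ∧
    ∀ q ∈ Λ, q.swap ∈ Λ

/-- The graph `Ψ(G,Λ)` on the `2`-paths of `G`: `p` and `q` are adjacent iff `(p,q) ∈ Λ`. -/
def psiGraph (G : SimpleGraph V) (Λ : Set ((V × Sym2 V) × (V × Sym2 V))) :
    SimpleGraph (Path2 G) :=
  SimpleGraph.fromRel fun p q => (p.1, q.1) ∈ Λ

/-- The pair `(τ,S)` stands for the `k`-star `{(τ,σ) | σ ∈ S}`, where `S` is a `k`-subset of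
the neighbourhood of `τ`. -/
def IsStar (G : SimpleGraph V) (k : ℕ) (s : V × Set V) : Prop :=
  s.2 ⊆ G.neighborSet s.1 ∧ s.2.ncard = k

/-- `DSt^k(G)`: the pairs of `k`-stars `((τ,L),(σ,R))` with `σ ∈ L` and `τ ∈ R`. -/
def doubleStars (G : SimpleGraph V) (k : ℕ) : Set ((V × Set V) × (V × Set V)) :=
  {p | IsStar G k p.1 ∧ IsStar G k p.2 ∧ p.2.1 ∈ p.1.2 ∧ p.1.1 ∈ p.2.2}

/-- `St(Θ)`, the stars occurring in a set `Θ` of double stars. -/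
def starsOf (Θ : Set ((V × Set V) × (V × Set V))) : Set (V × Set V) :=
  {s | ∃ p ∈ Θ, s = p.1 ∨ s = p.2}

/-- A set of stars is `X`-symmetric if it is nonempty, `X` is transitive on it, and for some
star `(τ,S)` in it `X_τ ∩ X_S` is transitive on `S`. -/
def IsSymmetricStarSet (X : Type*) [Group X] [MulAction X V] (𝒮 : Set (V × Set V)) : Prop :=
  (∃ s ∈ 𝒮, 𝒮 = MulAction.orbit X s) ∧
    ∃ s ∈ 𝒮, ∀ x ∈ s.2, ∀ y ∈ s.2, ∃ g : X, g • s.1 = s.1 ∧ g • s.2 = s.2 ∧ g • x = y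

/-- A self-paired `X`-symmetric orbit on `DSt^k(G)`. -/
def IsSelfPairedDoubleStarOrbit (X : Type*) [Group X] [MulAction X V] (G : SimpleGraph V)
    (k : ℕ) (Θ : Set ((V × Set V) × (V × Set V))) : Prop :=
  (∃ p ∈ doubleStars G k, Θ = MulAction.orbit X p) ∧
    IsSymmetricStarSet X (starsOf Θ) ∧ ∀ p ∈ Θ, p.swap ∈ Θ

/-- The double star graph `Π(G,Θ)`, on the vertex set `St(Θ)`. -/
def doubleStarGraph (Θ : Set ((V × Set V) × (V × Set V))) : SimpleGraph (starsOf Θ) :=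
  SimpleGraph.fromRel fun l r => ((l : V × Set V), (r : V × Set V)) ∈ Θ

end Constructions

/-! ### Small graphs, disjoint copies and cycles -/

section Cycles

/-- `m` disjoint copies of `H`. -/
def copies {W : Type*} (m : ℕ) (H : SimpleGraph W) : SimpleGraph (Fin m × W) where
  Adj p q := p.1 = q.1 ∧ H.Adj p.2 q.2
  symm := ⟨fun _ _ h => ⟨h.1.symm, h.2.symm⟩⟩
  loopless := ⟨fun p h => H.loopless.irrefl p.2 h.2⟩

/-- `K₂`. -/
def K2 : SimpleGraph (Fin 2) := ⊤

/-- `K_{3,3}`. -/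
def K33 : SimpleGraph (Fin 3 ⊕ Fin 3) := completeBipartiteGraph (Fin 3) (Fin 3)

/-- `K_{3,3} - 3K₂`: complete bipartite minus a perfect matching. -/
def K33minus : SimpleGraph (Fin 3 ⊕ Fin 3) :=
  SimpleGraph.fromRel fun a b => ∃ i j : Fin 3, i ≠ j ∧ a = Sum.inl i ∧ b = Sum.inr j

variable {V : Type*}

/-- `C` is an `n`-cycle of `G`. Here a cycle is recorded by its edges, as a graph on `V`; its
vertices are the elements of `C.support`. -/
def IsCycleOf (G : SimpleGraph V) (n : ℕ) (C : SimpleGraph V) : Prop :=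
  3 ≤ n ∧ C ≤ G ∧ ∃ f : Fin n ↪ V, C = (SimpleGraph.cycleGraph n).map f

/-- The image of the graph `C` under a group element. -/
def translate {X : Type*} [Group X] [MulAction X V] (g : X) (C : SimpleGraph V) :
    SimpleGraph V :=
  C.comap fun x => g⁻¹ • x

/-- `X_[C]`, the subgroup of `X` preserving the adjacency of `C`. -/
def graphStabilizer (X : Type*) [Group X] [MulAction X V] (C : SimpleGraph V) :
    Subgroup X where
  carrier := {g | ∀ u w : V, C.Adj (g • u) (g • w) ↔ C.Adj u w}
  one_mem' := fun u w => by simp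
  mul_mem' := by
    intro g h hg hh u w
    rw [mul_smul, mul_smul, hg, hh]
  inv_mem' := by
    intro g hg u w
    rw [← hg, smul_inv_smul, smul_inv_smul]

/-- `G` is a near `n`-gonal graph with respect to the set `ℰ` of `n`-cycles: `G` is connected of
girth at least `4`, and each `2`-arc is contained in a unique member of `ℰ`. -/
def IsNearGonal (G : SimpleGraph V) (n : ℕ) (ℰ : Set (SimpleGraph V)) : Prop :=
  G.Connected ∧ 4 ≤ G.egirth ∧ (∀ C ∈ ℰ, IsCycleOf G n C) ∧
    ∀ α ∈ arcs G 2, ∃! C, C ∈ ℰ ∧ α ∈ arcs C 2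

/-- `ℰ` is an `X`-orbit of `n`-cycles of `G` with `|ℰ| = m` and `Δ = ⋃_{C ∈ ℰ} Arc_3(C)`,
`X_[C]^[C]` is dihedral of order `2n` for all `C ∈ ℰ`, `m ≥ 6`, `n ≥ girth(G)`,
`mn = 3e = 6μ` for `e = |E(G)|` and `μ = |V(G)|`, and either `G ≅ K₅` or `G` is near `n`-gonal
with respect to `ℰ`. -/
def IsCycleDecomposition (X : Type*) [Group X] [MulAction X V] (G : SimpleGraph V)
    (Δ : Set (Fin 4 → V)) (ℰ : Set (SimpleGraph V)) (m n : ℕ) : Prop :=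
  (∃ C₀, IsCycleOf G n C₀ ∧ ℰ = {C | ∃ g : X, C = translate g C₀}) ∧
  ℰ.ncard = m ∧
  Δ = ⋃ C ∈ ℰ, arcs C 3 ∧
  (∀ C ∈ ℰ, Nonempty (inducedPerm (graphStabilizer X C) C.support ≃* DihedralGroup n)) ∧
  6 ≤ m ∧ G.egirth ≤ (n : ℕ∞) ∧
  m * n = 3 * G.edgeSet.ncard ∧ 3 * G.edgeSet.ncard = 6 * Nat.card V ∧
  (Nonempty (G ≃g (⊤ : SimpleGraph (Fin 5))) ∨ IsNearGonal G n ℰ)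

end Cycles

/-! ### The detailed conclusions in the four cases -/

namespace InvPartition

variable {X V : Type*} [Group X] [MulAction X V] (P : InvPartition X V)

/-- The description of `Γ` in case (a). -/
def ConclusionA (Γ : SimpleGraph V) (B : P.Block) : Prop :=
  FaithfulSMul X P.Block ∧
  ∃ Δ : Set (Fin 4 → P.Block), IsSelfPairedArcOrbit X (P.quotientGraph Γ) Δ ∧
    Nonempty (Γ ≃g threeArcGraph (P.quotientGraph Γ) Δ) ∧
    ((P.BetweenIso Γ (copies 3 K2) ∧ HasValency Γ 3 ∧
        (∃ ℰ m n, IsCycleDecomposition X (P.quotientGraph Γ) Δ ℰ m n) ∧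
        ((Nonempty (MulAction.stabilizer X B ≃* alternatingGroup (Fin 4)) ∧
            IsArcRegular X Γ 1 ∧ IsArcRegular X (P.quotientGraph Γ) 2) ∨
          (Nonempty (MulAction.stabilizer X B ≃* Equiv.Perm (Fin 4)) ∧
            IsArcRegular X Γ 2))) ∨
      (P.BetweenIso Γ K33minus ∧ HasValency Γ 6 ∧
        Nonempty (MulAction.stabilizer X B ≃* Equiv.Perm (Fin 4)) ∧
        Γ.Connected ∧ IsArcRegular X Γ 1 ∧
        IsSelfPairedArcOrbit X (P.quotientGraph Γ) (arcs (P.quotientGraph Γ) 3 \ Δ) ∧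
        ∃ ℰ m n, IsCycleDecomposition X (P.quotientGraph Γ)
          (arcs (P.quotientGraph Γ) 3 \ Δ) ℰ m n) ∨
      (P.BetweenIso Γ K33 ∧ HasValency Γ 9 ∧ Γ.Connected ∧ IsSTransitive X Γ 1 ∧
        IsArcTransitive X (P.quotientGraph Γ) 3))

/-- The description of `Γ` in case (b). -/
def ConclusionB (Γ : SimpleGraph V) (B : P.Block) : Prop :=
  FaithfulSMul X P.Block ∧
  ∃ Δ : Set (Fin 4 → P.Block), IsSelfPairedArcOrbit X (P.quotientGraph Γ) Δ ∧
    Nonempty (Γ ≃g gimelGraph (P.quotientGraph Γ) Δ) ∧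
    (∃ Λ, IsSelfPairedPathPairOrbit X (P.quotientGraph Γ) Λ ∧
      Nonempty (gimelGraph (P.quotientGraph Γ) Δ ≃g psiGraph (P.quotientGraph Γ) Λ)) ∧
    ((P.BetweenIso Γ (copies 3 K2) ∧
        (∃ ℰ m n, Nonempty (Γ ≃g copies m (SimpleGraph.cycleGraph n)) ∧
          IsCycleDecomposition X (P.quotientGraph Γ) Δ ℰ m n) ∧
        ((Nonempty (MulAction.stabilizer X B ≃* alternatingGroup (Fin 4)) ∧
            IsArcRegular X Γ 1 ∧ IsArcRegular X (P.quotientGraph Γ) 2) ∨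
          (Nonempty (MulAction.stabilizer X B ≃* Equiv.Perm (Fin 4)) ∧
            ¬ IsArcRegular X Γ 1))) ∨
      (P.BetweenIso Γ K33minus ∧ HasValency Γ 4 ∧
        Nonempty (MulAction.stabilizer X B ≃* Equiv.Perm (Fin 4)) ∧
        Γ.Connected ∧ IsArcRegular X Γ 1 ∧
        IsSelfPairedArcOrbit X (P.quotientGraph Γ) (arcs (P.quotientGraph Γ) 3 \ Δ) ∧
        ∃ ℰ m n, IsCycleDecomposition X (P.quotientGraph Γ)
          (arcs (P.quotientGraph Γ) 3 \ Δ) ℰ m n) ∨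
      (P.BetweenIso Γ K33 ∧ HasValency Γ 6 ∧ Γ.Connected ∧ IsSTransitive X Γ 1 ∧
        IsArcTransitive X (P.quotientGraph Γ) 3))

/-- The description of `Γ` in case (c). -/
def ConclusionC (Γ : SimpleGraph V) : Prop :=
  FaithfulSMul X P.Block ∧
  (∃ Θ, IsSelfPairedDoubleStarOrbit X (P.quotientGraph Γ) 3 Θ ∧
    Nonempty (Γ ≃g doubleStarGraph Θ)) ∧
  ((P.BetweenIso Γ (copies 3 K2) ∧ HasValency Γ 3 ∧
      IsArcTransitive X Γ 2 ∧ ¬ IsArcRegular X Γ 2) ∨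
    (P.BetweenIso Γ K33minus ∧ HasValency Γ 6 ∧ Γ.Connected ∧ IsSTransitive X Γ 1) ∨
    (P.BetweenIso Γ K33 ∧ HasValency Γ 9 ∧ Γ.Connected ∧ IsSTransitive X Γ 1))

/-- The description of `Γ` in case (d). -/
def ConclusionD (Γ : SimpleGraph V) : Prop :=
  (P.BetweenIso Γ (copies 3 K2) ∧
      Nonempty (Γ ≃g copies (3 * (P.quotientGraph Γ).edgeSet.ncard) K2)) ∨
    (P.BetweenIso Γ K33minus ∧
      Nonempty (Γ ≃g copies (P.quotientGraph Γ).edgeSet.ncard K33minus)) ∨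
    (P.BetweenIso Γ K33 ∧
      Nonempty (Γ ≃g copies (P.quotientGraph Γ).edgeSet.ncard K33))

end InvPartition

/-- The pair `(G, Y)` occurs as `Γ_𝓑` for a triple `(Γ, Y, 𝓑)` of `𝒢` with `k = 3` that falls in
the given case; the isomorphism between `Γ_𝓑` and `G` is compatible with the two actions of `Y`.
If `Y` is faithful on `G`, then `Y` is faithful on `Γ` and `Γ_𝓑` is connected. -/
def OccursAsQuotient {W : Type u} (Y : Type v) [Group Y] [MulAction Y W] (G : SimpleGraph W)
    (InCase : ∀ (V : Type u) [MulAction Y V] (P : InvPartition Y V),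
      SimpleGraph V → P.Block → V → Prop) : Prop :=
  ∃ (V : Type u) (_ : Finite V) (_ : MulAction Y V) (Γ : SimpleGraph V) (P : InvPartition Y V),
    P.InG Γ ∧ (FaithfulSMul Y W → P.InGHat Γ) ∧
    (∀ B C : P.Block, (P.quotientGraph Γ).Adj B C → (P.trace Γ B C).ncard = 3) ∧
    (∀ (B : P.Block) (u : V), u ∈ P.carrier B → InCase V P Γ B u) ∧
    ∃ φ : P.quotientGraph Γ ≃g G, ∀ (g : Y) (B : P.Block), φ (g • B) = g • φ B

end SymmQuot

open SymmQuot

/-! Regard a block B as an incidence structure: its points are the vertices of B, its blocks are the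
3-sets Γ(C) ∩ B for the neighbours C of B in the quotient, and X_B is flag-transitive on it because
Γ is X-symmetric. The quotient is 2-arc-transitive exactly when X_B is 2-transitive on the
neighbours of B, and then any two of the 3-sets meet in a constant number l of points. Double
counting (`design_parameters`) leaves l = 2, 1, 1, 0 with (v,b,r) = (4,4,3), (6,4,2), (7,7,3),
(3b,b,1). In the first three cases distinct points lie in distinct sets of blocks and distinct
blocks have distinct traces, so X_B has the same kernel on points and on neighbours and X_B^B is
isomorphic to the local group of the quotient (`fixes_iff`). For b = 4 a 2-transitive group has
order at least 12, so it is A₄ or S₄. For v = 7 an element of order seven puts the structure in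
cyclic form, hence makes it a Fano plane, and a flag-transitive group of collineations with an
involution is the full group PSL(3,2) (`eq_fanoAut`, `psl_of_two_arc`).

For the description of Γ let t be the number of neighbours of a vertex in an adjacent block; t = 1,
2, 3 gives 3K₂, K₃,₃ - 3K₂ and K₃,₃. When b = 4, a vertex u with a block D at u carries as label a
neighbour of its block other than D: the missing neighbour if r = 3, the other block at u if r = 2.
Arcs of Γ thereby become one self-paired orbit Δ of 3-arcs of the quotient, in which every 2-arc has
exactly t extensions (`IsLabelling.ncard_extensions`). For t = 1 the set Δ, for t = 2 its
complement, extends every 2-arc uniquely (`ExtendsUniquely`). Walking along such a set is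
deterministic in both directions, so 2-arcs close up to cycles. All these cycles are conjugate and
each 2-path lies on exactly one of them, which gives the near-polygonal structure, the dihedral
groups and the counts. Moreover only the identity fixes a vertex and all its neighbours, so the
stabilizer X_B is itself A₄ or S₄. For t = 3 all 3-arcs form one orbit. When (v,b,r) = (7,7,3) a
vertex is the 3-star formed by its block and the three blocks at it; when r = 1 the graphs between
adjacent blocks are pairwise disjoint.

For the graphs that occur, the passage is reversed (`IsStarModel`): the vertices of Γ are stars of
Σ, with three of the four neighbours, two of the four, or a Fano line of the seven as leaves, and Γ
is the orbit of a pair (u, h u), where h interchanges the ends of an arc and h² fixes u. In valency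
seven the group is given only up to abstract isomorphism, so the plane has to be reconstructed from
the group (`exists_fano_coordinates`). -/

namespace SymmQuot

/-! ### Induced permutation groups -/

section Induced

variable {X V V' : Type*} [Group X] [MulAction X V] [MulAction X V']

/-- The action of a subgroup on an invariant set. -/
def inducedHom (H : Subgroup X) (S : Set V) (hS : ∀ g ∈ H, ∀ x ∈ S, g • x ∈ S) :
    H →* Equiv.Perm S where
  toFun g :=
    { toFun := fun x => ⟨(g : X) • (x : V), hS g g.2 x x.2⟩
      invFun := fun x => ⟨(g : X)⁻¹ • (x : V), hS _ (H.inv_mem g.2) x x.2⟩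
      left_inv := fun x => by simp
      right_inv := fun x => by simp }
  map_one' := by ext x; simp
  map_mul' g h := by ext x; simp [mul_smul]

theorem inducedHom_apply (H : Subgroup X) (S : Set V) (hS : ∀ g ∈ H, ∀ x ∈ S, g • x ∈ S)
    (g : H) (x : S) : ((inducedHom H S hS g x : S) : V) = (g : X) • (x : V) := rfl

/-- With the kernel computed below, this brings `inducedPerm` under the first isomorphism theorem.
-/
theorem range_inducedHom (H : Subgroup X) (S : Set V) (hS : ∀ g ∈ H, ∀ x ∈ S, g • x ∈ S) :
    (inducedHom H S hS).range = inducedPerm H S := by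
  ext π
  constructor
  · rintro ⟨g, rfl⟩
    exact ⟨g, g.2, fun x => rfl⟩
  · rintro ⟨g, hg, h⟩
    exact ⟨⟨g, hg⟩, by ext x; exact (h x).symm⟩

theorem mem_ker_inducedHom (H : Subgroup X) (S : Set V) (hS : ∀ g ∈ H, ∀ x ∈ S, g • x ∈ S)
    (g : H) : g ∈ (inducedHom H S hS).ker ↔ ∀ x ∈ S, (g : X) • x = x := by
  rw [MonoidHom.mem_ker, Equiv.ext_iff]
  constructor
  · intro h x hx
    exact congrArg Subtype.val (h ⟨x, hx⟩)
  · intro h x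
    exact Subtype.ext (h x x.2)

/-- Two actions of `H` with the same kernel induce isomorphic permutation groups. -/
theorem nonempty_inducedPerm_mulEquiv (H : Subgroup X) (S : Set V) (T : Set V')
    (hS : ∀ g ∈ H, ∀ x ∈ S, g • x ∈ S) (hT : ∀ g ∈ H, ∀ x ∈ T, g • x ∈ T)
    (hk : ∀ g ∈ H, (∀ x ∈ S, g • x = x) ↔ ∀ y ∈ T, g • y = y) :
    Nonempty (inducedPerm H S ≃* inducedPerm H T) := by
  have hker : (inducedHom H S hS).ker = (inducedHom H T hT).ker := by
    ext g
    rw [mem_ker_inducedHom, mem_ker_inducedHom]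
    exact hk g g.2
  rw [← range_inducedHom H S hS, ← range_inducedHom H T hT]
  exact ⟨((QuotientGroup.quotientKerEquivRange _).symm.trans
    (QuotientGroup.quotientMulEquivOfEq hker)).trans (QuotientGroup.quotientKerEquivRange _)⟩

theorem nonempty_mulEquiv_inducedPerm (H : Subgroup X) (S : Set V)
    (hS : ∀ g ∈ H, ∀ x ∈ S, g • x ∈ S) (hk : ∀ g ∈ H, (∀ x ∈ S, g • x = x) → g = 1) :
    Nonempty (H ≃* inducedPerm H S) := by
  rw [← range_inducedHom H S hS]
  refine ⟨MonoidHom.ofInjective ((injective_iff_map_eq_one _).2 fun g hg => ?_)⟩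
  exact Subtype.ext (hk g g.2 ((mem_ker_inducedHom H S hS g).1 hg))

end Induced

/-! ### Permutation groups of degree four -/

section DegreeFour

/-- Transitivity on ordered pairs of distinct points. -/
def TwoTransitive {S : Type*} (K : Subgroup (Equiv.Perm S)) : Prop :=
  ∀ x y x' y' : S, x ≠ y → x' ≠ y' → ∃ π ∈ K, π x = x' ∧ π y = y'

theorem card_perm_four {S : Type*} [Finite S] (hS : Nat.card S = 4) :
    Nat.card (Equiv.Perm S) = 24 := by
  rw [Nat.card_perm, hS]; rfl

/-- Evaluation at one pair of distinct points maps the group onto the 4 · 3 ordered pairs. -/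
theorem twelve_le_card {S : Type*} [Finite S] (hS : Nat.card S = 4) {K : Subgroup (Equiv.Perm S)}
    (hK : TwoTransitive K) : 12 ≤ Nat.card K := by
  classical
  have := Fintype.ofFinite S
  have hS' : Fintype.card S = 4 := by rw [← Nat.card_eq_fintype_card, hS]
  obtain ⟨x, y, hxy⟩ := Fintype.exists_pair_of_one_lt_card (α := S) (by omega)
  have hc : Nat.card ((Finset.univ : Finset S).offDiag) = 12 := by
    rw [Nat.card_eq_fintype_card, Fintype.card_coe, Finset.offDiag_card, Finset.card_univ, hS']
  rw [← hc]
  refine Nat.card_le_card_of_surjective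
    (fun π : K => ⟨((π : Equiv.Perm S) x, (π : Equiv.Perm S) y), by simp [hxy]⟩) ?_
  rintro ⟨⟨a, b⟩, hab⟩
  obtain ⟨π, hπ, h1, h2⟩ := hK x y a b hxy (by simpa using hab)
  exact ⟨⟨π, hπ⟩, by simp [h1, h2]⟩

theorem card_eq_of_twelve_le {S : Type*} [Finite S] (hS : Nat.card S = 4)
    {K : Subgroup (Equiv.Perm S)} (hK : 12 ≤ Nat.card K) : K.index = 2 ∨ K = ⊤ := by
  have h := K.card_mul_index
  rw [card_perm_four hS] at h
  have h1 : K.index ≤ 2 := by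
    by_contra hc
    have : 12 * 3 ≤ Nat.card K * K.index := Nat.mul_le_mul hK (by omega)
    omega
  have h0 : K.index ≠ 0 := by rintro h0; rw [h0] at h; omega
  by_cases h2 : K.index = 2
  · exact Or.inl h2
  · exact Or.inr (Subgroup.index_eq_one.1 (by omega))

/-- Besides the identity, only the transposition of the other two points fixes two of four points,
and it is odd. -/
theorem even_perm_four_fix : ∀ π : Equiv.Perm (Fin 4), Equiv.Perm.sign π = 1 →
    ∀ i j : Fin 4, i ≠ j → π i = i → π j = j → π = 1 := by
  have key : ∀ (π : Equiv.Perm (Fin 4)) (i j : Fin 4),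
      Equiv.Perm.sign π = 1 ∧ i ≠ j ∧ π i = i ∧ π j = j → ∀ x, π x = x := by decide
  exact fun π h0 i j h1 h2 h3 => Equiv.ext (key π i j ⟨h0, h1, h2, h3⟩)

theorem exists_even_perm_four : ∀ x y x' y' : Fin 4, x ≠ y → x' ≠ y' →
    ∃ π : Equiv.Perm (Fin 4), Equiv.Perm.sign π = 1 ∧ π x = x' ∧ π y = y' := by decide

/-- The order is 12 or 24, and a subgroup of index two is the alternating group. The added clauses
later decide arc-regularity: trivial two-point stabilizers on the one side, all permutations on the
other. -/
theorem degree_four_cases {S : Type*} [Finite S] (hS : Nat.card S = 4)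
    {K : Subgroup (Equiv.Perm S)} (hK : 12 ≤ Nat.card K) :
    (Nonempty (K ≃* alternatingGroup (Fin 4)) ∧
      ∀ π ∈ K, ∀ x y : S, x ≠ y → π x = x → π y = y → π = 1) ∨
    (Nonempty (K ≃* Equiv.Perm (Fin 4)) ∧ K = ⊤) := by
  classical
  have := Fintype.ofFinite S
  let e : S ≃ Fin 4 := Finite.equivFinOfCardEq hS
  rcases card_eq_of_twelve_le hS hK with h | h
  · left
    have hA := Equiv.Perm.eq_alternatingGroup_of_index_eq_two h
    subst hA
    refine ⟨⟨Equiv.altCongrHom e⟩, fun π hπ x y hxy hx hy => ?_⟩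
    have h1 := even_perm_four_fix (e.permCongr π)
      (by rw [Equiv.Perm.sign_permCongr]; exact Equiv.Perm.mem_alternatingGroup.1 hπ)
      (e x) (e y) (by simpa using hxy) (by simp [hx]) (by simp [hy])
    exact e.permCongr.injective (by rw [h1]; ext; simp)
  · right
    subst h
    exact ⟨⟨Subgroup.topEquiv.trans e.permCongrHom⟩, rfl⟩

theorem twoTransitive_of_twelve_le {S : Type*} [Finite S] (hS : Nat.card S = 4)
    {K : Subgroup (Equiv.Perm S)} (hK : 12 ≤ Nat.card K) : TwoTransitive K := by
  classical
  have := Fintype.ofFinite S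
  let e : S ≃ Fin 4 := Finite.equivFinOfCardEq hS
  intro x y x' y' hxy hxy'
  obtain ⟨π, hπ, h1, h2⟩ := exists_even_perm_four (e x) (e y) (e x') (e y')
    (by simpa using hxy) (by simpa using hxy')
  refine ⟨e.symm.permCongr π, ?_, by simp [h1], by simp [h2]⟩
  rcases card_eq_of_twelve_le hS hK with h | h
  · rw [Equiv.Perm.eq_alternatingGroup_of_index_eq_two h, Equiv.Perm.mem_alternatingGroup,
      Equiv.Perm.sign_permCongr, hπ]
  · rw [h]; trivial

theorem twelve_le_card_of_mulEquiv {K : Type*} [Group K]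
    (h : Nonempty (K ≃* alternatingGroup (Fin 4)) ∨ Nonempty (K ≃* Equiv.Perm (Fin 4))) :
    12 ≤ Nat.card K := by
  rcases h with ⟨⟨e⟩⟩ | ⟨⟨e⟩⟩
  · rw [Nat.card_congr e.toEquiv, nat_card_alternatingGroup, Nat.card_fin]; decide
  · rw [Nat.card_congr e.toEquiv, card_perm_four (Nat.card_fin 4)]; decide

/-- `A₄` and `S₄` contain elements of order three that do not commute. -/
theorem exists_not_commute {K : Type*} [Group K]
    (h : Nonempty (K ≃* alternatingGroup (Fin 4)) ∨ Nonempty (K ≃* Equiv.Perm (Fin 4))) :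
    ∃ x y : K, x ^ 3 = 1 ∧ y ^ 3 = 1 ∧ x * y ≠ y * x := by
  have hF : ∃ x y : Equiv.Perm (Fin 4), Equiv.Perm.sign x = 1 ∧ Equiv.Perm.sign y = 1 ∧
      x ^ 3 = 1 ∧ y ^ 3 = 1 ∧ x * y ≠ y * x :=
    ⟨Equiv.swap 0 1 * Equiv.swap 1 2, Equiv.swap 0 1 * Equiv.swap 1 3, by decide, by decide,
      by decide, by decide, by decide⟩
  obtain ⟨x, y, sx, sy, hx, hy, hxy⟩ := hF
  rcases h with ⟨⟨e⟩⟩ | ⟨⟨e⟩⟩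
  · refine ⟨e.symm ⟨x, Equiv.Perm.mem_alternatingGroup.2 sx⟩,
      e.symm ⟨y, Equiv.Perm.mem_alternatingGroup.2 sy⟩, ?_, ?_, ?_⟩
    · rw [← map_pow, map_eq_one_iff _ e.symm.injective]; exact Subtype.ext hx
    · rw [← map_pow, map_eq_one_iff _ e.symm.injective]; exact Subtype.ext hy
    · rw [← map_mul, ← map_mul]
      intro h
      exact hxy (congrArg Subtype.val (e.symm.injective h))
  · refine ⟨e.symm x, e.symm y, ?_, ?_, ?_⟩
    · rw [← map_pow, hx, map_one]
    · rw [← map_pow, hy, map_one]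
    · rw [← map_mul, ← map_mul]
      intro h
      exact hxy (e.symm.injective h)

/-- Permutations of three points with trivial cube lie in the cyclic group of order three. -/
theorem perm_three_commute {S : Type*} [Finite S] (hS : Nat.card S = 3) (x y : Equiv.Perm S)
    (hx : x ^ 3 = 1) (hy : y ^ 3 = 1) : x * y = y * x := by
  have key : ∀ x y : Equiv.Perm (Fin 3), x ^ 3 = 1 → y ^ 3 = 1 → x * y = y * x := by decide
  let e : Equiv.Perm S ≃* Equiv.Perm (Fin 3) := (Finite.equivFinOfCardEq hS).permCongrHom
  apply e.injective
  rw [map_mul, map_mul]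
  exact key _ _ (by rw [← map_pow, hx, map_one]) (by rw [← map_pow, hy, map_one])

/-- A permutation of three points without fixed points is a 3-cycle. `IsStarModel.exists_swap` uses
this to find an element whose square fixes a star. -/
theorem perm_three_fix_or_cube {S : Type*} [Finite S] (hS : Nat.card S = 3) (π : Equiv.Perm S) :
    (∃ x, π x = x) ∨ π ^ 3 = 1 := by
  have key : ∀ π : Equiv.Perm (Fin 3), (∃ x, π x = x) ∨ π ^ 3 = 1 := by decide
  let f : S ≃ Fin 3 := Finite.equivFinOfCardEq hS
  rcases key (f.permCongr π) with ⟨x, hx⟩ | h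
  · exact Or.inl ⟨f.symm x, f.injective (by rw [f.apply_symm_apply]; exact hx)⟩
  · right
    apply f.permCongrHom.injective
    rw [map_pow, map_one]
    exact h

end DegreeFour

/-! ### Incidence structures with blocks of size three -/

section Design

variable {α β : Type*} [Finite α] [Finite β] (inc : α → β → Prop)

theorem ncard_mul_eq_ncard_mul (S : Set α) (N : Set β) {a c : ℕ}
    (ha : ∀ u ∈ S, {C ∈ N | inc u C}.ncard = a) (hc : ∀ C ∈ N, {u ∈ S | inc u C}.ncard = c) :
    S.ncard * a = N.ncard * c := by
  classical
  have := Fintype.ofFinite α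
  have := Fintype.ofFinite β
  rw [Set.ncard_eq_toFinset_card' S, Set.ncard_eq_toFinset_card' N]
  refine Finset.card_mul_eq_card_mul inc (fun u hu => ?_) (fun C hC => ?_)
  · rw [← ha u (by simpa using hu), Set.ncard_eq_toFinset_card']
    congr 1; ext C; simp [Finset.mem_bipartiteAbove]
  · rw [← hc C (by simpa using hC), Set.ncard_eq_toFinset_card']
    congr 1; ext u; simp [Finset.mem_bipartiteBelow]

theorem ncard_mul_le_ncard_mul (S : Set α) (N : Set β) {a c : ℕ}
    (ha : ∀ u ∈ S, a ≤ {C ∈ N | inc u C}.ncard) (hc : ∀ C ∈ N, {u ∈ S | inc u C}.ncard ≤ c) :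
    S.ncard * a ≤ N.ncard * c := by
  classical
  have := Fintype.ofFinite α
  have := Fintype.ofFinite β
  rw [Set.ncard_eq_toFinset_card' S, Set.ncard_eq_toFinset_card' N]
  refine Finset.card_mul_le_card_mul inc (fun u hu => ?_) (fun C hC => ?_)
  · refine (ha u (by simpa using hu)).trans (le_of_eq ?_)
    rw [Set.ncard_eq_toFinset_card']
    congr 1; ext C; simp [Finset.mem_bipartiteAbove]
  · refine le_trans (le_of_eq ?_) (hc C (by simpa using hC))
    rw [Set.ncard_eq_toFinset_card']
    congr 1; ext u; simp [Finset.mem_bipartiteBelow]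

/-- Count the pairs (u, D) with u on a fixed block C and D ≠ C through u. -/
theorem design_second_count (S : Set α) (N : Set β) {r l : ℕ}
    (hr : ∀ u ∈ S, {C ∈ N | inc u C}.ncard = r) (hk : ∀ C ∈ N, {u ∈ S | inc u C}.ncard = 3)
    (hl : ∀ C ∈ N, ∀ D ∈ N, C ≠ D → {u ∈ S | inc u C ∧ inc u D}.ncard = l)
    (hN : N.Nonempty) : 3 * (r - 1) = (N.ncard - 1) * l := by
  obtain ⟨C, hC⟩ := hN
  have h := ncard_mul_eq_ncard_mul inc {u ∈ S | inc u C} (N \ {C}) (a := r - 1) (c := l) ?_ ?_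
  · rwa [hk C hC, Set.ncard_sdiff_singleton_of_mem hC] at h
  · rintro u ⟨hu, huC⟩
    rw [← hr u hu, ← Set.ncard_sdiff_singleton_of_mem (a := C) (s := {C ∈ N | inc u C}) ⟨hC, huC⟩]
    congr 1; ext D; simp; tauto
  · rintro D ⟨hD, hDC⟩
    rw [← hl C hC D hD (fun h => hDC h.symm)]
    congr 1; ext u; simp; tauto

/-- Each of the r blocks through a fixed point has two further points, and these are all distinct
because two blocks share only one point. -/
theorem design_points_bound (S : Set α) (N : Set β) {r : ℕ}
    (hr : ∀ u ∈ S, {C ∈ N | inc u C}.ncard = r) (hk : ∀ C ∈ N, {u ∈ S | inc u C}.ncard = 3)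
    (hl : ∀ C ∈ N, ∀ D ∈ N, C ≠ D → {u ∈ S | inc u C ∧ inc u D}.ncard = 1)
    (hS : S.Nonempty) : r * 2 ≤ S.ncard - 1 := by
  obtain ⟨u, hu⟩ := hS
  have h := ncard_mul_le_ncard_mul (fun C u => inc u C) {C ∈ N | inc u C} (S \ {u})
    (a := 2) (c := 1) ?_ ?_
  · rwa [hr u hu, Set.ncard_sdiff_singleton_of_mem hu, mul_one] at h
  · rintro C ⟨hC, huC⟩
    have := hk C hC
    have h2 := Set.ncard_sdiff_singleton_of_mem (a := u) (s := {u ∈ S | inc u C}) ⟨hu, huC⟩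
    rw [this] at h2
    refine h2.symm.le.trans (le_of_eq ?_)
    congr 1; ext w; simp; tauto
  · rintro w ⟨hw, hwu⟩
    rw [Set.ncard_le_one]
    rintro C ⟨⟨hC, huC⟩, hwC⟩ D ⟨⟨hD, huD⟩, hwD⟩
    by_contra hne
    have := (Set.ncard_le_one).1 (hl C hC D hD hne).le u ⟨hu, huC, huD⟩ w ⟨hw, hwC, hwD⟩
    exact hwu this.symm

/-- The equations are v r = 3 b and 3 (r - 1) = (b - 1) l with l ≤ 3. The bound 2 r ≤ v - 1 for l =
1 serves to remove the solution (v,b,r) = (8,16,6). -/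
theorem design_parameters (S : Set α) (N : Set β) {r l : ℕ}
    (hr : ∀ u ∈ S, {C ∈ N | inc u C}.ncard = r) (hk : ∀ C ∈ N, {u ∈ S | inc u C}.ncard = 3)
    (hl : ∀ C ∈ N, ∀ D ∈ N, C ≠ D → {u ∈ S | inc u C ∧ inc u D}.ncard = l)
    (hN : 2 ≤ N.ncard) (hS : S.ncard ≠ 3) :
    (S.ncard = 4 ∧ N.ncard = 4 ∧ r = 3 ∧ l = 2) ∨ (S.ncard = 6 ∧ N.ncard = 4 ∧ r = 2 ∧ l = 1) ∨
    (S.ncard = 7 ∧ N.ncard = 7 ∧ r = 3 ∧ l = 1) ∨ (S.ncard = 3 * N.ncard ∧ r = 1 ∧ l = 0) := by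
  have hN0 : N.Nonempty := by
    rw [← Set.ncard_pos]; omega
  obtain ⟨C, hC, D, hD, hCD⟩ := (Set.one_lt_ncard).1 (show 1 < N.ncard by omega)
  have h1 := ncard_mul_eq_ncard_mul inc S N hr hk
  have h2 := design_second_count inc S N hr hk hl hN0
  have h3 : l = 1 → r * 2 ≤ S.ncard - 1 := by
    rintro rfl
    refine design_points_bound inc S N hr hk hl ?_
    rw [← Set.ncard_pos]
    rcases Nat.eq_zero_or_pos S.ncard with h | h
    · rw [h] at h1; omega
    · exact h
  have hl3 : l ≤ 3 := by
    rw [← hl C hC D hD hCD, ← hk C hC]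
    exact Set.ncard_le_ncard (fun u hu => ⟨hu.1, hu.2.1⟩)
  have hr0 : 1 ≤ r := by
    rcases Nat.eq_zero_or_pos r with h | h
    · rw [h] at h1; omega
    · exact h
  generalize S.ncard = v at *
  generalize N.ncard = b at *
  -- Replacing b and r by b + 1 and r + 1 removes the truncated subtractions from the second count.
  obtain ⟨b, rfl⟩ : ∃ b', b = b' + 1 := ⟨b - 1, by omega⟩
  obtain ⟨r, rfl⟩ : ∃ r', r = r' + 1 := ⟨r - 1, by omega⟩
  simp only [Nat.add_sub_cancel] at h2
  interval_cases l
  · right; right; right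
    have : r = 0 := by omega
    subst this
    omega
  · have hb : b = 3 * r := by omega
    subst hb
    have h3' := h3 rfl
    -- `v (r + 1) = 9 r + 3` leaves few possibilities
    have hv : v ≤ 9 := by
      by_contra hc
      have : 10 * (r + 1) ≤ v * (r + 1) := Nat.mul_le_mul_right _ (by omega)
      omega
    interval_cases v <;> omega
  -- In the shifted variables 3 r = 2 b, so 2 v (r + 1) = 9 r + 6 and v < 5.
  · have hr2 : v ≤ 4 := by
      by_contra hc
      have : 5 * (r + 1) ≤ v * (r + 1) := Nat.mul_le_mul_right _ (by omega)
      omega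
    interval_cases v <;> omega
  -- For l = 3 every point lies on every block, so v = 3, which is excluded.
  · have : r = b := by omega
    subst this
    exact absurd (Nat.eq_of_mul_eq_mul_right (Nat.succ_pos r) (show v * (r + 1) = 3 * (r + 1) by
      rw [h1]; ring)) hS

end Design

/-! ### Arcs of small length -/

section ArcBasics

variable {X V : Type*} [Group X] [MulAction X V] {G : SimpleGraph V}

theorem vec_two_eta (α : Fin 2 → V) : α = ![α 0, α 1] := by
  ext i; fin_cases i <;> rfl

theorem vec_three_eta (α : Fin 3 → V) : α = ![α 0, α 1, α 2] := by
  ext i; fin_cases i <;> rfl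

theorem vec_four_eta (α : Fin 4 → V) : α = ![α 0, α 1, α 2, α 3] := by
  ext i; fin_cases i <;> rfl

theorem vec_two_inj {a b c d : V} : (![a, b] : Fin 2 → V) = ![c, d] ↔ a = c ∧ b = d := by
  simp

theorem vec_three_inj {a b c a' b' c' : V} :
    (![a, b, c] : Fin 3 → V) = ![a', b', c'] ↔ a = a' ∧ b = b' ∧ c = c' := by
  simp

theorem vec_four_inj {a b c d a' b' c' d' : V} :
    (![a, b, c, d] : Fin 4 → V) = ![a', b', c', d'] ↔ a = a' ∧ b = b' ∧ c = c' ∧ d = d' := by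
  simp

theorem smul_vec_two (g : X) (a b : V) : g • (![a, b] : Fin 2 → V) = ![g • a, g • b] := by
  ext i; fin_cases i <;> rfl

theorem smul_vec_three (g : X) (a b c : V) :
    g • (![a, b, c] : Fin 3 → V) = ![g • a, g • b, g • c] := by
  ext i; fin_cases i <;> rfl

theorem smul_vec_four (g : X) (a b c d : V) :
    g • (![a, b, c, d] : Fin 4 → V) = ![g • a, g • b, g • c, g • d] := by
  ext i; fin_cases i <;> rfl

theorem vec_four_rev (a b c d : V) : (![a, b, c, d] : Fin 4 → V) ∘ Fin.rev = ![d, c, b, a] := by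
  ext i; fin_cases i <;> rfl

theorem mem_arcs_one {a b : V} : ![a, b] ∈ arcs G 1 ↔ G.Adj a b := by
  constructor
  · intro h; exact h.1 0
  · intro h
    refine ⟨fun i => ?_, fun i j hij => ?_⟩
    · fin_cases i; exact h
    · fin_cases i <;> fin_cases j <;> simp at hij

theorem mem_arcs_two {a b c : V} : ![a, b, c] ∈ arcs G 2 ↔ G.Adj a b ∧ G.Adj b c ∧ a ≠ c := by
  constructor
  · intro h; exact ⟨h.1 0, h.1 1, h.2 0 2 rfl⟩
  · rintro ⟨h1, h2, h3⟩
    refine ⟨fun i => ?_, fun i j hij => ?_⟩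
    · fin_cases i
      exacts [h1, h2]
    · fin_cases i <;> fin_cases j <;> first | exact h3 | simp at hij

theorem mem_arcs_three {a b c d : V} : ![a, b, c, d] ∈ arcs G 3 ↔
    G.Adj a b ∧ G.Adj b c ∧ G.Adj c d ∧ a ≠ c ∧ b ≠ d := by
  constructor
  · intro h; exact ⟨h.1 0, h.1 1, h.1 2, h.2 0 2 rfl, h.2 1 3 rfl⟩
  · rintro ⟨h1, h2, h3, h4, h5⟩
    refine ⟨fun i => ?_, fun i j hij => ?_⟩
    · fin_cases i
      exacts [h1, h2, h3]
    · fin_cases i <;> fin_cases j <;> first | exact h4 | exact h5 | simp at hij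

theorem smul_mem_arcs (hG : ∀ (g : X) (u w : V), G.Adj (g • u) (g • w) ↔ G.Adj u w) {s : ℕ}
    {α : Fin (s + 1) → V} (hα : α ∈ arcs G s) (g : X) : g • α ∈ arcs G s :=
  ⟨fun i => (hG g _ _).2 (hα.1 i), fun i j hij h => hα.2 i j hij (MulAction.injective g h)⟩

theorem IsArcTransitive.exists_one (h : IsArcTransitive X G 1) {a b a' b' : V} (h1 : G.Adj a b)
    (h2 : G.Adj a' b') : ∃ g : X, g • a = a' ∧ g • b = b' := by
  obtain ⟨g, hg⟩ := h.2 _ (mem_arcs_one.2 h1) _ (mem_arcs_one.2 h2)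
  rw [smul_vec_two, vec_two_inj] at hg
  exact ⟨g, hg⟩

theorem isArcTransitive_one (hv : IsVertexTransitive X G)
    (h : ∀ a b a' b' : V, G.Adj a b → G.Adj a' b' → ∃ g : X, g • a = a' ∧ g • b = b') :
    IsArcTransitive X G 1 := by
  refine ⟨hv, fun α hα β hβ => ?_⟩
  rw [vec_two_eta α] at hα ⊢
  rw [vec_two_eta β] at hβ ⊢
  obtain ⟨g, hg⟩ := h _ _ _ _ (mem_arcs_one.1 hα) (mem_arcs_one.1 hβ)
  exact ⟨g, by rw [smul_vec_two, vec_two_inj]; exact hg⟩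

theorem IsArcTransitive.exists_two (h : IsArcTransitive X G 2) {a b c a' b' c' : V}
    (h1 : G.Adj a b) (h2 : G.Adj b c) (h3 : a ≠ c) (h1' : G.Adj a' b') (h2' : G.Adj b' c')
    (h3' : a' ≠ c') : ∃ g : X, g • a = a' ∧ g • b = b' ∧ g • c = c' := by
  obtain ⟨g, hg⟩ := h.2 _ (mem_arcs_two.2 ⟨h1, h2, h3⟩) _ (mem_arcs_two.2 ⟨h1', h2', h3'⟩)
  rw [smul_vec_three, vec_three_inj] at hg
  exact ⟨g, hg⟩

theorem isArcTransitive_two (hv : IsVertexTransitive X G)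
    (h : ∀ a b c a' b' c' : V, G.Adj a b → G.Adj b c → a ≠ c → G.Adj a' b' → G.Adj b' c' →
      a' ≠ c' → ∃ g : X, g • a = a' ∧ g • b = b' ∧ g • c = c') :
    IsArcTransitive X G 2 := by
  refine ⟨hv, fun α hα β hβ => ?_⟩
  rw [vec_three_eta α] at hα ⊢
  rw [vec_three_eta β] at hβ ⊢
  obtain ⟨h1, h2, h3⟩ := mem_arcs_two.1 hα
  obtain ⟨h1', h2', h3'⟩ := mem_arcs_two.1 hβ
  obtain ⟨g, hg⟩ := h _ _ _ _ _ _ h1 h2 h3 h1' h2' h3'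
  exact ⟨g, by rw [smul_vec_three, vec_three_inj]; exact hg⟩

/-- Transitivity on `2`-arcs from transitivity of one vertex stabilizer on pairs of
neighbours. -/
theorem isArcTransitive_two_of_stabilizer (hv : IsVertexTransitive X G) (τ : V)
    (h : ∀ a c a' c' : V, G.Adj τ a → G.Adj τ c → G.Adj τ a' → G.Adj τ c' → a ≠ c → a' ≠ c' →
      ∃ g : X, g • τ = τ ∧ g • a = a' ∧ g • c = c') : IsArcTransitive X G 2 := by
  refine isArcTransitive_two hv fun a b c a' b' c' h1 h2 h3 h1' h2' h3' => ?_
  obtain ⟨p, rfl⟩ := hv.2 τ b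
  obtain ⟨q, rfl⟩ := hv.2 τ b'
  have key : ∀ (p : X) (x : V), G.Adj (p • τ) x → G.Adj τ (p⁻¹ • x) := fun p x hx => by
    rw [← hv.1 p, smul_inv_smul]; exact hx
  obtain ⟨g, hg, hga, hgc⟩ := h _ _ _ _ (key p _ h1.symm) (key p _ h2) (key q _ h1'.symm)
    (key q _ h2') (fun h => h3 (MulAction.injective _ h)) (fun h => h3' (MulAction.injective _ h))
  refine ⟨q * g * p⁻¹, ?_, ?_, ?_⟩
  · rw [mul_smul, mul_smul, hga, smul_inv_smul]
  · rw [mul_smul, mul_smul, inv_smul_smul, hg]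
  · rw [mul_smul, mul_smul, hgc, smul_inv_smul]

/-- The stabilizers of the s-arcs are conjugate, so one trivial stabilizer is enough. -/
theorem IsArcTransitive.isArcRegular {s : ℕ} (h : IsArcTransitive X G s) {α : Fin (s + 1) → V}
    (hα : α ∈ arcs G s) (h1 : ∀ g : X, g • α = α → g = 1) : IsArcRegular X G s := by
  refine ⟨h.1, fun β hβ γ hγ => ?_⟩
  obtain ⟨g, hg⟩ := h.2 β hβ γ hγ
  obtain ⟨k, hk⟩ := h.2 α hα β hβ
  refine ⟨g, hg, fun g' hg' => ?_⟩
  have : k⁻¹ * (g⁻¹ * g') * k = 1 := h1 _ (by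
    rw [mul_smul, mul_smul, mul_smul, hk, hg', ← hg, inv_smul_smul, ← hk, inv_smul_smul])
  have h2 : g⁻¹ * g' = 1 := by
    have := congrArg (fun x => k * x * k⁻¹) this
    simpa [mul_assoc] using this
  exact (inv_mul_eq_one.1 h2).symm

/-- Valency at least two extends every arc to a 2-arc. -/
theorem IsArcTransitive.one_of_two (h : IsArcTransitive X G 2)
    (hd : ∀ u, 2 ≤ (G.neighborSet u).ncard) : IsArcTransitive X G 1 := by
  have key : ∀ a b : V, G.Adj a b → ∃ c, G.Adj b c ∧ a ≠ c := by
    intro a b hab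
    obtain ⟨c, hc, hca⟩ := Set.exists_ne_of_one_lt_ncard (hd b) a
    exact ⟨c, hc, hca.symm⟩
  refine isArcTransitive_one h.1 fun a b a' b' hab hab' => ?_
  obtain ⟨c, hc, hac⟩ := key a b hab
  obtain ⟨c', hc', hac'⟩ := key a' b' hab'
  obtain ⟨g, h1, h2, -⟩ := h.exists_two hab hc hac hab' hc' hac'
  exact ⟨g, h1, h2⟩

theorem ncard_smul_set (g : X) (S : Set V) : (g • S).ncard = S.ncard :=
  Set.ncard_image_of_injective S (MulAction.injective g)

theorem smul_neighborSet (hG : ∀ (g : X) (u w : V), G.Adj (g • u) (g • w) ↔ G.Adj u w) (g : X)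
    (u : V) : g • G.neighborSet u = G.neighborSet (g • u) := by
  ext w
  rw [Set.mem_smul_set_iff_inv_smul_mem, SimpleGraph.mem_neighborSet, SimpleGraph.mem_neighborSet,
    ← hG g u, smul_inv_smul]

end ArcBasics

/-! ### The incidence structure on a block -/

namespace InvPartition

variable {X V : Type*} [Group X] [MulAction X V] {P : InvPartition X V} {Γ : SimpleGraph V}

instance [Finite V] : Finite P.Block := Quotient.finite _

theorem mem_carrier {B : P.Block} {u : V} : u ∈ P.carrier B ↔ P.blockOf u = B := Iff.rfl

theorem blockOf_smul (g : X) (u : V) : P.blockOf (g • u) = g • P.blockOf u := rfl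

theorem exists_blockOf (B : P.Block) : ∃ u, P.blockOf u = B := Quotient.exists_rep B

theorem mem_blocksAt {u : V} {C : P.Block} :
    C ∈ P.blocksAt Γ u ↔ ∃ w, P.blockOf w = C ∧ Γ.Adj u w :=
  ⟨fun ⟨w, hw, h⟩ => ⟨w, hw, h.symm⟩, fun ⟨w, hw, h⟩ => ⟨w, hw, h.symm⟩⟩

theorem mem_trace {u : V} {B C : P.Block} :
    u ∈ P.trace Γ B C ↔ C ∈ P.blocksAt Γ u ∧ P.blockOf u = B := Iff.rfl

namespace InG

theorem exists_arc (h : P.InG Γ) (u w : V) (u' w' : V) (h1 : Γ.Adj u w) (h2 : Γ.Adj u' w') :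
    ∃ g : X, g • u = u' ∧ g • w = w' := h.symmetric.exists_one h1 h2

theorem adj_smul (h : P.InG Γ) (g : X) (u w : V) : Γ.Adj (g • u) (g • w) ↔ Γ.Adj u w := h.symmetric.1.1 g u w

theorem exists_smul (h : P.InG Γ) (u w : V) : ∃ g : X, g • u = w := h.symmetric.1.2 u w

/-- The quotient has an edge, so some arc of Γ joins distinct blocks, and arc-transitivity carries
this to every arc. -/
theorem blockOf_ne (h : P.InG Γ) {u w : V} (huw : Γ.Adj u w) : P.blockOf u ≠ P.blockOf w := by
  have h2 := h.two_le_valency (P.blockOf u)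
  obtain ⟨C, hC⟩ : ((P.quotientGraph Γ).neighborSet (P.blockOf u)).Nonempty := by
    rw [Set.nonempty_iff_ne_empty]
    intro h0; rw [h0, Set.ncard_empty] at h2; omega
  obtain ⟨hne, u', hu', w', hw', huw'⟩ := hC
  obtain ⟨g, h1, h2⟩ := h.exists_arc _ _ _ _ huw huw'
  intro heq
  apply hne
  rw [← hu', ← hw', ← h1, ← h2, blockOf_smul, blockOf_smul, heq]

theorem quot_adj (h : P.InG Γ) {u w : V} (huw : Γ.Adj u w) :
    (P.quotientGraph Γ).Adj (P.blockOf u) (P.blockOf w) :=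
  ⟨h.blockOf_ne huw, u, rfl, w, rfl, huw⟩

theorem blocksAt_subset (h : P.InG Γ) (u : V) :
    P.blocksAt Γ u ⊆ (P.quotientGraph Γ).neighborSet (P.blockOf u) := by
  intro C hC
  obtain ⟨w, rfl, hw⟩ := mem_blocksAt.1 hC
  exact h.quot_adj hw

theorem smul_mem_blocksAt (h : P.InG Γ) (g : X) (u : V) (C : P.Block) :
    g • C ∈ P.blocksAt Γ (g • u) ↔ C ∈ P.blocksAt Γ u := by
  rw [mem_blocksAt, mem_blocksAt]
  constructor
  · rintro ⟨w, hw, hadj⟩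
    refine ⟨g⁻¹ • w, by rw [blockOf_smul, hw, inv_smul_smul], ?_⟩
    rw [← h.adj_smul g, smul_inv_smul]; exact hadj
  · rintro ⟨w, rfl, hadj⟩
    exact ⟨g • w, rfl, (h.adj_smul g _ _).2 hadj⟩

theorem smul_blocksAt (h : P.InG Γ) (g : X) (u : V) : g • P.blocksAt Γ u = P.blocksAt Γ (g • u) := by
  ext C
  rw [Set.mem_smul_set_iff_inv_smul_mem, ← h.smul_mem_blocksAt g, smul_inv_smul]

theorem smul_trace (h : P.InG Γ) (g : X) (B C : P.Block) :
    g • P.trace Γ B C = P.trace Γ (g • B) (g • C) := by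
  ext u
  rw [Set.mem_smul_set_iff_inv_smul_mem, mem_trace, mem_trace, ← h.smul_mem_blocksAt g,
    smul_inv_smul, blockOf_smul, inv_smul_eq_iff]

theorem smul_carrier (g : X) (B : P.Block) : g • P.carrier B = P.carrier (g • B) := by
  ext u
  rw [Set.mem_smul_set_iff_inv_smul_mem, mem_carrier, mem_carrier, blockOf_smul,
    inv_smul_eq_iff]

theorem exists_flag (h : P.InG Γ) {u u' : V} {C C' : P.Block} (hC : C ∈ P.blocksAt Γ u)
    (hC' : C' ∈ P.blocksAt Γ u') : ∃ g : X, g • u = u' ∧ g • C = C' := by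
  obtain ⟨w, rfl, hw⟩ := mem_blocksAt.1 hC
  obtain ⟨w', rfl, hw'⟩ := mem_blocksAt.1 hC'
  obtain ⟨g, h1, h2⟩ := h.exists_arc _ _ _ _ hw hw'
  exact ⟨g, h1, by rw [← blockOf_smul, h2]⟩

theorem quot_vertexTransitive (h : P.InG Γ) : IsVertexTransitive X (P.quotientGraph Γ) := by
  constructor
  · have key : ∀ (g : X) (B C : P.Block), (P.quotientGraph Γ).Adj B C →
        (P.quotientGraph Γ).Adj (g • B) (g • C) := by
      rintro g B C ⟨-, u, rfl, w, rfl, hadj⟩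
      exact h.quot_adj ((h.adj_smul g u w).2 hadj)
    refine fun g B C => ⟨fun hadj => ?_, key g B C⟩
    have := key g⁻¹ _ _ hadj
    rwa [inv_smul_smul, inv_smul_smul] at this
  · intro B C
    obtain ⟨u, rfl⟩ := exists_blockOf B
    obtain ⟨w, rfl⟩ := exists_blockOf C
    obtain ⟨g, rfl⟩ := h.exists_smul u w
    exact ⟨g, rfl⟩

theorem quot_arcTransitive (h : P.InG Γ) : IsArcTransitive X (P.quotientGraph Γ) 1 := by
  refine isArcTransitive_one h.quot_vertexTransitive ?_
  rintro _ _ _ _ ⟨-, u, rfl, w, rfl, hadj⟩ ⟨-, u', rfl, w', rfl, hadj'⟩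
  obtain ⟨g, rfl, rfl⟩ := h.exists_arc _ _ _ _ hadj hadj'
  exact ⟨g, rfl, rfl⟩

theorem ncard_carrier (h : P.InG Γ) (B C : P.Block) : (P.carrier B).ncard = (P.carrier C).ncard := by
  obtain ⟨g, rfl⟩ := h.quot_vertexTransitive.2 B C
  rw [← smul_carrier, ncard_smul_set]

theorem ncard_neighborSet (h : P.InG Γ) (B C : P.Block) : ((P.quotientGraph Γ).neighborSet B).ncard =
    ((P.quotientGraph Γ).neighborSet C).ncard := by
  obtain ⟨g, rfl⟩ := h.quot_vertexTransitive.2 B C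
  rw [← smul_neighborSet h.quot_vertexTransitive.1, ncard_smul_set]

theorem ncard_blocksAt (h : P.InG Γ) (u w : V) : (P.blocksAt Γ u).ncard = (P.blocksAt Γ w).ncard := by
  obtain ⟨g, rfl⟩ := h.exists_smul u w
  rw [← h.smul_blocksAt, ncard_smul_set]

theorem ncard_trace (h : P.InG Γ) {B C B' C' : P.Block} (h1 : (P.quotientGraph Γ).Adj B C)
    (h2 : (P.quotientGraph Γ).Adj B' C') : (P.trace Γ B C).ncard = (P.trace Γ B' C').ncard := by
  obtain ⟨g, rfl, rfl⟩ := h.quot_arcTransitive.exists_one h1 h2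
  rw [← h.smul_trace, ncard_smul_set]

theorem exists_mem_trace {B C : P.Block} (hBC : (P.quotientGraph Γ).Adj B C) :
    ∃ u w, P.blockOf u = B ∧ P.blockOf w = C ∧ Γ.Adj u w := by
  obtain ⟨-, u, hu, w, hw, hadj⟩ := hBC
  exact ⟨u, w, hu, hw, hadj⟩

theorem exists_adj (h : P.InG Γ) (u : V) : ∃ w, Γ.Adj u w := by
  obtain ⟨C, hC⟩ : ((P.quotientGraph Γ).neighborSet (P.blockOf u)).Nonempty := by
    rw [Set.nonempty_iff_ne_empty]
    intro h0
    have := h.two_le_valency (P.blockOf u)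
    rw [h0, Set.ncard_empty] at this; omega
  obtain ⟨u', w', -, -, hadj⟩ := exists_mem_trace hC
  obtain ⟨g, rfl⟩ := h.exists_smul u' u
  exact ⟨g • w', (h.adj_smul g _ _).2 hadj⟩

end InG

/-- The neighbours of `u` in the block `C`. -/
def nbrsIn (P : InvPartition X V) (Γ : SimpleGraph V) (u : V) (C : P.Block) : Set V :=
  {w | Γ.Adj u w ∧ P.blockOf w = C}

theorem nbrsIn_subset (u : V) (C : P.Block) :
    P.nbrsIn Γ u C ⊆ P.trace Γ C (P.blockOf u) :=
  fun _ hw => ⟨⟨u, rfl, hw.1⟩, hw.2⟩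

namespace InG

theorem ncard_nbrsIn (h : P.InG Γ) {u u' : V} {C C' : P.Block} (hC : C ∈ P.blocksAt Γ u)
    (hC' : C' ∈ P.blocksAt Γ u') : (P.nbrsIn Γ u C).ncard = (P.nbrsIn Γ u' C').ncard := by
  obtain ⟨g, rfl, rfl⟩ := h.exists_flag hC hC'
  rw [← ncard_smul_set g]
  congr 1
  ext w
  rw [Set.mem_smul_set_iff_inv_smul_mem]
  simp only [nbrsIn, Set.mem_ofPred_eq]
  rw [← h.adj_smul g, smul_inv_smul, blockOf_smul, inv_smul_eq_iff]

/-- The neighbours of `u` are distributed over the r blocks at `u`, with t in each. -/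
theorem hasValency [Finite V] {t r : ℕ}
    (ht : ∀ (u : V) (C : P.Block), C ∈ P.blocksAt Γ u → (P.nbrsIn Γ u C).ncard = t)
    (hr : ∀ u : V, (P.blocksAt Γ u).ncard = r) : HasValency Γ (r * t) := by
  intro u
  have := ncard_mul_eq_ncard_mul (fun w C => P.blockOf w = C) (Γ.neighborSet u) (P.blocksAt Γ u)
    (a := 1) (c := t) ?_ ?_
  · rw [← hr u, ← this, mul_one]
  · intro w hw
    rw [Set.ncard_eq_one]
    refine ⟨P.blockOf w, ?_⟩
    ext C
    simp only [Set.mem_ofPred_eq, Set.mem_singleton_iff]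
    exact ⟨fun hC => hC.2.symm, by
      rintro rfl
      exact ⟨mem_blocksAt.2 ⟨w, rfl, hw⟩, rfl⟩⟩
  · intro C hC
    exact ht u C hC

/-- The number of neighbours of a vertex in an adjacent block is the same for all flags. -/
theorem exists_ncard_nbrsIn (h : P.InG Γ) [Finite V]
    (hk : ∀ B C : P.Block, (P.quotientGraph Γ).Adj B C → (P.trace Γ B C).ncard = 3) (u₀ : V) :
    ∃ t, (∀ (u : V) (C : P.Block), C ∈ P.blocksAt Γ u → (P.nbrsIn Γ u C).ncard = t) ∧
      (t = 1 ∨ t = 2 ∨ t = 3) := by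
  obtain ⟨w, hw⟩ := h.exists_adj u₀
  have hC : P.blockOf w ∈ P.blocksAt Γ u₀ := mem_blocksAt.2 ⟨w, rfl, hw⟩
  refine ⟨_, fun u C hu => h.ncard_nbrsIn hu hC, ?_⟩
  have h1 : (P.nbrsIn Γ u₀ (P.blockOf w)).ncard ≤ 3 := by
    rw [← hk _ _ (h.quot_adj hw).symm]
    exact Set.ncard_le_ncard (nbrsIn_subset u₀ _)
  have h2 : 0 < (P.nbrsIn Γ u₀ (P.blockOf w)).ncard := by
    rw [Set.ncard_pos]; exact ⟨w, hw, rfl⟩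
  omega

end InG

end InvPartition

/-! ### The graphs between adjacent blocks -/

section Bipartite

/-- The bipartite graph on `3 + 3` vertices with the given incidence. -/
def bipGraph (R : Fin 3 → Fin 3 → Prop) : SimpleGraph (Fin 3 ⊕ Fin 3) where
  Adj a b := (∃ i j, a = Sum.inl i ∧ b = Sum.inr j ∧ R i j) ∨
    ∃ i j, b = Sum.inl i ∧ a = Sum.inr j ∧ R i j
  symm := ⟨fun _ _ h => h.symm⟩
  loopless := ⟨fun a h => by
    rcases h with ⟨i, j, h1, h2, -⟩ | ⟨i, j, h1, h2, -⟩ <;> rw [h1] at h2 <;> cases h2⟩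

theorem nonempty_induce_iso_bipGraph {V : Type*} (Γ : SimpleGraph V) {S T : Set V}
    (hd : Disjoint S T) (hS : ∀ u ∈ S, ∀ w ∈ S, ¬ Γ.Adj u w) (hT : ∀ u ∈ T, ∀ w ∈ T, ¬ Γ.Adj u w)
    (e : S ≃ Fin 3) (f : T ≃ Fin 3) (R : Fin 3 → Fin 3 → Prop)
    (hR : ∀ (u : S) (w : T), Γ.Adj u w ↔ R (e u) (f w)) :
    Nonempty (Γ.induce (S ∪ T) ≃g bipGraph R) := by
  classical
  refine ⟨RelIso.symm (RelIso.mk ((Equiv.sumCongr e f).symm.trans (Equiv.Set.union hd).symm) ?_)⟩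
  have hR' : ∀ i j, Γ.Adj (e.symm i) (f.symm j) ↔ R i j := fun i j => by simp [hR]
  rintro (i | i) (j | j)
  · simpa [bipGraph] using hS _ (e.symm i).2 _ (e.symm j).2
  · simpa [bipGraph] using hR' i j
  · simpa [bipGraph, SimpleGraph.adj_comm] using hR' j i
  · simpa [bipGraph] using hT _ (f.symm i).2 _ (f.symm j).2

theorem bipGraph_eq_K33 : bipGraph (fun _ _ => True) = K33 := by
  ext a b
  rcases a with i | i <;> rcases b with j | j <;> simp [bipGraph, K33]

theorem bipGraph_eq_K33minus : bipGraph (fun i j => i ≠ j) = K33minus := by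
  ext a b
  rcases a with i | i <;> rcases b with j | j <;> simp [bipGraph, K33minus]

theorem nonempty_bipGraph_iso_copies : Nonempty (bipGraph (fun i j => i = j) ≃g copies 3 K2) := by
  let e : Fin 3 ⊕ Fin 3 ≃ Fin 3 × Fin 2 :=
    { toFun := fun a => Sum.elim (fun i => (i, 0)) (fun i => (i, 1)) a
      invFun := fun p => if p.2 = 0 then Sum.inl p.1 else Sum.inr p.1
      left_inv := by decide
      right_inv := by decide }
  refine ⟨⟨e, ?_⟩⟩
  rintro (i | i) (j | j) <;> simp [bipGraph, copies, K2, e, eq_comm]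

/-- Applied to adjacency when t = 1 and to non-adjacency when t = 2: each vertex has exactly one
partner on the other side, so the relation is a perfect matching. -/
theorem exists_equiv_of_unique {S T : Type*} (Q : S → T → Prop) (h1 : ∀ u, ∃! w, Q u w)
    (h2 : ∀ w, ∃! u, Q u w) : ∃ f : S ≃ T, ∀ u w, Q u w ↔ f u = w := by
  choose f hf hf' using h1
  choose g hg hg' using h2
  refine ⟨⟨f, g, fun u => ((hg' _ _ (hf u))).symm, fun w => (hf' _ _ (hg w)).symm⟩,
    fun u w => ⟨fun h => (hf' u w h).symm, ?_⟩⟩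
  rintro rfl
  exact hf u

end Bipartite

namespace InvPartition.InG

variable {X V : Type*} [Group X] [MulAction X V] {P : InvPartition X V} {Γ : SimpleGraph V}

theorem ncard_adj_trace {t : ℕ}
    (ht : ∀ (u : V) (C : P.Block), C ∈ P.blocksAt Γ u → (P.nbrsIn Γ u C).ncard = t)
    {B C : P.Block} {u : V} (hu : u ∈ P.trace Γ B C) :
    {w ∈ P.trace Γ C B | Γ.Adj u w}.ncard = t := by
  rw [← ht u C hu.1]
  congr 1
  ext w
  constructor
  · rintro ⟨hw, hadj⟩
    exact ⟨hadj, hw.2⟩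
  · rintro ⟨hadj, hw⟩
    exact ⟨⟨⟨u, hu.2, hadj⟩, hw⟩, hadj⟩

theorem existsUnique_of_ncard {V : Type*} {T : Set V} {Q : V → Prop}
    (h : {w ∈ T | Q w}.ncard = 1) : ∃! w : T, Q w := by
  obtain ⟨w, hw⟩ := Set.ncard_eq_one.1 h
  have hw' : w ∈ {w ∈ T | Q w} := by rw [hw]; rfl
  refine ⟨⟨w, hw'.1⟩, hw'.2, fun x hx => Subtype.ext ?_⟩
  have : (x : V) ∈ {w ∈ T | Q w} := ⟨x.2, hx⟩
  rw [hw] at this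
  exact this

theorem disjoint_trace {B C : P.Block} (hBC : (P.quotientGraph Γ).Adj B C) :
    Disjoint (P.trace Γ B C) (P.trace Γ C B) := by
  rw [Set.disjoint_left]
  intro u hu hu'
  exact hBC.1 (hu.2.symm.trans hu'.2)

theorem not_adj_of_trace (h : P.InG Γ) (B C : P.Block) (u : V) (hu : u ∈ P.trace Γ B C) (w : V)
    (hw : w ∈ P.trace Γ B C) : ¬ Γ.Adj u w :=
  fun hadj => h.blockOf_ne hadj (hu.2.trans hw.2.symm)

variable [Finite V]

theorem ncard_not_adj_trace
    (hk : ∀ B C : P.Block, (P.quotientGraph Γ).Adj B C → (P.trace Γ B C).ncard = 3)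
    (ht : ∀ (u : V) (C : P.Block), C ∈ P.blocksAt Γ u → (P.nbrsIn Γ u C).ncard = 2)
    {B C : P.Block} (hBC : (P.quotientGraph Γ).Adj B C) {u : V} (hu : u ∈ P.trace Γ B C) :
    {w ∈ P.trace Γ C B | ¬ Γ.Adj u w}.ncard = 1 := by
  have h1 := ncard_adj_trace ht hu
  have h2 := hk C B hBC.symm
  have h3 := Set.ncard_sdiff_add_ncard_of_subset
    (Set.sep_subset (P.trace Γ C B) (fun w => Γ.Adj u w))
  rw [h1, h2] at h3
  have h4 : {w ∈ P.trace Γ C B | ¬ Γ.Adj u w} =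
      P.trace Γ C B \ {w ∈ P.trace Γ C B | Γ.Adj u w} := by
    ext w; simp
  rw [h4]; omega

theorem betweenIso_three_K2 (h : P.InG Γ)
    (hk : ∀ B C : P.Block, (P.quotientGraph Γ).Adj B C → (P.trace Γ B C).ncard = 3)
    (ht : ∀ (u : V) (C : P.Block), C ∈ P.blocksAt Γ u → (P.nbrsIn Γ u C).ncard = 1) :
    P.BetweenIso Γ (copies 3 K2) := by
  intro B C hBC
  obtain ⟨f, hf⟩ := exists_equiv_of_unique
    (fun (u : P.trace Γ B C) (w : P.trace Γ C B) => Γ.Adj u w)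
    (fun u => existsUnique_of_ncard (ncard_adj_trace ht u.2))
    (fun w => by
      simp_rw [Γ.adj_comm _ (w : V)]
      exact existsUnique_of_ncard (ncard_adj_trace ht w.2))
  -- One side is numbered arbitrarily and the other through the matching `f`, which turns the
  -- relation into i = j.
  let e : P.trace Γ B C ≃ Fin 3 := Finite.equivFinOfCardEq (hk B C hBC)
  obtain ⟨φ⟩ := nonempty_induce_iso_bipGraph Γ (disjoint_trace hBC) (h.not_adj_of_trace B C)
    (h.not_adj_of_trace C B) e (f.symm.trans e) (fun i j => i = j)
    (fun u w => by rw [hf u w]; simp [Equiv.eq_symm_apply])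
  obtain ⟨ψ⟩ := nonempty_bipGraph_iso_copies
  exact ⟨φ.trans ψ⟩

theorem betweenIso_K33minus (h : P.InG Γ)
    (hk : ∀ B C : P.Block, (P.quotientGraph Γ).Adj B C → (P.trace Γ B C).ncard = 3)
    (ht : ∀ (u : V) (C : P.Block), C ∈ P.blocksAt Γ u → (P.nbrsIn Γ u C).ncard = 2) :
    P.BetweenIso Γ K33minus := by
  intro B C hBC
  obtain ⟨f, hf⟩ := exists_equiv_of_unique
    (fun (u : P.trace Γ B C) (w : P.trace Γ C B) => ¬ Γ.Adj u w)
    (fun u => existsUnique_of_ncard (ncard_not_adj_trace hk ht hBC u.2))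
    (fun w => by
      simp_rw [Γ.adj_comm _ (w : V)]
      exact existsUnique_of_ncard (ncard_not_adj_trace hk ht hBC.symm w.2))
  let e : P.trace Γ B C ≃ Fin 3 := Finite.equivFinOfCardEq (hk B C hBC)
  rw [← bipGraph_eq_K33minus]
  exact nonempty_induce_iso_bipGraph Γ (disjoint_trace hBC) (h.not_adj_of_trace B C)
    (h.not_adj_of_trace C B) e (f.symm.trans e) (fun i j => i ≠ j)
    (fun u w => by rw [← not_iff_not, hf u w]; simp [Equiv.eq_symm_apply])

theorem adj_of_ncard_three
    (hk : ∀ B C : P.Block, (P.quotientGraph Γ).Adj B C → (P.trace Γ B C).ncard = 3)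
    (ht : ∀ (u : V) (C : P.Block), C ∈ P.blocksAt Γ u → (P.nbrsIn Γ u C).ncard = 3)
    {B C : P.Block} (hBC : (P.quotientGraph Γ).Adj B C) {u w : V} (hu : u ∈ P.trace Γ B C)
    (hw : w ∈ P.trace Γ C B) : Γ.Adj u w := by
  have h1 := ncard_adj_trace ht hu
  have h2 := hk C B hBC.symm
  have h3 := Set.eq_of_subset_of_ncard_le
    (Set.sep_subset (P.trace Γ C B) (fun w => Γ.Adj u w)) (by rw [h1, h2])
  rw [← h3] at hw
  exact hw.2

theorem betweenIso_K33 (h : P.InG Γ)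
    (hk : ∀ B C : P.Block, (P.quotientGraph Γ).Adj B C → (P.trace Γ B C).ncard = 3)
    (ht : ∀ (u : V) (C : P.Block), C ∈ P.blocksAt Γ u → (P.nbrsIn Γ u C).ncard = 3) :
    P.BetweenIso Γ K33 := by
  intro B C hBC
  rw [← bipGraph_eq_K33]
  exact nonempty_induce_iso_bipGraph Γ (disjoint_trace hBC) (h.not_adj_of_trace B C)
    (h.not_adj_of_trace C B) (Finite.equivFinOfCardEq (hk B C hBC))
    (Finite.equivFinOfCardEq (hk C B hBC.symm)) (fun _ _ => True)
    (fun u w => by simpa using adj_of_ncard_three hk ht hBC u.2 w.2)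

/-- `Γ` is connected as soon as `Γ_𝓑` is, the vertices of a block that see a common block are
joined by a path, and any two of the sets `Γ(C) ∩ B` meet. -/
theorem connected_of_two_le (h : P.InG Γ) (hc : (P.quotientGraph Γ).Connected)
    (hk : ∀ B C : P.Block, (P.quotientGraph Γ).Adj B C → (P.trace Γ B C).ncard = 3) {t : ℕ}
    (ht : ∀ (u : V) (C : P.Block), C ∈ P.blocksAt Γ u → (P.nbrsIn Γ u C).ncard = t)
    (ht2 : 2 ≤ t)
    (hmeet : ∀ B C D : P.Block, (P.quotientGraph Γ).Adj B C → (P.quotientGraph Γ).Adj B D →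
      ∃ x, x ∈ P.trace Γ B C ∧ x ∈ P.trace Γ B D) : Γ.Connected := by
  have h1 : ∀ {B C : P.Block} {u u' : V}, u ∈ P.trace Γ B C → u' ∈ P.trace Γ B C →
      Γ.Reachable u u' := by
    intro B C u u' hu hu'
    have hBC : (P.quotientGraph Γ).Adj B C := by
      have := h.blocksAt_subset u hu.1
      rwa [hu.2] at this
    have hex : ∃ w, w ∈ P.nbrsIn Γ u C ∧ w ∈ P.nbrsIn Γ u' C := by
      by_contra hne
      push Not at hne
      have hd : Disjoint (P.nbrsIn Γ u C) (P.nbrsIn Γ u' C) := Set.disjoint_left.2 hne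
      have h2 := Set.ncard_union_eq hd
      rw [ht u C hu.1, ht u' C hu'.1] at h2
      have h3 : (P.nbrsIn Γ u C ∪ P.nbrsIn Γ u' C).ncard ≤ 3 := by
        rw [← hk C B hBC.symm]
        refine Set.ncard_le_ncard (Set.union_subset ?_ ?_)
        · rw [← hu.2]; exact nbrsIn_subset _ _
        · rw [← hu'.2]; exact nbrsIn_subset _ _
      omega
    obtain ⟨w, hw, hw'⟩ := hex
    exact hw.1.reachable.trans hw'.1.symm.reachable
  have h2 : ∀ {u u' : V}, P.blockOf u = P.blockOf u' → Γ.Reachable u u' := by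
    intro u u' huu
    obtain ⟨w, hw⟩ := h.exists_adj u
    obtain ⟨w', hw'⟩ := h.exists_adj u'
    have hB := h.quot_adj hw
    have hB' := h.quot_adj hw'
    rw [← huu] at hB'
    obtain ⟨x, hx, hx'⟩ := hmeet _ _ _ hB hB'
    exact (h1 (B := P.blockOf u) ⟨⟨w, rfl, hw.symm⟩, rfl⟩ hx).trans
      (h1 hx' ⟨⟨w', rfl, hw'.symm⟩, huu.symm⟩)
  have h3 : ∀ {B C : P.Block} (_ : (P.quotientGraph Γ).Walk B C) (u w : V), P.blockOf u = B →
      P.blockOf w = C → Γ.Reachable u w := by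
    intro B C p
    induction p with
    | nil => exact fun u w hu hw => h2 (hu.trans hw.symm)
    | cons hadj _ ih =>
      intro u w hu hw
      obtain ⟨x, y, hx, hy, hxy⟩ := exists_mem_trace hadj
      exact (h2 (hu.trans hx.symm)).trans (hxy.reachable.trans (ih y w hy hw))
  have : Nonempty V := by
    obtain ⟨B⟩ := hc.nonempty
    exact ⟨(exists_blockOf B).choose⟩
  refine ⟨fun u w => ?_⟩
  obtain ⟨p⟩ := hc.preconnected (P.blockOf u) (P.blockOf w)
  exact h3 p u w rfl rfl

/-- Some 2-arcs of Γ have both ends in one block, since t ≥ 2, and some have ends in different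
blocks, since r ≥ 2. An element of X preserves the partition and cannot map one kind to the other.
-/
theorem isSTransitive_one (h : P.InG Γ) {t r : ℕ}
    (ht : ∀ (u : V) (C : P.Block), C ∈ P.blocksAt Γ u → (P.nbrsIn Γ u C).ncard = t)
    (ht2 : 2 ≤ t) {u : V} (hr : (P.blocksAt Γ u).ncard = r) (hr2 : 2 ≤ r) :
    IsSTransitive X Γ 1 := by
  refine ⟨h.symmetric, fun h2 => ?_⟩
  obtain ⟨C, hC, D, hD, hCD⟩ := (Set.one_lt_ncard).1 (show 1 < (P.blocksAt Γ u).ncard by omega)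
  obtain ⟨w, hw, w', hw', hne⟩ :=
    (Set.one_lt_ncard).1 (show 1 < (P.nbrsIn Γ u C).ncard by rw [ht u C hC]; omega)
  obtain ⟨x, rfl, hx⟩ := mem_blocksAt.1 hD
  have hwx : w ≠ x := by
    rintro rfl
    exact hCD hw.2.symm
  obtain ⟨g, h1, -, h3⟩ := h2.exists_two hw.1.symm hw'.1 hne hw.1.symm hx hwx
  apply hCD
  rw [← hw.2, ← h1, ← h3, blockOf_smul, blockOf_smul, hw.2, hw'.2]

end InvPartition.InG

/-! ### The Fano plane -/

section Fano

/-- The third point on the line of the Fano plane through two points; the lines are the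
translates of `{1, 2, 4}` modulo `7`. -/
def third (x y : Fin 7) : Fin 7 := x + ![0, 3, 6, 1, 5, 4, 2] (y - x)

/-- The lines of the Fano plane. -/
def fanoLine (i : Fin 7) : Finset (Fin 7) := {i + 1, i + 2, i + 4}

/-- The collineations of the Fano plane. -/
def fanoAut : Subgroup (Equiv.Perm (Fin 7)) where
  carrier := {π | ∀ x y, π (third x y) = third (π x) (π y)}
  one_mem' := fun x y => rfl
  mul_mem' := by
    intro π ρ hπ hρ x y
    rw [Equiv.Perm.mul_apply, hρ, hπ]; rfl
  inv_mem' := by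
    intro π hπ x y
    rw [Equiv.Perm.inv_eq_iff_eq, hπ]
    exact congrArg₂ third (π.apply_symm_apply x).symm (π.apply_symm_apply y).symm

theorem mem_fanoAut {π : Equiv.Perm (Fin 7)} :
    π ∈ fanoAut ↔ ∀ x y, π (third x y) = third (π x) (π y) := Iff.rfl

/-- The map with prescribed values at `0`, `1`, `2` that is compatible with `third`. -/
def fanoExtend (a b c : Fin 7) : Fin 7 → Fin 7 :=
  ![a, b, c, third a b, third b c, third a (third b c), third a c]

theorem eq_fanoExtend {π : Equiv.Perm (Fin 7)} (hπ : π ∈ fanoAut) (x : Fin 7) :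
    π x = fanoExtend (π 0) (π 1) (π 2) x := by
  have h3 : π 3 = third (π 0) (π 1) := hπ 0 1
  have h4 : π 4 = third (π 1) (π 2) := hπ 1 2
  have h5 : π 5 = third (π 0) (π 4) := hπ 0 4
  have h6 : π 6 = third (π 0) (π 2) := hπ 0 2
  rw [h4] at h5
  fin_cases x
  exacts [rfl, rfl, rfl, h3, h4, h5, h6]

theorem fanoAut_ext {π ρ : Equiv.Perm (Fin 7)} (hπ : π ∈ fanoAut) (hρ : ρ ∈ fanoAut)
    (h0 : π 0 = ρ 0) (h1 : π 1 = ρ 1) (h2 : π 2 = ρ 2) : π = ρ := by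
  ext x
  rw [eq_fanoExtend hπ, eq_fanoExtend hρ, h0, h1, h2]

/-- The elation with centre `p` whose axis is the line through `p` and `q`. -/
def elation (p q x : Fin 7) : Fin 7 :=
  if x = p ∨ x = q ∨ x = third p q then x else third p x

theorem elation_elation : ∀ p q x : Fin 7, p ≠ q → elation p q (elation p q x) = x := by decide

/-- Only the axis matters, not the point `q` that names it. -/
theorem elation_third_axis : ∀ p q x : Fin 7, p ≠ q → elation p (third p q) x = elation p q x := by
  decide

set_option maxRecDepth 20000 in
theorem elation_third : ∀ p q x y : Fin 7, p ≠ q →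
    elation p q (third x y) = third (elation p q x) (elation p q y) := by
  decide +kernel

/-- An elation as a permutation. -/
def elationPerm (p q : Fin 7) (h : p ≠ q) : Equiv.Perm (Fin 7) where
  toFun := elation p q
  invFun := elation p q
  left_inv x := elation_elation p q x h
  right_inv x := elation_elation p q x h

theorem elationPerm_mem (p q : Fin 7) (h : p ≠ q) : elationPerm p q h ∈ fanoAut :=
  fun x y => elation_third p q x y h

set_option maxRecDepth 20000 in
/-- A collineation of order two is an elation. -/
theorem exists_elation_of_involutive : ∀ a b c : Fin 7,
    (∀ x, fanoExtend a b c (fanoExtend a b c x) = x) → (∃ x, fanoExtend a b c x ≠ x) →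
    ∃ p q, p ≠ q ∧ ∀ x, fanoExtend a b c x = elation p q x := by
  decide +kernel

/-- Elations carry a triangle to 0, 1, 2 one vertex at a time. This and the next two statements
supply an elation that puts one vertex into place and fixes those placed before; in the last one 3
is excluded because it lies on the line through 0 and 1. -/
theorem exists_elation_zero : ∀ a : Fin 7, a ≠ 0 → ∃ p q, p ≠ q ∧ elation p q a = 0 := by decide

theorem exists_elation_one : ∀ b : Fin 7, b ≠ 0 → b ≠ 1 →
    ∃ p q, p ≠ q ∧ elation p q 0 = 0 ∧ elation p q b = 1 := by decide

theorem exists_elation_two : ∀ c : Fin 7, c ≠ 0 → c ≠ 1 → c ≠ 3 → c ≠ 2 →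
    ∃ p q, p ≠ q ∧ elation p q 0 = 0 ∧ elation p q 1 = 1 ∧ elation p q c = 2 := by decide

theorem exists_mem_triangle {H : Subgroup (Equiv.Perm (Fin 7))} (hH : H ≤ fanoAut)
    (hE : ∀ (p q : Fin 7) (h : p ≠ q), elationPerm p q h ∈ H) {a b c : Fin 7} (hab : a ≠ b)
    (hca : c ≠ a) (hcb : c ≠ b) (hc : c ≠ third a b) :
    ∃ g ∈ H, g a = 0 ∧ g b = 1 ∧ g c = 2 := by
  obtain ⟨f, hf, hfa⟩ : ∃ f ∈ H, f a = 0 := by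
    by_cases h : a = 0
    · exact ⟨1, H.one_mem, h⟩
    · obtain ⟨p, q, hpq, h1⟩ := exists_elation_zero a h
      exact ⟨_, hE p q hpq, h1⟩
  obtain ⟨g, hg, hga, hgb⟩ : ∃ g ∈ H, g a = 0 ∧ g b = 1 := by
    have hb0 : f b ≠ 0 := fun h => hab (f.injective (hfa.trans h.symm))
    by_cases h : f b = 1
    · exact ⟨f, hf, hfa, h⟩
    · obtain ⟨p, q, hpq, h1, h2⟩ := exists_elation_one _ hb0 h
      refine ⟨elationPerm p q hpq * f, H.mul_mem (hE p q hpq) hf, ?_, h2⟩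
      rw [Equiv.Perm.mul_apply, hfa]; exact h1
  have h0 : g c ≠ 0 := fun h => hca (g.injective (h.trans hga.symm))
  have h1 : g c ≠ 1 := fun h => hcb (g.injective (h.trans hgb.symm))
  have h3 : g c ≠ 3 := fun h => hc (g.injective (by rw [h, hH hg, hga, hgb]; rfl))
  by_cases h2 : g c = 2
  · exact ⟨g, hg, hga, hgb, h2⟩
  · obtain ⟨p, q, hpq, e0, e1, e2⟩ := exists_elation_two _ h0 h1 h3 h2
    refine ⟨elationPerm p q hpq * g, H.mul_mem (hE p q hpq) hg, ?_, ?_, e2⟩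
    · rw [Equiv.Perm.mul_apply, hga]; exact e0
    · rw [Equiv.Perm.mul_apply, hgb]; exact e1

theorem third_ne : ∀ x y : Fin 7, x ≠ y → third x y ≠ x ∧ third x y ≠ y := by decide

theorem third_third : ∀ x y : Fin 7, x ≠ y → third x (third x y) = y := by decide

theorem two_ne_third {π : Equiv.Perm (Fin 7)} (hπ : π ∈ fanoAut) : π 2 ≠ third (π 0) (π 1) := by
  rw [← hπ]
  exact fun h => absurd (π.injective h) (by decide)

/-- A group containing all elations is transitive on ordered triangles, and the only collineation
fixing 0, 1 and 2 is the identity. -/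
theorem eq_fanoAut_of_elations {H : Subgroup (Equiv.Perm (Fin 7))} (hH : H ≤ fanoAut)
    (hE : ∀ (p q : Fin 7) (h : p ≠ q), elationPerm p q h ∈ H) : H = fanoAut := by
  refine le_antisymm hH fun π hπ => ?_
  obtain ⟨g, hg, h0, h1, h2⟩ := exists_mem_triangle hH hE (a := π 0) (b := π 1) (c := π 2)
    (π.injective.ne (by decide)) (π.injective.ne (by decide)) (π.injective.ne (by decide))
    (two_ne_third hπ)
  have : g * π = 1 := fanoAut_ext (fanoAut.mul_mem (hH hg) hπ) fanoAut.one_mem h0 h1 h2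
  rw [eq_inv_of_mul_eq_one_right this]
  exact H.inv_mem hg

/-- A flag-transitive group of collineations of even order contains all collineations. -/
theorem eq_fanoAut {H : Subgroup (Equiv.Perm (Fin 7))} (hH : H ≤ fanoAut)
    (hflag : ∀ p q p' q' : Fin 7, p ≠ q → p' ≠ q' →
      ∃ g ∈ H, g p = p' ∧ (g q = q' ∨ g q = third p' q'))
    {t : Equiv.Perm (Fin 7)} (ht : t ∈ H) (ht2 : t * t = 1) (ht1 : t ≠ 1) : H = fanoAut := by
  -- A flag is given by a point p and a second point q of the line. The involution t is an elation,
  -- a conjugate of it by g has the centre and the axis moved by g, and flag-transitivity thus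
  -- yields every elation.
  refine eq_fanoAut_of_elations hH fun p' q' hpq' => ?_
  have hext := eq_fanoExtend (hH ht)
  obtain ⟨p, q, hpq, hel⟩ := exists_elation_of_involutive (t 0) (t 1) (t 2)
    (fun x => by rw [← hext, ← hext, ← Equiv.Perm.mul_apply, ht2]; rfl)
    (by
      by_contra hc
      push Not at hc
      exact ht1 (Equiv.ext fun x => (hext x).trans (hc x)))
  obtain ⟨g, hg, hgp, hgq⟩ := hflag p q p' q' hpq hpq'
  have hgq' : elation p' (g q) = elation p' q' := by
    rcases hgq with h | h
    · rw [h]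
    · rw [h]; funext x; exact elation_third_axis p' q' x hpq'
  have : elationPerm p' q' hpq' = g * t * g⁻¹ := by
    rw [eq_mul_inv_iff_mul_eq]
    ext x
    congr 1
    change elation p' q' (g x) = g (t x)
    rw [hext, hel, ← hgq', ← hgp, elation, elation, ← hH hg]
    simp only [g.injective.eq_iff]
    split_ifs with h1
    · rfl
    · rw [hH hg]
  rw [this]
  exact H.mul_mem (H.mul_mem hg ht) (H.inv_mem hg)

theorem exists_fanoAut_triangle {a b c a' b' c' : Fin 7} (hab : a ≠ b)
    (hca : c ≠ a) (hcb : c ≠ b) (hc : c ≠ third a b) (hab' : a' ≠ b')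
    (hca' : c' ≠ a') (hcb' : c' ≠ b') (hc' : c' ≠ third a' b') :
    ∃ g ∈ fanoAut, g a = a' ∧ g b = b' ∧ g c = c' := by
  obtain ⟨f, hf, h0, h1, h2⟩ := exists_mem_triangle le_rfl elationPerm_mem hab hca hcb hc
  obtain ⟨g, hg, h0', h1', h2'⟩ := exists_mem_triangle le_rfl elationPerm_mem hab' hca' hcb' hc'
  refine ⟨g⁻¹ * f, fanoAut.mul_mem (fanoAut.inv_mem hg) hf, ?_, ?_, ?_⟩
  · rw [Equiv.Perm.mul_apply, h0, ← h0']; exact g.symm_apply_apply _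
  · rw [Equiv.Perm.mul_apply, h1, ← h1']; exact g.symm_apply_apply _
  · rw [Equiv.Perm.mul_apply, h2, ← h2']; exact g.symm_apply_apply _

/-- The ordered triangles of the Fano plane. -/
abbrev Triangle : Type :=
  {t : Fin 7 × Fin 7 × Fin 7 //
    t.1 ≠ t.2.1 ∧ t.2.2 ≠ t.1 ∧ t.2.2 ≠ t.2.1 ∧ t.2.2 ≠ third t.1 t.2.1}

set_option maxRecDepth 20000 in
theorem card_triangle : Fintype.card Triangle = 168 := by decide +kernel

/-- Collineations correspond to the images of the triangle 0, 1, 2, and there are 7 · 6 · 4 ordered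
triangles. -/
theorem card_fanoAut : Nat.card fanoAut = 168 := by
  rw [← card_triangle, ← Nat.card_eq_fintype_card]
  refine Nat.card_congr (Equiv.ofBijective (fun π : fanoAut =>
    (⟨((π : Equiv.Perm (Fin 7)) 0, (π : Equiv.Perm (Fin 7)) 1, (π : Equiv.Perm (Fin 7)) 2),
      (π : Equiv.Perm (Fin 7)).injective.ne (by decide),
      (π : Equiv.Perm (Fin 7)).injective.ne (by decide),
      (π : Equiv.Perm (Fin 7)).injective.ne (by decide), two_ne_third π.2⟩ : Triangle)) ⟨?_, ?_⟩)
  · intro π ρ h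
    have h := congrArg Subtype.val h
    simp only [Prod.mk.injEq] at h
    exact Subtype.ext (fanoAut_ext π.2 ρ.2 h.1 h.2.1 h.2.2)
  · rintro ⟨⟨a, b, c⟩, h1, h2, h3, h4⟩
    obtain ⟨g, hg, e0, e1, e2⟩ := exists_fanoAut_triangle (a := 0) (b := 1) (c := 2) (by decide)
      (by decide) (by decide) (by decide) h1 h2 h3 h4
    exact ⟨⟨g, hg⟩, Subtype.ext (by simp [e0, e1, e2])⟩

/-! #### Collineations as matrices -/

/-- The points of the Fano plane as nonzero vectors. -/
def fanoVec : Fin 7 → Fin 3 → ZMod 2 :=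
  ![![1, 0, 0], ![0, 1, 0], ![0, 0, 1], ![1, 1, 0], ![0, 1, 1], ![1, 1, 1], ![1, 0, 1]]

theorem fanoVec_injective : Function.Injective fanoVec := by decide

theorem fanoVec_ne_zero : ∀ x, fanoVec x ≠ 0 := by decide

theorem exists_fanoVec : ∀ w : Fin 3 → ZMod 2, w ≠ 0 → ∃ x, fanoVec x = w := by decide

theorem fanoVec_third : ∀ x y, x ≠ y → fanoVec (third x y) = fanoVec x + fanoVec y := by decide

/-- This default value makes the condition defining `fanoAut` automatic for equal points. -/
theorem third_self : ∀ x, third x x = x := by decide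

theorem exists_mulVec (M : Matrix.SpecialLinearGroup (Fin 3) (ZMod 2)) (x : Fin 7) :
    ∃ y, fanoVec y = M.1.mulVec (fanoVec x) := by
  refine exists_fanoVec _ fun h => fanoVec_ne_zero x ?_
  have := congrArg (M⁻¹).1.mulVec h
  rwa [Matrix.mulVec_mulVec, ← Matrix.SpecialLinearGroup.coe_mul, inv_mul_cancel,
    Matrix.SpecialLinearGroup.coe_one, Matrix.one_mulVec, Matrix.mulVec_zero] at this

/-- The action of `SL(3,2)` on the points of the Fano plane. -/
noncomputable def fanoMul (M : Matrix.SpecialLinearGroup (Fin 3) (ZMod 2)) (x : Fin 7) : Fin 7 :=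
  (exists_mulVec M x).choose

theorem fanoVec_fanoMul (M : Matrix.SpecialLinearGroup (Fin 3) (ZMod 2)) (x : Fin 7) :
    fanoVec (fanoMul M x) = M.1.mulVec (fanoVec x) := (exists_mulVec M x).choose_spec

theorem fanoMul_mul (M N : Matrix.SpecialLinearGroup (Fin 3) (ZMod 2)) (x : Fin 7) :
    fanoMul (M * N) x = fanoMul M (fanoMul N x) := by
  apply fanoVec_injective
  rw [fanoVec_fanoMul, fanoVec_fanoMul, fanoVec_fanoMul, Matrix.mulVec_mulVec,
    Matrix.SpecialLinearGroup.coe_mul]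

theorem fanoMul_one (x : Fin 7) : fanoMul 1 x = x := by
  apply fanoVec_injective
  rw [fanoVec_fanoMul, Matrix.SpecialLinearGroup.coe_one, Matrix.one_mulVec]

/-- The representation of `SL(3,2)` by collineations. -/
noncomputable def fanoHom : Matrix.SpecialLinearGroup (Fin 3) (ZMod 2) →* Equiv.Perm (Fin 7) where
  toFun M :=
    { toFun := fanoMul M
      invFun := fanoMul M⁻¹
      left_inv := fun x => by rw [← fanoMul_mul, inv_mul_cancel, fanoMul_one]
      right_inv := fun x => by rw [← fanoMul_mul, mul_inv_cancel, fanoMul_one] }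
  map_one' := Equiv.ext fanoMul_one
  map_mul' M N := Equiv.ext (fanoMul_mul M N)

theorem fanoVec_fanoHom (M : Matrix.SpecialLinearGroup (Fin 3) (ZMod 2)) (x : Fin 7) :
    fanoVec (fanoHom M x) = M.1.mulVec (fanoVec x) := fanoVec_fanoMul M x

theorem fanoHom_mem (M : Matrix.SpecialLinearGroup (Fin 3) (ZMod 2)) : fanoHom M ∈ fanoAut := by
  intro x y
  by_cases hxy : x = y
  · rw [hxy, third_self, third_self]
  · apply fanoVec_injective
    rw [fanoVec_fanoHom, fanoVec_third _ _ hxy,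
      fanoVec_third _ _ ((fanoHom M).injective.ne hxy), Matrix.mulVec_add, fanoVec_fanoHom,
      fanoVec_fanoHom]

theorem fanoVec_basis (i : Fin 3) : fanoVec (i.castLE (by decide)) = Pi.single i 1 := by
  fin_cases i <;> decide

theorem fanoHom_injective : Function.Injective fanoHom := by
  intro M N h
  apply Subtype.ext
  ext i j
  have h1 := congrFun (fanoVec_fanoHom M (j.castLE (by decide))) i
  rw [h, fanoVec_fanoHom, fanoVec_basis, Matrix.mulVec_single_one, Matrix.mulVec_single_one] at h1
  exact h1.symm

-- Non-collinear points are linearly independent vectors, and over the field with two elements a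
-- nonzero determinant is 1. The left-hand side has the shape of `Matrix.det_fin_three`.
set_option maxRecDepth 20000 in
theorem det_fanoVec : ∀ a b c : Fin 7, a ≠ b ∧ c ≠ a ∧ c ≠ b ∧ c ≠ third a b →
    fanoVec a 0 * fanoVec b 1 * fanoVec c 2 - fanoVec a 0 * fanoVec b 2 * fanoVec c 1
      - fanoVec a 1 * fanoVec b 0 * fanoVec c 2 + fanoVec a 1 * fanoVec b 2 * fanoVec c 0
      + fanoVec a 2 * fanoVec b 0 * fanoVec c 1 - fanoVec a 2 * fanoVec b 1 * fanoVec c 0 = 1 := by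
  decide +kernel

/-- The points 0, 1, 2 are the standard basis vectors, so a collineation agrees with the matrix
whose columns are their images, first on these three points and then everywhere. -/
theorem range_fanoHom : fanoHom.range = fanoAut := by
  refine le_antisymm ?_ fun π hπ => ?_
  · rintro _ ⟨M, rfl⟩
    exact fanoHom_mem M
  · let M : Matrix (Fin 3) (Fin 3) (ZMod 2) :=
      (Matrix.of ![fanoVec (π 0), fanoVec (π 1), fanoVec (π 2)]).transpose
    have hM : M.det = 1 := by
      rw [Matrix.det_transpose, Matrix.det_fin_three]
      exact det_fanoVec _ _ _ ⟨π.injective.ne (by decide), π.injective.ne (by decide),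
        π.injective.ne (by decide), two_ne_third hπ⟩
    let N : Matrix.SpecialLinearGroup (Fin 3) (ZMod 2) := ⟨M, hM⟩
    have key : ∀ i : Fin 3, fanoHom N (i.castLE (by decide)) = π (i.castLE (by decide)) := by
      intro i
      apply fanoVec_injective
      rw [fanoVec_fanoHom, fanoVec_basis, Matrix.mulVec_single_one]
      fin_cases i <;> rfl
    exact ⟨N, fanoAut_ext (fanoHom_mem _) hπ (key 0) (key 1) (key 2)⟩

/-- A central matrix is a scalar r with r ^ 3 = 1, hence r = 1 over the field with two elements; so
PSL(3,2) is SL(3,2). -/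
theorem nonempty_fanoAut_mulEquiv :
    Nonempty (fanoAut ≃* Matrix.ProjectiveSpecialLinearGroup (Fin 3) (ZMod 2)) := by
  have hc : Subgroup.center (Matrix.SpecialLinearGroup (Fin 3) (ZMod 2)) = ⊥ := by
    rw [eq_bot_iff]
    intro M hM
    obtain ⟨r, hr, hM⟩ := Matrix.SpecialLinearGroup.mem_center_iff.1 hM
    have hr1 : r = 1 := by
      have : ∀ r : ZMod 2, r ^ Fintype.card (Fin 3) = 1 → r = 1 := by decide
      exact this r hr
    rw [Subgroup.mem_bot]
    apply Subtype.ext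
    rw [← hM, hr1]
    simp
  rw [← range_fanoHom]
  exact ⟨(MonoidHom.ofInjective fanoHom_injective).symm.trans
    (QuotientGroup.quotientBot.symm.trans (QuotientGroup.quotientMulEquivOfEq hc.symm))⟩

end Fano

/-! ### Permutation groups of degree seven -/

section DegreeSeven

/-- A nontrivial permutation of seven points with trivial seventh power is a single 7-cycle, and the
points are numbered along it. -/
theorem exists_coordinates {S : Type*} [Finite S] (hS : Nat.card S = 7) {c : Equiv.Perm S}
    (hc7 : c ^ 7 = 1) (hc1 : c ≠ 1) : ∃ e : S ≃ Fin 7, ∀ x, e (c x) = e x + 1 := by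
  obtain ⟨x₀, hx₀⟩ : ∃ x, c x ≠ x := by
    by_contra h
    push Not at h
    exact hc1 (Equiv.ext h)
  have hper : Function.minimalPeriod c x₀ = 7 := by
    have h7 : Function.IsPeriodicPt c 7 x₀ := by
      rw [Function.IsPeriodicPt, Function.IsFixedPt, Equiv.Perm.iterate_eq_pow, hc7]; rfl
    refine ((Nat.dvd_prime (by norm_num)).1 h7.minimalPeriod_dvd).resolve_left fun h => hx₀ ?_
    exact Function.minimalPeriod_eq_one_iff_isFixedPt.1 h
  let f : Fin 7 → S := fun i => c^[(i : ℕ)] x₀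
  have hinj : Function.Injective f := fun i j hij => by
    refine Fin.ext (Function.iterate_injOn_Iio_minimalPeriod (f := c) (x := x₀) ?_ ?_ hij)
    · rw [hper]; exact i.2
    · rw [hper]; exact j.2
  have hbij : Function.Bijective f := by
    have := Fintype.ofFinite S
    rw [Fintype.bijective_iff_injective_and_card]
    exact ⟨hinj, by rw [Fintype.card_fin, ← Nat.card_eq_fintype_card, hS]⟩
  let e := Equiv.ofBijective f hbij
  refine ⟨e.symm, fun x => ?_⟩
  obtain ⟨i, rfl⟩ := e.surjective x
  rw [e.symm_apply_apply, Equiv.symm_apply_eq]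
  change c (c^[(i : ℕ)] x₀) = c^[((i + 1 : Fin 7) : ℕ)] x₀
  rw [← Function.iterate_succ_apply' c, Fin.val_add]
  conv_lhs => rw [← Function.iterate_mod_minimalPeriod_eq, hper]
  rfl

theorem exists_fanoLine : ∀ x y : Fin 7, x ≠ y →
    ∃ k, x ∈ fanoLine k ∧ y ∈ fanoLine k ∧ third x y ∈ fanoLine k := by decide

theorem eq_third : ∀ k a b c : Fin 7, a ∈ fanoLine k → b ∈ fanoLine k → c ∈ fanoLine k → a ≠ b →
    c ≠ a → c ≠ b → c = third a b := by decide +kernel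

theorem mem_fanoAut_of_lines {π : Equiv.Perm (Fin 7)}
    (h : ∀ i, ∃ j, ∀ x ∈ fanoLine i, π x ∈ fanoLine j) : π ∈ fanoAut := by
  intro x y
  by_cases hxy : x = y
  · rw [hxy, third_self, third_self]
  · obtain ⟨k, h1, h2, h3⟩ := exists_fanoLine x y hxy
    obtain ⟨j, hj⟩ := h k
    obtain ⟨h4, h5⟩ := third_ne x y hxy
    exact eq_third j _ _ _ (hj _ h1) (hj _ h2) (hj _ h3) (π.injective.ne hxy)
      (π.injective.ne h4) (π.injective.ne h5)

set_option synthInstance.maxSize 1000 in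
/-- A `3`-subset of `ℤ/7` is a line of the Fano plane, the negative of one, or has exactly one
difference that occurs twice. -/
theorem triple_cases : ∀ a b c : Fin 7, a ≠ b ∧ a ≠ c ∧ b ≠ c →
    (∃ j, ∀ x, (x = a ∨ x = b ∨ x = c) ↔ x ∈ fanoLine j) ∨
    (∃ j, ∀ x, (x = a ∨ x = b ∨ x = c) ↔ -x ∈ fanoLine j) ∨
    ∃ d, d ≠ 0 ∧ ∀ z, (z ≠ 0 ∧ ∃ p, (p = a ∨ p = b ∨ p = c) ∧ (p + z = a ∨ p + z = b ∨ p + z = c) ∧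
      ∃ q, q ≠ p ∧ (q = a ∨ q = b ∨ q = c) ∧ (q + z = a ∨ q + z = b ∨ q + z = c)) ↔
        (z = d ∨ z = -d) := by
  decide +kernel

/-- The pairs x, x + d form a cycle through all seven points. An automorphism of this cycle that
fixes two adjacent points is trivial. -/
theorem eq_one_of_preserves_cycle {σ : Equiv.Perm (Fin 7)} {d : Fin 7} (hd : d ≠ 0) (h0 : σ 0 = 0)
    (h1 : σ d = d) (h : ∀ x, σ (x + d) = σ x + d ∨ σ (x + d) = σ x + -d) : σ = 1 := by
  have key : ∀ k : ℕ, σ (k • d) = k • d ∧ σ ((k + 1) • d) = (k + 1) • d := by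
    intro k
    induction k with
    | zero => simpa using ⟨h0, h1⟩
    | succ k ih =>
      refine ⟨ih.2, ?_⟩
      have e1 : (k + 1 + 1) • d = (k + 1) • d + d := succ_nsmul d (k + 1)
      rcases h ((k + 1) • d) with h2 | h2
      · rw [e1, h2, ih.2]
      · exfalso
        have e2 : (k + 1) • d + -d = k • d := by rw [succ_nsmul, add_neg_cancel_right]
        rw [ih.2, e2, ← ih.1] at h2
        have h3 := σ.injective h2
        rw [succ_nsmul, add_assoc, add_eq_left] at h3
        exact (show ∀ d : Fin 7, d ≠ 0 → d + d ≠ 0 by decide) d hd h3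
  ext x
  obtain ⟨k, rfl⟩ : ∃ k : Fin 7, (k : ℕ) • d = x :=
    (show ∀ d : Fin 7, d ≠ 0 → ∀ x : Fin 7, ∃ k : Fin 7, (k : ℕ) • d = x by decide) d hd x
  rw [(key k).1]; rfl

/-- Seven triples on seven points that admit a permutation of order seven form a Fano plane, unless
two of them meet in two points and their group is small. -/
theorem fano_or_small {S N : Type*} [Finite S] [Finite N] (hS : Nat.card S = 7)
    (hN : Nat.card N = 7) (inc : S → N → Prop) (hk : ∀ C, {x | inc x C}.ncard = 3)
    (H : Subgroup (Equiv.Perm S))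
    (hH : ∀ g ∈ H, ∃ σ : Equiv.Perm N, ∀ x C, inc (g x) (σ C) ↔ inc x C)
    {c : Equiv.Perm S} (hcH : c ∈ H) (hc7 : c ^ 7 = 1) (hc1 : c ≠ 1) :
    (∃ (e : S ≃ Fin 7) (f : N ≃ Fin 7), ∀ x C, inc x C ↔ e x ∈ fanoLine (f C)) ∨
    ((∃ C D, C ≠ D ∧ ∃ x y, x ≠ y ∧ inc x C ∧ inc y C ∧ inc x D ∧ inc y D) ∧
      Nat.card H ≤ 14) := by
  obtain ⟨e, he⟩ := exists_coordinates hS hc7 hc1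
  obtain ⟨σ, hσ⟩ := hH c hcH
  have : Nonempty N := (Nat.card_pos_iff.1 (by omega)).1
  obtain ⟨C₀⟩ := this
  obtain ⟨a', b', c', hab, hac, hbc, hT⟩ := Set.ncard_eq_three.1 (hk C₀)
  have hinc0 : ∀ x, inc x C₀ ↔ (e x = e a' ∨ e x = e b' ∨ e x = e c') := by
    intro x
    have : x ∈ {x | inc x C₀} ↔ x ∈ ({a', b', c'} : Set S) := by rw [hT]
    simpa using this
  -- The blocks obtained from `C₀` by powers of the 7-cycle are the translates of a single triple in
  -- ℤ/7.
  have hit : ∀ (n : ℕ) x, inc x (σ^[n] C₀) ↔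
      (e x - n • 1 = e a' ∨ e x - n • 1 = e b' ∨ e x - n • 1 = e c') := by
    intro n
    induction n with
    | zero => intro x; rw [zero_nsmul, sub_zero]; exact hinc0 x
    | succ n ih =>
      intro x
      obtain ⟨y, rfl⟩ := c.surjective x
      rw [Function.iterate_succ_apply', hσ, ih, he]
      have : e y + 1 - (n + 1) • (1 : Fin 7) = e y - n • (1 : Fin 7) := by
        rw [succ_nsmul, add_sub_add_right_eq_sub]
      rw [this]
  have hne : e a' ≠ e b' ∧ e a' ≠ e c' ∧ e b' ≠ e c' :=
    ⟨e.injective.ne hab, e.injective.ne hac, e.injective.ne hbc⟩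
  have hit' : ∀ (i : Fin 7) x, inc x (σ^[(i : ℕ)] C₀) ↔
      (e x - i = e a' ∨ e x - i = e b' ∨ e x - i = e c') := by
    intro i x
    rw [hit, (show ∀ i : Fin 7, (i : ℕ) • (1 : Fin 7) = i by decide) i]
  generalize e a' = a at *
  generalize e b' = b at *
  generalize e c' = c'' at *
  let f : Fin 7 → N := fun i => σ^[(i : ℕ)] C₀
  have hf : ∀ x i, inc x (f i) ↔ (e x - i = a ∨ e x - i = b ∨ e x - i = c'') :=
    fun x i => hit' i x
  -- No nonzero translation preserves a triple in ℤ/7, so the seven translates are distinct and are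
  -- all the blocks.
  have hinj : Function.Injective f := by
    intro i j hij
    have h1 : ∀ x : Fin 7, (x - i = a ∨ x - i = b ∨ x - i = c'') ↔
        (x - j = a ∨ x - j = b ∨ x - j = c'') := by
      intro x
      have := hf (e.symm x) i
      rw [hij, hf, e.apply_symm_apply] at this
      exact this.symm
    have h2 : ∀ z : Fin 7, (z = a ∨ z = b ∨ z = c'') → (z + (i - j) = a ∨ z + (i - j) = b ∨
        z + (i - j) = c'') := by
      intro z hz
      have := (h1 (z + i)).1 (by rwa [add_sub_cancel_right])
      rwa [add_sub_assoc] at this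
    have h3 : ∀ a b c s : Fin 7, a ≠ b ∧ a ≠ c ∧ b ≠ c → (a + s = a ∨ a + s = b ∨ a + s = c) →
        (b + s = a ∨ b + s = b ∨ b + s = c) → (c + s = a ∨ c + s = b ∨ c + s = c) → s = 0 := by
      decide +kernel
    exact sub_eq_zero.1 (h3 a b c'' _ hne (h2 a (by simp)) (h2 b (by simp)) (h2 c'' (by simp)))
  have hbij : Function.Bijective f := by
    have := Fintype.ofFinite N
    rw [Fintype.bijective_iff_injective_and_card]
    exact ⟨hinj, by rw [Fintype.card_fin, ← Nat.card_eq_fintype_card, hN]⟩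
  let F := (Equiv.ofBijective f hbij).symm
  have hF : ∀ C, f (F C) = C := fun C => (Equiv.ofBijective f hbij).apply_symm_apply C
  have hinc : ∀ x C, inc x C ↔ (e x - F C = a ∨ e x - F C = b ∨ e x - F C = c'') := by
    intro x C
    have := hf x (F C)
    rwa [hF] at this
  rcases triple_cases a b c'' hne with ⟨j, hj⟩ | ⟨j, hj⟩ | ⟨d, hd, hz⟩
  · left
    refine ⟨e, F.trans (Equiv.addRight j), fun x C => ?_⟩
    rw [hinc, hj]
    exact (show ∀ x i j : Fin 7, x - i ∈ fanoLine j ↔ x ∈ fanoLine (i + j) by decide) _ _ _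
  · left
    refine ⟨e.trans (Equiv.neg _), F.trans (Equiv.subLeft j), fun x C => ?_⟩
    rw [hinc, hj]
    exact (show ∀ x i j : Fin 7, -(x - i) ∈ fanoLine j ↔ -x ∈ fanoLine (j - i) by decide) _ _ _
  · right
    -- Two points lie together in two blocks exactly when they differ by d or -d, so this relation
    -- is a 7-cycle preserved by the group. An element is determined by the image of 0 and by which
    -- of the two neighbours of that image is the image of d, which leaves 14 possibilities.
    have hR : ∀ x y, (x ≠ y ∧ ∃ C, inc x C ∧ inc y C ∧ ∃ D, D ≠ C ∧ inc x D ∧ inc y D) ↔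
        (e y - e x = d ∨ e y - e x = -d) := by
      intro x y
      rw [← hz]
      constructor
      · rintro ⟨hxy, C, hxC, hyC, D, hDC, hxD, hyD⟩
        rw [hinc] at hxC hyC hxD hyD
        refine ⟨fun h => hxy (e.injective (sub_eq_zero.1 h).symm), e x - F C, hxC, ?_,
          e x - F D, ?_, hxD, ?_⟩
        · rwa [show e x - F C + (e y - e x) = e y - F C by abel]
        · exact fun h => hDC (F.injective (sub_right_injective h))
        · rwa [show e x - F D + (e y - e x) = e y - F D by abel]
      · rintro ⟨hne', p, hp, hp', q, hqp, hq, hq'⟩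
        refine ⟨?_, f (e x - p), ?_, ?_, f (e x - q), ?_, ?_, ?_⟩
        · rintro rfl; exact hne' (sub_self _)
        · rw [hf]; rwa [sub_sub_cancel]
        · rw [hf]; rwa [show e y - (e x - p) = p + (e y - e x) by abel]
        · exact fun h => hqp (sub_right_injective (hinj h))
        · rw [hf]; rwa [sub_sub_cancel]
        · rw [hf]; rwa [show e y - (e x - q) = q + (e y - e x) by abel]
    refine ⟨?_, ?_⟩
    · obtain ⟨hxy, C, h1, h2, D, hDC, h3, h4⟩ := (hR (e.symm 0) (e.symm d)).2 (by simp)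
      exact ⟨C, D, hDC.symm, _, _, hxy, h1, h2, h3, h4⟩
    · have hpres : ∀ g ∈ H, ∀ x y, (e y - e x = d ∨ e y - e x = -d) →
          (e (g y) - e (g x) = d ∨ e (g y) - e (g x) = -d) := by
        intro g hg x y hxy
        obtain ⟨ρ, hρ⟩ := hH g hg
        rw [← hR] at hxy ⊢
        obtain ⟨hxy, C, h1, h2, D, hDC, h3, h4⟩ := hxy
        exact ⟨g.injective.ne hxy, ρ C, (hρ _ _).2 h1, (hρ _ _).2 h2, ρ D, ρ.injective.ne hDC,
          (hρ _ _).2 h3, (hρ _ _).2 h4⟩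
      have hcard : Nat.card (Fin 7 × Bool) = 14 := by simp
      rw [← hcard]
      refine Nat.card_le_card_of_injective (fun g : H => (e (g.1 (e.symm 0)),
        decide (e (g.1 (e.symm d)) = e (g.1 (e.symm 0)) + d))) ?_
      intro g g' hgg
      simp only [Prod.mk.injEq, decide_eq_decide] at hgg
      obtain ⟨e0, e1⟩ := hgg
      have hval : ∀ g ∈ H, e (g (e.symm d)) = e (g (e.symm 0)) + d ∨
          e (g (e.symm d)) = e (g (e.symm 0)) + -d := by
        intro g hg
        rcases hpres g hg (e.symm 0) (e.symm d) (by simp) with h | h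
        · exact Or.inl (eq_add_of_sub_eq' h)
        · exact Or.inr (eq_add_of_sub_eq' h)
      have e2 : e (g.1 (e.symm d)) = e (g'.1 (e.symm d)) := by
        rcases hval g g.2 with h | h
        · rw [h, e1.1 h, e0]
        · rcases hval g' g'.2 with h' | h'
          · rw [h', e1.2 h', e0]
          · rw [h, h', e0]
      have hone : e.permCongr ((g'⁻¹ * g : H) : Equiv.Perm S) = 1 := by
        refine eq_one_of_preserves_cycle hd ?_ ?_ ?_
        · rw [Equiv.permCongr_apply, ← Equiv.eq_symm_apply]
          exact (Equiv.symm_apply_eq g'.1).2 (e.injective e0)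
        · rw [Equiv.permCongr_apply, ← Equiv.eq_symm_apply]
          exact (Equiv.symm_apply_eq g'.1).2 (e.injective e2)
        · intro x
          rw [Equiv.permCongr_apply, Equiv.permCongr_apply]
          rcases hpres _ (g'⁻¹ * g).2 (e.symm x) (e.symm (x + d)) (by simp) with h | h
          · exact Or.inl (eq_add_of_sub_eq' h)
          · exact Or.inr (eq_add_of_sub_eq' h)
      have : ((g'⁻¹ * g : H) : Equiv.Perm S) = 1 := by
        apply e.permCongr.injective
        rw [hone]; ext; simp
      exact (inv_mul_eq_one.1 (Subtype.ext this)).symm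

end DegreeSeven

/-! ### Recovering the Fano plane from a group of degree seven isomorphic to PSL(3,2) -/

section DegreeSeven

/-- The permutation group on coordinates. -/
def coordGroup {S : Type*} (e : S ≃ Fin 7) (H : Subgroup (Equiv.Perm S)) :
    Subgroup (Equiv.Perm (Fin 7)) := H.map e.permCongrHom.toMonoidHom

theorem mem_coordGroup {S : Type*} {e : S ≃ Fin 7} {H : Subgroup (Equiv.Perm S)}
    {π : Equiv.Perm (Fin 7)} : π ∈ coordGroup e H ↔ ∃ g ∈ H, ∀ x, π (e x) = e (g x) := by
  constructor
  · rintro ⟨g, hg, rfl⟩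
    refine ⟨g, hg, fun x => ?_⟩
    change e (g (e.symm (e x))) = _
    rw [e.symm_apply_apply]
  · rintro ⟨g, hg, h⟩
    refine ⟨g, hg, Equiv.ext fun x => ?_⟩
    change e (g (e.symm x)) = _
    rw [← h, e.apply_symm_apply]

theorem nonempty_mulEquiv_coordGroup {S : Type*} (e : S ≃ Fin 7) (H : Subgroup (Equiv.Perm S)) :
    Nonempty (H ≃* coordGroup e H) :=
  ⟨e.permCongrHom.subgroupMap H⟩

theorem card_coordGroup {S : Type*} (e : S ≃ Fin 7) (H : Subgroup (Equiv.Perm S)) :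
    Nat.card (coordGroup e H) = Nat.card H := by
  obtain ⟨φ⟩ := nonempty_mulEquiv_coordGroup e H
  exact (Nat.card_congr φ.toEquiv).symm

theorem eq_fanoAut_of_card {H : Subgroup (Equiv.Perm (Fin 7))} (hH : H ≤ fanoAut)
    (hc : Nat.card H = 168) : H = fanoAut := by
  exact Subgroup.eq_of_le_of_card_ge hH (by rw [hc, card_fanoAut])

theorem eq_fanoAut_of_ge {H : Subgroup (Equiv.Perm (Fin 7))} (hH : fanoAut ≤ H)
    (hc : Nat.card H = 168) : H = fanoAut := by
  exact (Subgroup.eq_of_le_of_card_ge hH (by rw [hc, card_fanoAut])).symm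

theorem coordGroup_le_fanoAut {S N : Type*} {inc : S → N → Prop} {H : Subgroup (Equiv.Perm S)}
    (hH : ∀ g ∈ H, ∃ σ : Equiv.Perm N, ∀ x C, inc (g x) (σ C) ↔ inc x C)
    {e : S ≃ Fin 7} {f : N ≃ Fin 7} (hef : ∀ x C, inc x C ↔ e x ∈ fanoLine (f C)) :
    coordGroup e H ≤ fanoAut := by
  intro π hπ
  obtain ⟨g, hg, h⟩ := mem_coordGroup.1 hπ
  obtain ⟨σ, hσ⟩ := hH g hg
  refine mem_fanoAut_of_lines fun i => ⟨f (σ (f.symm i)), fun x hx => ?_⟩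
  obtain ⟨y, rfl⟩ := e.surjective x
  rw [h, ← hef, hσ, hef, f.apply_symm_apply]
  exact hx

/-- The rotation of the Fano plane. -/
def fanoRotation : Equiv.Perm (Fin 7) := Equiv.addRight 1

/-- The multiplier of the Fano plane. -/
def fanoMultiplier : Equiv.Perm (Fin 7) where
  toFun x := 2 * x
  invFun x := 4 * x
  left_inv := by decide
  right_inv := by decide

theorem fanoRotation_mem : fanoRotation ∈ fanoAut := by
  rw [mem_fanoAut]; decide

theorem fanoMultiplier_mem : fanoMultiplier ∈ fanoAut := by
  rw [mem_fanoAut]; decide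

/-- Already the 21 maps x ↦ 2^k x + b are transitive on the 21 flags. -/
theorem fano_affine_flag : ∀ p q p' q' : Fin 7, p ≠ q → p' ≠ q' → ∃ k : Fin 3,
    (2 ^ (k : ℕ) * q + (p' - 2 ^ (k : ℕ) * p) = q' ∨
      2 ^ (k : ℕ) * q + (p' - 2 ^ (k : ℕ) * p) = third p' q') := by
  decide +kernel

theorem fanoRotation_pow (n : ℕ) (x : Fin 7) : (fanoRotation ^ n) x = x + n • 1 := by
  induction n with
  | zero => simp
  | succ n ih => rw [pow_succ', Equiv.Perm.mul_apply, ih, succ_nsmul, ← add_assoc]; rfl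

theorem fanoMultiplier_pow (n : ℕ) (x : Fin 7) : (fanoMultiplier ^ n) x = 2 ^ n * x := by
  induction n with
  | zero => simp
  | succ n ih =>
    rw [pow_succ', Equiv.Perm.mul_apply, ih, pow_succ', mul_assoc]; rfl

theorem exists_affine {H : Subgroup (Equiv.Perm (Fin 7))} (h1 : fanoRotation ∈ H)
    (h2 : fanoMultiplier ∈ H) (k : ℕ) (b : Fin 7) : ∃ g ∈ H, ∀ x, g x = 2 ^ k * x + b := by
  refine ⟨fanoRotation ^ (b : ℕ) * fanoMultiplier ^ k,
    H.mul_mem (H.pow_mem h1 _) (H.pow_mem h2 _), fun x => ?_⟩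
  rw [Equiv.Perm.mul_apply, fanoRotation_pow, fanoMultiplier_pow,
    (show ∀ i : Fin 7, (i : ℕ) • (1 : Fin 7) = i by decide) b]

theorem eq_fanoAut_of_affine {H : Subgroup (Equiv.Perm (Fin 7))} (hH : H ≤ fanoAut)
    (h1 : fanoRotation ∈ H) (h2 : fanoMultiplier ∈ H) {t : Equiv.Perm (Fin 7)} (ht : t ∈ H)
    (ht2 : t * t = 1) (ht1 : t ≠ 1) : H = fanoAut := by
  refine eq_fanoAut hH (fun p q p' q' hpq hpq' => ?_) ht ht2 ht1
  obtain ⟨k, hk⟩ := fano_affine_flag p q p' q' hpq hpq'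
  obtain ⟨g, hg, hgx⟩ := exists_affine h1 h2 k (p' - 2 ^ (k : ℕ) * p)
  refine ⟨g, hg, ?_, ?_⟩
  · rw [hgx, add_sub_cancel]
  · rw [hgx]; exact hk

/-- The negative of a line of the Fano plane. -/
def negLine (i : Fin 7) : Finset (Fin 7) := {-(i + 1), -(i + 2), -(i + 4)}

theorem negLine_eq (i : Fin 7) : ∀ x, x ∈ negLine i ↔ -x ∈ fanoLine i := by
  revert i; decide

/-- A `3`-subset of `ℤ/7` in arithmetic progression. -/
def progression (k : Fin 3) (b : Fin 7) : Finset (Fin 7) := {b - 2 ^ (k : ℕ), b, b + 2 ^ (k : ℕ)}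

/-- The 35 triples split as 7 + 7 + 21, which are the orbits of the maps x ↦ 2^k x + b. The
difference of a progression matters only up to sign, so 1, 2 and 4 suffice. -/
theorem triple_trichotomy : ∀ a b c : Fin 7, a ≠ b ∧ a ≠ c ∧ b ≠ c →
    (∃ i, ({a, b, c} : Finset (Fin 7)) = fanoLine i) ∨
    (∃ i, ({a, b, c} : Finset (Fin 7)) = negLine i) ∨
    ∃ k i, ({a, b, c} : Finset (Fin 7)) = progression k i := by
  decide +kernel

theorem finset_trichotomy {T : Finset (Fin 7)} (hT : T.card = 3) :
    (∃ i, T = fanoLine i) ∨ (∃ i, T = negLine i) ∨ ∃ k i, T = progression k i := by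
  obtain ⟨a, b, c, h1, h2, h3, rfl⟩ := Finset.card_eq_three.1 hT
  exact triple_trichotomy a b c ⟨h1, h2, h3⟩

theorem card_fanoLine : ∀ i, (fanoLine i).card = 3 := by decide

theorem card_negLine : ∀ i, (negLine i).card = 3 := by decide

/-- Triples of one class meet in one or three points, whereas `exists_negLine` finds even
intersections between the two classes. Parity therefore prevents a permutation from sending some
lines to lines and others to negatives of lines. -/
theorem card_fanoLine_inter : ∀ i j, (fanoLine i ∩ fanoLine j).card ≠ 0 ∧
    (fanoLine i ∩ fanoLine j).card ≠ 2 := by decide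

theorem card_negLine_inter : ∀ i j, (negLine i ∩ negLine j).card ≠ 0 ∧
    (negLine i ∩ negLine j).card ≠ 2 := by decide

theorem exists_negLine : ∀ i j, ∃ k,
    ((fanoLine i ∩ negLine k).card = 0 ∨ (fanoLine i ∩ negLine k).card = 2) ∧
    ((fanoLine j ∩ negLine k).card = 0 ∨ (fanoLine j ∩ negLine k).card = 2) := by decide

theorem exists_inter_negLine : ∀ k, ∃ i,
    ((fanoLine i ∩ negLine k).card = 0 ∨ (fanoLine i ∩ negLine k).card = 2) := by decide

/-- An element of the group might interchange the lines with their negatives, while its square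
cannot. An element of order four has a square that is an involution. -/
theorem exists_order_four : ∃ s ∈ fanoAut, (s * s) * (s * s) = 1 ∧ s * s ≠ 1 := by
  obtain ⟨s, hs, h0, h1, h2⟩ := exists_fanoAut_triangle (a := 0) (b := 1) (c := 2) (a' := 0)
    (b' := 3) (c' := 4) (by decide) (by decide) (by decide) (by decide) (by decide) (by decide)
    (by decide) (by decide)
  have hx : ∀ x, s x = fanoExtend 0 3 4 x := fun x => by rw [eq_fanoExtend hs, h0, h1, h2]
  refine ⟨s, hs, ?_, fun h => ?_⟩
  · ext x
    simp only [Equiv.Perm.mul_apply, hx]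
    revert x; decide
  · have := congrArg (fun π => π 2) h
    simp only [Equiv.Perm.mul_apply, hx] at this
    revert this; decide

/-- The image of a set under a permutation. -/
theorem card_image_inter (π : Equiv.Perm (Fin 7)) (A B : Finset (Fin 7)) :
    (A.image π ∩ B.image π).card = (A ∩ B).card := by
  rw [← Finset.image_inter _ _ π.injective, Finset.card_image_of_injective _ π.injective]

/-- A permutation that permutes the lines and the negatives of the lines has its square in
`fanoAut`. -/
theorem square_mem_fanoAut {s : Equiv.Perm (Fin 7)}
    (hFs : ∀ j, (∃ i, (fanoLine j).image s = fanoLine i) ∨ ∃ i, (fanoLine j).image s = negLine i)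
    (hNs : ∀ j, (∃ i, (negLine j).image s = fanoLine i) ∨ ∃ i, (negLine j).image s = negLine i) :
    s * s ∈ fanoAut := by
  have key : ∀ j, ∃ k, ((fanoLine j).image s).image s = fanoLine k := by
    intro j
    rcases hFs j with ⟨i, hi⟩ | ⟨i, hi⟩
    -- A negative line with even intersections with lines `j` and `l` cannot go to a line, because
    -- `j` does; so it goes to a negative line, and then `l` cannot go to a negative line.
    · have hall : ∀ l, ∃ m, (fanoLine l).image s = fanoLine m := by
        intro l
        obtain ⟨k, hk1, hk2⟩ := exists_negLine j l
        rw [← card_image_inter s] at hk1 hk2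
        rcases hNs k with ⟨m, hm⟩ | ⟨m, hm⟩
        · rw [hi, hm] at hk1
          exact (not_or.2 (card_fanoLine_inter i m) hk1).elim
        · refine (hFs l).resolve_right ?_
          rintro ⟨n, hn⟩
          rw [hm, hn] at hk2
          exact (not_or.2 (card_negLine_inter n m) hk2).elim
      rw [hi]
      exact hall i
    · rw [hi]
      have hall : ∀ l, ∃ m, (fanoLine l).image s = negLine m := by
        intro l
        obtain ⟨k, hk1, hk2⟩ := exists_negLine j l
        rw [← card_image_inter s] at hk1 hk2
        rcases hNs k with ⟨m, hm⟩ | ⟨m, hm⟩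
        · refine (hFs l).resolve_left ?_
          rintro ⟨n, hn⟩
          rw [hm, hn] at hk2
          exact (not_or.2 (card_fanoLine_inter n m) hk2).elim
        · rw [hi, hm] at hk1
          exact (not_or.2 (card_negLine_inter i m) hk1).elim
      refine (hNs i).resolve_right ?_
      rintro ⟨n, hn⟩
      obtain ⟨l, hl⟩ := exists_inter_negLine i
      obtain ⟨m, hm⟩ := hall l
      rw [← card_image_inter s, hm, hn] at hl
      exact (not_or.2 (card_negLine_inter m n) hl).elim
  refine mem_fanoAut_of_lines fun i => ?_
  obtain ⟨k, hk⟩ := key i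
  refine ⟨k, fun x hx => ?_⟩
  rw [← hk]
  exact Finset.mem_image_of_mem _ (Finset.mem_image_of_mem _ hx)

/-- A permutation group of degree seven that contains the affine maps with square
multiplier, has order `168` and contains an element of order four whose square is an
involution preserves the Fano plane or its negative. -/
theorem fano_or_neg {H : Subgroup (Equiv.Perm (Fin 7))} (hcard : Nat.card H = 168)
    (h1 : fanoRotation ∈ H) (h2 : fanoMultiplier ∈ H) {s : Equiv.Perm (Fin 7)} (hs : s ∈ H)
    (hs4 : (s * s) * (s * s) = 1) (hs2 : s * s ≠ 1) :
    H = fanoAut ∨ ∀ g ∈ H, ∀ i, ∃ j, (negLine i).image g = negLine j := by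
  -- The orbit of a line contains all lines and is a union of the three classes of triples. All
  -- three would give 35 elements, which does not divide 168. If the orbit consists of the lines
  -- only, the group preserves them; lines with progressions leave the negatives invariant; lines
  -- with negatives are handled through the involution `s * s`, which is a collineation.
  let Orb : Finset (Fin 7) → Prop := fun T => ∃ g ∈ H, (fanoLine 0).image g = T
  have hOrb : ∀ T, Orb T → ∀ g ∈ H, Orb (T.image g) := by
    rintro T ⟨f, hf, rfl⟩ g hg
    exact ⟨g * f, H.mul_mem hg hf, by rw [Finset.image_image]; rfl⟩
  have hOrb' : ∀ T, ∀ g ∈ H, Orb (T.image g) → Orb T := by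
    intro T g hg hT
    have := hOrb _ hT g⁻¹ (H.inv_mem hg)
    rw [Finset.image_image] at this
    have h3 : ((g⁻¹ : Equiv.Perm (Fin 7)) : Fin 7 → Fin 7) ∘ g = id := by
      funext x; exact g.symm_apply_apply x
    rwa [h3, Finset.image_id] at this
  have hcard3 : ∀ T, Orb T → T.card = 3 := by
    rintro T ⟨f, hf, rfl⟩
    rw [Finset.card_image_of_injective _ f.injective, card_fanoLine]
  have himg : ∀ (g : Equiv.Perm (Fin 7)) (k : ℕ) (b : Fin 7) (T : Finset (Fin 7)),
      (∀ x, g x = 2 ^ k * x + b) → T.image g = T.image (fun x => 2 ^ k * x + b) := by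
    intro g k b T h
    exact Finset.image_congr fun x _ => h x
  have hF : ∀ i, Orb (fanoLine i) := by
    intro i
    obtain ⟨g, hg, hx⟩ := exists_affine h1 h2 0 i
    refine ⟨g, hg, ?_⟩
    rw [himg g 0 i _ hx]
    exact (show ∀ i, (fanoLine 0).image (fun x => 2 ^ 0 * x + i) = fanoLine i by decide) i
  have hNN : ∀ i j, Orb (negLine i) → Orb (negLine j) := by
    intro i j hi
    obtain ⟨g, hg, hx⟩ := exists_affine h1 h2 0 (i - j)
    have := hOrb _ hi g hg
    rw [himg g 0 _ _ hx] at this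
    rwa [(show ∀ i j, (negLine i).image (fun x => 2 ^ 0 * x + (i - j)) = negLine j by decide)]
      at this
  have hPP : ∀ k i l j, Orb (progression k i) → Orb (progression l j) := by
    intro k i l j hi
    -- Exponents may be subtracted modulo three because 2 ^ 3 = 1 in ℤ/7.
    obtain ⟨g, hg, hx⟩ := exists_affine h1 h2 ((l - k : Fin 3) : ℕ)
      (j - 2 ^ ((l - k : Fin 3) : ℕ) * i)
    have := hOrb _ hi g hg
    rw [himg g _ _ _ hx] at this
    rwa [(show ∀ k i l j, (progression k i).image (fun x => 2 ^ ((l - k : Fin 3) : ℕ) * x +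
      (j - 2 ^ ((l - k : Fin 3) : ℕ) * i)) = progression l j by decide +kernel)] at this
  by_cases hN : ∃ i, Orb (negLine i)
  · obtain ⟨i₀, hi₀⟩ := hN
    have hN : ∀ i, Orb (negLine i) := fun i => hNN i₀ i hi₀
    left
    by_cases hA : ∃ k i, Orb (progression k i)
    · exfalso
      obtain ⟨k, i, hki⟩ := hA
      have hall : ∀ T, Orb T ↔ T.card = 3 := by
        refine fun T => ⟨hcard3 T, fun hT => ?_⟩
        rcases finset_trichotomy hT with ⟨j, rfl⟩ | ⟨j, rfl⟩ | ⟨l, j, rfl⟩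
        exacts [hF j, hN j, hPP k i l j hki]
      have horb : MulAction.orbit H (fanoLine 0) =
          ((Finset.univ.powersetCard 3 : Finset (Finset (Fin 7))) : Set (Finset (Fin 7))) := by
        ext T
        rw [Finset.mem_coe, Finset.mem_powersetCard, ← hall]
        constructor
        · rintro ⟨g, rfl⟩
          exact ⟨Finset.subset_univ _, g, g.2, rfl⟩
        · rintro ⟨-, g, hg, rfl⟩
          exact ⟨⟨g, hg⟩, rfl⟩
      have hdvd : Nat.card (MulAction.orbit H (fanoLine 0)) ∣ Nat.card H := by
        rw [Nat.card_congr (MulAction.orbitEquivQuotientStabilizer H (fanoLine 0))]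
        exact Subgroup.card_quotient_dvd_card _
      rw [hcard, horb, Nat.card_coe_set_eq, Set.ncard_coe_finset, Finset.card_powersetCard,
        Finset.card_univ, Fintype.card_fin] at hdvd
      revert hdvd; decide
    · push Not at hA
      have hFN : ∀ T, Orb T → (∃ i, T = fanoLine i) ∨ ∃ i, T = negLine i := by
        intro T hT
        rcases finset_trichotomy (hcard3 T hT) with h | h | ⟨k, i, rfl⟩
        exacts [Or.inl h, Or.inr h, absurd hT (hA k i)]
      have hss : s * s ∈ fanoAut := square_mem_fanoAut (fun j => hFN _ (hOrb _ (hF j) s hs))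
        (fun j => hFN _ (hOrb _ (hN j) s hs))
      have hinf : H ⊓ fanoAut = fanoAut := eq_fanoAut_of_affine inf_le_right
        ⟨h1, fanoRotation_mem⟩ ⟨h2, fanoMultiplier_mem⟩ ⟨H.mul_mem hs hs, hss⟩ hs4 hs2
      exact eq_fanoAut_of_ge (inf_eq_right.1 hinf) hcard
  · push Not at hN
    by_cases hA : ∃ k i, Orb (progression k i)
    · right
      intro g hg i
      obtain ⟨k, l, hkl⟩ := hA
      have hni : ¬ Orb ((negLine i).image g) := fun h => hN i (hOrb' _ g hg h)
      rcases finset_trichotomy (T := (negLine i).image g) (by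
        rw [Finset.card_image_of_injective _ g.injective, card_negLine]) with ⟨j, hj⟩ | h | ⟨m, j, hj⟩
      · rw [hj] at hni; exact absurd (hF j) hni
      · exact h
      · rw [hj] at hni; exact absurd (hPP k l m j hkl) hni
    · left
      push Not at hA
      refine eq_fanoAut_of_card (fun g hg => mem_fanoAut_of_lines fun i => ?_) hcard
      have hgi := hOrb _ (hF i) g hg
      rcases finset_trichotomy (hcard3 _ hgi) with ⟨j, hj⟩ | ⟨j, hj⟩ | ⟨m, j, hj⟩
      · exact ⟨j, fun x hx => hj ▸ Finset.mem_image_of_mem g hx⟩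
      · rw [hj] at hgi; exact absurd hgi (hN j)
      · rw [hj] at hgi; exact absurd hgi (hA m j)

/-- A permutation group of degree seven isomorphic to `PSL(3,2)` is the group of a Fano
plane. -/
theorem exists_fano_coordinates {S : Type*} [Finite S] (hS : Nat.card S = 7)
    (H : Subgroup (Equiv.Perm S))
    (hH : Nonempty (H ≃* Matrix.ProjectiveSpecialLinearGroup (Fin 3) (ZMod 2))) :
    ∃ e : S ≃ Fin 7, coordGroup e H = fanoAut := by
  obtain ⟨φ⟩ := hH
  obtain ⟨ψ⟩ := nonempty_fanoAut_mulEquiv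
  let θ : fanoAut ≃* H := ψ.trans φ.symm
  have hval : ∀ {a b : fanoAut}, ((θ a : H) : Equiv.Perm S) = θ b ↔ a = b := by
    intro a b; rw [Subtype.coe_inj, θ.injective.eq_iff]
  -- These are the images of x ↦ x + 1 and x ↦ 2 x under the abstract isomorphism. Coordinates are
  -- chosen so that c is again x ↦ x + 1, and the relation m c = c² m then forces m to be x ↦ 2 x +
  -- b.
  let c : Equiv.Perm S := θ ⟨fanoRotation, fanoRotation_mem⟩
  let m : Equiv.Perm S := θ ⟨fanoMultiplier, fanoMultiplier_mem⟩
  have hone : ((θ 1 : H) : Equiv.Perm S) = 1 := by rw [map_one]; rfl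
  have hc7 : c ^ 7 = 1 := by
    have : c ^ 7 = ((θ (⟨fanoRotation, fanoRotation_mem⟩ ^ 7) : H) : Equiv.Perm S) := by
      rw [map_pow]; rfl
    rw [this, ← hone, hval]
    apply Subtype.ext
    change fanoRotation ^ 7 = 1
    decide
  have hc1 : c ≠ 1 := by
    rw [← hone, Ne, hval]
    intro h
    exact absurd (congrArg Subtype.val h) (show fanoRotation ≠ 1 by decide)
  have hmc : m * c = c * c * m := by
    have h1 : m * c = ((θ (⟨fanoMultiplier, fanoMultiplier_mem⟩ *
      ⟨fanoRotation, fanoRotation_mem⟩) : H) : Equiv.Perm S) := by rw [map_mul]; rfl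
    have h2 : c * c * m = ((θ (⟨fanoRotation, fanoRotation_mem⟩ *
      ⟨fanoRotation, fanoRotation_mem⟩ * ⟨fanoMultiplier, fanoMultiplier_mem⟩) : H) :
        Equiv.Perm S) := by rw [map_mul, map_mul]; rfl
    rw [h1, h2, hval]
    apply Subtype.ext
    change fanoMultiplier * fanoRotation = fanoRotation * fanoRotation * fanoMultiplier
    decide
  obtain ⟨e, he⟩ := exists_coordinates hS hc7 hc1
  have hcardH : Nat.card (coordGroup e H) = 168 := by
    rw [card_coordGroup, ← card_fanoAut]
    exact (Nat.card_congr θ.toEquiv).symm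
  have hrot : fanoRotation ∈ coordGroup e H :=
    mem_coordGroup.2 ⟨c, (θ _).2, fun x => (he x).symm⟩
  have hmx : ∀ x, e (m (e.symm (x + 1))) = e (m (e.symm x)) + 2 := by
    intro x
    have h1 : e.symm (x + 1) = c (e.symm x) := by
      rw [Equiv.symm_apply_eq, he, e.apply_symm_apply]
    have h2 := congrArg (fun π : Equiv.Perm S => e (π (e.symm x))) hmc
    simp only [Equiv.Perm.mul_apply, he] at h2
    rw [h1, h2, add_assoc]; rfl
  have hmx' : ∀ n : ℕ, e (m (e.symm (n • 1))) = e (m (e.symm 0)) + 2 * n • 1 := by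
    intro n
    induction n with
    | zero => simp
    | succ n ih =>
      rw [succ_nsmul, hmx, ih, mul_add, mul_one, add_assoc]
  have hm2 : ∀ x, e (m (e.symm x)) = 2 * x + e (m (e.symm 0)) := by
    intro x
    have := hmx' x
    rwa [(show ∀ i : Fin 7, (i : ℕ) • (1 : Fin 7) = i by decide) x, add_comm] at this
  have hmul : fanoMultiplier ∈ coordGroup e H := by
    have h1 : e.permCongr m ∈ coordGroup e H := ⟨m, (θ _).2, rfl⟩
    have h2 : fanoMultiplier =
        fanoRotation ^ ((-(e (m (e.symm 0))) : Fin 7) : ℕ) * e.permCongr m := by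
      ext x
      rw [Equiv.Perm.mul_apply, fanoRotation_pow, Equiv.permCongr_apply, hm2,
        (show ∀ i : Fin 7, (i : ℕ) • (1 : Fin 7) = i by decide), add_neg_cancel_right]
      rfl
    rw [h2]
    exact Subgroup.mul_mem _ (Subgroup.pow_mem _ hrot _) h1
  obtain ⟨s, hs, hs4, hs2⟩ := exists_order_four
  let s' : Equiv.Perm S := θ ⟨s, hs⟩
  have hs' : e.permCongrHom s' ∈ coordGroup e H := ⟨s', (θ _).2, rfl⟩
  have hss' : s' * s' = ((θ (⟨s, hs⟩ * ⟨s, hs⟩) : H) : Equiv.Perm S) := by rw [map_mul]; rfl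
  have hs4' : (s' * s') * (s' * s') = 1 := by
    have : (s' * s') * (s' * s') =
        ((θ ((⟨s, hs⟩ * ⟨s, hs⟩) * (⟨s, hs⟩ * ⟨s, hs⟩)) : H) : Equiv.Perm S) := by
      rw [map_mul, map_mul]; rfl
    rw [this, ← hone, hval]
    exact Subtype.ext hs4
  have hs2' : s' * s' ≠ 1 := by
    rw [hss', ← hone, Ne, hval]
    exact fun h => hs2 (congrArg Subtype.val h)
  rcases fano_or_neg hcardH hrot hmul hs'
    (by rw [← map_mul, ← map_mul, hs4', map_one])
    (by rw [← map_mul]; exact fun h => hs2' (e.permCongrHom.injective (h.trans (map_one _).symm)))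
    with h | h
  · exact ⟨e, h⟩
  -- The group preserves the negatives of the lines, and a change of sign in the coordinates turns
  -- them into lines.
  · refine ⟨e.trans (Equiv.neg _), eq_fanoAut_of_card (fun π hπ => ?_) ?_⟩
    · obtain ⟨g, hg, hx⟩ := mem_coordGroup.1 hπ
      refine mem_fanoAut_of_lines fun i => ?_
      obtain ⟨j, hj⟩ := h (e.permCongr g) ⟨g, hg, rfl⟩ i
      refine ⟨j, fun x hxi => ?_⟩
      have h1 := hx (e.symm (-x))
      have h2 : (e.permCongr g) (-x) ∈ negLine j := by
        rw [← hj]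
        refine Finset.mem_image_of_mem _ ?_
        rw [negLine_eq, neg_neg]; exact hxi
      rw [Equiv.trans_apply, Equiv.trans_apply, e.apply_symm_apply, Equiv.neg_apply, neg_neg] at h1
      rw [h1, ← negLine_eq]
      exact h2
    · rw [card_coordGroup, ← card_coordGroup e]; exact hcardH

end DegreeSeven

/-! ### Two-arc-transitivity and the local actions -/

section LocalAction

variable {X V : Type*} [Group X] [MulAction X V] {G : SimpleGraph V}

theorem smul_mem_neighborSet (hG : ∀ (g : X) (u w : V), G.Adj (g • u) (g • w) ↔ G.Adj u w) (τ : V)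
    (g : X) (hg : g ∈ MulAction.stabilizer X τ) (x : V) (hx : x ∈ G.neighborSet τ) :
    g • x ∈ G.neighborSet τ := by
  have h := (hG g τ x).2 hx
  rwa [MulAction.mem_stabilizer_iff.1 hg] at h

theorem IsArcTransitive.twoTransitive (h : IsArcTransitive X G 2) (τ : V) :
    TwoTransitive (inducedPerm (MulAction.stabilizer X τ) (G.neighborSet τ)) := by
  rintro ⟨x, hx⟩ ⟨y, hy⟩ ⟨x', hx'⟩ ⟨y', hy'⟩ hxy hxy'
  obtain ⟨g, h1, h2, h3⟩ := h.exists_two (a := x) (b := τ) (c := y) (a' := x') (b' := τ) (c' := y')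
    hx.symm hy (fun h => hxy (Subtype.ext h)) hx'.symm hy' (fun h => hxy' (Subtype.ext h))
  have hg : g ∈ MulAction.stabilizer X τ := h2
  refine ⟨inducedHom _ _ (smul_mem_neighborSet h.1.1 τ) ⟨g, hg⟩, ⟨g, hg, fun _ => rfl⟩,
    Subtype.ext h1, Subtype.ext h3⟩

theorem isArcTransitive_two_of_twoTransitive (hv : IsVertexTransitive X G) (τ : V)
    (h : TwoTransitive (inducedPerm (MulAction.stabilizer X τ) (G.neighborSet τ))) :
    IsArcTransitive X G 2 := by
  refine isArcTransitive_two_of_stabilizer hv τ fun a c a' c' ha hc ha' hc' hac hac' => ?_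
  obtain ⟨π, ⟨g, hg, hπ⟩, h1, h2⟩ := h ⟨a, ha⟩ ⟨c, hc⟩ ⟨a', ha'⟩ ⟨c', hc'⟩
    (fun h => hac (congrArg Subtype.val h)) (fun h => hac' (congrArg Subtype.val h))
  refine ⟨g, hg, ?_, ?_⟩
  · rw [← hπ ⟨a, ha⟩, h1]
  · rw [← hπ ⟨c, hc⟩, h2]

end LocalAction

/-- Permutations of order three commute if they preserve a partition of six points into two
triples. -/
theorem commute_of_two_triples {S β : Type*} [Finite S] (hS : Nat.card S = 6) (cl : S → β)
    (h3 : ∀ w, {w' | cl w' = cl w}.ncard = 3) (x y : Equiv.Perm S)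
    (hx : ∀ w w', cl w = cl w' → cl (x w) = cl (x w'))
    (hy : ∀ w w', cl w = cl w' → cl (y w) = cl (y w')) (hx3 : x ^ 3 = 1) (hy3 : y ^ 3 = 1) :
    x * y = y * x := by
  -- A permutation with trivial cube acts on the two classes with odd order, so it fixes both of
  -- them; within each triple such permutations commute.
  have hfix : ∀ x : Equiv.Perm S, (∀ w w', cl w = cl w' → cl (x w) = cl (x w')) → x ^ 3 = 1 →
      ∀ w, cl (x w) = cl w := by
    intro x hx hx3 w
    have hxxx : x (x (x w)) = w := by
      have := congrArg (fun π : Equiv.Perm S => π w) hx3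
      simpa [pow_succ, Equiv.Perm.mul_apply] using this
    by_contra hne
    have hd : Disjoint {w' | cl w' = cl w} {w' | cl w' = cl (x w)} := by
      rw [Set.disjoint_left]
      intro z hz hz'
      exact hne (Eq.trans (Eq.symm hz') hz)
    have hu := Set.ncard_union_eq hd
    rw [h3, h3] at hu
    have huniv : {w' | cl w' = cl w} ∪ {w' | cl w' = cl (x w)} = Set.univ :=
      Set.eq_of_subset_of_ncard_le (Set.subset_univ _) (by rw [hu, Set.ncard_univ, hS])
    have hmem : x (x w) ∈ {w' | cl w' = cl w} ∪ {w' | cl w' = cl (x w)} := by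
      rw [huniv]; trivial
    rcases hmem with h | h
    · have := hx _ _ h
      rw [hxxx] at this
      exact hne this.symm
    · have := hx _ _ (hx _ _ h)
      rw [hxxx] at this
      exact hne this
  ext w
  have hKx : ∀ z, cl (x z) = cl w ↔ cl z = cl w := fun z => by rw [hfix x hx hx3]
  have hKy : ∀ z, cl (y z) = cl w ↔ cl z = cl w := fun z => by rw [hfix y hy hy3]
  have hc := perm_three_commute (S := {z // cl z = cl w}) (h3 w) (x.subtypePerm hKx)
    (y.subtypePerm hKy) ?_ ?_
  · have := congrArg (fun π : Equiv.Perm {z // cl z = cl w} => ((π ⟨w, rfl⟩ : _) : S)) hc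
    exact this
  · rw [Equiv.Perm.subtypePerm_pow]
    ext z
    simp [hx3]
  · rw [Equiv.Perm.subtypePerm_pow]
    ext z
    simp [hy3]

/-- The exponent is half the order. -/
theorem exists_involution_of_even {K : Type*} [Group K] [Finite K] (π : K)
    (h : Even (orderOf π)) : ∃ m, π ^ m * π ^ m = 1 ∧ π ^ m ≠ 1 := by
  obtain ⟨m, hm⟩ := h
  have hpos := orderOf_pos π
  refine ⟨m, by rw [← pow_add, ← hm, pow_orderOf_eq_one], fun h1 => ?_⟩
  have := Nat.le_of_dvd (by omega) (orderOf_dvd_of_pow_eq_one h1)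
  omega

/-- Encodes two distinct lines by a triangle: their common point x, a point y of the first and a
point z of the second. Transitivity on triangles thus gives transitivity on ordered pairs of lines.
-/
theorem fano_lines_triangle : ∀ i j : Fin 7, i ≠ j → ∃ x y z, x ∈ fanoLine i ∧ x ∈ fanoLine j ∧
    y ∈ fanoLine i ∧ z ∈ fanoLine j ∧ x ≠ y ∧ z ≠ x ∧ z ≠ y ∧ z ≠ third x y := by decide +kernel

theorem fanoLine_unique : ∀ i j x y : Fin 7, x ≠ y → x ∈ fanoLine i → y ∈ fanoLine i →
    x ∈ fanoLine j → y ∈ fanoLine j → i = j := by decide +kernel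

theorem eq_or_eq_third : ∀ k p q z : Fin 7, p ∈ fanoLine k → q ∈ fanoLine k → z ∈ fanoLine k →
    p ≠ q → z ≠ p → z = q ∨ z = third p q := by decide +kernel

/-! ### The incidence structure on a block: parameters and induced groups -/

namespace InvPartition

variable {X V : Type*} [Group X] [MulAction X V] {P : InvPartition X V} {Γ : SimpleGraph V}

theorem smul_mem_carrier (B : P.Block) (g : X) (hg : g ∈ MulAction.stabilizer X B) (x : V)
    (hx : x ∈ P.carrier B) : g • x ∈ P.carrier B := by
  rw [mem_carrier, blockOf_smul, mem_carrier.1 hx, MulAction.mem_stabilizer_iff.1 hg]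

/-- The group induced by `X_B` on `Γ_𝓑(B)`. -/
def nbrGroup (P : InvPartition X V) (Γ : SimpleGraph V) (B : P.Block) :
    Subgroup (Equiv.Perm ((P.quotientGraph Γ).neighborSet B)) :=
  inducedPerm (MulAction.stabilizer X B) ((P.quotientGraph Γ).neighborSet B)

/-- Distinct vertices of `B` are adjacent to different sets of blocks. -/
def SeparatesPoints (P : InvPartition X V) (Γ : SimpleGraph V) (B : P.Block) : Prop :=
  ∀ u u', P.blockOf u = B → P.blockOf u' = B → P.blocksAt Γ u = P.blocksAt Γ u' → u = u'

/-- Distinct neighbours of `B` in the quotient have different traces in `B`. -/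
def SeparatesBlocks (P : InvPartition X V) (Γ : SimpleGraph V) (B : P.Block) : Prop :=
  ∀ C D, (P.quotientGraph Γ).Adj B C → (P.quotientGraph Γ).Adj B D →
    P.trace Γ B C = P.trace Γ B D → C = D

/-- Any two of the traces in a block have exactly `l` common elements. -/
def MeetIn (P : InvPartition X V) (Γ : SimpleGraph V) (l : ℕ) : Prop :=
  ∀ B C D, (P.quotientGraph Γ).Adj B C → (P.quotientGraph Γ).Adj B D → C ≠ D →
    {u ∈ P.carrier B | C ∈ P.blocksAt Γ u ∧ D ∈ P.blocksAt Γ u}.ncard = l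

namespace InG

theorem smul_mem_nbr (h : P.InG Γ) (B : P.Block) (g : X) (hg : g ∈ MulAction.stabilizer X B)
    (C : P.Block) (hC : C ∈ (P.quotientGraph Γ).neighborSet B) :
    g • C ∈ (P.quotientGraph Γ).neighborSet B :=
  smul_mem_neighborSet h.quot_vertexTransitive.1 B g hg C hC

/-- A vertex of `B` is determined by the blocks at it and a neighbour of `B` by its trace, so an
element that fixes everything of one kind fixes everything of the other. -/
theorem fixes_iff (h : P.InG Γ) {B : P.Block} (h1 : P.SeparatesPoints Γ B)
    (h2 : P.SeparatesBlocks Γ B) (g : X) (hg : g ∈ MulAction.stabilizer X B) :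
    (∀ x ∈ P.carrier B, g • x = x) ↔
      ∀ C ∈ (P.quotientGraph Γ).neighborSet B, g • C = C := by
  constructor
  · intro hx C hC
    refine h2 _ _ (h.smul_mem_nbr B g hg C hC) hC ?_
    have := h.smul_trace g B C
    rw [MulAction.mem_stabilizer_iff.1 hg] at this
    rw [← this]
    ext w
    constructor
    · rintro ⟨x, hx', rfl⟩
      change g • x ∈ _
      rw [hx x hx'.2]; exact hx'
    · intro hw
      exact ⟨w, hw, hx w hw.2⟩
  · intro hC x hx
    refine h1 _ _ (smul_mem_carrier B g hg x hx) hx ?_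
    rw [← h.smul_blocksAt]
    have hsub : ∀ C ∈ P.blocksAt Γ x, g • C = C := fun C hCx => hC C (by
      have := h.blocksAt_subset x hCx
      rwa [mem_carrier.1 hx] at this)
    ext C
    constructor
    · rintro ⟨D, hD, rfl⟩
      change g • D ∈ _
      rw [hsub D hD]; exact hD
    · intro hCx
      exact ⟨C, hCx, hsub C hCx⟩

theorem nonempty_blockGroup_mulEquiv (h : P.InG Γ) {B : P.Block} (h1 : P.SeparatesPoints Γ B)
    (h2 : P.SeparatesBlocks Γ B) : Nonempty (P.blockGroup B ≃* P.nbrGroup Γ B) :=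
  nonempty_inducedPerm_mulEquiv _ _ _ (smul_mem_carrier B) (h.smul_mem_nbr B)
    (h.fixes_iff h1 h2)

theorem blocks_eq_sep (h : P.InG Γ) {B : P.Block} {u : V} (hu : u ∈ P.carrier B) :
    {C ∈ (P.quotientGraph Γ).neighborSet B | C ∈ P.blocksAt Γ u} = P.blocksAt Γ u := by
  ext C
  refine ⟨fun hC => hC.2, fun hC => ⟨?_, hC⟩⟩
  have := h.blocksAt_subset u hC
  rwa [mem_carrier.1 hu] at this

theorem trace_eq_sep (B C : P.Block) :
    {u ∈ P.carrier B | C ∈ P.blocksAt Γ u} = P.trace Γ B C := by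
  ext u
  exact ⟨fun hu => ⟨hu.2, hu.1⟩, fun hu => ⟨hu.2, hu.1⟩⟩

/-- Two distinct neighbours of `B` are the ends of a 2-arc centred at `B`, and all 2-arcs are
conjugate. -/
theorem exists_meetIn (h : P.InG Γ) (h2 : IsArcTransitive X (P.quotientGraph Γ) 2) (B : P.Block) :
    ∃ l, P.MeetIn Γ l := by
  obtain ⟨C, hC, D, hD, hCD⟩ := (Set.one_lt_ncard_iff_nontrivial_and_finite.1
    (show 1 < ((P.quotientGraph Γ).neighborSet B).ncard from h.two_le_valency B)).1
  refine ⟨_, fun B' C' D' hC' hD' hCD' =>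
    (?_ : _ = {u ∈ P.carrier B | C ∈ P.blocksAt Γ u ∧ D ∈ P.blocksAt Γ u}.ncard)⟩
  obtain ⟨g, rfl, rfl, rfl⟩ := h2.exists_two hC'.symm hD' hCD' hC.symm hD hCD
  rw [← ncard_smul_set g]
  congr 1
  ext u
  rw [Set.mem_smul_set_iff_inv_smul_mem]
  have key : ∀ E : P.Block, E ∈ P.blocksAt Γ (g⁻¹ • u) ↔ g • E ∈ P.blocksAt Γ u := fun E => by
    rw [← h.smul_mem_blocksAt g, smul_inv_smul]
  simp only [Set.mem_ofPred_eq, mem_carrier]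
  rw [key, key, blockOf_smul, inv_smul_eq_iff]

theorem separatesBlocks_of_meetIn
    (hk : ∀ B C : P.Block, (P.quotientGraph Γ).Adj B C → (P.trace Γ B C).ncard = 3)
    {l : ℕ} (hl : P.MeetIn Γ l) (hl3 : l < 3) (B : P.Block) : P.SeparatesBlocks Γ B := by
  intro C D hC hD hCD
  by_contra hne
  have h1 := hl B C D hC hD hne
  have h2 : {u ∈ P.carrier B | C ∈ P.blocksAt Γ u ∧ D ∈ P.blocksAt Γ u} = P.trace Γ B C := by
    ext u
    constructor
    · rintro ⟨hu, hu', -⟩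
      exact ⟨hu', hu⟩
    · intro hu
      refine ⟨hu.2, hu.1, ?_⟩
      rw [hCD] at hu
      exact hu.1
  rw [h2, hk B C hC] at h1
  omega

theorem card_nbr (B : P.Block) : Nat.card ((P.quotientGraph Γ).neighborSet B) =
    ((P.quotientGraph Γ).neighborSet B).ncard := Nat.card_coe_set_eq _

variable [Finite V]

theorem parameters (h : P.InG Γ)
    (hk : ∀ B C : P.Block, (P.quotientGraph Γ).Adj B C → (P.trace Γ B C).ncard = 3)
    {l : ℕ} (hl : P.MeetIn Γ l) (B : P.Block) (u : V) :
    ((P.carrier B).ncard = 4 ∧ ((P.quotientGraph Γ).neighborSet B).ncard = 4 ∧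
      (P.blocksAt Γ u).ncard = 3 ∧ l = 2) ∨
    ((P.carrier B).ncard = 6 ∧ ((P.quotientGraph Γ).neighborSet B).ncard = 4 ∧
      (P.blocksAt Γ u).ncard = 2 ∧ l = 1) ∨
    ((P.carrier B).ncard = 7 ∧ ((P.quotientGraph Γ).neighborSet B).ncard = 7 ∧
      (P.blocksAt Γ u).ncard = 3 ∧ l = 1) ∨
    ((P.carrier B).ncard = 3 * ((P.quotientGraph Γ).neighborSet B).ncard ∧
      (P.blocksAt Γ u).ncard = 1 ∧ l = 0) := by
  refine design_parameters (fun u C => C ∈ P.blocksAt Γ u) (P.carrier B)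
    ((P.quotientGraph Γ).neighborSet B) (fun w hw => ?_) (fun C hC => ?_)
    (fun C hC D hD => hl B C D hC hD) (h.two_le_valency B) ?_
  · rw [h.blocks_eq_sep hw]; exact h.ncard_blocksAt w u
  · rw [trace_eq_sep]; exact hk B C hC
  · obtain ⟨C, hC⟩ : ((P.quotientGraph Γ).neighborSet B).Nonempty := by
      rw [← Set.ncard_pos]
      have := h.two_le_valency B
      omega
    rw [← hk B C hC]
    exact (h.not_multicover B C hC).symm

/-- A point is the only common point of any two blocks through it. -/
theorem separatesPoints_of_meetIn_one (h : P.InG Γ) (hl : P.MeetIn Γ 1) {r : ℕ}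
    (hr : ∀ u, (P.blocksAt Γ u).ncard = r) (hr2 : 2 ≤ r) (B : P.Block) :
    P.SeparatesPoints Γ B := by
  intro u u' hu hu' huu
  obtain ⟨C, hC, D, hD, hCD⟩ := (Set.one_lt_ncard).1
    (show 1 < (P.blocksAt Γ u).ncard by rw [hr]; omega)
  have h1 := h.blocksAt_subset u hC
  have h2 := h.blocksAt_subset u hD
  rw [hu] at h1 h2
  exact (Set.ncard_le_one).1 (hl B C D h1 h2 hCD).le u ⟨hu, hC, hD⟩ u'
    ⟨hu', by rw [← huu]; exact hC, by rw [← huu]; exact hD⟩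

/-- Since r < b, two points with the same blocks are both missed by some trace, which would then
have at most two elements. -/
theorem separatesPoints_of_four
    (hk : ∀ B C : P.Block, (P.quotientGraph Γ).Adj B C → (P.trace Γ B C).ncard = 3) {B : P.Block}
    (hv : (P.carrier B).ncard = 4) (hb : ((P.quotientGraph Γ).neighborSet B).ncard = 4)
    (hr : ∀ u, (P.blocksAt Γ u).ncard = 3) : P.SeparatesPoints Γ B := by
  intro u u' hu hu' huu
  by_contra hne
  obtain ⟨C, hC, hCu⟩ := Set.exists_mem_notMem_of_ncard_lt_ncard
    (show (P.blocksAt Γ u).ncard < ((P.quotientGraph Γ).neighborSet B).ncard by rw [hr, hb]; omega)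
  have hsub : P.trace Γ B C ⊆ P.carrier B \ {u, u'} := by
    intro w hw
    refine ⟨hw.2, ?_⟩
    rintro (rfl | rfl)
    · exact hCu hw.1
    · exact hCu (huu ▸ hw.1)
  have h1 := Set.ncard_le_ncard hsub
  rw [Set.ncard_sdiff (by rintro w (rfl | rfl) <;> assumption), Set.ncard_pair hne, hv,
    hk B C hC] at h1
  omega

/-- The dual count: a vertex outside two equal traces would have at most two blocks. -/
theorem separatesBlocks_of_four (h : P.InG Γ)
    (hk : ∀ B C : P.Block, (P.quotientGraph Γ).Adj B C → (P.trace Γ B C).ncard = 3) {B : P.Block}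
    (hv : (P.carrier B).ncard = 4) (hb : ((P.quotientGraph Γ).neighborSet B).ncard = 4)
    (hr : ∀ u, (P.blocksAt Γ u).ncard = 3) : P.SeparatesBlocks Γ B := by
  intro C D hC hD hCD
  by_contra hne
  obtain ⟨u, hu, huC⟩ := Set.exists_mem_notMem_of_ncard_lt_ncard
    (show (P.trace Γ B C).ncard < (P.carrier B).ncard by rw [hk B C hC, hv]; omega)
  have hsub : P.blocksAt Γ u ⊆ (P.quotientGraph Γ).neighborSet B \ {C, D} := by
    intro E hE
    have := h.blocksAt_subset u hE
    rw [mem_carrier.1 hu] at this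
    refine ⟨this, ?_⟩
    rintro (rfl | rfl)
    · exact huC ⟨hE, hu⟩
    · exact huC (hCD ▸ ⟨hE, hu⟩)
  have h1 := Set.ncard_le_ncard hsub
  rw [Set.ncard_sdiff (by rintro w (rfl | rfl) <;> assumption), Set.ncard_pair hne, hb, hr] at h1
  omega

theorem two_arc_of_separates (h : P.InG Γ) {B : P.Block} (h1 : P.SeparatesPoints Γ B)
    (h2 : P.SeparatesBlocks Γ B) (hb : ((P.quotientGraph Γ).neighborSet B).ncard = 4)
    (hA : Nonempty (P.blockGroup B ≃* alternatingGroup (Fin 4)) ∨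
      Nonempty (P.blockGroup B ≃* Equiv.Perm (Fin 4))) :
    IsArcTransitive X (P.quotientGraph Γ) 2 := by
  refine isArcTransitive_two_of_twoTransitive h.quot_vertexTransitive B ?_
  refine twoTransitive_of_twelve_le ((card_nbr B).trans hb) ?_
  obtain ⟨φ⟩ := h.nonempty_blockGroup_mulEquiv h1 h2
  have := twelve_le_card_of_mulEquiv hA
  rwa [Nat.card_congr φ.toEquiv] at this

theorem blockGroup_of_two_arc (h : P.InG Γ) {B : P.Block} (h1 : P.SeparatesPoints Γ B)
    (h2 : P.SeparatesBlocks Γ B) (hb : ((P.quotientGraph Γ).neighborSet B).ncard = 4)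
    (hA : IsArcTransitive X (P.quotientGraph Γ) 2) :
    Nonempty (P.blockGroup B ≃* alternatingGroup (Fin 4)) ∨
      Nonempty (P.blockGroup B ≃* Equiv.Perm (Fin 4)) := by
  obtain ⟨φ⟩ := h.nonempty_blockGroup_mulEquiv h1 h2
  have hS := (card_nbr (Γ := Γ) B).trans hb
  rcases degree_four_cases hS (twelve_le_card hS (hA.twoTransitive B)) with ⟨⟨ψ⟩, -⟩ | ⟨⟨ψ⟩, -⟩
  · exact Or.inl ⟨φ.trans ψ⟩
  · exact Or.inr ⟨φ.trans ψ⟩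

/-- X_B is transitive on `B`, so the classes of vertices with equal `blocksAt` have a common size,
and a trace is a union of classes. Classes of more than one element would therefore be two triples;
but permutations with trivial cube that preserve two triples commute, and A₄ and S₄ contain such
elements that do not. -/
theorem separatesPoints_of_six (h : P.InG Γ)
    (hk : ∀ B C : P.Block, (P.quotientGraph Γ).Adj B C → (P.trace Γ B C).ncard = 3) {B : P.Block}
    (hv : (P.carrier B).ncard = 6)
    (hA : Nonempty (P.blockGroup B ≃* alternatingGroup (Fin 4)) ∨
      Nonempty (P.blockGroup B ≃* Equiv.Perm (Fin 4))) : P.SeparatesPoints Γ B := by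
  intro u u' hu hu' huu
  by_contra hne
  let cl : P.carrier B → Set P.Block := fun w => P.blocksAt Γ w
  have hcl : ∀ π ∈ P.blockGroup B, ∀ w w', cl w = cl w' → cl (π w) = cl (π w') := by
    rintro π ⟨g, hg, hπ⟩ w w' hww
    change P.blocksAt Γ (π w) = P.blocksAt Γ (π w')
    rw [hπ, hπ, ← h.smul_blocksAt, ← h.smul_blocksAt]
    exact congrArg (g • ·) hww
  -- the classes have the same size
  have hsize : ∀ w, {w' | cl w' = cl w}.ncard = {w' | cl w' = cl ⟨u, hu⟩}.ncard := by
    intro w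
    obtain ⟨g, hg⟩ := h.exists_smul (w : V) u
    have hgB : g ∈ MulAction.stabilizer X B := by
      have := congrArg P.blockOf hg
      rw [blockOf_smul, hu, mem_carrier.1 w.2] at this
      exact this
    let π := inducedHom _ _ (smul_mem_carrier B) ⟨g, hgB⟩
    have hπ : π ∈ P.blockGroup B := ⟨g, hgB, fun _ => rfl⟩
    have hπw : π w = ⟨u, hu⟩ := Subtype.ext hg
    rw [← Set.ncard_image_of_injective _ π.injective]
    congr 1
    ext z
    constructor
    · rintro ⟨y, hy, rfl⟩
      have := hcl π hπ _ _ hy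
      rwa [hπw] at this
    · intro hz
      refine ⟨π⁻¹ z, ?_, π.apply_symm_apply z⟩
      have := hcl π⁻¹ (Subgroup.inv_mem _ hπ) _ _ hz
      rwa [← hπw, show π⁻¹ (π w) = w from π.symm_apply_apply w] at this
  have h3 : {w' | cl w' = cl ⟨u, hu⟩}.ncard = 3 := by
    obtain ⟨w, hw⟩ := h.exists_adj u
    have hCu : P.blockOf w ∈ P.blocksAt Γ u := mem_blocksAt.2 ⟨w, rfl, hw⟩
    have hadj : (P.quotientGraph Γ).Adj B (P.blockOf w) := by
      rw [← show P.blockOf u = B from hu]; exact h.quot_adj hw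
    let T : Set (P.carrier B) := {z | P.blockOf w ∈ cl z}
    have hT : T.ncard = 3 := by
      rw [← hk _ _ hadj, ← Set.ncard_image_of_injective T Subtype.val_injective]
      congr 1
      ext z
      constructor
      · rintro ⟨y, hy, rfl⟩
        exact ⟨hy, y.2⟩
      · intro hz
        exact ⟨⟨z, hz.2⟩, hz.1, rfl⟩
    have hsub : ∀ z ∈ T, {w' | cl w' = cl z} ⊆ T := by
      intro z hz w' hw'
      change P.blockOf w ∈ cl w'
      rw [show cl w' = cl z from hw']; exact hz
    have hle := Set.ncard_le_ncard (hsub ⟨u, hu⟩ hCu)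
    -- A class smaller than the trace leaves room for a second class in it, so twice the common
    -- size, which is at least 2, would be at most 3.
    by_contra hc
    have hlt : {w' | cl w' = cl ⟨u, hu⟩}.ncard < T.ncard := by omega
    obtain ⟨z, hz, hzu⟩ := Set.exists_mem_notMem_of_ncard_lt_ncard hlt
    have hd : Disjoint {w' | cl w' = cl ⟨u, hu⟩} {w' | cl w' = cl z} := by
      rw [Set.disjoint_left]
      intro y hy hy'
      exact hzu (Eq.trans (Eq.symm hy') hy)
    have h1 := Set.ncard_union_eq hd
    have h2 := Set.ncard_le_ncard (Set.union_subset (hsub ⟨u, hu⟩ hCu) (hsub z hz))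
    have h4 : 1 < {w' | cl w' = cl ⟨u, hu⟩}.ncard :=
      (Set.one_lt_ncard).2 ⟨⟨u, hu⟩, rfl, ⟨u', hu'⟩, huu.symm,
        fun h => hne (congrArg Subtype.val h)⟩
    rw [h1, hsize z, hT] at h2
    omega
  obtain ⟨x, y, hx, hy, hxy⟩ := exists_not_commute hA
  refine hxy (Subtype.ext (commute_of_two_triples ((Nat.card_coe_set_eq _).trans hv) cl
    (fun w => (hsize w).trans h3) x y (hcl x x.2) (hcl y y.2) ?_ ?_))
  · exact congrArg Subtype.val hx
  · exact congrArg Subtype.val hy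

end InG

end InvPartition

/-! ### The Fano plane on a block and the characterization of 2-arc-transitive quotients -/

namespace InvPartition

variable {X V : Type*} [Group X] [MulAction X V] {P : InvPartition X V} {Γ : SimpleGraph V}

/-- The traces in `B` are the lines of a Fano plane. -/
def IsFano (P : InvPartition X V) (Γ : SimpleGraph V) (B : P.Block)
    (e : P.carrier B ≃ Fin 7) (f : (P.quotientGraph Γ).neighborSet B ≃ Fin 7) : Prop :=
  ∀ (x : P.carrier B) (C : (P.quotientGraph Γ).neighborSet B),
    (C : P.Block) ∈ P.blocksAt Γ (x : V) ↔ e x ∈ fanoLine (f C)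

namespace InG

theorem exists_block_perm (h : P.InG Γ) (B : P.Block) (π : Equiv.Perm (P.carrier B))
    (hπ : π ∈ P.blockGroup B) :
    ∃ σ : Equiv.Perm ((P.quotientGraph Γ).neighborSet B), ∀ (x : P.carrier B) C,
      (σ C : P.Block) ∈ P.blocksAt Γ (π x : V) ↔ (C : P.Block) ∈ P.blocksAt Γ (x : V) := by
  obtain ⟨g, hg, hx⟩ := hπ
  refine ⟨inducedHom _ _ (h.smul_mem_nbr B) ⟨g, hg⟩, fun x C => ?_⟩
  rw [hx, inducedHom_apply]
  exact h.smul_mem_blocksAt g x C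

/-- The group is transitive on the seven vertices of the block. -/
theorem seven_dvd_card (h : P.InG Γ) {B : P.Block} (hv : (P.carrier B).ncard = 7) :
    7 ∣ Nat.card (P.blockGroup B) := by
  obtain ⟨u, hu⟩ := exists_blockOf B
  have horb : MulAction.orbit (P.blockGroup B) (⟨u, hu⟩ : P.carrier B) = Set.univ := by
    refine Set.eq_univ_of_forall fun w => ?_
    obtain ⟨g, hg⟩ := h.exists_smul u (w : V)
    have hgB : g ∈ MulAction.stabilizer X B := by
      have := congrArg P.blockOf hg
      rw [blockOf_smul, hu, mem_carrier.1 w.2] at this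
      exact this
    exact ⟨⟨inducedHom _ _ (smul_mem_carrier B) ⟨g, hgB⟩, g, hgB, fun _ => rfl⟩, Subtype.ext hg⟩
  have hdvd : Nat.card (MulAction.orbit (P.blockGroup B) (⟨u, hu⟩ : P.carrier B)) ∣
      Nat.card (P.blockGroup B) := by
    rw [Nat.card_congr (MulAction.orbitEquivQuotientStabilizer (P.blockGroup B) _)]
    exact Subgroup.card_quotient_dvd_card _
  rwa [horb, Nat.card_coe_set_eq, Set.ncard_univ, Nat.card_coe_set_eq, hv] at hdvd

/-- Collineations are induced by elements of the stabilizer of the block. -/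
theorem exists_smul_of_fano (h : P.InG Γ) {B : P.Block} {e : P.carrier B ≃ Fin 7}
    {f : (P.quotientGraph Γ).neighborSet B ≃ Fin 7} (hef : P.IsFano Γ B e f)
    (hgrp : coordGroup e (P.blockGroup B) = fanoAut) {π : Equiv.Perm (Fin 7)} (hπ : π ∈ fanoAut) :
    ∃ (g : X) (hg : g ∈ MulAction.stabilizer X B),
      (∀ x : P.carrier B, (e.symm (π (e x)) : V) = g • (x : V)) ∧
      ∀ E (hE : (P.quotientGraph Γ).Adj B E) (w : Fin 7), w ∈ fanoLine (f ⟨E, hE⟩) →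
        π w ∈ fanoLine (f ⟨g • E, h.smul_mem_nbr B g hg E hE⟩) := by
  rw [← hgrp] at hπ
  obtain ⟨ρ, ⟨g, hg, hρ⟩, hπρ⟩ := mem_coordGroup.1 hπ
  refine ⟨g, hg, fun x => by rw [hπρ, e.symm_apply_apply, hρ], fun E hE w hw => ?_⟩
  obtain ⟨w, rfl⟩ := e.surjective w
  rw [hπρ, ← hef, hρ]
  rw [← hef] at hw
  exact (h.smul_mem_blocksAt g _ _).2 hw

variable [Finite V]

/-- Cauchy's theorem supplies the element of order seven that `fano_or_small` needs. -/
theorem isFano_or_small (h : P.InG Γ)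
    (hk : ∀ B C : P.Block, (P.quotientGraph Γ).Adj B C → (P.trace Γ B C).ncard = 3) {B : P.Block}
    (hv : (P.carrier B).ncard = 7) (hb : ((P.quotientGraph Γ).neighborSet B).ncard = 7)
    (h7 : 7 ∣ Nat.card (P.blockGroup B)) :
    (∃ e f, P.IsFano Γ B e f) ∨
    ((∃ C D : (P.quotientGraph Γ).neighborSet B, C ≠ D ∧ ∃ x y : P.carrier B, x ≠ y ∧
      (C : P.Block) ∈ P.blocksAt Γ (x : V) ∧ (C : P.Block) ∈ P.blocksAt Γ (y : V) ∧
      (D : P.Block) ∈ P.blocksAt Γ (x : V) ∧ (D : P.Block) ∈ P.blocksAt Γ (y : V)) ∧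
      Nat.card (P.blockGroup B) ≤ 14) := by
  have : Fact (Nat.Prime 7) := ⟨by norm_num⟩
  obtain ⟨c, hc⟩ := exists_prime_orderOf_dvd_card' (G := P.blockGroup B) 7 h7
  refine fano_or_small ((Nat.card_coe_set_eq _).trans hv) ((card_nbr B).trans hb)
    (fun (x : P.carrier B) (C : (P.quotientGraph Γ).neighborSet B) =>
      (C : P.Block) ∈ P.blocksAt Γ (x : V)) (fun C => ?_) (P.blockGroup B)
    (h.exists_block_perm B) c.2 ?_ ?_
  · rw [← hk B C C.2, ← Set.ncard_image_of_injective _ Subtype.val_injective]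
    congr 1
    ext z
    constructor
    · rintro ⟨y, hy, rfl⟩
      exact ⟨hy, y.2⟩
    · intro hz
      exact ⟨⟨z, hz.2⟩, hz.1, rfl⟩
  · have : c ^ 7 = 1 := by rw [← hc, pow_orderOf_eq_one]
    exact congrArg Subtype.val this
  · intro h1
    have : c = 1 := Subtype.ext h1
    rw [this, orderOf_one] at hc
    omega

/-- The order 168 excludes the small alternative and makes the group equal to `fanoAut`, which is
transitive on ordered pairs of distinct lines. -/
theorem two_arc_of_psl (h : P.InG Γ)
    (hk : ∀ B C : P.Block, (P.quotientGraph Γ).Adj B C → (P.trace Γ B C).ncard = 3) {B : P.Block}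
    (hv : (P.carrier B).ncard = 7) (hb : ((P.quotientGraph Γ).neighborSet B).ncard = 7)
    (hA : Nonempty (P.blockGroup B ≃* Matrix.ProjectiveSpecialLinearGroup (Fin 3) (ZMod 2))) :
    (∃ e f, P.IsFano Γ B e f ∧ coordGroup e (P.blockGroup B) = fanoAut) ∧
      IsArcTransitive X (P.quotientGraph Γ) 2 := by
  have hcard : Nat.card (P.blockGroup B) = 168 := by
    obtain ⟨φ⟩ := hA
    obtain ⟨ψ⟩ := nonempty_fanoAut_mulEquiv
    rw [← card_fanoAut]
    exact Nat.card_congr (φ.trans ψ.symm).toEquiv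
  rcases h.isFano_or_small hk hv hb (h.seven_dvd_card hv) with ⟨e, f, hef⟩ | ⟨-, h14⟩
  swap
  · omega
  have hgrp : coordGroup e (P.blockGroup B) = fanoAut :=
    eq_fanoAut_of_card (coordGroup_le_fanoAut (h.exists_block_perm B) hef)
      ((card_coordGroup _ _).trans hcard)
  refine ⟨⟨e, f, hef, hgrp⟩, ?_⟩
  refine isArcTransitive_two_of_stabilizer h.quot_vertexTransitive B
    fun C D C' D' hC hD hC' hD' hCD hCD' => ?_
  obtain ⟨x, y, z, h1, h2, h3, h4, h5, h6, h7, h8⟩ := fano_lines_triangle (f ⟨C, hC⟩) (f ⟨D, hD⟩)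
    (f.injective.ne fun h => hCD (congrArg Subtype.val h))
  obtain ⟨x', y', z', h1', h2', h3', h4', h5', h6', h7', h8'⟩ :=
    fano_lines_triangle (f ⟨C', hC'⟩) (f ⟨D', hD'⟩)
      (f.injective.ne fun h => hCD' (congrArg Subtype.val h))
  obtain ⟨π, hπ, hx, hy, hz⟩ := exists_fanoAut_triangle h5 h6 h7 h8 h5' h6' h7' h8'
  obtain ⟨g, hg, -, key⟩ := h.exists_smul_of_fano hef hgrp hπ
  refine ⟨g, hg, ?_, ?_⟩
  · have e1 := fanoLine_unique (f ⟨g • C, h.smul_mem_nbr B g hg C hC⟩) (f ⟨C', hC'⟩) x' y' h5'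
      (hx ▸ key C hC x h1) (hy ▸ key C hC y h3) h1' h3'
    exact congrArg Subtype.val (f.injective e1)
  · have e1 := fanoLine_unique (f ⟨g • D, h.smul_mem_nbr B g hg D hD⟩) (f ⟨D', hD'⟩) x' z' h6'.symm
      (hx ▸ key D hD x h2) (hz ▸ key D hD z h4) h2' h4'
    exact congrArg Subtype.val (f.injective e1)

/-- Flag-transitivity comes from the arcs of Γ, but a group of order 21 has it as well. The
additional information is an element interchanging two neighbours of `B`, of which some power is an
involution on `B`. -/
theorem psl_of_two_arc (h : P.InG Γ)
    (hk : ∀ B C : P.Block, (P.quotientGraph Γ).Adj B C → (P.trace Γ B C).ncard = 3)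
    (h2 : IsArcTransitive X (P.quotientGraph Γ) 2) (hl : P.MeetIn Γ 1) {B : P.Block}
    (hv : (P.carrier B).ncard = 7) (hb : ((P.quotientGraph Γ).neighborSet B).ncard = 7) :
    Nonempty (P.blockGroup B ≃* Matrix.ProjectiveSpecialLinearGroup (Fin 3) (ZMod 2)) := by
  rcases h.isFano_or_small hk hv hb (h.seven_dvd_card hv) with
    ⟨e, f, hef⟩ | ⟨⟨C, D, hCD, x, y, hxy, hxC, hyC, hxD, hyD⟩, -⟩
  swap
  · exfalso
    have := (Set.ncard_le_one).1 (hl B C D C.2 D.2 (fun h => hCD (Subtype.ext h))).le x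
      ⟨x.2, hxC, hxD⟩ y ⟨y.2, hyC, hyD⟩
    exact hxy (Subtype.ext this)
  have hle := coordGroup_le_fanoAut (h.exists_block_perm B) hef
  -- an involution in the group
  obtain ⟨C, hC, D, hD, hCD⟩ := (Set.one_lt_ncard).1
    (show 1 < ((P.quotientGraph Γ).neighborSet B).ncard by omega)
  obtain ⟨g, hgC, hgB, hgD⟩ := h2.exists_two hC.symm hD hCD hD.symm hC hCD.symm
  have hg : g ∈ MulAction.stabilizer X B := hgB
  let ρ : P.blockGroup B :=
    ⟨inducedHom _ _ (smul_mem_carrier B) ⟨g, hg⟩, g, hg, fun _ => rfl⟩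
  have hρ : ∀ (n : ℕ) (x : P.carrier B), (((ρ ^ n : P.blockGroup B) : Equiv.Perm (P.carrier B)) x : V)
      = g ^ n • (x : V) := by
    intro n
    induction n with
    | zero => intro x; simp
    | succ n ih =>
      intro x
      rw [pow_succ', pow_succ', mul_smul, ← ih]
      rfl
  -- If the order of g on B were odd, the corresponding power of g would be trivial on B and still
  -- carry C to D, whose traces are distinct.
  have heven : Even (orderOf ρ) := by
    by_contra hodd
    rw [Nat.not_even_iff_odd] at hodd
    obtain ⟨n, hn⟩ := hodd
    have hgg : ∀ n : ℕ, g ^ (2 * n) • C = C := by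
      intro n
      induction n with
      | zero => simp
      | succ n ih =>
        rw [show 2 * (n + 1) = 2 * n + 1 + 1 by ring, pow_succ, pow_succ, mul_smul, mul_smul, hgC,
          hgD, ih]
    have h3 : g ^ orderOf ρ • C = D := by
      rw [hn, pow_succ', mul_smul, hgg, hgC]
    have h4 : ∀ x ∈ P.carrier B, g ^ orderOf ρ • x = x := by
      intro x hx
      rw [← hρ _ ⟨x, hx⟩, pow_orderOf_eq_one]
      rfl
    have hs := separatesBlocks_of_meetIn hk hl (by omega) B
    refine hCD (hs C D hC hD ?_)
    have h5 := h.smul_trace (g ^ orderOf ρ) B C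
    rw [MulAction.mem_stabilizer_iff.1 (Subgroup.pow_mem _ hg _), h3] at h5
    rw [← h5]
    ext w
    constructor
    · intro hw
      exact ⟨w, hw, h4 w hw.2⟩
    · rintro ⟨x, hx, rfl⟩
      change g ^ orderOf ρ • x ∈ _
      rw [h4 x hx.2]
      exact hx
  obtain ⟨m, hm1, hm2⟩ := exists_involution_of_even ρ heven
  obtain ⟨φ⟩ := nonempty_mulEquiv_coordGroup e (P.blockGroup B)
  have hflag : ∀ p q p' q' : Fin 7, p ≠ q → p' ≠ q' →
      ∃ π ∈ coordGroup e (P.blockGroup B), π p = p' ∧ (π q = q' ∨ π q = third p' q') := by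
    intro p q p' q' hpq hpq'
    obtain ⟨k, hk1, hk2, -⟩ := exists_fanoLine p q hpq
    obtain ⟨k', hk1', hk2', -⟩ := exists_fanoLine p' q' hpq'
    obtain ⟨x, rfl⟩ := e.surjective p
    obtain ⟨y, rfl⟩ := e.surjective q
    obtain ⟨x', rfl⟩ := e.surjective p'
    obtain ⟨C, rfl⟩ := f.surjective k
    obtain ⟨C', rfl⟩ := f.surjective k'
    rw [← hef] at hk1 hk2 hk1'
    obtain ⟨g, hgx, hgC⟩ := h.exists_flag hk1 hk1'
    have hg : g ∈ MulAction.stabilizer X B := by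
      have := congrArg P.blockOf hgx
      rw [blockOf_smul, mem_carrier.1 x.2, mem_carrier.1 x'.2] at this
      exact this
    let π := inducedHom _ _ (smul_mem_carrier B) ⟨g, hg⟩
    have hπx : π x = x' := Subtype.ext hgx
    have hmem : e.permCongr π ∈ coordGroup e (P.blockGroup B) :=
      ⟨π, ⟨g, hg, fun _ => rfl⟩, rfl⟩
    have happ : ∀ z, e.permCongr π (e z) = e (π z) := fun z => by
      rw [Equiv.permCongr_apply, e.symm_apply_apply]
    refine ⟨_, hmem, by rw [happ, hπx], ?_⟩
    rw [happ]
    refine eq_or_eq_third (f C') _ _ _ ((hef _ _).1 hk1') hk2' ?_ hpq' ?_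
    · rw [← hef, ← hgC]
      exact (h.smul_mem_blocksAt g _ _).2 hk2
    · rw [← hπx]
      exact e.injective.ne (π.injective.ne fun h => hpq (by rw [h]))
  have hgrp : coordGroup e (P.blockGroup B) = fanoAut := by
    refine eq_fanoAut hle hflag (t := φ (ρ ^ m)) (φ (ρ ^ m)).2 ?_ ?_
    · have : φ (ρ ^ m) * φ (ρ ^ m) = 1 := by rw [← map_mul, hm1, map_one]
      exact congrArg Subtype.val this
    · intro h1
      have : φ (ρ ^ m) = φ 1 := by rw [map_one]; exact Subtype.ext h1
      exact hm2 (φ.injective this)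
  obtain ⟨ψ⟩ := nonempty_fanoAut_mulEquiv
  rw [← hgrp] at ψ
  exact ⟨φ.trans ψ⟩

/-- The characterization of two-arc-transitive quotients with `k = 3`. -/
theorem two_arc_iff (h : P.InG Γ)
    (hk : ∀ B C : P.Block, (P.quotientGraph Γ).Adj B C → (P.trace Γ B C).ncard = 3) (B : P.Block)
    (u : V) : IsArcTransitive X (P.quotientGraph Γ) 2 ↔
      P.CaseA Γ B u ∨ P.CaseB Γ B u ∨ P.CaseC Γ B u ∨ P.CaseD Γ B u := by
  constructor
  · intro h2
    obtain ⟨l, hl⟩ := h.exists_meetIn h2 B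
    rcases h.parameters hk hl B u with ⟨hv, hb, hr, rfl⟩ | ⟨hv, hb, hr, rfl⟩ |
      ⟨hv, hb, hr, rfl⟩ | ⟨hv, hr, rfl⟩
    · have hr' := fun w => (h.ncard_blocksAt w u).trans hr
      exact Or.inl ⟨hv, hb, hr, h.blockGroup_of_two_arc (separatesPoints_of_four hk hv hb hr')
        (h.separatesBlocks_of_four hk hv hb hr') hb h2⟩
    · have hr' := fun w => (h.ncard_blocksAt w u).trans hr
      exact Or.inr (Or.inl ⟨hv, hb, hr, h.blockGroup_of_two_arc
        (h.separatesPoints_of_meetIn_one hl hr' le_rfl B)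
        (separatesBlocks_of_meetIn hk hl (by omega) B) hb h2⟩)
    · exact Or.inr (Or.inr (Or.inl ⟨hv, hb, hr, h.psl_of_two_arc hk h2 hl hv hb⟩))
    · refine Or.inr (Or.inr (Or.inr ⟨hv, ?_, hr, ?_⟩))
      · have := h.two_le_valency B
        omega
      · intro C hC D hD C' hC' D' hD' hCD hCD'
        obtain ⟨g, h1, h2, h3⟩ := h2.exists_two hC.symm hD hCD hC'.symm hD' hCD'
        exact ⟨g, h2, h1, h3⟩
  · rintro (⟨hv, hb, hr, hA⟩ | ⟨hv, hb, hr, hA⟩ | ⟨hv, hb, hr, hA⟩ | ⟨-, -, -, hA⟩)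
    · have hr' := fun w => (h.ncard_blocksAt w u).trans hr
      exact h.two_arc_of_separates (separatesPoints_of_four hk hv hb hr')
        (h.separatesBlocks_of_four hk hv hb hr') hb hA
    · have h1 := h.separatesPoints_of_six hk hv hA
      refine h.two_arc_of_separates h1 ?_ hb hA
      -- As r = 2, all three points of two equal traces would have C and D as their only blocks and
      -- so would not be separated.
      intro C D hC hD hCD
      by_contra hne
      obtain ⟨x, hx, y, hy, hxy⟩ := (Set.one_lt_ncard).1
        (show 1 < (P.trace Γ B C).ncard by rw [hk B C hC]; omega)
      have key : ∀ z ∈ P.trace Γ B C, P.blocksAt Γ z = {C, D} := by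
        intro z hz
        refine (Set.eq_of_subset_of_ncard_le ?_ ?_).symm
        · rintro E (rfl | rfl)
          · exact hz.1
          · rw [hCD] at hz; exact hz.1
        · rw [Set.ncard_pair hne, h.ncard_blocksAt z u, hr]
      exact hxy (h1 x y hx.2 hy.2 (by rw [key x hx, key y hy]))
    · exact (h.two_arc_of_psl hk hv hb hA).2
    · refine isArcTransitive_two_of_stabilizer h.quot_vertexTransitive B
        fun C D C' D' hC hD hC' hD' hCD hCD' => ?_
      obtain ⟨g, hg, h1, h2⟩ := hA C hC D hD C' hC' D' hD' hCD hCD'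
      exact ⟨g, hg, h1, h2⟩

end InG

end InvPartition

/-! ### Cycles as sequences indexed by the integers -/

section Sequences

variable {W : Type*}

/-- The graph of consecutive members of a sequence. -/
def seqGraph (q : ℤ → W) : SimpleGraph W :=
  SimpleGraph.fromRel fun x y => ∃ i, x = q i ∧ y = q (i + 1)

/-- `q` has period exactly `n`. -/
def HasPeriod (n : ℕ) (q : ℤ → W) : Prop := ∀ i j, q i = q j ↔ (n : ℤ) ∣ i - j

theorem HasPeriod.eq {n : ℕ} {q : ℤ → W} (h : HasPeriod n q) {i j : ℤ} (hij : (n : ℤ) ∣ i - j) :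
    q i = q j := (h i j).2 hij

theorem HasPeriod.ne {n : ℕ} (hn : 3 ≤ n) {q : ℤ → W} (h : HasPeriod n q) (i : ℤ) {d : ℤ}
    (hd : 0 < d) (hd' : d < 3) : q i ≠ q (i + d) := by
  rw [Ne, h]
  intro hdvd
  have h1 : (n : ℤ) ∣ d := by
    have := (dvd_neg).2 hdvd
    rwa [show -(i - (i + d)) = d by ring] at this
  have := Int.le_of_dvd hd h1
  omega

theorem seqGraph_adj {n : ℕ} (hn : 3 ≤ n) {q : ℤ → W} (h : HasPeriod n q) {x y : W} :
    (seqGraph q).Adj x y ↔ ∃ i, (x = q i ∧ y = q (i + 1)) ∨ (y = q i ∧ x = q (i + 1)) := by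
  rw [seqGraph, SimpleGraph.fromRel_adj]
  constructor
  · rintro ⟨-, ⟨i, hi⟩ | ⟨i, hi⟩⟩
    exacts [⟨i, Or.inl hi⟩, ⟨i, Or.inr hi⟩]
  · rintro ⟨i, ⟨rfl, rfl⟩ | ⟨rfl, rfl⟩⟩
    · exact ⟨h.ne hn i (by omega) (by omega), Or.inl ⟨i, rfl, rfl⟩⟩
    · exact ⟨(h.ne hn i (by omega) (by omega)).symm, Or.inr ⟨i, rfl, rfl⟩⟩

theorem seqGraph_adj_left {n : ℕ} (hn : 3 ≤ n) {q : ℤ → W} (h : HasPeriod n q) {i : ℤ} {y : W} :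
    (seqGraph q).Adj (q i) y ↔ y = q (i + 1) ∨ y = q (i - 1) := by
  rw [seqGraph_adj hn h]
  constructor
  · rintro ⟨j, ⟨h1, rfl⟩ | ⟨rfl, h1⟩⟩
    · left
      rw [h] at h1 ⊢
      have := (dvd_neg).2 h1
      rwa [show j + 1 - (i + 1) = -(i - j) by ring]
    · right
      rw [h] at h1 ⊢
      have := (dvd_neg).2 h1
      rwa [show j - (i - 1) = -(i - (j + 1)) by ring]
  · rintro (rfl | rfl)
    · exact ⟨i, Or.inl ⟨rfl, rfl⟩⟩
    · exact ⟨i - 1, Or.inr ⟨rfl, by rw [sub_add_cancel]⟩⟩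

theorem seqGraph_shift (q : ℤ → W) (k : ℤ) : seqGraph (fun i => q (k + i)) = seqGraph q := by
  ext x y
  simp only [seqGraph, SimpleGraph.fromRel_adj]
  have key : ∀ x y, (∃ i, x = q (k + i) ∧ y = q (k + (i + 1))) ↔ ∃ i, x = q i ∧ y = q (i + 1) := by
    intro x y
    constructor
    · rintro ⟨i, rfl, rfl⟩
      exact ⟨k + i, rfl, by rw [add_assoc]⟩
    · rintro ⟨i, rfl, rfl⟩
      exact ⟨i - k, by rw [add_sub_cancel], by rw [← add_assoc, add_sub_cancel]⟩
  rw [key, key]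

theorem seqGraph_reverse (q : ℤ → W) (k : ℤ) : seqGraph (fun i => q (k - i)) = seqGraph q := by
  ext x y
  simp only [seqGraph, SimpleGraph.fromRel_adj]
  have key : ∀ x y, (∃ i, x = q (k - i) ∧ y = q (k - (i + 1))) ↔ ∃ i, y = q i ∧ x = q (i + 1) := by
    intro x y
    constructor
    · rintro ⟨i, rfl, rfl⟩
      exact ⟨k - (i + 1), rfl, by congr 1; ring⟩
    · rintro ⟨i, rfl, rfl⟩
      exact ⟨k - (i + 1), by congr 1; ring, by congr 1; ring⟩
  rw [key, key, or_comm]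

/-- An arc of the cycle is the beginning of a reparametrization. -/
theorem exists_reparam {n : ℕ} (hn : 3 ≤ n) {q : ℤ → W} (h : HasPeriod n q) {a b : W}
    (hab : (seqGraph q).Adj a b) :
    ∃ k, (a = q k ∧ b = q (k + 1)) ∨ (a = q k ∧ b = q (k - 1)) := by
  obtain ⟨i, ⟨rfl, rfl⟩ | ⟨rfl, rfl⟩⟩ := (seqGraph_adj hn h).1 hab
  · exact ⟨i, Or.inl ⟨rfl, rfl⟩⟩
  · exact ⟨i + 1, Or.inr ⟨rfl, by rw [add_sub_cancel_right]⟩⟩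

/-- Turns adjacency in `SimpleGraph.cycleGraph`, expressed by subtraction in `Fin n`, into the
divisibility used by `HasPeriod`. -/
theorem fin_sub_val_eq_one {n : ℕ} (hn : 3 ≤ n) (u w : Fin n) :
    (u - w).val = 1 ↔ (n : ℤ) ∣ (u : ℤ) - w - 1 := by
  have h1 : (((u - w).val : ℕ) : ℤ) = ((u : ℤ) - w) % n := by
    rw [Fin.val_sub]
    push_cast [w.2.le]
    rw [show (n : ℤ) - w + u = (u - w) + n by ring, Int.add_emod_right]
  have h2 : (1 : ℤ) % n = 1 := Int.emod_eq_of_lt (by omega) (by omega)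
  rw [Int.dvd_iff_emod_eq_zero, ← Int.emod_eq_emod_iff_emod_sub_eq_zero, h2, ← h1]
  norm_cast

end Sequences

/-! ### Sets of `3`-arcs extending every `2`-arc uniquely -/

section UniqueExtension

variable {X W : Type*} [Group X] [MulAction X W] {G : SimpleGraph W} {Δ : Set (Fin 4 → W)}

/-- `Δ` is a self-paired `X`-invariant set of `3`-arcs of the `(X,2)`-arc-transitive graph `G`, and
every `2`-arc is the beginning of exactly one member of `Δ`. -/
structure ExtendsUniquely (X : Type*) [Group X] [MulAction X W] (G : SimpleGraph W)
    (Δ : Set (Fin 4 → W)) : Prop where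
  trans : IsArcTransitive X G 2
  adj : ∀ {a b c d}, ![a, b, c, d] ∈ Δ → G.Adj a b ∧ G.Adj b c ∧ G.Adj c d ∧ a ≠ c ∧ b ≠ d
  smul : ∀ (g : X) {a b c d}, ![a, b, c, d] ∈ Δ → ![g • a, g • b, g • c, g • d] ∈ Δ
  rev : ∀ {a b c d}, ![a, b, c, d] ∈ Δ → ![d, c, b, a] ∈ Δ
  exists_ext : ∀ {a b c}, G.Adj a b → G.Adj b c → a ≠ c → ∃ d, ![a, b, c, d] ∈ Δ
  unique : ∀ {a b c d d'}, ![a, b, c, d] ∈ Δ → ![a, b, c, d'] ∈ Δ → d = d'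

theorem IsSelfPairedArcOrbit.extendsUniquely (h : IsSelfPairedArcOrbit X G Δ)
    (hT : IsArcTransitive X G 2)
    (hu : ∀ a b c, G.Adj a b → G.Adj b c → a ≠ c → ∃! d, ![a, b, c, d] ∈ Δ) :
    ExtendsUniquely X G Δ := by
  obtain ⟨⟨α, hα, rfl⟩, hr⟩ := h
  have hadj : ∀ {a b c d}, ![a, b, c, d] ∈ MulAction.orbit X α →
      G.Adj a b ∧ G.Adj b c ∧ G.Adj c d ∧ a ≠ c ∧ b ≠ d := by
    rintro a b c d ⟨g, hg⟩
    have := smul_mem_arcs hT.1.1 hα g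
    change g • α = _ at hg
    rw [hg] at this
    exact mem_arcs_three.1 this
  refine ⟨hT, hadj, ?_, ?_, fun h1 h2 h3 => (hu _ _ _ h1 h2 h3).exists, fun h1 h2 => ?_⟩
  · rintro g a b c d h
    rw [← smul_vec_four]
    exact (MulAction.mem_orbit_of_mem_orbit g h)
  · intro a b c d h
    rw [← vec_four_rev]
    exact hr _ h
  · obtain ⟨p, q, -, r, -⟩ := hadj h1
    exact (hu _ _ _ p q r).unique h1 h2

/-- Sequences all of whose stretches of length `4` lie in `Δ`. -/
def IsThread (Δ : Set (Fin 4 → W)) (q : ℤ → W) : Prop :=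
  ∀ i, ![q i, q (i + 1), q (i + 2), q (i + 3)] ∈ Δ

theorem IsThread.shift {q : ℤ → W} (hq : IsThread Δ q) (k : ℤ) :
    IsThread Δ fun i => q (k + i) := fun i => by
  have := hq (k + i)
  simpa only [add_assoc] using this

namespace ExtendsUniquely

theorem reverse (h : ExtendsUniquely X G Δ) {q : ℤ → W} (hq : IsThread Δ q) (k : ℤ) :
    IsThread Δ fun i => q (k - i) := fun i => by
  have := h.rev (hq (k - i - 3))
  convert this using 3 <;> ring_nf

theorem smul_thread (h : ExtendsUniquely X G Δ) {q : ℤ → W} (hq : IsThread Δ q) (g : X) :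
    IsThread Δ fun i => g • q i := fun i => h.smul g (hq i)

theorem thread_forward (h : ExtendsUniquely X G Δ) {q q' : ℤ → W} (hq : IsThread Δ q)
    (hq' : IsThread Δ q') (h0 : q 0 = q' 0) (h1 : q 1 = q' 1) (h2 : q 2 = q' 2) (n : ℕ) :
    q n = q' n ∧ q (n + 1) = q' (n + 1) ∧ q (n + 2) = q' (n + 2) := by
  induction n with
  | zero => exact ⟨by simpa using h0, by simpa using h1, by simpa using h2⟩
  | succ n ih =>
    obtain ⟨i0, i1, i2⟩ := ih
    have e1 : (n : ℤ) + 1 + 1 = n + 2 := by ring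
    have e2 : (n : ℤ) + 1 + 2 = n + 3 := by ring
    push_cast
    rw [e1, e2]
    refine ⟨i1, i2, ?_⟩
    have := hq' n
    rw [← i0, ← i1, ← i2] at this
    exact h.unique (hq n) this

/-- Uniqueness of extension determines a thread forwards. Since Δ is self-paired, reversed threads
are threads, which settles the negative positions. -/
theorem thread_ext (h : ExtendsUniquely X G Δ) {q q' : ℤ → W} (hq : IsThread Δ q)
    (hq' : IsThread Δ q') (h0 : q 0 = q' 0) (h1 : q 1 = q' 1) (h2 : q 2 = q' 2) : q = q' := by
  funext i
  rcases le_or_gt 0 i with hi | hi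
  · have := (h.thread_forward hq hq' h0 h1 h2 i.toNat).1
    rwa [Int.toNat_of_nonneg hi] at this
  -- The reflection i ↦ 2 - i preserves the window 0, 1, 2.
  · have := (h.thread_forward (h.reverse hq 2) (h.reverse hq' 2) (by simpa using h2)
      (by simpa using h1) (by simpa using h0) (2 - i).toNat).1
    rwa [Int.toNat_of_nonneg (by omega), sub_sub_cancel] at this

theorem thread_adj (h : ExtendsUniquely X G Δ) {q : ℤ → W} (hq : IsThread Δ q) (i : ℤ) :
    G.Adj (q i) (q (i + 1)) := (h.adj (hq i)).1

theorem thread_arc (h : ExtendsUniquely X G Δ) {q : ℤ → W} (hq : IsThread Δ q) :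
    G.Adj (q 0) (q 1) ∧ G.Adj (q 1) (q 2) ∧ q 0 ≠ q 2 := by
  obtain ⟨p, r, -, s, -⟩ := h.adj (hq 0)
  simp only [zero_add] at p r s
  exact ⟨p, r, s⟩

/-- Any two threads are conjugate. -/
theorem exists_smul_thread (h : ExtendsUniquely X G Δ) {q q' : ℤ → W} (hq : IsThread Δ q)
    (hq' : IsThread Δ q') : ∃ g : X, ∀ i, g • q i = q' i := by
  obtain ⟨a1, a2, a3⟩ := h.thread_arc hq
  obtain ⟨b1, b2, b3⟩ := h.thread_arc hq'
  obtain ⟨g, h0, h1, h2⟩ := h.trans.exists_two a1 a2 a3 b1 b2 b3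
  exact ⟨g, congrFun (h.thread_ext (h.smul_thread hq g) hq' h0 h1 h2)⟩

/-- If d extends (a, b, c), some g maps (a, b, c) to (b, c, d). The powers of g translate this 3-arc
along a thread, which is then periodic on a finite vertex set. -/
theorem exists_thread (h : ExtendsUniquely X G Δ) {a b c : W} (hab : G.Adj a b) (hbc : G.Adj b c)
    (hac : a ≠ c) : ∃ q, IsThread Δ q ∧ q 0 = a ∧ q 1 = b ∧ q 2 = c ∧ ∃ g : X, ∀ i : ℤ,
      q i = g ^ i • a := by
  obtain ⟨d, hd⟩ := h.exists_ext hab hbc hac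
  obtain ⟨-, -, hcd, -, hbd⟩ := h.adj hd
  obtain ⟨g, rfl, rfl, rfl⟩ := h.trans.exists_two hab hbc hac hbc hcd hbd
  refine ⟨fun i => g ^ i • a, fun i => ?_, by simp, by simp, ?_, g, fun i => rfl⟩
  · have := h.smul (g ^ i) hd
    simpa only [zpow_add, mul_smul, zpow_one, zpow_ofNat, pow_succ, pow_zero, one_mul] using this
  · simp only [zpow_ofNat, pow_succ, pow_zero, one_mul, mul_smul]

/-- All threads have one and the same period. -/
theorem exists_period [Finite W] (h : ExtendsUniquely X G Δ) {a b c : W} (hab : G.Adj a b)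
    (hbc : G.Adj b c) (hac : a ≠ c) : ∃ n, 3 ≤ n ∧ ∀ q, IsThread Δ q → HasPeriod n q := by
  obtain ⟨q, hq, -, -, -, g, hg⟩ := h.exists_thread hab hbc hac
  have hpos : 0 < MulAction.period g a :=
    Function.minimalPeriod_pos_of_mem_periodicPts
      ((MulAction.injective g).mem_periodicPts a)
  have hper : HasPeriod (MulAction.period g a) q := fun i j => by
    rw [hg, hg, ← MulAction.zpow_smul_eq_iff_period_dvd, sub_eq_neg_add, zpow_add, mul_smul,
      zpow_neg, inv_smul_eq_iff]
  refine ⟨MulAction.period g a, ?_, fun q' hq' i j => ?_⟩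
  -- Period 1 is impossible because q 0 and q 1 are adjacent, period 2 because q 0 ≠ q 2.
  · obtain ⟨a1, a2, a3⟩ := h.thread_arc hq
    by_contra hlt
    have h1 := a1.ne
    rw [Ne, hper] at h1 a3
    interval_cases MulAction.period g a
    · norm_num at h1
    · norm_num at a3
  · obtain ⟨k, hk⟩ := h.exists_smul_thread hq hq'
    rw [← hk, ← hk, smul_left_cancel_iff, hper]

end ExtendsUniquely

end UniqueExtension

/-! ### The cycles traced out by threads -/

section Cycles

variable {X W : Type*} [Group X] [MulAction X W] {G : SimpleGraph W} {Δ : Set (Fin 4 → W)}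

theorem HasPeriod.cycleGraph_adj {n : ℕ} (hn : 3 ≤ n) {q : ℤ → W} (h : HasPeriod n q)
    (i j : Fin n) : (SimpleGraph.cycleGraph n).Adj i j ↔ (seqGraph q).Adj (q i) (q j) := by
  rw [seqGraph_adj_left hn h, SimpleGraph.cycleGraph_adj', fin_sub_val_eq_one hn,
    fin_sub_val_eq_one hn, h, h, or_comm]
  have e1 : (j : ℤ) - i - 1 = j - (i + 1) := by ring
  have e2 : (i : ℤ) - j - 1 = -(j - (i - 1)) := by ring
  rw [e1, e2, dvd_neg]

theorem HasPeriod.injective {n : ℕ} {q : ℤ → W} (h : HasPeriod n q) :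
    Function.Injective fun i : Fin n => q i := by
  intro i j hij
  have h1 : (n : ℤ) ∣ (i : ℤ) - j := (h _ _).1 hij
  have hi := i.2
  have hj := j.2
  obtain ⟨c, hc⟩ := h1
  have hc0 : c = 0 := by
    by_contra hne
    rcases lt_or_gt_of_ne hne with hlt | hgt
    · have : (n : ℤ) * c ≤ n * (-1) := by gcongr; omega
      omega
    · have : (n : ℤ) * 1 ≤ n * c := by gcongr; omega
      omega
  rw [hc0] at hc
  ext
  omega

theorem exists_fin_dvd_sub {n : ℕ} (hn : 3 ≤ n) (k : ℤ) :
    ∃ i : Fin n, (n : ℤ) ∣ k - i := by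
  have hn0 : (n : ℤ) ≠ 0 := by omega
  refine ⟨⟨(k % n).toNat, ?_⟩, ?_⟩
  · have := Int.emod_lt_of_pos k (show (0 : ℤ) < n by omega)
    have := Int.emod_nonneg k hn0
    omega
  · simp only [Int.toNat_of_nonneg (Int.emod_nonneg k hn0)]
    exact Int.dvd_self_sub_emod

theorem seqGraph_eq_map {n : ℕ} (hn : 3 ≤ n) {q : ℤ → W} (h : HasPeriod n q) :
    seqGraph q = (SimpleGraph.cycleGraph n).map
      (⟨fun i : Fin n => q i, h.injective⟩ : Fin n ↪ W) := by
  ext x y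
  rw [SimpleGraph.map_adj]
  constructor
  · intro hxy
    obtain ⟨k, hk⟩ : ∃ k l, x = q k ∧ y = q l := by
      obtain ⟨i, ⟨h1, h2⟩ | ⟨h1, h2⟩⟩ := (seqGraph_adj hn h).1 hxy
      exacts [⟨_, _, h1, h2⟩, ⟨_, _, h2, h1⟩]
    obtain ⟨l, rfl, rfl⟩ := hk
    obtain ⟨i, hi⟩ := exists_fin_dvd_sub hn k
    obtain ⟨j, hj⟩ := exists_fin_dvd_sub hn l
    rw [h.eq hi, h.eq hj] at hxy ⊢
    exact ⟨i, j, (h.cycleGraph_adj hn i j).2 hxy, rfl, rfl⟩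
  · rintro ⟨i, j, hij, rfl, rfl⟩
    exact (h.cycleGraph_adj hn i j).1 hij

theorem translate_seqGraph (g : X) (q : ℤ → W) :
    translate g (seqGraph q) = seqGraph fun i => g • q i := by
  ext x y
  simp only [translate, seqGraph, SimpleGraph.comap_adj, SimpleGraph.fromRel_adj,
    inv_smul_eq_iff, ne_eq, smul_left_cancel_iff]

theorem mem_graphStabilizer_iff {C : SimpleGraph W} {g : X} :
    g ∈ graphStabilizer X C ↔ translate g C = C := by
  constructor
  · intro hg
    ext x y
    have := hg (g⁻¹ • x) (g⁻¹ • y)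
    rw [smul_inv_smul, smul_inv_smul] at this
    exact this.symm
  · intro hg u w
    have : (translate g C).Adj (g • u) (g • w) ↔ C.Adj (g • u) (g • w) := by rw [hg]
    rw [← this]
    simp [translate]

theorem mem_support_seqGraph {n : ℕ} (hn : 3 ≤ n) {q : ℤ → W} (h : HasPeriod n q) {x : W} :
    x ∈ (seqGraph q).support ↔ ∃ i, x = q i := by
  rw [SimpleGraph.mem_support]
  constructor
  · rintro ⟨w, hw⟩
    obtain ⟨i, ⟨h1, -⟩ | ⟨-, h1⟩⟩ := (seqGraph_adj hn h).1 hw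
    exacts [⟨_, h1⟩, ⟨_, h1⟩]
  · rintro ⟨i, rfl⟩
    exact ⟨_, (seqGraph_adj_left hn h).2 (Or.inl rfl)⟩

/-- The `2`-arcs of the cycle traced out by `q`. -/
theorem arc_two_seqGraph {n : ℕ} (hn : 3 ≤ n) {q : ℤ → W} (h : HasPeriod n q) {a b c : W} :
    ![a, b, c] ∈ arcs (seqGraph q) 2 ↔ ∃ k, (a = q k ∧ b = q (k + 1) ∧ c = q (k + 2)) ∨
      (a = q k ∧ b = q (k - 1) ∧ c = q (k - 2)) := by
  rw [mem_arcs_two]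
  constructor
  · rintro ⟨h1, h2, h3⟩
    obtain ⟨k, ⟨rfl, rfl⟩ | ⟨rfl, rfl⟩⟩ := exists_reparam hn h h1
    · rcases (seqGraph_adj_left hn h).1 h2 with rfl | rfl
      · exact ⟨k, Or.inl ⟨rfl, rfl, by rw [add_assoc]; rfl⟩⟩
      · exact absurd (by rw [add_sub_cancel_right]) h3
    · rcases (seqGraph_adj_left hn h).1 h2 with rfl | rfl
      · exact absurd (by rw [sub_add_cancel]) h3
      · exact ⟨k, Or.inr ⟨rfl, rfl, by rw [sub_sub]; rfl⟩⟩
  · rintro ⟨k, ⟨rfl, rfl, rfl⟩ | ⟨rfl, rfl, rfl⟩⟩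
    · refine ⟨(seqGraph_adj_left hn h).2 (Or.inl rfl), (seqGraph_adj_left hn h).2 (Or.inl ?_),
        h.ne hn k (by omega) (by omega)⟩
      rw [add_assoc]; rfl
    · refine ⟨(seqGraph_adj_left hn h).2 (Or.inr rfl), (seqGraph_adj_left hn h).2 (Or.inr ?_), ?_⟩
      · rw [sub_sub]; rfl
      · have := h.ne hn (k - 2) (d := 2) (by omega) (by omega)
        rw [sub_add_cancel] at this
        exact this.symm

/-- The cycles traced out by the threads of `Δ`. -/
def threadCycles (Δ : Set (Fin 4 → W)) : Set (SimpleGraph W) :=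
  {C | ∃ q, IsThread Δ q ∧ C = seqGraph q}

namespace ExtendsUniquely

/-- The arcs of length two on the cycle traced out by a thread begin a reparametrization of it. -/
theorem exists_thread_of_arc (h : ExtendsUniquely X G Δ) {n : ℕ} (hn : 3 ≤ n) {q : ℤ → W}
    (hq : IsThread Δ q) (hp : HasPeriod n q) {a b c : W} (ha : ![a, b, c] ∈ arcs (seqGraph q) 2) :
    ∃ q', IsThread Δ q' ∧ seqGraph q' = seqGraph q ∧ q' 0 = a ∧ q' 1 = b ∧ q' 2 = c ∧
      ∃ k, (q' = fun i => q (k + i)) ∨ q' = fun i => q (k - i) := by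
  obtain ⟨k, ⟨rfl, rfl, rfl⟩ | ⟨rfl, rfl, rfl⟩⟩ := (arc_two_seqGraph hn hp).1 ha
  · exact ⟨_, hq.shift k, seqGraph_shift q k, by simp, by simp, by simp, k, Or.inl rfl⟩
  · exact ⟨_, h.reverse hq k, seqGraph_reverse q k, by simp, by simp, by simp, k, Or.inr rfl⟩

theorem arc_of_thread {n : ℕ} (hn : 3 ≤ n) {q : ℤ → W} (hp : HasPeriod n q) :
    ![q 0, q 1, q 2] ∈ arcs (seqGraph q) 2 :=
  (arc_two_seqGraph hn hp).2 ⟨0, Or.inl ⟨rfl, by simp, by simp⟩⟩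

/-- A 2-arc on such a cycle begins a thread tracing the cycle, and the 2-arc determines that thread.
-/
theorem cycle_unique (h : ExtendsUniquely X G Δ) {n : ℕ} (hn : 3 ≤ n)
    (hper : ∀ q, IsThread Δ q → HasPeriod n q) {a b c : W} {C C' : SimpleGraph W}
    (hC : C ∈ threadCycles Δ) (hC' : C' ∈ threadCycles Δ) (ha : ![a, b, c] ∈ arcs C 2)
    (ha' : ![a, b, c] ∈ arcs C' 2) : C = C' := by
  obtain ⟨q, hq, rfl⟩ := hC
  obtain ⟨q', hq', rfl⟩ := hC'
  obtain ⟨r, hr, e, r0, r1, r2, -⟩ := h.exists_thread_of_arc hn hq (hper q hq) ha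
  obtain ⟨r', hr', e', r0', r1', r2', -⟩ := h.exists_thread_of_arc hn hq' (hper q' hq') ha'
  rw [← e, ← e', h.thread_ext hr hr' (r0.trans r0'.symm) (r1.trans r1'.symm) (r2.trans r2'.symm)]

theorem seqGraph_le (h : ExtendsUniquely X G Δ) {q : ℤ → W} (hq : IsThread Δ q) :
    seqGraph q ≤ G := by
  intro x y hxy
  rw [seqGraph, SimpleGraph.fromRel_adj] at hxy
  obtain ⟨-, ⟨i, rfl, rfl⟩ | ⟨i, rfl, rfl⟩⟩ := hxy
  exacts [h.thread_adj hq i, (h.thread_adj hq i).symm]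

theorem isCycleOf (h : ExtendsUniquely X G Δ) {n : ℕ} (hn : 3 ≤ n) {q : ℤ → W}
    (hq : IsThread Δ q) (hp : HasPeriod n q) : IsCycleOf G n (seqGraph q) :=
  ⟨hn, h.seqGraph_le hq, _, seqGraph_eq_map hn hp⟩

theorem threadCycles_eq_orbit (h : ExtendsUniquely X G Δ) {q : ℤ → W} (hq : IsThread Δ q) :
    threadCycles Δ = {C | ∃ g : X, C = translate g (seqGraph q)} := by
  ext C
  constructor
  · rintro ⟨q', hq', rfl⟩
    obtain ⟨g, hg⟩ := h.exists_smul_thread hq hq'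
    exact ⟨g, by rw [translate_seqGraph]; exact congrArg _ (funext fun i => (hg i).symm)⟩
  · rintro ⟨g, rfl⟩
    exact ⟨_, h.smul_thread hq g, translate_seqGraph g q⟩

theorem eq_iUnion_arcs (h : ExtendsUniquely X G Δ) {n : ℕ} (hn : 3 ≤ n)
    (hper : ∀ q, IsThread Δ q → HasPeriod n q) : Δ = ⋃ C ∈ threadCycles Δ, arcs C 3 := by
  ext α
  rw [vec_four_eta α]
  simp only [Set.mem_iUnion, exists_prop]
  constructor
  · intro hα
    obtain ⟨h1, h2, h3, h4, h5⟩ := h.adj hα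
    obtain ⟨q, hq, h0, h1, h2, -⟩ := h.exists_thread h1 h2 h4
    refine ⟨_, ⟨q, hq, rfl⟩, ?_⟩
    have hq0 := hq 0
    simp only [zero_add] at hq0
    rw [← h0, ← h1, ← h2] at hα ⊢
    rw [h.unique hα hq0, mem_arcs_three]
    have hp := hper q hq
    obtain ⟨a1, a2, a3⟩ := mem_arcs_two.1 (arc_of_thread hn hp)
    exact ⟨a1, a2, (seqGraph_adj_left hn hp).2 (Or.inl (by norm_num)), a3,
      by simpa using hp.ne hn 1 (d := 2) (by omega) (by omega)⟩
  · rintro ⟨C, ⟨q, hq, rfl⟩, hα⟩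
    obtain ⟨h1, h2, h3, h4, h5⟩ := mem_arcs_three.1 hα
    obtain ⟨q', hq', e, h0, h1, h2, -⟩ := h.exists_thread_of_arc hn hq (hper q hq)
      (mem_arcs_two.2 ⟨h1, h2, h4⟩)
    rw [← e, ← h2, seqGraph_adj_left hn (hper q' hq')] at h3
    have hd : α 3 = q' 3 := by
      rcases h3 with h3 | h3
      · rw [h3]; norm_num
      · rw [← h1, h3] at h5
        norm_num at h5
    rw [← h0, ← h1, ← h2, hd]
    simpa using hq' 0

end ExtendsUniquely

end Cycles

/-! ### The dihedral groups of the cycles -/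

section Dihedral

/-- The natural action of the dihedral group on `ZMod n`. -/
def dihedralPerm (n : ℕ) : DihedralGroup n →* Equiv.Perm (ZMod n) where
  toFun
    | .r k => Equiv.addLeft k
    -- The map is x ↦ -k - x; the sign agrees with the rule `sr i * r j = sr (i + j)`.
    | .sr k => Equiv.subLeft (-k)
  map_one' := by
    ext x
    exact zero_add x
  map_mul' := by
    rintro (i | i) (j | j) <;> ext x <;>
      simp [DihedralGroup.r_mul_r, DihedralGroup.r_mul_sr, DihedralGroup.sr_mul_r,
        DihedralGroup.sr_mul_sr] <;> ring

/-- A reflection acting trivially would fix 0 and 1, which gives 2 = 0 in `ZMod n`; this fails for n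
≥ 3. -/
theorem dihedralPerm_injective {n : ℕ} (hn : 3 ≤ n) : Function.Injective (dihedralPerm n) := by
  have h2 : (1 : ZMod n) + 1 ≠ 0 := by
    intro h
    have : ((2 : ℕ) : ZMod n) = 0 := by push_cast; rw [← h]; norm_num
    rw [ZMod.natCast_eq_zero_iff] at this
    exact absurd (Nat.le_of_dvd (by norm_num) this) (by omega)
  rw [injective_iff_map_eq_one]
  rintro (k | k) h
  · have := Equiv.congr_fun h 0
    have h0 : k + 0 = 0 := this
    rw [add_zero] at h0
    rw [h0]; rfl
  · have e0 : -k - 0 = 0 := Equiv.congr_fun h 0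
    have e1 : -k - 1 = 1 := Equiv.congr_fun h 1
    refine absurd ?_ h2
    rw [sub_zero] at e0
    rw [e0, zero_sub] at e1
    rw [← e1]; nth_rewrite 2 [e1]; ring

variable {X W : Type*} [Group X] [MulAction X W] {G : SimpleGraph W} {Δ : Set (Fin 4 → W)}

theorem HasPeriod.exists_equiv {n : ℕ} (hn : 3 ≤ n) {q : ℤ → W} (h : HasPeriod n q) :
    ∃ e : ZMod n ≃ (seqGraph q).support, ∀ i : ℤ, (e i : W) = q i := by
  have key : ∀ i : ℤ, q (((i : ZMod n).cast : ℤ)) = q i := fun i => h.eq (by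
    rw [← ZMod.intCast_eq_intCast_iff_dvd_sub, ZMod.intCast_zmod_cast])
  refine ⟨Equiv.ofBijective (fun z => ⟨q z.cast, (mem_support_seqGraph hn h).2 ⟨_, rfl⟩⟩) ⟨?_, ?_⟩,
    fun i => key i⟩
  · intro z z' hz
    have hz' := (h _ _).1 (congrArg Subtype.val hz)
    rw [← ZMod.intCast_eq_intCast_iff_dvd_sub, ZMod.intCast_zmod_cast,
      ZMod.intCast_zmod_cast] at hz'
    exact hz'.symm
  · rintro ⟨x, hx⟩
    obtain ⟨i, rfl⟩ := (mem_support_seqGraph hn h).1 hx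
    exact ⟨i, Subtype.ext (key i)⟩

/-- Shifts and reversals of a thread are threads and any two threads are conjugate, so every
dihedral symmetry of the cycle is induced by X. Conversely an element preserving the cycle maps the
thread to a thread on the same cycle, which is a shift or a reversal. -/
theorem ExtendsUniquely.nonempty_dihedral (h : ExtendsUniquely X G Δ) {n : ℕ} (hn : 3 ≤ n)
    {q : ℤ → W} (hq : IsThread Δ q) (hp : HasPeriod n q) :
    Nonempty (inducedPerm (graphStabilizer X (seqGraph q)) (seqGraph q).support ≃*
      DihedralGroup n) := by
  obtain ⟨e, he⟩ := hp.exists_equiv hn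
  have hr : ∀ (k : ZMod n) (i : ℤ), dihedralPerm n (.r k) i = k + i := fun _ _ => rfl
  have hs : ∀ (k : ZMod n) (i : ℤ), dihedralPerm n (.sr k) i = -k - i := fun _ _ => rfl
  let φ : DihedralGroup n →* Equiv.Perm (seqGraph q).support :=
    e.permCongrHom.toMonoidHom.comp (dihedralPerm n)
  have hφ : ∀ (d : DihedralGroup n) (i : ℤ) (l : ℤ), dihedralPerm n d i = l →
      (φ d (e i) : W) = q l := by
    intro d i l hl
    have : φ d (e i) = e (dihedralPerm n d (e.symm (e i))) := rfl
    rw [this, e.symm_apply_apply, hl, he]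
  have hinj : Function.Injective φ :=
    e.permCongrHom.injective.comp (dihedralPerm_injective hn)
  have hext : ∀ (π : Equiv.Perm (seqGraph q).support) (d : DihedralGroup n),
      (∀ i : ℤ, (π (e i) : W) = φ d (e i)) → π = φ d := by
    intro π d hd
    ext x
    obtain ⟨z, rfl⟩ := e.surjective x
    obtain ⟨i, rfl⟩ := ZMod.intCast_surjective z
    exact hd i
  have hrange : φ.range = inducedPerm (graphStabilizer X (seqGraph q)) (seqGraph q).support := by
    ext π
    constructor
    · rintro ⟨d, rfl⟩
      obtain ⟨q', hq', hgr, hd⟩ : ∃ q', IsThread Δ q' ∧ seqGraph q' = seqGraph q ∧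
          ∀ i : ℤ, (φ d (e i) : W) = q' i := by
        rcases d with k | k
        · obtain ⟨k, rfl⟩ := ZMod.intCast_surjective k
          exact ⟨_, hq.shift k, seqGraph_shift q k, fun i => hφ _ _ _ (by rw [hr]; push_cast; rfl)⟩
        · obtain ⟨k, rfl⟩ := ZMod.intCast_surjective k
          exact ⟨_, h.reverse hq (-k), seqGraph_reverse q (-k),
            fun i => hφ _ _ _ (by rw [hs]; push_cast; rfl)⟩
      obtain ⟨g, hg⟩ := h.exists_smul_thread hq hq'
      refine ⟨g, mem_graphStabilizer_iff.2 ?_, fun x => ?_⟩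
      · rw [translate_seqGraph, ← hgr]
        exact congrArg _ (funext hg)
      · obtain ⟨z, rfl⟩ := e.surjective x
        obtain ⟨i, rfl⟩ := ZMod.intCast_surjective z
        rw [hd, he, hg]
    · rintro ⟨g, hg, hπ⟩
      have hgq := h.smul_thread hq g
      rw [mem_graphStabilizer_iff, translate_seqGraph] at hg
      have ha := ExtendsUniquely.arc_of_thread hn (q := fun i => g • q i) (fun i j => by
        rw [smul_left_cancel_iff]; exact hp i j)
      rw [hg] at ha
      obtain ⟨q', hq', -, h0, h1, h2, k, hk⟩ := h.exists_thread_of_arc hn hq hp ha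
      have hqq := h.thread_ext hq' hgq h0 h1 h2
      rcases hk with rfl | rfl
      · refine ⟨.r k, (hext _ _ fun i => ?_).symm⟩
        rw [hφ _ _ (k + i) (by rw [hr]; push_cast; rfl), hπ, he]
        exact (congrFun hqq i).symm
      · refine ⟨.sr (-k : ℤ), (hext _ _ fun i => ?_).symm⟩
        rw [hφ _ _ (k - i) (by rw [hs]; push_cast; ring), hπ, he]
        exact (congrFun hqq i).symm
  exact ⟨((MonoidHom.ofInjective hinj).trans (MulEquiv.subgroupCongr hrange)).symm⟩

end Dihedral

/-! ### Counting -/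

section Counting

variable {X W : Type*} [Group X] [MulAction X W] {G : SimpleGraph W} {Δ : Set (Fin 4 → W)}

/-- Each vertex is the middle of one 2-path for each of the six pairs of its neighbours. -/
theorem card_path2 [Finite W] (hval : HasValency G 4) : Nat.card (Path2 G) = 6 * Nat.card W := by
  classical
  have := Fintype.ofFinite W
  let F : W → Set (Sym2 W) := fun w => {z | ¬ z.IsDiag ∧ ∀ x ∈ z, G.Adj w x}
  have e : Path2 G ≃ Σ w : W, F w :=
    { toFun := fun p => ⟨p.1.1, p.1.2, p.2⟩
      invFun := fun p => ⟨(p.1, p.2.1), p.2.2⟩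
      left_inv := fun _ => rfl
      right_inv := fun _ => rfl }
  rw [Nat.card_congr e, Nat.card_sigma]
  have hF : ∀ w, Nat.card (F w) = 6 := by
    intro w
    have h1 : F w = ((G.neighborSet w).toFinset.offDiag.image Sym2.mk.uncurry : Finset (Sym2 W)) := by
      ext z
      induction z using Sym2.ind with
      | _ x y =>
      simp only [F, Set.mem_ofPred_eq, Sym2.mk_isDiag_iff, Sym2.mem_iff, forall_eq_or_imp, forall_eq,
        Finset.coe_image, Set.mem_image, Finset.mem_coe, Finset.mem_offDiag, Set.mem_toFinset,
        SimpleGraph.mem_neighborSet, Prod.exists, Function.uncurry_apply_pair, Sym2.eq_iff]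
      constructor
      · rintro ⟨h1, h2, h3⟩
        exact ⟨x, y, ⟨h2, h3, h1⟩, Or.inl ⟨rfl, rfl⟩⟩
      · rintro ⟨a, b, ⟨h1, h2, h3⟩, ⟨rfl, rfl⟩ | ⟨rfl, rfl⟩⟩
        exacts [⟨h3, h1, h2⟩, ⟨fun h => h3 h.symm, h2, h1⟩]
    rw [h1, Nat.card_coe_set_eq, Set.ncard_coe_finset, Sym2.card_image_offDiag,
      ← Set.ncard_eq_toFinset_card', hval w]
    rfl
  simp only [hF]
  simp [mul_comm]

theorem ncard_edgeSet [Finite W] (hval : HasValency G 4) : G.edgeSet.ncard = 2 * Nat.card W := by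
  classical
  have := Fintype.ofFinite W
  have h := G.sum_degrees_eq_twice_card_edges
  have hd : ∀ w, G.degree w = 4 := fun w => by
    rw [← hval w, Set.ncard_eq_toFinset_card', ← SimpleGraph.card_neighborFinset_eq_degree]
    rfl
  simp only [hd, Finset.sum_const, Finset.card_univ, smul_eq_mul] at h
  rw [Set.ncard_eq_toFinset_card', Nat.card_eq_fintype_card]
  have : G.edgeFinset.card = G.edgeSet.toFinset.card := rfl
  omega

/-- A connected `2`-arc-transitive graph of valency `4` with a triangle is `K₅`. -/
theorem complete_or_four_le_egirth [Finite W] (hc : G.Connected) (hval : HasValency G 4)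
    (hT : IsArcTransitive X G 2) :
    Nonempty (G ≃g (⊤ : SimpleGraph (Fin 5))) ∨ 4 ≤ G.egirth := by
  by_cases htri : ∃ a b c, G.Adj a b ∧ G.Adj b c ∧ G.Adj a c
  · left
    obtain ⟨a, b, c, hab, hbc, hac⟩ := htri
    -- All 2-arcs are conjugate to one that lies in a triangle, so the ends of every 2-arc are
    -- adjacent, and connectedness makes the graph complete.
    have h1 : ∀ x y z, G.Adj x y → G.Adj y z → x ≠ z → G.Adj x z := by
      intro x y z hxy hyz hxz
      obtain ⟨g, rfl, rfl, rfl⟩ := hT.exists_two hab hbc hac.ne hxy hyz hxz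
      exact (hT.1.1 g _ _).2 hac
    have h2 : ∀ x y, G.Reachable x y → x = y ∨ G.Adj x y := by
      rintro x y ⟨p⟩
      induction p with
      | nil => exact Or.inl rfl
      | cons hxy p ih =>
        rename_i x y z
        rcases ih with rfl | hyz
        · exact Or.inr hxy
        · by_cases hxz : x = z
          · exact Or.inl hxz
          · exact Or.inr (h1 _ _ _ hxy hyz hxz)
    have hG : ∀ x y, G.Adj x y ↔ x ≠ y := fun x y =>
      ⟨fun h => h.ne, fun hne => (h2 x y (hc.preconnected x y)).resolve_left hne⟩
    have hcard : Nat.card W = 5 := by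
      have h4 := hval a
      have : G.neighborSet a = {a}ᶜ := by
        ext x
        simp [hG, eq_comm]
      rw [this] at h4
      have := Set.ncard_add_ncard_compl ({a} : Set W)
      rw [Set.ncard_singleton, h4] at this
      omega
    refine ⟨⟨Finite.equivFinOfCardEq hcard, ?_⟩⟩
    intro x y
    simp [hG]
  · right
    rw [SimpleGraph.le_egirth]
    intro a w hw
    have h3 := hw.three_le_length
    by_contra hlt
    have hlen : w.length = 3 := by
      have : w.length < 4 := by
        by_contra hge
        exact hlt (by exact_mod_cast Nat.le_of_not_lt hge)
      omega
    refine htri ?_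
    match w, hlen with
    | .cons h1 (.cons h2 (.cons h3 .nil)), _ => exact ⟨_, _, _, h1, h2, h3.symm⟩

end Counting

/-! ### The decomposition into cycles -/

section Decomposition

variable {X W : Type*} [Group X] [MulAction X W] {G : SimpleGraph W} {Δ : Set (Fin 4 → W)}

namespace ExtendsUniquely

/-- The `2`-path of `G` in the middle of which a thread is at time `i`. -/
def threadPath (h : ExtendsUniquely X G Δ) {q : ℤ → W} (hq : IsThread Δ q) (i : ℤ) : Path2 G :=
  ⟨(q i, s(q (i - 1), q (i + 1))), by
    obtain ⟨h1, h2, -, h3, -⟩ := h.adj (hq (i - 1))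
    rw [sub_add_cancel] at h1 h2
    rw [show i - 1 + 2 = i + 1 by ring] at h2 h3
    refine ⟨h3, fun x hx => ?_⟩
    rcases Sym2.mem_iff.1 hx with rfl | rfl
    exacts [h1.symm, h2]⟩

theorem mem_arcs_of_threadPath (h : ExtendsUniquely X G Δ) {n : ℕ} (hn : 3 ≤ n) {q : ℤ → W}
    (hq : IsThread Δ q) (hp : HasPeriod n q) {i : ℤ} {a b c : W}
    (e : (h.threadPath hq i).1 = (b, s(a, c))) : ![a, b, c] ∈ arcs (seqGraph q) 2 := by
  rw [arc_two_seqGraph hn hp]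
  obtain ⟨rfl, e2⟩ := Prod.ext_iff.1 e
  have e3 : s(q (i - 1), q (i + 1)) = s(a, c) := e2
  rcases Sym2.eq_iff.1 e3 with ⟨rfl, rfl⟩ | ⟨rfl, rfl⟩
  · exact ⟨i - 1, Or.inl ⟨rfl, by rw [sub_add_cancel]; rfl, by congr 1; ring⟩⟩
  · exact ⟨i + 1, Or.inr ⟨rfl, by rw [add_sub_cancel_right]; rfl, by congr 1; ring⟩⟩

/-- The graph on the `2`-paths is the disjoint union of the cycles. -/
theorem exists_cycles_iso [Finite W] (h : ExtendsUniquely X G Δ) {n : ℕ} (hn : 3 ≤ n)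
    (hper : ∀ q, IsThread Δ q → HasPeriod n q) :
    Nonempty (gimelGraph G Δ ≃g
      copies (threadCycles Δ).ncard (SimpleGraph.cycleGraph n)) := by
  classical
  have hfin : Finite (SimpleGraph W) := by
    have := Fintype.ofFinite W
    exact Finite.of_injective (fun G : SimpleGraph W => G.Adj) fun a b h => SimpleGraph.ext h
  let m := (threadCycles Δ).ncard
  obtain e : Fin m ≃ threadCycles Δ :=
    (Finite.equivFinOfCardEq (Nat.card_coe_set_eq (threadCycles Δ))).symm
  choose q hq hqe using fun j : Fin m => (e j).2
  have hp : ∀ j, HasPeriod n (q j) := fun j => hper _ (hq j)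
  have huniq : ∀ (j j' : Fin m) (a b c : W), ![a, b, c] ∈ arcs (seqGraph (q j)) 2 →
      ![a, b, c] ∈ arcs (seqGraph (q j')) 2 → j = j' := by
    intro j j' a b c h1 h2
    apply e.injective
    apply Subtype.ext
    rw [hqe, hqe]
    exact h.cycle_unique hn hper ⟨_, hq j, rfl⟩ ⟨_, hq j', rfl⟩ h1 h2
  -- Every 2-path occurs on exactly one cycle and at exactly one position there, so 2-paths are
  -- pairs of a cycle and a position.
  let f : Fin m × Fin n → Path2 G := fun p => h.threadPath (hq p.1) p.2
  have hf1 : ∀ p, (f p).1 = (q p.1 p.2, s(q p.1 (p.2 - 1), q p.1 (p.2 + 1))) := fun p => rfl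
  have hinj : Function.Injective f := by
    rintro ⟨j, i⟩ ⟨j', i'⟩ hij
    have e1 : (h.threadPath (hq j) i).1 = (h.threadPath (hq j') i').1 := congrArg Subtype.val hij
    have hj : j = j' := huniq _ _ _ _ _ (h.mem_arcs_of_threadPath hn (hq j) (hp j) rfl)
      (h.mem_arcs_of_threadPath hn (hq j') (hp j') e1.symm)
    subst hj
    have : i = i' := (hp j).injective (congrArg Prod.fst e1)
    rw [this]
  have hthr : ∀ a b c, G.Adj a b → G.Adj b c → a ≠ c →
      ∃ j, ![a, b, c] ∈ arcs (seqGraph (q j)) 2 := by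
    intro a b c h1 h2 h3
    obtain ⟨q', hq', rfl, rfl, rfl, -⟩ := h.exists_thread h1 h2 h3
    obtain ⟨j, hj⟩ := e.surjective ⟨_, q', hq', rfl⟩
    refine ⟨j, ?_⟩
    rw [← hqe, hj]
    exact arc_of_thread hn (hper q' hq')
  have hsurj : Function.Surjective f := by
    rintro ⟨⟨b, z⟩, hz⟩
    induction z using Sym2.ind with
    | _ a c =>
    obtain ⟨hd, had⟩ := hz
    obtain ⟨j, hj⟩ := hthr a b c (had a (Sym2.mem_mk_left a c)).symm (had c (Sym2.mem_mk_right a c))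
      hd
    obtain ⟨k, hk⟩ : ∃ k, q j k = b ∧ s(q j (k - 1), q j (k + 1)) = s(a, c) := by
      obtain ⟨k, ⟨rfl, rfl, rfl⟩ | ⟨rfl, rfl, rfl⟩⟩ := (arc_two_seqGraph hn (hp j)).1 hj
      · exact ⟨k + 1, rfl, by rw [add_sub_cancel_right, add_assoc]; rfl⟩
      · exact ⟨k - 1, rfl, by rw [sub_add_cancel, sub_sub, Sym2.eq_swap]; rfl⟩
    obtain ⟨rfl, hk2⟩ := hk
    obtain ⟨i, hi⟩ := exists_fin_dvd_sub hn k
    refine ⟨(j, i), Subtype.ext ?_⟩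
    change (f (j, i)).1 = (q j k, s(a, c))
    rw [hf1, ← hk2]
    have e1 : q j k = q j i := (hp j).eq hi
    have e2 : q j (k - 1) = q j (i - 1) := (hp j).eq (by rwa [sub_sub_sub_cancel_right])
    have e3 : q j (k + 1) = q j (i + 1) := (hp j).eq (by rwa [add_sub_add_right_eq_sub])
    rw [e1, e2, e3]
  have hstep : ∀ (j : Fin m) (i i' : Fin n), q j i' = q j (i + 1) →
      ∃ α ∈ Δ, (f (j, i)).1 = (α 1, s(α 0, α 2)) ∧ (f (j, i')).1 = (α 2, s(α 1, α 3)) := by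
    intro j i i' hi
    refine ⟨_, hq j (i - 1), ?_⟩
    simp only [hf1]
    have hi2 := ((hp j) _ _).1 hi
    have e2 : q j (i' - 1) = q j i := (hp j).eq (by
      rwa [show (i' : ℤ) - 1 - i = i' - (i + 1) by ring])
    have e3 : q j (i' + 1) = q j (i + 2) := (hp j).eq (by
      rwa [show (i' : ℤ) + 1 - (i + 2) = i' - (i + 1) by ring])
    rw [e2, e3, hi]
    have s1 : (i : ℤ) - 1 + 1 = i := by ring
    have s2 : (i : ℤ) - 1 + 2 = i + 1 := by ring
    have s3 : (i : ℤ) - 1 + 3 = i + 2 := by ring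
    rw [s1, s2, s3]
    exact ⟨rfl, rfl⟩
  have hback : ∀ p p', (∃ α ∈ Δ, (f p).1 = (α 1, s(α 0, α 2)) ∧ (f p').1 = (α 2, s(α 1, α 3))) →
      p.1 = p'.1 ∧ (SimpleGraph.cycleGraph n).Adj p.2 p'.2 := by
    rintro ⟨j, i⟩ ⟨j', i'⟩ ⟨α, hα, h1, h2⟩
    have hα' := hα
    rw [h.eq_iUnion_arcs hn hper] at hα'
    simp only [Set.mem_iUnion, exists_prop] at hα'
    obtain ⟨C, hC, hαC⟩ := hα'
    obtain ⟨j₀, hj₀⟩ := e.surjective ⟨C, hC⟩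
    have hCq : C = seqGraph (q j₀) := by rw [← hqe, hj₀]
    rw [hCq, vec_four_eta α] at hαC
    obtain ⟨a1, a2, a3, a4, a5⟩ := mem_arcs_three.1 hαC
    have hj : j = j₀ := huniq _ _ _ _ _ (h.mem_arcs_of_threadPath hn (hq j) (hp j) h1)
      (mem_arcs_two.2 ⟨a1, a2, a4⟩)
    have hj' : j' = j₀ := huniq _ _ _ _ _ (h.mem_arcs_of_threadPath hn (hq j') (hp j') h2)
      (mem_arcs_two.2 ⟨a2, a3, a5⟩)
    subst hj
    subst hj'
    refine ⟨rfl, ?_⟩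
    rw [(hp j').cycleGraph_adj hn]
    have e1 : q j' i = α 1 := congrArg Prod.fst h1
    have e2 : q j' i' = α 2 := congrArg Prod.fst h2
    change (seqGraph (q j')).Adj (q j' i) (q j' i')
    rw [e1, e2]
    exact a2
  refine ⟨(⟨Equiv.ofBijective f ⟨hinj, hsurj⟩, ?_⟩ : copies m _ ≃g gimelGraph G Δ).symm⟩
  intro p p'
  change (gimelGraph G Δ).Adj (f p) (f p') ↔ _
  rw [gimelGraph, SimpleGraph.fromRel_adj]
  constructor
  · rintro ⟨-, hh | hh⟩
    · exact hback _ _ hh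
    · obtain ⟨h1, h2⟩ := hback _ _ hh
      exact ⟨h1.symm, h2.symm⟩
  · rintro ⟨h1, h2⟩
    obtain ⟨j, i⟩ := p
    obtain ⟨j', i'⟩ := p'
    obtain rfl : j = j' := h1
    refine ⟨fun heq => h2.ne (congrArg Prod.snd (hinj heq)), ?_⟩
    have h3 := ((hp j).cycleGraph_adj hn i i').1 h2
    rcases (seqGraph_adj_left hn (hp j)).1 h3 with h4 | h4
    · exact Or.inl (hstep j i i' h4)
    · refine Or.inr (hstep j i' i ?_)
      rw [hp] at h4 ⊢
      rw [← dvd_neg] at h4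
      rwa [show (i : ℤ) - (i' + 1) = -(i' - (i - 1)) by ring]

/-- The cycles share out the 2-paths, n to each cycle, so m n = 6 |V|; since a cycle has n ≤ |V|
vertices, m ≥ 6. -/
theorem exists_isCycleDecomposition [Finite W] (h : ExtendsUniquely X G Δ) (hc : G.Connected)
    (hval : HasValency G 4) : ∃ ℰ m n, IsCycleDecomposition X G Δ ℰ m n ∧
      Nonempty (gimelGraph G Δ ≃g copies m (SimpleGraph.cycleGraph n)) := by
  obtain ⟨b⟩ := hc.nonempty
  obtain ⟨a, c, ha, hcc, hac⟩ : ∃ a c, G.Adj b a ∧ G.Adj b c ∧ a ≠ c := by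
    obtain ⟨a, ha⟩ : (G.neighborSet b).Nonempty :=
      Set.nonempty_of_ncard_ne_zero (by rw [hval b]; norm_num)
    obtain ⟨c, hc1, hc2⟩ := Set.exists_ne_of_one_lt_ncard
      (show 1 < (G.neighborSet b).ncard by rw [hval b]; norm_num) a
    exact ⟨a, c, ha, hc1, hc2.symm⟩
  obtain ⟨n, hn, hper⟩ := h.exists_period ha.symm hcc hac
  obtain ⟨q, hq, -⟩ := h.exists_thread ha.symm hcc hac
  have hp := hper q hq
  obtain ⟨φ⟩ := h.exists_cycles_iso hn hper
  have hmn : (threadCycles Δ).ncard * n = 6 * Nat.card W := by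
    rw [← card_path2 hval, Nat.card_congr φ.toEquiv]
    simp
  have hnW : n ≤ Nat.card W := by
    have := Nat.card_le_card_of_injective _ hp.injective
    simpa using this
  refine ⟨threadCycles Δ, (threadCycles Δ).ncard, n, ⟨⟨_, h.isCycleOf hn hq hp,
    h.threadCycles_eq_orbit hq⟩, rfl, h.eq_iUnion_arcs hn hper, ?_, ?_, ?_, ?_, ?_, ?_⟩, ⟨φ⟩⟩
  · rintro C ⟨q', hq', rfl⟩
    exact h.nonempty_dihedral hn hq' (hper _ hq')
  · have : 6 * n ≤ (threadCycles Δ).ncard * n := by omega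
    exact Nat.le_of_mul_le_mul_right this (by omega)
  · have hcont : (SimpleGraph.cycleGraph n).IsContained G := by
      refine ⟨⟨⟨fun i => q i, ?_⟩, hp.injective⟩⟩
      intro i j hij
      exact h.seqGraph_le hq ((hp.cycleGraph_adj hn i j).1 hij)
    obtain ⟨v, p, hpc, rfl⟩ := (SimpleGraph.cycleGraph_isContained_iff (by omega)).1 hcont
    exact SimpleGraph.egirth_le_length hpc
  · rw [hmn, ncard_edgeSet hval]; ring
  · rw [ncard_edgeSet hval]; ring
  · refine (complete_or_four_le_egirth hc hval h.trans).imp_right fun h4 => ⟨hc, h4, ?_, ?_⟩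
    · rintro C ⟨q', hq', rfl⟩
      exact h.isCycleOf hn hq' (hper q' hq')
    · intro α hα
      rw [vec_three_eta α] at hα ⊢
      obtain ⟨h1, h2, h3⟩ := mem_arcs_two.1 hα
      obtain ⟨q', hq', h1', h2', h3', -⟩ := h.exists_thread h1 h2 h3
      have h4 := arc_of_thread hn (hper q' hq')
      rw [h1', h2', h3'] at h4
      exact ⟨_, ⟨⟨q', hq', rfl⟩, h4⟩, fun C hC =>
        h.cycle_unique hn hper hC.1 ⟨q', hq', rfl⟩ hC.2 h4⟩

end ExtendsUniquely

end Decomposition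

/-! ### Vertex stabilizers -/

section Stabilizer

variable {X W : Type*} [Group X] [MulAction X W] {G : SimpleGraph W} {Δ : Set (Fin 4 → W)}

theorem HasValency.ncard_sdiff {d : ℕ} (hv : HasValency G (d + 1)) {u w : W} (h : G.Adj u w) :
    (G.neighborSet u \ {w}).ncard = d := by
  have hw : w ∈ G.neighborSet u := h
  rw [Set.ncard_sdiff_singleton_of_mem hw, hv u, Nat.add_sub_cancel]

/-- An element fixing a vertex of valency four and three of its neighbours fixes the fourth. -/
theorem HasValency.fixes_of_fixes_three [Finite W] (hv : HasValency G 4)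
    (hG : ∀ (g : X) (u w : W), G.Adj (g • u) (g • w) ↔ G.Adj u w) {g : X} {τ x y z : W}
    (hτ : g • τ = τ) (hx : G.Adj τ x) (hy : G.Adj τ y) (hz : G.Adj τ z) (hxy : x ≠ y) (hxz : x ≠ z)
    (hyz : y ≠ z) (gx : g • x = x) (gy : g • y = y) (gz : g • z = z) (w : W) (hw : G.Adj τ w) :
    g • w = w := by
  by_contra hne
  have hsub : ({x, y, z} : Set W) ⊆ G.neighborSet τ \ {w} := by
    rintro a (rfl | rfl | rfl)
    · exact ⟨hx, by rintro rfl; exact hne gx⟩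
    · exact ⟨hy, by rintro rfl; exact hne gy⟩
    · exact ⟨hz, by rintro rfl; exact hne gz⟩
  have hcard : ({x, y, z} : Set W).ncard = 3 := Set.ncard_eq_three.2 ⟨_, _, _, hxy, hxz, hyz, rfl⟩
  have heq := Set.eq_of_subset_of_ncard_le hsub (by rw [hcard, hv.ncard_sdiff hw])
  have hgw : g • w ∈ G.neighborSet τ \ {w} := by
    refine ⟨?_, hne⟩
    have := (hG g τ w).2 hw
    rwa [hτ] at this
  rw [← heq] at hgw
  have hcancel : ∀ a, g • a = a → g • w = a → False := by
    intro a ha hwa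
    have : w = a := MulAction.injective g (hwa.trans ha.symm)
    exact hne (by rw [this, ha])
  rcases hgw with h1 | h1 | h1
  exacts [hcancel _ gx h1, hcancel _ gy h1, hcancel _ gz h1]

namespace ExtendsUniquely

/-- An element fixing a vertex and all its neighbours is trivial. -/
theorem eq_one_of_fixes (h : ExtendsUniquely X G Δ) [FaithfulSMul X W] (hc : G.Connected)
    {g : X} {τ : W} (hτ : g • τ = τ) (hN : ∀ x, G.Adj τ x → g • x = x) : g = 1 := by
  have key : ∀ x y, G.Reachable x y → (g • x = x ∧ ∀ z, G.Adj x z → g • z = z) →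
      g • y = y ∧ ∀ z, G.Adj y z → g • z = z := by
    rintro x y ⟨p⟩
    induction p with
    | nil => exact id
    | cons hxy p ih =>
      rename_i x y z
      rintro ⟨h1, h3⟩
      refine ih ⟨h3 _ hxy, fun w hw => ?_⟩
      by_cases hwx : w = x
      · rw [hwx, h1]
      -- In the reversed 3-arc (ρ, x, y, w) the first three vertices are fixed, so uniqueness of the
      -- extension fixes w.
      · obtain ⟨ρ, hρ⟩ := h.exists_ext hw.symm hxy.symm hwx
        have hρ' := h.rev hρ
        have h4 := h.smul g hρ'
        rw [h1, h3 _ hxy, h3 _ (h.adj hρ').1.symm] at h4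
        exact h.unique h4 hρ'
  refine FaithfulSMul.eq_of_smul_eq_smul (α := W) fun w => ?_
  rw [one_smul]
  exact (key τ w (hc.preconnected τ w) ⟨hτ, hN⟩).1

/-- The stabilizer acts faithfully on the four neighbours by `eq_one_of_fixes`, and 2-transitively,
so `degree_four_cases` applies to the stabilizer itself. -/
theorem stabilizer_cases [Finite W] (h : ExtendsUniquely X G Δ) [FaithfulSMul X W]
    (hc : G.Connected) (hval : HasValency G 4) (τ : W) :
    (Nonempty (MulAction.stabilizer X τ ≃* alternatingGroup (Fin 4)) ∧
      ∀ (g : X) (a c : W), g • τ = τ → G.Adj τ a → G.Adj τ c → a ≠ c → g • a = a → g • c = c →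
        g = 1) ∨
    (Nonempty (MulAction.stabilizer X τ ≃* Equiv.Perm (Fin 4)) ∧
      ∀ π : Equiv.Perm (G.neighborSet τ), ∃ g : X, g • τ = τ ∧ ∀ x, (π x : W) = g • (x : W)) := by
  have hmem := smul_mem_neighborSet h.trans.1.1 τ
  obtain ⟨e⟩ := nonempty_mulEquiv_inducedPerm (MulAction.stabilizer X τ) (G.neighborSet τ) hmem
    fun g hg hfix => h.eq_one_of_fixes hc hg hfix
  have hS : Nat.card (G.neighborSet τ) = 4 := by rw [Nat.card_coe_set_eq, hval τ]
  rcases degree_four_cases hS (twelve_le_card hS (h.trans.twoTransitive τ)) with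
    ⟨⟨f⟩, hfix⟩ | ⟨⟨f⟩, htop⟩
  · refine Or.inl ⟨⟨e.trans f⟩, fun g a c hg ha hcc hac hga hgc => ?_⟩
    have h1 := hfix (inducedHom _ _ hmem ⟨g, hg⟩) ⟨g, hg, fun _ => rfl⟩ ⟨a, ha⟩ ⟨c, hcc⟩
      (fun h => hac (congrArg Subtype.val h)) (Subtype.ext hga) (Subtype.ext hgc)
    refine h.eq_one_of_fixes hc hg fun x hx => ?_
    exact congrArg Subtype.val (Equiv.congr_fun h1 ⟨x, hx⟩)
  · refine Or.inr ⟨⟨e.trans f⟩, fun π => ?_⟩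
    have : π ∈ inducedPerm (MulAction.stabilizer X τ) (G.neighborSet τ) := by
      rw [htop]; exact Subgroup.mem_top π
    obtain ⟨g, hg, hπ⟩ := this
    exact ⟨g, hg, hπ⟩

theorem isSelfPairedArcOrbit (h : ExtendsUniquely X G Δ) {a b c : W} (hab : G.Adj a b)
    (hbc : G.Adj b c) (hac : a ≠ c) : IsSelfPairedArcOrbit X G Δ := by
  obtain ⟨d, hd⟩ := h.exists_ext hab hbc hac
  refine ⟨⟨_, mem_arcs_three.2 (h.adj hd), ?_⟩, fun α hα => ?_⟩
  · ext α
    constructor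
    · intro hα
      rw [vec_four_eta α] at hα ⊢
      obtain ⟨h1, h2, -, h3, -⟩ := h.adj hα
      obtain ⟨g, e1, e2, e3⟩ := h.trans.exists_two hab hbc hac h1 h2 h3
      refine ⟨g, ?_⟩
      change g • _ = _
      have h4 := h.smul g hd
      rw [e1, e2, e3] at h4
      rw [smul_vec_four, e1, e2, e3, h.unique h4 hα]
    · rintro ⟨g, rfl⟩
      change g • _ ∈ _
      rw [smul_vec_four]
      exact h.smul g hd
  · rw [vec_four_eta α] at hα ⊢
    rw [vec_four_rev]
    exact h.rev hα

/-- If `2`-arcs have trivial stabilizers, then the graph is `2`-arc-regular. -/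
theorem isArcRegular_two (hT : IsArcTransitive X G 2) {a b c : W} (hab : G.Adj b a)
    (hbc : G.Adj b c) (hac : a ≠ c)
    (h1 : ∀ (g : X) (a c : W), g • b = b → G.Adj b a → G.Adj b c → a ≠ c → g • a = a →
      g • c = c → g = 1) : IsArcRegular X G 2 := by
  refine hT.isArcRegular (mem_arcs_two.2 ⟨hab.symm, hbc, hac⟩) fun g hg => ?_
  rw [smul_vec_three, vec_three_inj] at hg
  exact h1 g a c hg.2.1 hab hbc hac hg.1 hg.2.2

end ExtendsUniquely

/-- A permutation with two prescribed values on distinct points, fixing whatever differs from these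
points and their images. -/
theorem exists_perm_two {S : Type*} {a b a' b' : S} (hab : a ≠ b) (hab' : a' ≠ b') :
    ∃ π : Equiv.Perm S, π a = a' ∧ π b = b' ∧
      ∀ z, z ≠ a → z ≠ a' → z ≠ b → z ≠ b' → π z = z := by
  classical
  have h1 : Equiv.swap a a' b ≠ a' := fun h => hab (by
    have := congrArg (Equiv.swap a a') h
    rw [Equiv.swap_apply_self, Equiv.swap_apply_right] at this
    exact this.symm)
  refine ⟨Equiv.swap (Equiv.swap a a' b) b' * Equiv.swap a a', ?_, ?_, fun z h2 h3 h4 h5 => ?_⟩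
  · rw [Equiv.Perm.mul_apply, Equiv.swap_apply_left, Equiv.swap_apply_of_ne_of_ne h1.symm hab']
  · rw [Equiv.Perm.mul_apply, Equiv.swap_apply_left]
  · rw [Equiv.Perm.mul_apply, Equiv.swap_apply_of_ne_of_ne h2 h3,
      Equiv.swap_apply_of_ne_of_ne ?_ h5]
    intro h6
    apply h4
    have := congrArg (Equiv.swap a a') h6
    rwa [Equiv.swap_apply_self, Equiv.swap_apply_of_ne_of_ne h2 h3] at this

end Stabilizer

namespace InvPartition

/-! ### Labelling flags by neighbouring blocks -/

variable {X V : Type*} [Group X] [MulAction X V] {P : InvPartition X V} {Γ : SimpleGraph V}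
  {ℓ : V → P.Block → P.Block}

/-- An equivariant map that attaches to a vertex `u` and a block `D` of `Γ_𝓑(u)` a neighbour of
the block of `u` other than `D`, and is injective on the vertices of a block that are adjacent
to `D`. -/
structure IsLabelling (P : InvPartition X V) (Γ : SimpleGraph V) (ℓ : V → P.Block → P.Block) :
    Prop where
  smul : ∀ (g : X) {u D}, D ∈ P.blocksAt Γ u → ℓ (g • u) (g • D) = g • ℓ u D
  adj : ∀ {u D}, D ∈ P.blocksAt Γ u → (P.quotientGraph Γ).Adj (P.blockOf u) (ℓ u D)
  ne : ∀ {u D}, D ∈ P.blocksAt Γ u → ℓ u D ≠ D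
  inj : ∀ {u u' D}, D ∈ P.blocksAt Γ u → D ∈ P.blocksAt Γ u' → P.blockOf u = P.blockOf u' →
    ℓ u D = ℓ u' D → u = u'

/-- The `3`-arcs of `Γ_𝓑` read off from the arcs of `Γ`. -/
def labelArcs (P : InvPartition X V) (Γ : SimpleGraph V) (ℓ : V → P.Block → P.Block) :
    Set (Fin 4 → P.Block) :=
  {α | ∃ u w, Γ.Adj u w ∧
    α = ![ℓ u (P.blockOf w), P.blockOf u, P.blockOf w, ℓ w (P.blockOf u)]}

theorem mem_blocksAt_left {u w : V} (huw : Γ.Adj u w) : P.blockOf w ∈ P.blocksAt Γ u :=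
  mem_blocksAt.2 ⟨w, rfl, huw⟩

theorem mem_blocksAt_right {u w : V} (huw : Γ.Adj u w) : P.blockOf u ∈ P.blocksAt Γ w :=
  mem_blocksAt.2 ⟨u, rfl, huw.symm⟩

namespace IsLabelling

/-- A vertex is recovered from its block, a block at it and its label, so no information about the
arcs of Γ is lost in the 3-arcs. -/
theorem adj_iff (L : P.IsLabelling Γ ℓ) {u w : V} (h1 : P.blockOf w ∈ P.blocksAt Γ u)
    (h2 : P.blockOf u ∈ P.blocksAt Γ w) : Γ.Adj u w ↔
      ![ℓ u (P.blockOf w), P.blockOf u, P.blockOf w, ℓ w (P.blockOf u)] ∈ P.labelArcs Γ ℓ := by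
  constructor
  · exact fun h => ⟨u, w, h, rfl⟩
  · rintro ⟨u', w', h, he⟩
    obtain ⟨e1, e2, e3, e4⟩ := vec_four_inj.1 he
    have hu : u = u' := L.inj h1 (by rw [e3]; exact mem_blocksAt_left h) e2 (by rw [e1, e3])
    have hw : w = w' := L.inj h2 (by rw [e2]; exact mem_blocksAt_right h) e3 (by rw [e4, e2])
    rwa [hu, hw]

theorem mem_arcs (L : P.IsLabelling Γ ℓ) (h : P.InG Γ) {α : Fin 4 → P.Block}
    (hα : α ∈ P.labelArcs Γ ℓ) : α ∈ arcs (P.quotientGraph Γ) 3 := by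
  obtain ⟨u, w, huw, rfl⟩ := hα
  exact mem_arcs_three.2 ⟨(L.adj (mem_blocksAt_left huw)).symm, h.quot_adj huw,
    L.adj (mem_blocksAt_right huw), L.ne (mem_blocksAt_left huw),
    (L.ne (mem_blocksAt_right huw)).symm⟩

theorem smul_arc (L : P.IsLabelling Γ ℓ) (g : X) {u w : V} (huw : Γ.Adj u w) :
    g • ![ℓ u (P.blockOf w), P.blockOf u, P.blockOf w, ℓ w (P.blockOf u)] =
      ![ℓ (g • u) (P.blockOf (g • w)), P.blockOf (g • u), P.blockOf (g • w),
        ℓ (g • w) (P.blockOf (g • u))] := by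
  rw [smul_vec_four, blockOf_smul, blockOf_smul, L.smul g (mem_blocksAt_left huw),
    L.smul g (mem_blocksAt_right huw)]

/-- The labelling is equivariant and Γ is symmetric, so the 3-arcs form one orbit; reversing an arc
of Γ reverses its 3-arc. -/
theorem isSelfPairedArcOrbit (L : P.IsLabelling Γ ℓ) (h : P.InG Γ) {u w : V} (huw : Γ.Adj u w) :
    IsSelfPairedArcOrbit X (P.quotientGraph Γ) (P.labelArcs Γ ℓ) := by
  refine ⟨⟨_, L.mem_arcs h ⟨u, w, huw, rfl⟩, ?_⟩, ?_⟩
  · ext α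
    constructor
    · rintro ⟨u', w', huw', rfl⟩
      obtain ⟨g, rfl, rfl⟩ := h.exists_arc _ _ _ _ huw huw'
      exact ⟨g, L.smul_arc g huw⟩
    · rintro ⟨g, rfl⟩
      exact ⟨g • u, g • w, (h.adj_smul g u w).2 huw, L.smul_arc g huw⟩
  · rintro α ⟨u', w', huw', rfl⟩
    rw [vec_four_rev]
    exact ⟨w', u', huw'.symm, rfl⟩

/-- An element fixing an arc of `Γ` fixes the labels. -/
theorem fixes_of_fixes (L : P.IsLabelling Γ ℓ) {u w : V} (huw : Γ.Adj u w) {g : X}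
    (hu : g • u = u) (hw : g • w = w) : g • P.blockOf u = P.blockOf u ∧
      g • P.blockOf w = P.blockOf w ∧ g • ℓ u (P.blockOf w) = ℓ u (P.blockOf w) ∧
      g • ℓ w (P.blockOf u) = ℓ w (P.blockOf u) := by
  have h1 : g • P.blockOf u = P.blockOf u := by rw [← blockOf_smul, hu]
  have h2 : g • P.blockOf w = P.blockOf w := by rw [← blockOf_smul, hw]
  have h3 := L.smul g (mem_blocksAt_left huw)
  have h4 := L.smul g (mem_blocksAt_right huw)
  rw [hu, h2] at h3
  rw [hw, h1] at h4
  exact ⟨h1, h2, h3.symm, h4.symm⟩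

/-- The arc-regularity of `Γ` when the `2`-arcs of `Γ_𝓑` have trivial stabilizers. -/
theorem isArcRegular_one (L : P.IsLabelling Γ ℓ) (h : P.InG Γ) {u w : V} (huw : Γ.Adj u w)
    (h1 : ∀ (g : X) (A D : P.Block), g • P.blockOf u = P.blockOf u →
      (P.quotientGraph Γ).Adj (P.blockOf u) A → (P.quotientGraph Γ).Adj (P.blockOf u) D → A ≠ D →
      g • A = A → g • D = D → g = 1) : IsArcRegular X Γ 1 := by
  refine h.symmetric.isArcRegular (mem_arcs_one.2 huw) fun g hg => ?_
  rw [smul_vec_two, vec_two_inj] at hg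
  obtain ⟨h2, h3, h4, -⟩ := L.fixes_of_fixes huw hg.1 hg.2
  exact h1 g _ _ h2 (L.adj (mem_blocksAt_left huw)) (h.quot_adj huw)
    (L.ne (mem_blocksAt_left huw)) h4 h3

variable [Finite V]

/-- The three vertices of the trace have distinct labels among the three neighbours of B other than
D, so every such neighbour is a label. -/
theorem exists_label (L : P.IsLabelling Γ ℓ)
    (hk : ∀ B C : P.Block, (P.quotientGraph Γ).Adj B C → (P.trace Γ B C).ncard = 3)
    (hb : HasValency (P.quotientGraph Γ) 4) {A B D : P.Block} (hA : (P.quotientGraph Γ).Adj B A)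
    (hD : (P.quotientGraph Γ).Adj B D) (hAD : A ≠ D) :
    ∃ u, P.blockOf u = B ∧ D ∈ P.blocksAt Γ u ∧ ℓ u D = A := by
  have h1 : ((fun u => ℓ u D) '' P.trace Γ B D).ncard = 3 := by
    rw [Set.InjOn.ncard_image, hk B D hD]
    rintro u hu u' hu' he
    exact L.inj hu.1 hu'.1 (hu.2.trans hu'.2.symm) he
  have h2 : (fun u => ℓ u D) '' P.trace Γ B D ⊆ (P.quotientGraph Γ).neighborSet B \ {D} := by
    rintro _ ⟨u, hu, rfl⟩
    have h3 := L.adj hu.1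
    rw [hu.2] at h3
    exact ⟨h3, L.ne hu.1⟩
  have h3 : ((P.quotientGraph Γ).neighborSet B \ {D}).ncard = 3 := by
    rw [hb.ncard_sdiff hD]
  have h4 := Set.eq_of_subset_of_ncard_le h2 (by rw [h1, h3])
  obtain ⟨u, hu, rfl⟩ : A ∈ (fun u => ℓ u D) '' P.trace Γ B D := by
    rw [h4]; exact ⟨hA, hAD⟩
  exact ⟨u, hu.2, hu.1, rfl⟩

/-- The 2-arc (A, B, D) determines a vertex u of B with a neighbour in D. The extensions are the
labels of the t neighbours of u in D, and these labels are distinct. -/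
theorem ncard_extensions (L : P.IsLabelling Γ ℓ)
    (hk : ∀ B C : P.Block, (P.quotientGraph Γ).Adj B C → (P.trace Γ B C).ncard = 3)
    (hb : HasValency (P.quotientGraph Γ) 4) {t : ℕ}
    (ht : ∀ (u : V) (C : P.Block), C ∈ P.blocksAt Γ u → (P.nbrsIn Γ u C).ncard = t)
    {A B D : P.Block} (hA : (P.quotientGraph Γ).Adj A B)
    (hD : (P.quotientGraph Γ).Adj B D) (hAD : A ≠ D) :
    {E | ![A, B, D, E] ∈ P.labelArcs Γ ℓ}.ncard = t := by
  obtain ⟨u, rfl, hu, rfl⟩ := L.exists_label hk hb hA.symm hD hAD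
  have : {E | ![ℓ u D, P.blockOf u, D, E] ∈ P.labelArcs Γ ℓ} =
      (fun w => ℓ w (P.blockOf u)) '' P.nbrsIn Γ u D := by
    ext E
    constructor
    · rintro ⟨u', w, huw, he⟩
      obtain ⟨e1, e2, rfl, rfl⟩ := vec_four_inj.1 he
      obtain rfl : u = u' := L.inj hu (mem_blocksAt_left huw) e2 e1
      exact ⟨w, ⟨huw, rfl⟩, rfl⟩
    · rintro ⟨w, ⟨huw, rfl⟩, rfl⟩
      exact ⟨u, w, huw, rfl⟩
  rw [this, Set.InjOn.ncard_image, ht u D hu]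
  rintro w ⟨hw, hw1⟩ w' ⟨hw', hw1'⟩ he
  exact L.inj (mem_blocksAt_right hw) (mem_blocksAt_right hw') (hw1.trans hw1'.symm) he

theorem extendsUniquely (L : P.IsLabelling Γ ℓ) (h : P.InG Γ)
    (hk : ∀ B C : P.Block, (P.quotientGraph Γ).Adj B C → (P.trace Γ B C).ncard = 3)
    (hb : HasValency (P.quotientGraph Γ) 4) (hT : IsArcTransitive X (P.quotientGraph Γ) 2)
    (ht : ∀ (u : V) (C : P.Block), C ∈ P.blocksAt Γ u → (P.nbrsIn Γ u C).ncard = 1)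
    {u w : V} (huw : Γ.Adj u w) :
    ExtendsUniquely X (P.quotientGraph Γ) (P.labelArcs Γ ℓ) := by
  refine (L.isSelfPairedArcOrbit h huw).extendsUniquely hT fun A B D hA hD hAD => ?_
  obtain ⟨E, hE⟩ := Set.ncard_eq_one.1 (L.ncard_extensions hk hb ht hA hD hAD)
  have hmem : ∀ F, ![A, B, D, F] ∈ P.labelArcs Γ ℓ ↔ F = E := fun F => by
    have : F ∈ {E | ![A, B, D, E] ∈ P.labelArcs Γ ℓ} ↔ F ∈ ({E} : Set P.Block) := by rw [hE]
    exact this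
  exact ⟨E, (hmem E).2 rfl, fun F hF => (hmem F).1 hF⟩

/-- A 2-arc has three extensions to a 3-arc; for t = 2 exactly one of them is left outside the
orbit. -/
theorem extendsUniquely_compl (L : P.IsLabelling Γ ℓ) (h : P.InG Γ)
    (hk : ∀ B C : P.Block, (P.quotientGraph Γ).Adj B C → (P.trace Γ B C).ncard = 3)
    (hb : HasValency (P.quotientGraph Γ) 4) (hT : IsArcTransitive X (P.quotientGraph Γ) 2)
    (ht : ∀ (u : V) (C : P.Block), C ∈ P.blocksAt Γ u → (P.nbrsIn Γ u C).ncard = 2)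
    {u w : V} (huw : Γ.Adj u w) :
    ExtendsUniquely X (P.quotientGraph Γ) (arcs (P.quotientGraph Γ) 3 \ P.labelArcs Γ ℓ) := by
  obtain ⟨⟨α, hα, horb⟩, hrev⟩ := L.isSelfPairedArcOrbit h huw
  have hex : ∀ A B D, (P.quotientGraph Γ).Adj A B → (P.quotientGraph Γ).Adj B D → A ≠ D →
      ∃ E, ∀ F, ![A, B, D, F] ∈ arcs (P.quotientGraph Γ) 3 \ P.labelArcs Γ ℓ ↔ F = E := by
    intro A B D hA hD hAD
    have h1 := L.ncard_extensions hk hb ht hA hD hAD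
    have h2 : {E | ![A, B, D, E] ∈ P.labelArcs Γ ℓ} ⊆
        (P.quotientGraph Γ).neighborSet D \ {B} := by
      intro E hE
      obtain ⟨-, -, h3, -, h4⟩ := mem_arcs_three.1 (L.mem_arcs h hE)
      exact ⟨h3, h4.symm⟩
    have h3 : (((P.quotientGraph Γ).neighborSet D \ {B}) \
        {E | ![A, B, D, E] ∈ P.labelArcs Γ ℓ}).ncard = 1 := by
      rw [Set.ncard_sdiff h2, h1, hb.ncard_sdiff hD.symm]
    obtain ⟨E, hE⟩ := Set.ncard_eq_one.1 h3
    refine ⟨E, fun F => ?_⟩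
    have h4 : F ∈ ((P.quotientGraph Γ).neighborSet D \ {B}) \
        {E | ![A, B, D, E] ∈ P.labelArcs Γ ℓ} ↔ F ∈ ({E} : Set P.Block) := by rw [hE]
    rw [Set.mem_singleton_iff] at h4
    rw [← h4, Set.mem_sdiff, Set.mem_sdiff, Set.mem_sdiff, mem_arcs_three]
    exact ⟨fun ⟨⟨_, _, h5, _, h6⟩, h7⟩ => ⟨⟨h5, fun h => h6 h.symm⟩, h7⟩,
      fun ⟨⟨h5, h6⟩, h7⟩ => ⟨⟨hA, hD, h5, hAD, fun h => h6 h.symm⟩, h7⟩⟩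
  refine ⟨hT, fun h1 => mem_arcs_three.1 h1.1, ?_, ?_, ?_, ?_⟩
  · intro g A B D E hE
    rw [← smul_vec_four]
    refine ⟨smul_mem_arcs hT.1.1 hE.1 g, fun h1 => hE.2 ?_⟩
    rw [horb] at h1 ⊢
    have h2 := MulAction.mem_orbit_of_mem_orbit g⁻¹ h1
    rwa [inv_smul_smul] at h2
  · intro A B D E hE
    obtain ⟨h1, h2, h3, h4, h5⟩ := mem_arcs_three.1 hE.1
    refine ⟨mem_arcs_three.2 ⟨h3.symm, h2.symm, h1.symm, h5.symm, h4.symm⟩, fun h6 => hE.2 ?_⟩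
    rw [← vec_four_rev]
    exact hrev _ h6
  · intro A B D hA hD hAD
    obtain ⟨E, hE⟩ := hex A B D hA hD hAD
    exact ⟨E, (hE E).2 rfl⟩
  · intro A B D E F hE hF
    obtain ⟨h1, h2, -, h3, -⟩ := mem_arcs_three.1 hE.1
    obtain ⟨E', hE'⟩ := hex A B D h1 h2 h3
    rw [(hE' E).1 hE, (hE' F).1 hF]

/-- For t = 3 every extension of every 2-arc belongs to the orbit. -/
theorem three_arc_transitive (L : P.IsLabelling Γ ℓ) (h : P.InG Γ)
    (hk : ∀ B C : P.Block, (P.quotientGraph Γ).Adj B C → (P.trace Γ B C).ncard = 3)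
    (hb : HasValency (P.quotientGraph Γ) 4)
    (ht : ∀ (u : V) (C : P.Block), C ∈ P.blocksAt Γ u → (P.nbrsIn Γ u C).ncard = 3)
    {u w : V} (huw : Γ.Adj u w) : IsArcTransitive X (P.quotientGraph Γ) 3 := by
  obtain ⟨⟨α, hα, horb⟩, -⟩ := L.isSelfPairedArcOrbit h huw
  have hall : ∀ β ∈ arcs (P.quotientGraph Γ) 3, β ∈ MulAction.orbit X α := by
    intro β hβ
    rw [← horb]
    rw [vec_four_eta β] at hβ ⊢
    obtain ⟨h1, h2, h3, h4, h5⟩ := mem_arcs_three.1 hβ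
    have h6 := L.ncard_extensions hk hb ht h1 h2 h4
    have h7 : {E | ![β 0, β 1, β 2, E] ∈ P.labelArcs Γ ℓ} ⊆
        (P.quotientGraph Γ).neighborSet (β 2) \ {β 1} := by
      intro E hE
      obtain ⟨-, -, h3, -, h4⟩ := mem_arcs_three.1 (L.mem_arcs h hE)
      exact ⟨h3, h4.symm⟩
    have h8 := Set.eq_of_subset_of_ncard_le h7 (by
      rw [h6, hb.ncard_sdiff h2.symm])
    have h9 : β 3 ∈ {E | ![β 0, β 1, β 2, E] ∈ P.labelArcs Γ ℓ} := by
      rw [h8]; exact ⟨h3, h5.symm⟩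
    exact h9
  refine ⟨h.quot_vertexTransitive, fun β hβ γ hγ => ?_⟩
  obtain ⟨g, rfl⟩ := hall β hβ
  obtain ⟨k, rfl⟩ := hall γ hγ
  refine ⟨k * g⁻¹, ?_⟩
  change (k * g⁻¹) • g • α = k • α
  rw [mul_smul, inv_smul_smul]

/-- The unique extension in the complement makes the stabilizer A₄ or S₄. Two extensions of one
2-arc lie in the orbit, and an element carrying one to the other fixes the 2-arc without being
trivial, which rules out A₄. -/
theorem symmetric_stabilizer (L : P.IsLabelling Γ ℓ) (h : P.InG Γ) [FaithfulSMul X P.Block]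
    (hc : (P.quotientGraph Γ).Connected)
    (hk : ∀ B C : P.Block, (P.quotientGraph Γ).Adj B C → (P.trace Γ B C).ncard = 3)
    (hb : HasValency (P.quotientGraph Γ) 4) (hT : IsArcTransitive X (P.quotientGraph Γ) 2)
    (ht : ∀ (u : V) (C : P.Block), C ∈ P.blocksAt Γ u → (P.nbrsIn Γ u C).ncard = 2)
    {u w : V} (huw : Γ.Adj u w) :
    Nonempty (MulAction.stabilizer X (P.blockOf u) ≃* Equiv.Perm (Fin 4)) ∧
      IsArcRegular X Γ 1 := by
  have hE := L.extendsUniquely_compl h hk hb hT ht huw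
  have hA := L.mem_arcs h ⟨u, w, huw, rfl⟩
  obtain ⟨a1, a2, a3, a4, a5⟩ := mem_arcs_three.1 hA
  constructor
  · rcases hE.stabilizer_cases hc hb (P.blockOf u) with ⟨-, h1⟩ | ⟨h1, -⟩
    · exfalso
      have h2 := L.ncard_extensions hk hb ht a1 a2 a4
      obtain ⟨E, hE1, F, hF, hne⟩ := (Set.one_lt_ncard).1 (lt_of_lt_of_eq one_lt_two h2.symm)
      obtain ⟨⟨α, hα, horb⟩, -⟩ := L.isSelfPairedArcOrbit h huw
      have hE2 : _ ∈ MulAction.orbit X α := horb ▸ hE1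
      have hF2 : _ ∈ MulAction.orbit X α := horb ▸ hF
      rw [← MulAction.orbit_eq_iff.2 hE2] at hF2
      obtain ⟨g, hg⟩ := hF2
      change g • _ = _ at hg
      rw [smul_vec_four, vec_four_inj] at hg
      obtain ⟨g1, g2, g3, g4⟩ := hg
      have := h1 g _ _ g2 a1.symm a2 a4 g1 g3
      rw [this, one_smul] at g4
      exact hne g4
    · exact h1
  · refine h.symmetric.isArcRegular (mem_arcs_one.2 huw) fun g hg => ?_
    rw [smul_vec_two, vec_two_inj] at hg
    obtain ⟨g1, g2, g3, g4⟩ := L.fixes_of_fixes huw hg.1 hg.2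
    -- The extension E outside the orbit is fixed as well. This makes three fixed neighbours of the
    -- block of w, hence all four are fixed.
    obtain ⟨E, hE1⟩ := hE.exists_ext a1 a2 a4
    have g5 : g • E = E := by
      have := hE.smul g hE1
      rw [g1, g2, g3] at this
      exact hE.unique this hE1
    obtain ⟨-, -, b1, -, b2⟩ := hE.adj hE1
    have hne : E ≠ ℓ w (P.blockOf u) := by
      rintro rfl
      exact hE1.2 ⟨u, w, huw, rfl⟩
    exact hE.eq_one_of_fixes hc g2 (hb.fixes_of_fixes_three h.quot_vertexTransitive.1 g2 a2.symm a3
      b1 a5 b2 hne.symm g1 g4 g5)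

end IsLabelling

end InvPartition

/-! ### Faithfulness on the blocks and common points of traces -/

namespace InvPartition

variable {X V : Type*} [Group X] [MulAction X V] {P : InvPartition X V} {Γ : SimpleGraph V}

namespace InG

/-- An element fixing all blocks preserves every set `blocksAt`, and this set determines a vertex
within its block. -/
theorem faithfulSMul_block (h : P.InG Γ) [FaithfulSMul X V]
    (h1 : ∀ B, P.SeparatesPoints Γ B) : FaithfulSMul X P.Block := by
  refine ⟨fun {g k} hgk => ?_⟩
  have key : k⁻¹ * g = 1 := by
    refine FaithfulSMul.eq_of_smul_eq_smul (α := V) fun u => ?_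
    have hfix : ∀ C : P.Block, (k⁻¹ * g) • C = C := fun C => by
      rw [mul_smul, hgk C, inv_smul_smul]
    rw [one_smul]
    refine h1 (P.blockOf u) _ _ (by rw [blockOf_smul, hfix]) rfl ?_
    ext C
    rw [← h.smul_mem_blocksAt (k⁻¹ * g) u C, hfix]
  exact (inv_mul_eq_one.1 key).symm

theorem exists_mem_traces [Finite V] {l : ℕ} (hl : P.MeetIn Γ l) (hl1 : 1 ≤ l) (B C D : P.Block)
    (hC : (P.quotientGraph Γ).Adj B C) (hD : (P.quotientGraph Γ).Adj B D) :
    ∃ x, x ∈ P.trace Γ B C ∧ x ∈ P.trace Γ B D := by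
  by_cases hCD : C = D
  · subst hCD
    obtain ⟨u, w, hu, hw, huw⟩ := exists_mem_trace hC
    have : u ∈ P.trace Γ B C := mem_trace.2 ⟨mem_blocksAt.2 ⟨w, hw, huw⟩, hu⟩
    exact ⟨u, this, this⟩
  · obtain ⟨x, hx, h1, h2⟩ := Set.nonempty_of_ncard_ne_zero
      (show _ ≠ 0 by rw [hl B C D hC hD hCD]; omega)
    exact ⟨x, ⟨h1, hx⟩, ⟨h2, hx⟩⟩

theorem eq_of_adj_of_ncard_one [Finite V]
    (ht : ∀ (u : V) (C : P.Block), C ∈ P.blocksAt Γ u → (P.nbrsIn Γ u C).ncard = 1)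
    {u w w' : V} (h1 : Γ.Adj u w) (h2 : Γ.Adj u w') (h3 : P.blockOf w = P.blockOf w') : w = w' :=
  (Set.ncard_le_one).1 (ht u _ (mem_blocksAt_left h1)).le w ⟨h1, rfl⟩ w' ⟨h2, h3.symm⟩

end InG

/-! ### The description of `Γ` when `(v,b,r) = (4,4,3)` -/

section CaseA

variable {ℓ : V → P.Block}

/-- `ℓ u` is the only neighbour of the block of `u` that is not in `Γ_𝓑(u)`. -/
def IsMissing (P : InvPartition X V) (Γ : SimpleGraph V) (ℓ : V → P.Block) : Prop :=
  ∀ u, (P.quotientGraph Γ).Adj (P.blockOf u) (ℓ u) ∧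
    ∀ C, C ∈ P.blocksAt Γ u ↔ (P.quotientGraph Γ).Adj (P.blockOf u) C ∧ C ≠ ℓ u

theorem exists_isMissing [Finite V] (h : P.InG Γ) (hb : HasValency (P.quotientGraph Γ) 4)
    (hr : ∀ u, (P.blocksAt Γ u).ncard = 3) : ∃ ℓ, P.IsMissing Γ ℓ := by
  have key : ∀ u, ∃ M, (P.quotientGraph Γ).neighborSet (P.blockOf u) \ P.blocksAt Γ u = {M} := by
    intro u
    rw [← Set.ncard_eq_one, Set.ncard_sdiff (h.blocksAt_subset u), hb, hr]
  choose ℓ hℓ using key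
  have hmem : ∀ u C, (P.quotientGraph Γ).Adj (P.blockOf u) C ∧ C ∉ P.blocksAt Γ u ↔ C = ℓ u := by
    intro u C
    have : C ∈ (P.quotientGraph Γ).neighborSet (P.blockOf u) \ P.blocksAt Γ u ↔
      C ∈ ({ℓ u} : Set P.Block) := by rw [hℓ]
    exact this
  refine ⟨ℓ, fun u => ⟨((hmem u _).2 rfl).1, fun C => ⟨fun hC => ⟨h.blocksAt_subset u hC, ?_⟩, ?_⟩⟩⟩
  · rintro rfl
    exact ((hmem u _).2 rfl).2 hC
  · rintro ⟨h1, h2⟩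
    by_contra h3
    exact h2 ((hmem u C).1 ⟨h1, h3⟩)

theorem IsMissing.isLabelling (M : P.IsMissing Γ ℓ) (h : P.InG Γ)
    (h1 : ∀ B, P.SeparatesPoints Γ B) : P.IsLabelling Γ fun u _ => ℓ u where
  smul := by
    intro g u D _
    by_contra hne
    have h2 : g • ℓ u ∈ P.blocksAt Γ (g • u) := (M (g • u)).2 _ |>.2
      ⟨(h.quot_vertexTransitive.1 g _ _).2 (M u).1, Ne.symm hne⟩
    exact ((M u).2 _ |>.1 ((h.smul_mem_blocksAt g u _).1 h2)).2 rfl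
  adj := fun {u D} _ => (M u).1
  ne := fun {u D} hD => (((M u).2 D).1 hD).2.symm
  inj := fun {u u' D} _ _ hb he => h1 (P.blockOf u) u u' rfl hb.symm (by
    ext C
    rw [(M u).2, (M u').2, hb, he])

/-- A vertex corresponds to the arc from its block to the missing neighbour. -/
theorem IsMissing.nonempty_iso [Finite V] (M : P.IsMissing Γ ℓ) (h : P.InG Γ)
    (h1 : ∀ B, P.SeparatesPoints Γ B)
    (hk : ∀ B C : P.Block, (P.quotientGraph Γ).Adj B C → (P.trace Γ B C).ncard = 3)
    (hb : HasValency (P.quotientGraph Γ) 4) :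
    Nonempty (Γ ≃g threeArcGraph (P.quotientGraph Γ) (P.labelArcs Γ fun u _ => ℓ u)) := by
  have L := M.isLabelling h h1
  let f : V → {p : P.Block × P.Block // (P.quotientGraph Γ).Adj p.1 p.2} :=
    fun u => ⟨(P.blockOf u, ℓ u), (M u).1⟩
  have hinj : Function.Injective f := by
    intro u u' he
    have he' := congrArg Subtype.val he
    have e1 : P.blockOf u = P.blockOf u' := congrArg Prod.fst he'
    have e2 : ℓ u = ℓ u' := congrArg Prod.snd he'
    exact h1 (P.blockOf u) u u' rfl e1.symm (by ext C; rw [(M u).2, (M u').2, e1, e2])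
  have hsurj : Function.Surjective f := by
    rintro ⟨⟨B, A⟩, hBA⟩
    obtain ⟨D, hD, hDA⟩ := Set.exists_ne_of_one_lt_ncard
      (show 1 < ((P.quotientGraph Γ).neighborSet B).ncard by rw [hb B]; norm_num) A
    obtain ⟨u, rfl, -, rfl⟩ := L.exists_label hk hb hBA hD hDA.symm
    exact ⟨u, rfl⟩
  have hadj : ∀ u w, Γ.Adj u w ↔
      ![ℓ u, P.blockOf u, P.blockOf w, ℓ w] ∈ P.labelArcs Γ fun u _ => ℓ u := by
    intro u w
    constructor
    · exact fun huw => ⟨u, w, huw, rfl⟩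
    · intro hα
      obtain ⟨-, a2, -, a4, a5⟩ := mem_arcs_three.1 (L.mem_arcs h hα)
      exact (L.adj_iff (((M u).2 _).2 ⟨a2, a4.symm⟩) (((M w).2 _).2 ⟨a2.symm, a5⟩)).2 hα
  refine ⟨⟨Equiv.ofBijective f ⟨hinj, hsurj⟩, ?_⟩⟩
  intro u w
  change (threeArcGraph _ _).Adj (f u) (f w) ↔ _
  rw [threeArcGraph, SimpleGraph.fromRel_adj]
  change f u ≠ f w ∧ (![ℓ u, P.blockOf u, P.blockOf w, ℓ w] ∈ _ ∨
    ![ℓ w, P.blockOf w, P.blockOf u, ℓ u] ∈ _) ↔ _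
  rw [← hadj, ← hadj, Γ.adj_comm w u, or_self]
  exact ⟨fun h => h.2, fun h => ⟨fun he => h.ne (hinj he), h⟩⟩

/-- The neighbours of u lie one in each of the three blocks at u. A permutation of the four
neighbouring blocks that fixes the missing one and moves a pair of the others as prescribed is
induced by an element, which fixes u. An element fixing a 2-arc centred at u fixes three
neighbouring blocks, hence all four, and is trivial. -/
theorem IsMissing.isArcRegular_two [Finite V] (M : P.IsMissing Γ ℓ) (h : P.InG Γ)
    (h1 : ∀ B, P.SeparatesPoints Γ B) (hb : HasValency (P.quotientGraph Γ) 4)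
    (hr : ∀ u, (P.blocksAt Γ u).ncard = 3)
    (ht : ∀ (u : V) (C : P.Block), C ∈ P.blocksAt Γ u → (P.nbrsIn Γ u C).ncard = 1) (u : V)
    (hπ : ∀ π : Equiv.Perm ((P.quotientGraph Γ).neighborSet (P.blockOf u)),
      ∃ g : X, g • P.blockOf u = P.blockOf u ∧ ∀ x, (π x : P.Block) = g • (x : P.Block))
    (hfix : ∀ g : X, g • P.blockOf u = P.blockOf u →
      (∀ C, (P.quotientGraph Γ).Adj (P.blockOf u) C → g • C = C) → g = 1) :
    IsArcRegular X Γ 2 := by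
  have L := M.isLabelling h h1
  have hne : ∀ {a c}, Γ.Adj u a → Γ.Adj u c → a ≠ c → P.blockOf a ≠ P.blockOf c :=
    fun ha hc hac he => hac (InG.eq_of_adj_of_ncard_one ht ha hc he)
  have hM : ∀ {a}, Γ.Adj u a → ℓ u ≠ P.blockOf a := fun ha =>
    (((M u).2 _).1 (mem_blocksAt_left ha)).2.symm
  have hT : IsArcTransitive X Γ 2 := by
    refine isArcTransitive_two_of_stabilizer h.symmetric.1 u
      fun a c a' c' ha hc ha' hc' hac hac' => ?_
    obtain ⟨π, e1, e2, e3⟩ := exists_perm_two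
      (S := (P.quotientGraph Γ).neighborSet (P.blockOf u))
      (a := ⟨_, h.quot_adj ha⟩) (b := ⟨_, h.quot_adj hc⟩) (a' := ⟨_, h.quot_adj ha'⟩)
      (b' := ⟨_, h.quot_adj hc'⟩) (fun he => hne ha hc hac (congrArg Subtype.val he))
      (fun he => hne ha' hc' hac' (congrArg Subtype.val he))
    obtain ⟨g, hg, hgπ⟩ := hπ π
    have g1 : g • P.blockOf a = P.blockOf a' :=
      (hgπ ⟨_, h.quot_adj ha⟩).symm.trans (congrArg Subtype.val e1)
    have g2 : g • P.blockOf c = P.blockOf c' :=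
      (hgπ ⟨_, h.quot_adj hc⟩).symm.trans (congrArg Subtype.val e2)
    have g3 : g • ℓ u = ℓ u := (hgπ ⟨_, (M u).1⟩).symm.trans (congrArg Subtype.val (e3 _
      (fun he => hM ha (congrArg Subtype.val he)) (fun he => hM ha' (congrArg Subtype.val he))
      (fun he => hM hc (congrArg Subtype.val he)) (fun he => hM hc' (congrArg Subtype.val he))))
    have gu : g • u = u := by
      have h2 := (h.smul_mem_blocksAt g u _).2 (mem_blocksAt_left (P := P) ha)
      rw [g1] at h2
      exact L.inj h2 (mem_blocksAt_left ha') (by rw [blockOf_smul, hg])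
        ((L.smul g (mem_blocksAt_left ha)).trans g3)
    have hadj : ∀ {w}, Γ.Adj u w → Γ.Adj u (g • w) := fun {w} hw => by
      have := (h.adj_smul g u w).2 hw
      rwa [gu] at this
    exact ⟨g, gu, InG.eq_of_adj_of_ncard_one ht (hadj ha) ha' g1,
      InG.eq_of_adj_of_ncard_one ht (hadj hc) hc' g2⟩
  have h2 : HasValency Γ (3 * 1) := InG.hasValency ht hr
  obtain ⟨a, ha, c, hc, hac⟩ := (Set.one_lt_ncard).1
    (show 1 < (Γ.neighborSet u).ncard by rw [h2 u]; norm_num)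
  refine hT.isArcRegular (mem_arcs_two.2 ⟨SimpleGraph.Adj.symm ha, hc, hac⟩) fun g hg => ?_
  rw [smul_vec_three, vec_three_inj] at hg
  obtain ⟨ga, gu, gc⟩ := hg
  obtain ⟨g1, g2, g3, -⟩ := L.fixes_of_fixes ha gu ga
  have g4 : g • P.blockOf c = P.blockOf c := by rw [← blockOf_smul, gc]
  exact hfix g g1 (hb.fixes_of_fixes_three h.quot_vertexTransitive.1 g1 (M u).1 (h.quot_adj ha)
    (h.quot_adj hc) (hM ha) (hM hc) (hne ha hc hac) g3 g2 g4)

theorem InGHat.conclusionA [Finite V] (h : P.InGHat Γ)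
    (hk : ∀ B C : P.Block, (P.quotientGraph Γ).Adj B C → (P.trace Γ B C).ncard = 3) (u : V)
    (hA : P.CaseA Γ (P.blockOf u) u) : P.ConclusionA Γ (P.blockOf u) := by
  have hG := h.toInG
  have hT := (hG.two_arc_iff hk (P.blockOf u) u).2 (Or.inl hA)
  obtain ⟨hv, hb, hr, -⟩ := hA
  have hb' : HasValency (P.quotientGraph Γ) 4 := fun C => (hG.ncard_neighborSet C _).trans hb
  have hr' : ∀ w, (P.blocksAt Γ w).ncard = 3 := fun w => (hG.ncard_blocksAt w u).trans hr
  have h1 : ∀ B, P.SeparatesPoints Γ B := fun B =>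
    InG.separatesPoints_of_four hk ((hG.ncard_carrier B _).trans hv) (hb' B) hr'
  obtain ⟨l, hl⟩ := hG.exists_meetIn hT (P.blockOf u)
  have hl1 : 1 ≤ l := by rcases hG.parameters hk hl (P.blockOf u) u with h | h | h | h <;> omega
  have hfX := h.faithful
  have hfB := hG.faithfulSMul_block h1
  obtain ⟨ℓ, M⟩ := exists_isMissing hG hb' hr'
  have L := M.isLabelling hG h1
  obtain ⟨w, huw⟩ := hG.exists_adj u
  refine ⟨hfB, _, L.isSelfPairedArcOrbit hG huw, M.nonempty_iso hG h1 hk hb', ?_⟩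
  have hc := h.connected
  obtain ⟨t, ht, rfl | rfl | rfl⟩ := hG.exists_ncard_nbrsIn hk u
  · left
    have hE := L.extendsUniquely hG hk hb' hT ht huw
    obtain ⟨ℰ, m, n, hdec, -⟩ := hE.exists_isCycleDecomposition hc hb'
    refine ⟨hG.betweenIso_three_K2 hk ht, InG.hasValency ht hr', ⟨ℰ, m, n, hdec⟩, ?_⟩
    rcases hE.stabilizer_cases hc hb' (P.blockOf u) with ⟨h2, h3⟩ | ⟨h2, h3⟩
    · exact Or.inl ⟨h2, L.isArcRegular_one hG huw h3, ExtendsUniquely.isArcRegular_two hT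
        (L.adj (mem_blocksAt_left huw)) (hG.quot_adj huw) (L.ne (mem_blocksAt_left huw)) h3⟩
    · exact Or.inr ⟨h2, M.isArcRegular_two hG h1 hb' hr' ht u h3
        fun g hg hN => hE.eq_one_of_fixes hc hg hN⟩
  · right; left
    obtain ⟨h2, h3⟩ := L.symmetric_stabilizer hG hc hk hb' hT ht huw
    have hE := L.extendsUniquely_compl hG hk hb' hT ht huw
    obtain ⟨ℰ, m, n, hdec, -⟩ := hE.exists_isCycleDecomposition hc hb'
    exact ⟨hG.betweenIso_K33minus hk ht, InG.hasValency ht hr', h2,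
      hG.connected_of_two_le hc hk ht le_rfl (InG.exists_mem_traces hl hl1), h3,
      hE.isSelfPairedArcOrbit (L.adj (mem_blocksAt_left huw)).symm (hG.quot_adj huw)
        (L.ne (mem_blocksAt_left huw)), ℰ, m, n, hdec⟩
  · right; right
    exact ⟨hG.betweenIso_K33 hk ht, InG.hasValency ht hr',
      hG.connected_of_two_le hc hk ht (by norm_num) (InG.exists_mem_traces hl hl1),
      hG.isSTransitive_one ht (by norm_num) hr (by norm_num),
      L.three_arc_transitive hG hk hb' ht huw⟩

end CaseA

end InvPartition

theorem exists_sym2 {α : Type*} {S : Set α} (hS : S.ncard = 2) :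
    ∃ z : Sym2 α, ¬ z.IsDiag ∧ ∀ x, x ∈ z ↔ x ∈ S := by
  obtain ⟨x, y, hxy, rfl⟩ := Set.ncard_eq_two.1 hS
  exact ⟨s(x, y), hxy, fun a => Sym2.mem_iff⟩

namespace InvPartition

variable {X V : Type*} [Group X] [MulAction X V] {P : InvPartition X V} {Γ : SimpleGraph V}

/-! ### The description of `Γ` when `(v,b,r) = (6,4,2)` -/

section CaseB

variable {ℓ : V → P.Block → P.Block}

/-- `ℓ u D` is the member of `Γ_𝓑(u)` other than `D`. -/
def IsOther (P : InvPartition X V) (Γ : SimpleGraph V) (ℓ : V → P.Block → P.Block) : Prop :=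
  ∀ u D, D ∈ P.blocksAt Γ u → P.blocksAt Γ u = {D, ℓ u D} ∧ ℓ u D ≠ D

theorem exists_isOther (hr : ∀ u, (P.blocksAt Γ u).ncard = 2) : ∃ ℓ, P.IsOther Γ ℓ := by
  have key : ∀ u D, ∃ E, D ∈ P.blocksAt Γ u → P.blocksAt Γ u = {D, E} ∧ E ≠ D := by
    intro u D
    obtain ⟨x, y, hxy, he⟩ := Set.ncard_eq_two.1 (hr u)
    by_cases hD : D = x
    · subst hD
      exact ⟨y, fun _ => ⟨he, hxy.symm⟩⟩
    · refine ⟨x, fun hD' => ⟨?_, Ne.symm hD⟩⟩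
      rw [he] at hD' ⊢
      rcases hD' with rfl | rfl
      exacts [absurd rfl hD, Set.pair_comm _ _]
  choose ℓ hℓ using key
  exact ⟨ℓ, hℓ⟩

theorem IsOther.isLabelling (M : P.IsOther Γ ℓ) (h : P.InG Γ)
    (h1 : ∀ B, P.SeparatesPoints Γ B) : P.IsLabelling Γ ℓ where
  smul := by
    intro g u D hD
    have h2 : ℓ u D ∈ P.blocksAt Γ u := by rw [(M u D hD).1]; exact Or.inr rfl
    have h3 := (h.smul_mem_blocksAt g u _).2 h2
    rw [(M (g • u) (g • D) ((h.smul_mem_blocksAt g u D).2 hD)).1] at h3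
    rcases h3 with h3 | h3
    · exact absurd (MulAction.injective g h3) (M u D hD).2
    · exact h3.symm
  adj := fun {u D} hD => h.blocksAt_subset u (by rw [(M u D hD).1]; exact Or.inr rfl)
  ne := fun {u D} hD => (M u D hD).2
  inj := fun {u u' D} hD hD' hb he => h1 (P.blockOf u) u u' rfl hb.symm (by
    rw [(M u D hD).1, (M u' D hD').1, he])

theorem IsOther.exists_blocksAt [Finite V] (M : P.IsOther Γ ℓ) (h : P.InG Γ)
    (h1 : ∀ B, P.SeparatesPoints Γ B)
    (hk : ∀ B C : P.Block, (P.quotientGraph Γ).Adj B C → (P.trace Γ B C).ncard = 3)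
    (hb : HasValency (P.quotientGraph Γ) 4) {B C D : P.Block} (hC : (P.quotientGraph Γ).Adj B C)
    (hD : (P.quotientGraph Γ).Adj B D) (hCD : C ≠ D) :
    ∃ u, P.blockOf u = B ∧ P.blocksAt Γ u = {C, D} := by
  obtain ⟨u, hu, hu1, rfl⟩ := (M.isLabelling h h1).exists_label hk hb hC hD hCD
  exact ⟨u, hu, by rw [(M u D hu1).1, Set.pair_comm]⟩

/-- A vertex corresponds to the 2-path centred at its block whose ends are the two blocks at the
vertex. -/
theorem IsOther.nonempty_iso_gimel [Finite V] (M : P.IsOther Γ ℓ) (h : P.InG Γ)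
    (h1 : ∀ B, P.SeparatesPoints Γ B)
    (hk : ∀ B C : P.Block, (P.quotientGraph Γ).Adj B C → (P.trace Γ B C).ncard = 3)
    (hb : HasValency (P.quotientGraph Γ) 4) (hr : ∀ u, (P.blocksAt Γ u).ncard = 2) :
    Nonempty (Γ ≃g gimelGraph (P.quotientGraph Γ) (P.labelArcs Γ ℓ)) := by
  have L := M.isLabelling h h1
  choose z hz hmem using fun u => exists_sym2 (hr u)
  let f : V → Path2 (P.quotientGraph Γ) := fun u =>
    ⟨(P.blockOf u, z u), hz u, fun x hx => h.blocksAt_subset u ((hmem u x).1 hx)⟩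
  have hinj : Function.Injective f := by
    intro u u' he
    have he' := congrArg Subtype.val he
    have e1 : P.blockOf u = P.blockOf u' := congrArg Prod.fst he'
    have e2 : z u = z u' := congrArg Prod.snd he'
    exact h1 (P.blockOf u) u u' rfl e1.symm (by ext C; rw [← hmem, ← hmem, e2])
  have hsurj : Function.Surjective f := by
    rintro ⟨⟨B, p⟩, hp⟩
    induction p using Sym2.ind with
    | _ x y =>
    obtain ⟨u, rfl, hu⟩ := M.exists_blocksAt h h1 hk hb (hp.2 x (Sym2.mem_mk_left x y))
      (hp.2 y (Sym2.mem_mk_right x y)) hp.1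
    refine ⟨u, Subtype.ext (Prod.ext rfl (Sym2.ext fun a => ?_))⟩
    change a ∈ z u ↔ _
    rw [hmem, hu, Sym2.mem_iff]
    rfl
  have hadj : ∀ u w, Γ.Adj u w ↔ ∃ α ∈ P.labelArcs Γ ℓ,
      (f u).1 = (α 1, s(α 0, α 2)) ∧ (f w).1 = (α 2, s(α 1, α 3)) := by
    intro u w
    constructor
    · intro huw
      refine ⟨_, ⟨u, w, huw, rfl⟩, Prod.ext rfl (Sym2.ext fun a => ?_),
        Prod.ext rfl (Sym2.ext fun a => ?_)⟩
      · change a ∈ z u ↔ a ∈ s(ℓ u (P.blockOf w), P.blockOf w)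
        rw [hmem, (M u _ (mem_blocksAt_left huw)).1, Sym2.mem_iff, or_comm]
        rfl
      · change a ∈ z w ↔ a ∈ s(P.blockOf u, ℓ w (P.blockOf u))
        rw [hmem, (M w _ (mem_blocksAt_right huw)).1, Sym2.mem_iff]
        rfl
    · rintro ⟨α, hα, e1, e2⟩
      have b1 : P.blockOf u = α 1 := congrArg Prod.fst e1
      have b2 : P.blockOf w = α 2 := congrArg Prod.fst e2
      have z1 : z u = s(α 0, α 2) := congrArg Prod.snd e1
      have z2 : z w = s(α 1, α 3) := congrArg Prod.snd e2
      have m1 : P.blockOf w ∈ P.blocksAt Γ u := by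
        rw [← hmem, z1, b2]; exact Sym2.mem_mk_right _ _
      have m2 : P.blockOf u ∈ P.blocksAt Γ w := by
        rw [← hmem, z2, b1]; exact Sym2.mem_mk_left _ _
      have l1 : ℓ u (P.blockOf w) = α 0 := by
        have : ℓ u (P.blockOf w) ∈ z u := by
          rw [hmem, (M u _ m1).1]; exact Or.inr rfl
        rw [z1, Sym2.mem_iff, ← b2] at this
        exact this.resolve_right (M u _ m1).2
      have l2 : ℓ w (P.blockOf u) = α 3 := by
        have : ℓ w (P.blockOf u) ∈ z w := by
          rw [hmem, (M w _ m2).1]; exact Or.inr rfl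
        rw [z2, Sym2.mem_iff, ← b1] at this
        exact this.resolve_left (M w _ m2).2
      rw [L.adj_iff m1 m2, l1, l2, b1, b2, ← vec_four_eta α]
      exact hα
  refine ⟨⟨Equiv.ofBijective f ⟨hinj, hsurj⟩, ?_⟩⟩
  intro u w
  change (gimelGraph _ _).Adj (f u) (f w) ↔ _
  rw [gimelGraph, SimpleGraph.fromRel_adj, ← hadj, ← hadj, Γ.adj_comm w u, or_self]
  exact ⟨fun h => h.2, fun h => ⟨fun he => h.ne (hinj he), h⟩⟩

/-- Here a vertex corresponds to the complementary 2-path, with the two neighbours of its block that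
are not in `blocksAt` as ends. For an arc of Γ the centre of each path is then not an end of the
other. -/
theorem IsOther.exists_iso_psi [Finite V] (M : P.IsOther Γ ℓ) (h : P.InG Γ)
    (h1 : ∀ B, P.SeparatesPoints Γ B)
    (hk : ∀ B C : P.Block, (P.quotientGraph Γ).Adj B C → (P.trace Γ B C).ncard = 3)
    (hb : HasValency (P.quotientGraph Γ) 4) (hr : ∀ u, (P.blocksAt Γ u).ncard = 2)
    {u₀ w₀ : V} (h₀ : Γ.Adj u₀ w₀) :
    ∃ Λ, IsSelfPairedPathPairOrbit X (P.quotientGraph Γ) Λ ∧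
      Nonempty (Γ ≃g psiGraph (P.quotientGraph Γ) Λ) := by
  have hS : ∀ u, ((P.quotientGraph Γ).neighborSet (P.blockOf u) \ P.blocksAt Γ u).ncard = 2 := by
    intro u
    rw [Set.ncard_sdiff (h.blocksAt_subset u), hb, hr]
  choose z hz hmem using fun u => exists_sym2 (hS u)
  have hpath : ∀ u, IsPath2 (P.quotientGraph Γ) (P.blockOf u, z u) :=
    fun u => ⟨hz u, fun x hx => ((hmem u x).1 hx).1⟩
  let f : V → Path2 (P.quotientGraph Γ) := fun u => ⟨(P.blockOf u, z u), hpath u⟩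
  have hinj : Function.Injective f := by
    intro u u' he
    have he' := congrArg Subtype.val he
    have e1 : P.blockOf u = P.blockOf u' := congrArg Prod.fst he'
    have e2 : z u = z u' := congrArg Prod.snd he'
    refine h1 (P.blockOf u) u u' rfl e1.symm ?_
    have e3 : (P.quotientGraph Γ).neighborSet (P.blockOf u) \ P.blocksAt Γ u =
        (P.quotientGraph Γ).neighborSet (P.blockOf u') \ P.blocksAt Γ u' := by
      ext C; rw [← hmem, ← hmem, e2]
    rw [← Set.sdiff_sdiff_cancel_left (h.blocksAt_subset u), e3, e1,
      Set.sdiff_sdiff_cancel_left (h.blocksAt_subset u')]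
  have hsurj : Function.Surjective f := by
    rintro ⟨⟨B, p⟩, hp⟩
    induction p using Sym2.ind with
    | _ x y =>
    have hx : x ∈ (P.quotientGraph Γ).neighborSet B := hp.2 x (Sym2.mem_mk_left x y)
    have hy : y ∈ (P.quotientGraph Γ).neighborSet B := hp.2 y (Sym2.mem_mk_right x y)
    have hxy : ({x, y} : Set P.Block) ⊆ (P.quotientGraph Γ).neighborSet B := by
      rintro a (rfl | rfl)
      exacts [hx, hy]
    have hcard : ((P.quotientGraph Γ).neighborSet B \ {x, y}).ncard = 2 := by
      rw [Set.ncard_sdiff hxy, hb, Set.ncard_pair hp.1]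
    obtain ⟨C, D, hCD, he⟩ := Set.ncard_eq_two.1 hcard
    have hC : C ∈ (P.quotientGraph Γ).neighborSet B \ {x, y} := by rw [he]; exact Or.inl rfl
    have hD : D ∈ (P.quotientGraph Γ).neighborSet B \ {x, y} := by rw [he]; exact Or.inr rfl
    obtain ⟨u, rfl, hu⟩ := M.exists_blocksAt h h1 hk hb hC.1 hD.1 hCD
    refine ⟨u, Subtype.ext (Prod.ext rfl (Sym2.ext fun a => ?_))⟩
    change a ∈ z u ↔ _
    rw [hmem, hu, ← he, Set.sdiff_sdiff_cancel_left hxy, Sym2.mem_iff]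
    rfl
  have hsmul : ∀ (g : X) u, smulPath g (f u).1 = (f (g • u)).1 := by
    intro g u
    refine Prod.ext rfl (Sym2.ext fun a => ?_)
    change a ∈ (z u).map _ ↔ a ∈ z (g • u)
    rw [Sym2.mem_map, hmem]
    constructor
    · rintro ⟨x, hx, rfl⟩
      rw [hmem] at hx
      exact ⟨(h.quot_vertexTransitive.1 g _ _).2 hx.1,
        fun h2 => hx.2 ((h.smul_mem_blocksAt g u x).1 h2)⟩
    · rintro ⟨h2, h3⟩
      refine ⟨g⁻¹ • a, ?_, smul_inv_smul g a⟩
      rw [hmem]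
      constructor
      · have := (h.quot_vertexTransitive.1 g (P.blockOf u) (g⁻¹ • a))
        rw [smul_inv_smul] at this
        exact this.1 h2
      · intro h4
        have := (h.smul_mem_blocksAt g u _).2 h4
        rw [smul_inv_smul] at this
        exact h3 this
  let Λ : Set ((P.Block × Sym2 P.Block) × (P.Block × Sym2 P.Block)) :=
    {q | ∃ u w, Γ.Adj u w ∧ q = ((f u).1, (f w).1)}
  have hadj : ∀ u w, ((f u).1, (f w).1) ∈ Λ ↔ Γ.Adj u w := by
    intro u w
    constructor
    · rintro ⟨u', w', huw, he⟩
      obtain ⟨e1, e2⟩ := Prod.ext_iff.1 he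
      rwa [hinj (Subtype.ext e1), hinj (Subtype.ext e2)]
    · exact fun huw => ⟨u, w, huw, rfl⟩
  refine ⟨Λ, ⟨⟨((f u₀).1, (f w₀).1), ⟨hpath u₀, hpath w₀, h.quot_adj h₀, ?_, ?_⟩, ?_⟩, ?_⟩, ?_⟩
  · exact fun h2 => ((hmem u₀ _).1 h2).2 (mem_blocksAt_left h₀)
  · exact fun h2 => ((hmem w₀ _).1 h2).2 (mem_blocksAt_right h₀)
  · ext q
    constructor
    · rintro ⟨u, w, huw, rfl⟩
      obtain ⟨g, rfl, rfl⟩ := h.exists_arc _ _ _ _ h₀ huw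
      exact ⟨g, by rw [hsmul, hsmul]⟩
    · rintro ⟨g, rfl⟩
      exact ⟨g • u₀, g • w₀, (h.adj_smul g _ _).2 h₀, by rw [hsmul, hsmul]⟩
  · rintro q ⟨u, w, huw, rfl⟩
    exact ⟨w, u, huw.symm, rfl⟩
  · refine ⟨⟨Equiv.ofBijective f ⟨hinj, hsurj⟩, ?_⟩⟩
    intro u w
    change (psiGraph _ _).Adj (f u) (f w) ↔ _
    rw [psiGraph, SimpleGraph.fromRel_adj, hadj, hadj, Γ.adj_comm w u, or_self]
    exact ⟨fun h => h.2, fun h => ⟨fun he => h.ne (hinj he), h⟩⟩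

/-- An element interchanging the two neighbours of the block of u outside `blocksAt` and fixing the
two in it fixes u, and then w as the only neighbour of u in its block. So the arc has a nontrivial
stabilizer. -/
theorem IsOther.not_isArcRegular [Finite V] (M : P.IsOther Γ ℓ) (h : P.InG Γ)
    (h1 : ∀ B, P.SeparatesPoints Γ B) (hb : HasValency (P.quotientGraph Γ) 4)
    (ht : ∀ (u : V) (C : P.Block), C ∈ P.blocksAt Γ u → (P.nbrsIn Γ u C).ncard = 1) {u w : V}
    (huw : Γ.Adj u w)
    (hπ : ∀ π : Equiv.Perm ((P.quotientGraph Γ).neighborSet (P.blockOf u)),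
      ∃ g : X, g • P.blockOf u = P.blockOf u ∧ ∀ x, (π x : P.Block) = g • (x : P.Block)) :
    ¬ IsArcRegular X Γ 1 := by
  classical
  intro hreg
  have L := M.isLabelling h h1
  have hm := mem_blocksAt_left (P := P) huw
  have hsub : ({P.blockOf w, ℓ u (P.blockOf w)} : Set P.Block) ⊆
      (P.quotientGraph Γ).neighborSet (P.blockOf u) := by
    rw [← (M u _ hm).1]; exact h.blocksAt_subset u
  have hcard : ((P.quotientGraph Γ).neighborSet (P.blockOf u) \
      {P.blockOf w, ℓ u (P.blockOf w)}).ncard = 2 := by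
    rw [Set.ncard_sdiff hsub, hb, Set.ncard_pair (L.ne hm).symm]
  obtain ⟨C, D, hCD, he⟩ := Set.ncard_eq_two.1 hcard
  have hC : C ∈ (P.quotientGraph Γ).neighborSet (P.blockOf u) \
      {P.blockOf w, ℓ u (P.blockOf w)} := by rw [he]; exact Or.inl rfl
  have hD : D ∈ (P.quotientGraph Γ).neighborSet (P.blockOf u) \
      {P.blockOf w, ℓ u (P.blockOf w)} := by rw [he]; exact Or.inr rfl
  obtain ⟨g, hg, hgπ⟩ := hπ (Equiv.swap ⟨C, hC.1⟩ ⟨D, hD.1⟩)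
  have gfix : ∀ Z (hZ : (P.quotientGraph Γ).Adj (P.blockOf u) Z), Z ≠ C → Z ≠ D → g • Z = Z := by
    intro Z hZ h2 h3
    rw [← hgπ ⟨Z, hZ⟩, Equiv.swap_apply_of_ne_of_ne (fun h => h2 (congrArg Subtype.val h))
      (fun h => h3 (congrArg Subtype.val h))]
  have g1 : g • P.blockOf w = P.blockOf w := gfix _ (h.quot_adj huw)
    (fun h => hC.2 (Or.inl h.symm)) (fun h => hD.2 (Or.inl h.symm))
  have g2 : g • ℓ u (P.blockOf w) = ℓ u (P.blockOf w) := gfix _ (L.adj hm)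
    (fun h => hC.2 (Or.inr h.symm)) (fun h => hD.2 (Or.inr h.symm))
  have g3 : g • C = D := by
    rw [← hgπ ⟨C, hC.1⟩, Equiv.swap_apply_left]
  have gu : g • u = u := by
    have h2 := (h.smul_mem_blocksAt g u _).2 hm
    have h3 := L.smul g hm
    rw [g1] at h2 h3
    exact L.inj h2 hm (by rw [blockOf_smul, hg]) (h3.trans g2)
  have gw : g • w = w := by
    have h2 := (h.adj_smul g u w).2 huw
    rw [gu] at h2
    exact InG.eq_of_adj_of_ncard_one ht h2 huw g1
  obtain ⟨k, -, hk⟩ := hreg.2 _ (mem_arcs_one.2 huw) _ (mem_arcs_one.2 huw)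
  have e1 : g = k := hk g (by change g • _ = _; rw [smul_vec_two, gu, gw])
  have e2 : 1 = k := hk 1 (one_smul _ _)
  rw [e1, ← e2, one_smul] at g3
  exact hCD g3

theorem InGHat.conclusionB [Finite V] (h : P.InGHat Γ)
    (hk : ∀ B C : P.Block, (P.quotientGraph Γ).Adj B C → (P.trace Γ B C).ncard = 3) (u : V)
    (hB : P.CaseB Γ (P.blockOf u) u) : P.ConclusionB Γ (P.blockOf u) := by
  have hG := h.toInG
  have hT := (hG.two_arc_iff hk (P.blockOf u) u).2 (Or.inr (Or.inl hB))
  obtain ⟨hv, hb, hr, -⟩ := hB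
  have hb' : HasValency (P.quotientGraph Γ) 4 := fun C => (hG.ncard_neighborSet C _).trans hb
  have hr' : ∀ w, (P.blocksAt Γ w).ncard = 2 := fun w => (hG.ncard_blocksAt w u).trans hr
  obtain ⟨l, hl⟩ := hG.exists_meetIn hT (P.blockOf u)
  obtain rfl : l = 1 := by
    rcases hG.parameters hk hl (P.blockOf u) u with h | h | h | h <;> omega
  have h1 : ∀ B, P.SeparatesPoints Γ B := hG.separatesPoints_of_meetIn_one hl hr' le_rfl
  have hfX := h.faithful
  have hfB := hG.faithfulSMul_block h1
  obtain ⟨ℓ, M⟩ := exists_isOther hr'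
  have L := M.isLabelling hG h1
  obtain ⟨w, huw⟩ := hG.exists_adj u
  obtain ⟨φ⟩ := M.nonempty_iso_gimel hG h1 hk hb' hr'
  obtain ⟨Λ, hΛ, ⟨ψ⟩⟩ := M.exists_iso_psi hG h1 hk hb' hr' huw
  refine ⟨hfB, _, L.isSelfPairedArcOrbit hG huw, ⟨φ⟩, ⟨Λ, hΛ, ⟨φ.symm.trans ψ⟩⟩, ?_⟩
  have hc := h.connected
  obtain ⟨t, ht, rfl | rfl | rfl⟩ := hG.exists_ncard_nbrsIn hk u
  · left
    have hE := L.extendsUniquely hG hk hb' hT ht huw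
    obtain ⟨ℰ, m, n, hdec, ⟨χ⟩⟩ := hE.exists_isCycleDecomposition hc hb'
    refine ⟨hG.betweenIso_three_K2 hk ht, ⟨ℰ, m, n, ⟨φ.trans χ⟩, hdec⟩, ?_⟩
    rcases hE.stabilizer_cases hc hb' (P.blockOf u) with ⟨h2, h3⟩ | ⟨h2, h3⟩
    · exact Or.inl ⟨h2, L.isArcRegular_one hG huw h3, ExtendsUniquely.isArcRegular_two hT
        (L.adj (mem_blocksAt_left huw)) (hG.quot_adj huw) (L.ne (mem_blocksAt_left huw)) h3⟩
    · exact Or.inr ⟨h2, M.not_isArcRegular hG h1 hb' ht huw h3⟩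
  · right; left
    obtain ⟨h2, h3⟩ := L.symmetric_stabilizer hG hc hk hb' hT ht huw
    have hE := L.extendsUniquely_compl hG hk hb' hT ht huw
    obtain ⟨ℰ, m, n, hdec, -⟩ := hE.exists_isCycleDecomposition hc hb'
    exact ⟨hG.betweenIso_K33minus hk ht, InG.hasValency ht hr', h2,
      hG.connected_of_two_le hc hk ht le_rfl (InG.exists_mem_traces hl le_rfl), h3,
      hE.isSelfPairedArcOrbit (L.adj (mem_blocksAt_left huw)).symm (hG.quot_adj huw)
        (L.ne (mem_blocksAt_left huw)), ℰ, m, n, hdec⟩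
  · right; right
    exact ⟨hG.betweenIso_K33 hk ht, InG.hasValency ht hr',
      hG.connected_of_two_le hc hk ht (by norm_num) (InG.exists_mem_traces hl le_rfl),
      hG.isSTransitive_one ht (by norm_num) hr le_rfl,
      L.three_arc_transitive hG hk hb' ht huw⟩

end CaseB

end InvPartition

theorem third_mem_fanoLine {i x y : Fin 7} (hxy : x ≠ y) (hx : x ∈ fanoLine i)
    (hy : y ∈ fanoLine i) : third x y ∈ fanoLine i := by
  obtain ⟨k, h1, h2, h3⟩ := exists_fanoLine x y hxy
  rwa [fanoLine_unique i k x y hxy hx hy h1 h2]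

namespace InvPartition

variable {X V : Type*} [Group X] [MulAction X V] {P : InvPartition X V} {Γ : SimpleGraph V}

/-! ### The description of `Γ` when `(v,b,r) = (7,7,3)` -/

section CaseC

namespace InG

/-- A vertex corresponds to the star of its block with the three blocks at it as leaves;
transitivity on the leaves is flag-transitivity. -/
theorem exists_iso_doubleStarGraph (h : P.InG Γ) (h1 : ∀ B, P.SeparatesPoints Γ B)
    (hr : ∀ u, (P.blocksAt Γ u).ncard = 3) {u₀ w₀ : V} (h₀ : Γ.Adj u₀ w₀) :
    ∃ Θ, IsSelfPairedDoubleStarOrbit X (P.quotientGraph Γ) 3 Θ ∧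
      Nonempty (Γ ≃g doubleStarGraph Θ) := by
  let s : V → P.Block × Set P.Block := fun u => (P.blockOf u, P.blocksAt Γ u)
  have hinj : Function.Injective s := by
    intro u u' he
    exact h1 (P.blockOf u) u u' rfl (congrArg Prod.fst he).symm (congrArg Prod.snd he)
  have hsmul : ∀ (g : X) u, g • s u = s (g • u) := fun g u =>
    Prod.ext rfl (h.smul_blocksAt g u)
  have hstar : ∀ u, IsStar (P.quotientGraph Γ) 3 (s u) := fun u => ⟨h.blocksAt_subset u, hr u⟩
  let Θ : Set ((P.Block × Set P.Block) × (P.Block × Set P.Block)) :=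
    {q | ∃ u w, Γ.Adj u w ∧ q = (s u, s w)}
  have hadj : ∀ u w, (s u, s w) ∈ Θ ↔ Γ.Adj u w := by
    intro u w
    constructor
    · rintro ⟨u', w', huw, he⟩
      obtain ⟨e1, e2⟩ := Prod.ext_iff.1 he
      rwa [hinj e1, hinj e2]
    · exact fun huw => ⟨u, w, huw, rfl⟩
  have hmem : ∀ u, s u ∈ starsOf Θ := by
    intro u
    obtain ⟨w, huw⟩ := h.exists_adj u
    exact ⟨_, ⟨u, w, huw, rfl⟩, Or.inl rfl⟩
  have hrange : ∀ x ∈ starsOf Θ, ∃ u, s u = x := by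
    rintro x ⟨_, ⟨u, w, huw, rfl⟩, rfl | rfl⟩
    exacts [⟨u, rfl⟩, ⟨w, rfl⟩]
  refine ⟨Θ, ⟨⟨(s u₀, s w₀), ⟨hstar u₀, hstar w₀, mem_blocksAt_left h₀, mem_blocksAt_right h₀⟩, ?_⟩,
    ⟨⟨s u₀, hmem u₀, ?_⟩, s u₀, hmem u₀, ?_⟩, ?_⟩, ?_⟩
  · ext q
    constructor
    · rintro ⟨u, w, huw, rfl⟩
      obtain ⟨g, rfl, rfl⟩ := h.exists_arc _ _ _ _ h₀ huw
      exact ⟨g, Prod.ext (hsmul g u₀) (hsmul g w₀)⟩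
    · rintro ⟨g, rfl⟩
      exact ⟨g • u₀, g • w₀, (h.adj_smul g _ _).2 h₀, Prod.ext (hsmul g u₀) (hsmul g w₀)⟩
  · ext x
    constructor
    · intro hx
      obtain ⟨u, rfl⟩ := hrange x hx
      obtain ⟨g, rfl⟩ := h.exists_smul u₀ u
      exact ⟨g, hsmul g u₀⟩
    · rintro ⟨g, rfl⟩
      change g • s u₀ ∈ _
      rw [hsmul]
      exact hmem _
  · intro x hx y hy
    obtain ⟨g, hg, hxy⟩ := h.exists_flag hx hy
    have := hsmul g u₀
    rw [hg] at this
    exact ⟨g, congrArg Prod.fst this, congrArg Prod.snd this, hxy⟩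
  · rintro q ⟨u, w, huw, rfl⟩
    exact ⟨w, u, huw.symm, rfl⟩
  · refine ⟨⟨Equiv.ofBijective (fun u => (⟨s u, hmem u⟩ : starsOf Θ)) ⟨fun u u' he =>
      hinj (congrArg Subtype.val he), fun x => ?_⟩, ?_⟩⟩
    · obtain ⟨u, hu⟩ := hrange x x.2
      exact ⟨u, Subtype.ext hu⟩
    · intro u w
      change (doubleStarGraph Θ).Adj ⟨s u, hmem u⟩ ⟨s w, hmem w⟩ ↔ _
      rw [doubleStarGraph, SimpleGraph.fromRel_adj, hadj, hadj, Γ.adj_comm w u, or_self]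
      exact ⟨fun h => h.2, fun h => ⟨fun he => h.ne (hinj (congrArg Subtype.val he)), h⟩⟩

/-- An element moving two of the blocks at `u` to blocks at `u` fixes `u`. -/
theorem smul_eq_of_meetIn_one [Finite V] (h : P.InG Γ) (hl : P.MeetIn Γ 1) {u : V} {C D : P.Block}
    (hC : C ∈ P.blocksAt Γ u) (hD : D ∈ P.blocksAt Γ u) (hCD : C ≠ D) {g : X}
    (hg : g • P.blockOf u = P.blockOf u) (hgC : g • C ∈ P.blocksAt Γ u)
    (hgD : g • D ∈ P.blocksAt Γ u) : g • u = u :=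
  (Set.ncard_le_one).1 (hl (P.blockOf u) (g • C) (g • D) (h.blocksAt_subset u hgC)
    (h.blocksAt_subset u hgD) fun he => hCD (MulAction.injective g he)).le (g • u)
    ⟨hg, (h.smul_mem_blocksAt g u C).2 hC, (h.smul_mem_blocksAt g u D).2 hD⟩ u ⟨rfl, hgC, hgD⟩

theorem smul_eq_of_adj [Finite V] (h : P.InG Γ)
    (ht : ∀ (u : V) (C : P.Block), C ∈ P.blocksAt Γ u → (P.nbrsIn Γ u C).ncard = 1) {u a a' : V}
    {g : X} (hg : g • u = u) (ha : Γ.Adj u a) (ha' : Γ.Adj u a')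
    (hb : g • P.blockOf a = P.blockOf a') : g • a = a' := by
  have h2 := (h.adj_smul g u a).2 ha
  rw [hg] at h2
  exact eq_of_adj_of_ncard_one ht h2 ha' hb

/-- A 2-arc centred at u projects to a 2-arc of the quotient. An element mapping one such projection
to another fixes u, the only vertex common to the two traces, and t = 1 determines where the ends
go. -/
theorem isArcTransitive_two_of_meetIn_one [Finite V] (h : P.InG Γ) (hl : P.MeetIn Γ 1)
    (hT : IsArcTransitive X (P.quotientGraph Γ) 2)
    (ht : ∀ (u : V) (C : P.Block), C ∈ P.blocksAt Γ u → (P.nbrsIn Γ u C).ncard = 1) (u : V) :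
    IsArcTransitive X Γ 2 := by
  refine isArcTransitive_two_of_stabilizer h.symmetric.1 u
    fun a c a' c' ha hc ha' hc' hac hac' => ?_
  have hne : ∀ {a c}, Γ.Adj u a → Γ.Adj u c → a ≠ c → P.blockOf a ≠ P.blockOf c :=
    fun ha hc hac he => hac (eq_of_adj_of_ncard_one ht ha hc he)
  obtain ⟨g, g1, g2, g3⟩ := hT.exists_two (h.quot_adj ha).symm (h.quot_adj hc) (hne ha hc hac)
    (h.quot_adj ha').symm (h.quot_adj hc') (hne ha' hc' hac')
  have gu : g • u = u := h.smul_eq_of_meetIn_one hl (mem_blocksAt_left ha) (mem_blocksAt_left hc)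
    (hne ha hc hac) g2 (by rw [g1]; exact mem_blocksAt_left ha')
    (by rw [g3]; exact mem_blocksAt_left hc')
  exact ⟨g, gu, h.smul_eq_of_adj ht gu ha ha' g1, h.smul_eq_of_adj ht gu hc hc' g3⟩

/-- There is a nontrivial collineation preserving two given lines: it fixes their common point x and
a point z of the second, and moves a point y of the first to the third point of that line. It fixes
the 2-arc whose ends lie in the corresponding blocks. -/
theorem not_isArcRegular_two [Finite V] (h : P.InG Γ) (hl : P.MeetIn Γ 1)
    (hr : ∀ u, (P.blocksAt Γ u).ncard = 3)
    (ht : ∀ (u : V) (C : P.Block), C ∈ P.blocksAt Γ u → (P.nbrsIn Γ u C).ncard = 1) {u : V}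
    {e : P.carrier (P.blockOf u) ≃ Fin 7}
    {f : (P.quotientGraph Γ).neighborSet (P.blockOf u) ≃ Fin 7}
    (hef : P.IsFano Γ (P.blockOf u) e f)
    (hgrp : coordGroup e (P.blockGroup (P.blockOf u)) = fanoAut) : ¬ IsArcRegular X Γ 2 := by
  intro hreg
  have h2 : HasValency Γ (3 * 1) := hasValency ht hr
  obtain ⟨a, ha, c, hc, hac⟩ := (Set.one_lt_ncard).1
    (show 1 < (Γ.neighborSet u).ncard by rw [h2 u]; norm_num)
  have hne : P.blockOf a ≠ P.blockOf c := fun he => hac (eq_of_adj_of_ncard_one ht ha hc he)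
  have hC := h.quot_adj ha
  have hD := h.quot_adj hc
  obtain ⟨x, y, z, h1, h2, h3, h4, h5, h6, h7, h8⟩ := fano_lines_triangle (f ⟨_, hC⟩)
    (f ⟨_, hD⟩) (f.injective.ne fun he => hne (congrArg Subtype.val he))
  obtain ⟨h9, h10⟩ := third_ne x y h5
  obtain ⟨π, hπ, hx, hy, hz⟩ := exists_fanoAut_triangle h5 h6 h7 h8 h9.symm h6 h8
    (by rw [third_third x y h5]; exact h7)
  obtain ⟨g, hg, hge, key⟩ := h.exists_smul_of_fano hef hgrp hπ
  have g1 : g • P.blockOf a = P.blockOf a := by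
    have e1 := fanoLine_unique (f ⟨_, h.smul_mem_nbr _ g hg _ hC⟩) (f ⟨_, hC⟩) x (third x y) h9.symm
      (hx ▸ key _ hC x h1) (hy ▸ key _ hC y h3) h1 (third_mem_fanoLine h5 h1 h3)
    exact congrArg Subtype.val (f.injective e1)
  have g2 : g • P.blockOf c = P.blockOf c := by
    have e1 := fanoLine_unique (f ⟨_, h.smul_mem_nbr _ g hg _ hD⟩) (f ⟨_, hD⟩) x z h6.symm
      (hx ▸ key _ hD x h2) (hz ▸ key _ hD z h4) h2 h4
    exact congrArg Subtype.val (f.injective e1)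
  have gu : g • u = u := h.smul_eq_of_meetIn_one hl (mem_blocksAt_left ha) (mem_blocksAt_left hc)
    hne hg (by rw [g1]; exact mem_blocksAt_left ha) (by rw [g2]; exact mem_blocksAt_left hc)
  have ga := h.smul_eq_of_adj ht gu ha ha g1
  have gc := h.smul_eq_of_adj ht gu hc hc g2
  have hα : ![a, u, c] ∈ arcs Γ 2 := mem_arcs_two.2 ⟨SimpleGraph.Adj.symm ha, hc, hac⟩
  obtain ⟨k, -, hk⟩ := hreg.2 _ hα _ hα
  have e1 : g = k := hk g (by change g • _ = _; rw [smul_vec_three, ga, gu, gc])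
  have e2 : 1 = k := hk 1 (one_smul _ _)
  have e3 := hge (e.symm y)
  rw [e1, ← e2, one_smul, e.apply_symm_apply, hy] at e3
  exact h10 (e.symm.injective (Subtype.ext e3))

end InG

theorem InGHat.conclusionC [Finite V] (h : P.InGHat Γ)
    (hk : ∀ B C : P.Block, (P.quotientGraph Γ).Adj B C → (P.trace Γ B C).ncard = 3) (u : V)
    (hC : P.CaseC Γ (P.blockOf u) u) : P.ConclusionC Γ := by
  have hG := h.toInG
  obtain ⟨hv, hb, hr, hpsl⟩ := hC
  obtain ⟨⟨e, f, hef, hgrp⟩, hT⟩ := hG.two_arc_of_psl hk hv hb hpsl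
  have hr' : ∀ w, (P.blocksAt Γ w).ncard = 3 := fun w => (hG.ncard_blocksAt w u).trans hr
  obtain ⟨l, hl⟩ := hG.exists_meetIn hT (P.blockOf u)
  obtain rfl : l = 1 := by
    rcases hG.parameters hk hl (P.blockOf u) u with h | h | h | h <;> omega
  have h1 : ∀ B, P.SeparatesPoints Γ B := hG.separatesPoints_of_meetIn_one hl hr' (by norm_num)
  have hfX := h.faithful
  obtain ⟨w, huw⟩ := hG.exists_adj u
  refine ⟨hG.faithfulSMul_block h1, hG.exists_iso_doubleStarGraph h1 hr' huw, ?_⟩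
  have hc := h.connected
  obtain ⟨t, ht, rfl | rfl | rfl⟩ := hG.exists_ncard_nbrsIn hk u
  · exact Or.inl ⟨hG.betweenIso_three_K2 hk ht, InG.hasValency ht hr',
      hG.isArcTransitive_two_of_meetIn_one hl hT ht u,
      hG.not_isArcRegular_two hl hr' ht hef hgrp⟩
  · exact Or.inr (Or.inl ⟨hG.betweenIso_K33minus hk ht, InG.hasValency ht hr',
      hG.connected_of_two_le hc hk ht le_rfl (InG.exists_mem_traces hl le_rfl),
      hG.isSTransitive_one ht le_rfl hr (by norm_num)⟩)
  · exact Or.inr (Or.inr ⟨hG.betweenIso_K33 hk ht, InG.hasValency ht hr',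
      hG.connected_of_two_le hc hk ht (by norm_num) (InG.exists_mem_traces hl le_rfl),
      hG.isSTransitive_one ht (by norm_num) hr (by norm_num)⟩)

end CaseC

/-! ### The description of `Γ` when `r = 1` -/

section CaseD

/-- With one block at each vertex, every vertex and every edge of Γ belong to the graph between
exactly one pair of adjacent blocks, so Γ is the disjoint union of these graphs over the edges of
the quotient. -/
theorem InG.nonempty_iso_copies [Finite V] (h : P.InG Γ) (hr : ∀ u, (P.blocksAt Γ u).ncard = 1)
    {W : Type*} {H : SimpleGraph W} (hH : P.BetweenIso Γ H) :
    Nonempty (Γ ≃g copies (P.quotientGraph Γ).edgeSet.ncard H) := by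
  have huniq : ∀ {u : V} {C D : P.Block}, C ∈ P.blocksAt Γ u → D ∈ P.blocksAt Γ u → C = D :=
    fun {u C D} hC hD => (Set.ncard_le_one).1 (hr u).le C hC D hD
  have hE : Nat.card (P.quotientGraph Γ).edgeSet = (P.quotientGraph Γ).edgeSet.ncard :=
    Nat.card_coe_set_eq _
  let ε : Fin (P.quotientGraph Γ).edgeSet.ncard ≃ (P.quotientGraph Γ).edgeSet :=
    (Finite.equivFinOfCardEq hE).symm
  have hrep : ∀ s : (P.quotientGraph Γ).edgeSet, ∃ B C, s.1 = s(B, C) := fun s => by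
    induction s.1 using Sym2.ind with
    | _ B C => exact ⟨B, C, rfl⟩
  choose B C hBC using fun i => hrep (ε i)
  have hadj : ∀ i, (P.quotientGraph Γ).Adj (B i) (C i) := fun i => by
    rw [← SimpleGraph.mem_edgeSet, ← hBC]
    exact (ε i).2
  let φ := fun i => (hH (B i) (C i) (hadj i)).some
  have hedge : ∀ i u, u ∈ P.trace Γ (B i) (C i) ∪ P.trace Γ (C i) (B i) ↔
      ∃ D ∈ P.blocksAt Γ u, (ε i).1 = s(P.blockOf u, D) := by
    intro i u
    rw [hBC]
    constructor
    · rintro (⟨h1, h2⟩ | ⟨h1, h2⟩)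
      · exact ⟨C i, h1, by rw [show P.blockOf u = B i from h2]⟩
      · exact ⟨B i, h1, by rw [show P.blockOf u = C i from h2, Sym2.eq_swap]⟩
    · rintro ⟨D, hD, he⟩
      rcases Sym2.eq_iff.1 he with ⟨h1, rfl⟩ | ⟨rfl, h1⟩
      · exact Or.inl ⟨hD, h1.symm⟩
      · exact Or.inr ⟨hD, h1.symm⟩
  let F : Fin (P.quotientGraph Γ).edgeSet.ncard × W → V := fun p => ((φ p.1).symm p.2).1
  have hF : ∀ p, ∃ D ∈ P.blocksAt Γ (F p), (ε p.1).1 = s(P.blockOf (F p), D) := fun p =>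
    (hedge _ _).1 ((φ p.1).symm p.2).2
  have hsame : ∀ p q, F p = F q → p.1 = q.1 := by
    intro p q he
    obtain ⟨D, hD, h1⟩ := hF p
    obtain ⟨D', hD', h2⟩ := hF q
    rw [← he] at hD' h2
    rw [huniq hD' hD, ← h1] at h2
    exact ε.injective (Subtype.ext h2.symm)
  have hinj : Function.Injective F := by
    rintro ⟨i, x⟩ ⟨j, y⟩ he
    obtain rfl : i = j := hsame _ _ he
    have : x = y := (φ i).symm.injective (Subtype.ext he)
    rw [this]
  have hex : ∀ u D, D ∈ P.blocksAt Γ u → ∃ i, (ε i).1 = s(P.blockOf u, D) := by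
    intro u D hD
    obtain ⟨i, hi⟩ := ε.surjective ⟨s(P.blockOf u, D), h.blocksAt_subset u hD⟩
    exact ⟨i, congrArg Subtype.val hi⟩
  have hsurj : Function.Surjective F := by
    intro u
    obtain ⟨w, huw⟩ := h.exists_adj u
    obtain ⟨i, hi⟩ := hex u _ (mem_blocksAt_left huw)
    refine ⟨(i, φ i ⟨u, (hedge i u).2 ⟨_, mem_blocksAt_left huw, hi⟩⟩), ?_⟩
    simp only [F, RelIso.symm_apply_apply]
  have hin : ∀ i x y, Γ.Adj (F (i, x)) (F (i, y)) ↔ H.Adj x y := fun i x y =>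
    (φ i).symm.map_adj_iff
  refine ⟨(⟨Equiv.ofBijective F ⟨hinj, hsurj⟩, ?_⟩ : copies _ H ≃g Γ).symm⟩
  rintro ⟨i, x⟩ ⟨j, y⟩
  change Γ.Adj (F (i, x)) (F (j, y)) ↔ _
  constructor
  · intro hxy
    obtain ⟨D, hD, h1⟩ := hF (i, x)
    obtain ⟨D', hD', h2⟩ := hF (j, y)
    rw [huniq hD (mem_blocksAt_left hxy)] at h1
    rw [huniq hD' (mem_blocksAt_right hxy), Sym2.eq_swap, ← h1] at h2
    obtain rfl : i = j := ε.injective (Subtype.ext h2.symm)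
    exact ⟨rfl, (hin i x y).1 hxy⟩
  · rintro ⟨h1, h2⟩
    obtain rfl : i = j := h1
    exact (hin i x y).2 h2

theorem nonempty_copies_copies (m n : ℕ) {W : Type*} (H : SimpleGraph W) :
    Nonempty (copies n (copies m H) ≃g copies (m * n) H) := by
  refine ⟨⟨(Equiv.prodAssoc _ _ _).symm.trans (Equiv.prodCongr
    ((Equiv.prodComm _ _).trans finProdFinEquiv) (Equiv.refl W)), ?_⟩⟩
  rintro ⟨i, j, x⟩ ⟨i', j', x'⟩
  change finProdFinEquiv (j, i) = finProdFinEquiv (j', i') ∧ H.Adj x x' ↔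
    i = i' ∧ (j = j' ∧ H.Adj x x')
  rw [finProdFinEquiv.injective.eq_iff, Prod.ext_iff]
  tauto

theorem InG.conclusionD [Finite V] (h : P.InG Γ)
    (hk : ∀ B C : P.Block, (P.quotientGraph Γ).Adj B C → (P.trace Γ B C).ncard = 3) (B : P.Block)
    (u : V) (hD : P.CaseD Γ B u) : P.ConclusionD Γ := by
  have hr' : ∀ w, (P.blocksAt Γ w).ncard = 1 := fun w => (h.ncard_blocksAt w u).trans hD.2.2.1
  obtain ⟨t, ht, rfl | rfl | rfl⟩ := h.exists_ncard_nbrsIn hk u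
  · have h1 := h.betweenIso_three_K2 hk ht
    obtain ⟨φ⟩ := h.nonempty_iso_copies hr' h1
    obtain ⟨ψ⟩ := nonempty_copies_copies 3 (P.quotientGraph Γ).edgeSet.ncard K2
    exact Or.inl ⟨h1, ⟨φ.trans ψ⟩⟩
  · have h1 := h.betweenIso_K33minus hk ht
    exact Or.inr (Or.inl ⟨h1, h.nonempty_iso_copies hr' h1⟩)
  · have h1 := h.betweenIso_K33 hk ht
    exact Or.inr (Or.inr ⟨h1, h.nonempty_iso_copies hr' h1⟩)

end CaseD

end InvPartition

/-! ### Graphs on stars with a prescribed quotient -/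

/-- An equivariant isomorphism of graphs transports the local actions. -/
theorem nonempty_inducedPerm_congr {Y V W : Type*} [Group Y] [MulAction Y V] [MulAction Y W]
    {G : SimpleGraph V} {G' : SimpleGraph W}
    (hG : ∀ (g : Y) (u w : V), G.Adj (g • u) (g • w) ↔ G.Adj u w)
    (hG' : ∀ (g : Y) (u w : W), G'.Adj (g • u) (g • w) ↔ G'.Adj u w)
    (φ : G ≃g G') (hφ : ∀ (g : Y) (u : V), φ (g • u) = g • φ u) (u : V) :
    Nonempty (inducedPerm (MulAction.stabilizer Y u) (G.neighborSet u) ≃*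
      inducedPerm (MulAction.stabilizer Y (φ u)) (G'.neighborSet (φ u))) := by
  have hstab : MulAction.stabilizer Y (φ u) = MulAction.stabilizer Y u := by
    ext g
    rw [MulAction.mem_stabilizer_iff, MulAction.mem_stabilizer_iff, ← hφ, φ.injective.eq_iff]
  rw [hstab]
  refine nonempty_inducedPerm_mulEquiv _ _ _ (smul_mem_neighborSet hG u)
    (fun g hg x hx => smul_mem_neighborSet hG' (φ u) g (by rwa [hstab]) x hx) fun g hg => ?_
  constructor
  · intro h y hy
    obtain ⟨x, rfl⟩ := φ.surjective y
    rw [← hφ, h x (φ.map_adj_iff.1 hy)]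
  · intro h x hx
    apply φ.injective
    rw [hφ, h (φ x) (φ.map_adj_iff.2 hx)]

section StarModel

variable {Y V W : Type*} [Group Y] [MulAction Y V] [MulAction Y W] {G : SimpleGraph W}
  {c : V → W} {L : V → Set W} {r : ℕ}

/-- The elements of `V` stand for stars of `G`: `u` has the centre `c u` and the set `L u` of
leaves. Every arc of `G` lies on exactly three of them, and `Y` is transitive on the flags. -/
structure IsStarModel (Y : Type*) {V W : Type*} [Group Y] [MulAction Y V] [MulAction Y W]
    (G : SimpleGraph W) (c : V → W) (L : V → Set W) (r : ℕ) : Prop where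
  smul_centre : ∀ (g : Y) (u : V), c (g • u) = g • c u
  smul_leaves : ∀ (g : Y) (u : V), L (g • u) = g • L u
  inj : ∀ u u', c u = c u' → L u = L u' → u = u'
  sub : ∀ u, L u ⊆ G.neighborSet (c u)
  card : ∀ u, (L u).ncard = r
  flag : ∀ u u' σ σ', σ ∈ L u → σ' ∈ L u' → ∃ g : Y, g • u = u' ∧ g • σ = σ'
  three : ∀ τ σ, G.Adj τ σ → {u | c u = τ ∧ σ ∈ L u}.ncard = 3
  sep : ∀ τ σ σ', G.Adj τ σ → G.Adj τ σ' → σ ≠ σ' → ∃ u, c u = τ ∧ σ ∈ L u ∧ σ' ∉ L u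

/-- The graph whose edges are the images of the pair `u`, `w`. -/
def orbitGraph (Y : Type*) {V : Type*} [Group Y] [MulAction Y V] (u w : V) : SimpleGraph V :=
  SimpleGraph.fromRel fun p q => ∃ g : Y, g • u = p ∧ g • w = q

/-- Since h interchanges u and h • u, the orbit of the pair is closed under reversal and the
symmetrization in `SimpleGraph.fromRel` adds nothing. -/
theorem orbitGraph_adj {u : V} {h : Y} (hh : h • h • u = u) (hne : h • u ≠ u) {p q : V} :
    (orbitGraph Y u (h • u)).Adj p q ↔ ∃ g : Y, g • u = p ∧ g • h • u = q := by
  rw [orbitGraph, SimpleGraph.fromRel_adj]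
  constructor
  · rintro ⟨-, ⟨g, rfl, rfl⟩ | ⟨g, rfl, rfl⟩⟩
    · exact ⟨g, rfl, rfl⟩
    · exact ⟨g * h, mul_smul g h u, by rw [mul_smul, hh]⟩
  · rintro ⟨g, rfl, rfl⟩
    exact ⟨fun he => hne (MulAction.injective g he).symm, Or.inl ⟨g, rfl, rfl⟩⟩

namespace IsStarModel

theorem smul_mem (M : IsStarModel Y G c L r) {g : Y} {u : V} {σ : W} :
    g • σ ∈ L (g • u) ↔ σ ∈ L u := by
  rw [M.smul_leaves, Set.smul_mem_smul_set_iff]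

/-- Some element interchanges the ends of an arc and acts as an involution on a star through
it. -/
theorem exists_swap [Finite V] (M : IsStarModel Y G c L r) (hG : IsArcTransitive Y G 1) {τ σ : W}
    (hτσ : G.Adj τ σ) : ∃ (u : V) (h : Y), c u = τ ∧ σ ∈ L u ∧ h • τ = σ ∧ h • σ = τ ∧
      h • h • u = u := by
  -- The square of g fixes both ends of the arc and permutes the three stars through it. Either it
  -- fixes one of them and h = g works, or its cube is trivial on them and h = g ^ 3 works, an odd
  -- power that still interchanges the ends.
  obtain ⟨g, hg1, hg2⟩ := hG.exists_one hτσ hτσ.symm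
  let S : Set V := {u | c u = τ ∧ σ ∈ L u}
  have hS : Nat.card S = 3 := by rw [Nat.card_coe_set_eq]; exact M.three τ σ hτσ
  have hgg : (g * g) • τ = τ ∧ (g * g) • σ = σ := by
    rw [mul_smul, mul_smul, hg1, hg2, hg1]; exact ⟨rfl, rfl⟩
  let H : Subgroup Y := MulAction.stabilizer Y τ ⊓ MulAction.stabilizer Y σ
  have hH : ∀ k ∈ H, ∀ x ∈ S, k • x ∈ S := by
    rintro k ⟨hk1, hk2⟩ x ⟨hx1, hx2⟩
    refine ⟨by rw [M.smul_centre, hx1]; exact hk1, ?_⟩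
    have := (M.smul_mem (g := k)).2 hx2
    rwa [MulAction.mem_stabilizer_iff.1 hk2] at this
  let k : H := ⟨g * g, hgg⟩
  obtain ⟨u₀⟩ : Nonempty S := by
    by_contra hemp
    rw [not_nonempty_iff] at hemp
    rw [Nat.card_of_isEmpty] at hS
    omega
  rcases perm_three_fix_or_cube hS (inducedHom H S hH k) with ⟨u, hu⟩ | hcube
  · refine ⟨u, g, u.2.1, u.2.2, hg1, hg2, ?_⟩
    rw [← mul_smul]
    exact congrArg Subtype.val hu
  · refine ⟨u₀, g ^ 3, u₀.2.1, u₀.2.2, ?_, ?_, ?_⟩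
    · rw [pow_succ, mul_smul, hg1, pow_two, hgg.2]
    · rw [pow_succ, mul_smul, hg2, pow_two, hgg.1]
    · rw [← map_pow] at hcube
      have := congrArg Subtype.val (Equiv.congr_fun hcube u₀)
      rw [inducedHom_apply] at this
      rw [← mul_smul]
      have e1 : ((k ^ 3 : H) : Y) = g ^ 3 * g ^ 3 := by
        change (g * g) ^ 3 = _
        rw [← pow_two, ← pow_mul, ← pow_add]
      rw [e1] at this
      exact this

/-- The partition of the stars according to their centres. -/
def partition (M : IsStarModel Y G c L r) : InvPartition Y V where
  toSetoid := Setoid.ker c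
  smul_rel := fun g a b hab => by
    change c (g • a) = c (g • b)
    rw [M.smul_centre, M.smul_centre, show c a = c b from hab]

/-- The centre of the stars in a block. -/
def blockCentre (M : IsStarModel Y G c L r) : M.partition.Block → W :=
  Quotient.lift c fun _ _ h => h

theorem blockCentre_blockOf (M : IsStarModel Y G c L r) (u : V) :
    M.blockCentre (M.partition.blockOf u) = c u := rfl

theorem blockCentre_injective (M : IsStarModel Y G c L r) : Function.Injective M.blockCentre := by
  intro B C
  obtain ⟨u, rfl⟩ := InvPartition.exists_blockOf B
  obtain ⟨w, rfl⟩ := InvPartition.exists_blockOf C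
  exact fun h => Quotient.sound h

theorem blockCentre_smul (M : IsStarModel Y G c L r) (g : Y) (B : M.partition.Block) :
    M.blockCentre (g • B) = g • M.blockCentre B := by
  obtain ⟨u, rfl⟩ := InvPartition.exists_blockOf B
  exact M.smul_centre g u

theorem blockOf_eq_iff (M : IsStarModel Y G c L r) {u : V} {B : M.partition.Block} :
    M.partition.blockOf u = B ↔ c u = M.blockCentre B :=
  ⟨fun h => by rw [← h]; rfl, fun h => M.blockCentre_injective h⟩

/-- Graphs on the stars in which every star is adjacent to stars at each of its leaves and nowhere
else. -/
structure Realizes (M : IsStarModel Y G c L r) (Γ : SimpleGraph V) : Prop where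
  symmetric : IsArcTransitive Y Γ 1
  mem : ∀ {p q}, Γ.Adj p q → c q ∈ L p
  exists_adj : ∀ p σ, σ ∈ L p → ∃ q, Γ.Adj p q ∧ c q = σ

/-- The orbit of the pair (u, h • u) is symmetric under reversal. Flag-transitivity spreads the
adjacency from one leaf of u to all leaves of all stars. -/
theorem exists_realizes [Finite V] (M : IsStarModel Y G c L r) (hG : IsArcTransitive Y G 1)
    (hr : 1 ≤ r) {τ σ : W} (hτσ : G.Adj τ σ) : ∃ Γ, M.Realizes Γ := by
  obtain ⟨u, h, rfl, hσ, h1, h2, hh⟩ := M.exists_swap hG hτσ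
  have hne : h • u ≠ u := fun he => hτσ.ne (by
    rw [← h1, ← M.smul_centre, he])
  have hadj := fun {p q} => orbitGraph_adj (p := p) (q := q) hh hne
  have hL : ∀ p, ∃ ρ, ρ ∈ L p := fun p => Set.nonempty_of_ncard_ne_zero (by rw [M.card]; omega)
  refine ⟨orbitGraph Y u (h • u), isArcTransitive_one ⟨fun g p q => ?_, fun p q => ?_⟩ ?_, ?_, ?_⟩
  · rw [hadj, hadj]
    constructor
    · rintro ⟨k, h3, h4⟩
      exact ⟨g⁻¹ * k, by rw [mul_smul, h3, inv_smul_smul], by rw [mul_smul, h4, inv_smul_smul]⟩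
    · rintro ⟨k, rfl, rfl⟩
      exact ⟨g * k, mul_smul _ _ _, mul_smul _ _ _⟩
  · obtain ⟨ρ, hρ⟩ := hL p
    obtain ⟨ρ', hρ'⟩ := hL q
    obtain ⟨g, hg, -⟩ := M.flag p q ρ ρ' hρ hρ'
    exact ⟨g, hg⟩
  · intro a b a' b' hab hab'
    obtain ⟨k, rfl, rfl⟩ := hadj.1 hab
    obtain ⟨k', rfl, rfl⟩ := hadj.1 hab'
    exact ⟨k' * k⁻¹, by rw [mul_smul, inv_smul_smul], by rw [mul_smul, inv_smul_smul]⟩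
  · intro p q hpq
    obtain ⟨k, rfl, rfl⟩ := hadj.1 hpq
    rw [M.smul_centre, M.smul_centre, h1]
    exact M.smul_mem.2 hσ
  · intro p ρ hρ
    obtain ⟨k, rfl, rfl⟩ := M.flag u p σ ρ hσ hρ
    exact ⟨k • h • u, hadj.2 ⟨k, rfl, rfl⟩, by rw [M.smul_centre, M.smul_centre, h1]⟩

namespace Realizes

variable {M : IsStarModel Y G c L r} {Γ : SimpleGraph V}

theorem mem_blocksAt (R : M.Realizes Γ) {u : V} {B : M.partition.Block} :
    B ∈ M.partition.blocksAt Γ u ↔ M.blockCentre B ∈ L u := by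
  rw [InvPartition.mem_blocksAt]
  constructor
  · rintro ⟨w, rfl, huw⟩
    exact R.mem huw
  · intro hB
    obtain ⟨w, huw, hw⟩ := R.exists_adj u _ hB
    exact ⟨w, M.blockOf_eq_iff.2 hw, huw⟩

theorem quotient_adj [Finite V] (R : M.Realizes Γ) {B C : M.partition.Block} :
    (M.partition.quotientGraph Γ).Adj B C ↔ G.Adj (M.blockCentre B) (M.blockCentre C) := by
  constructor
  · rintro ⟨-, u, rfl, w, rfl, huw⟩
    exact M.sub u (R.mem huw)
  · intro hBC
    obtain ⟨u, hu1, hu2⟩ := Set.nonempty_of_ncard_ne_zero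
      (show _ ≠ 0 by rw [M.three _ _ hBC]; norm_num)
    obtain ⟨w, huw, hw⟩ := R.exists_adj u _ hu2
    exact ⟨fun he => hBC.ne (congrArg _ he), u, M.blockOf_eq_iff.2 hu1, w,
      M.blockOf_eq_iff.2 hw, huw⟩

theorem ncard_trace [Finite V] (R : M.Realizes Γ) {B C : M.partition.Block}
    (hBC : (M.partition.quotientGraph Γ).Adj B C) : (M.partition.trace Γ B C).ncard = 3 := by
  rw [← M.three _ _ (R.quotient_adj.1 hBC)]
  congr 1
  ext u
  rw [InvPartition.mem_trace, R.mem_blocksAt, M.blockOf_eq_iff, and_comm]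
  rfl

end Realizes

end IsStarModel

end StarModel

/-! ### Parameters of the triple built from a family of stars -/

section Quotients

variable {Y V W : Type*} [Group Y] [MulAction Y V] [MulAction Y W] {G : SimpleGraph W}
  {c : V → W} {L : V → Set W} {r b : ℕ}

namespace IsStarModel

theorem blockCentre_surjective [Finite V] (M : IsStarModel Y G c L r) (hb : HasValency G b)
    (hb1 : 1 ≤ b) : Function.Surjective M.blockCentre := by
  intro τ
  obtain ⟨σ, hσ⟩ := Set.nonempty_of_ncard_ne_zero (show (G.neighborSet τ).ncard ≠ 0 by
    rw [hb]; omega)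
  obtain ⟨u, hu, -⟩ := Set.nonempty_of_ncard_ne_zero
    (show _ ≠ 0 by rw [M.three _ _ hσ]; norm_num)
  exact ⟨M.partition.blockOf u, hu⟩

/-- Counting pairs of a star with a given centre and a leaf of it gives v r = 3 b. -/
theorem ncard_carrier [Finite V] [Finite W] (M : IsStarModel Y G c L r) (hb : HasValency G b)
    (B : M.partition.Block) : (M.partition.carrier B).ncard * r = b * 3 := by
  rw [← hb (M.blockCentre B)]
  refine ncard_mul_eq_ncard_mul (fun u σ => σ ∈ L u) _ _ (fun u hu => ?_) fun σ hσ => ?_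
  · refine Eq.trans ?_ (M.card u)
    congr 1
    ext σ
    refine ⟨fun h => h.2, fun h => ⟨?_, h⟩⟩
    rw [← M.blockOf_eq_iff.1 hu]
    exact M.sub u h
  · rw [← M.three _ _ hσ]
    congr 1
    ext u
    exact and_congr_left' M.blockOf_eq_iff

namespace Realizes

variable {M : IsStarModel Y G c L r} {Γ : SimpleGraph V}

theorem ncard_blocksAt [Finite V] (R : M.Realizes Γ) (hb : HasValency G b) (hb1 : 1 ≤ b) (u : V) :
    (M.partition.blocksAt Γ u).ncard = r := by
  refine ((M.blockCentre_injective.injOn).ncard_image).symm.trans (Eq.trans ?_ (M.card u))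
  congr 1
  ext σ
  constructor
  · rintro ⟨B, hB, rfl⟩
    exact R.mem_blocksAt.1 hB
  · intro hσ
    obtain ⟨B, rfl⟩ := M.blockCentre_surjective hb hb1 σ
    exact ⟨B, R.mem_blocksAt.2 hσ, rfl⟩

theorem exists_iso [Finite V] (R : M.Realizes Γ) (hb : HasValency G b) (hb1 : 1 ≤ b) :
    ∃ φ : M.partition.quotientGraph Γ ≃g G, ∀ B, φ B = M.blockCentre B :=
  ⟨⟨Equiv.ofBijective _ ⟨M.blockCentre_injective, M.blockCentre_surjective hb hb1⟩,
    R.quotient_adj.symm⟩, fun _ => rfl⟩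

theorem ncard_neighborSet [Finite V] (R : M.Realizes Γ) (hb : HasValency G b) (hb1 : 1 ≤ b)
    (B : M.partition.Block) : ((M.partition.quotientGraph Γ).neighborSet B).ncard = b := by
  obtain ⟨φ, hφ⟩ := R.exists_iso hb hb1
  rw [← hb (φ B), ← (φ.injective.injOn).ncard_image]
  congr 1
  ext σ
  constructor
  · rintro ⟨C, hC, rfl⟩
    exact φ.map_adj_iff.2 hC
  · intro hσ
    obtain ⟨C, rfl⟩ := φ.surjective σ
    exact ⟨C, φ.map_adj_iff.1 hσ, rfl⟩

theorem inG [Finite V] [Finite W] (R : M.Realizes Γ) (hb : HasValency G b) (hb2 : 2 ≤ b)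
    (hrb : r < b) : M.partition.InG Γ where
  symmetric := R.symmetric
  nontrivial := by
    intro B
    have h1 := M.ncard_carrier hb B
    constructor
    · by_contra hle
      have : (M.partition.carrier B).ncard * r ≤ 1 * r := Nat.mul_le_mul_right r (by omega)
      omega
    · obtain ⟨C, hC⟩ := Set.nonempty_of_ncard_ne_zero
        (show ((M.partition.quotientGraph Γ).neighborSet B).ncard ≠ 0 by
          rw [R.ncard_neighborSet hb (by omega)]; omega)
      obtain ⟨u, rfl⟩ := InvPartition.exists_blockOf C
      rw [← Set.ncard_univ]
      refine Set.ncard_lt_ncard ⟨Set.subset_univ _, fun h => ?_⟩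
      exact hC.1 (h (Set.mem_univ u) : M.partition.blockOf u = B).symm
  two_le_valency := fun B => by rw [R.ncard_neighborSet hb (by omega)]; exact hb2
  -- If v were 3, then v r = 3 b would contradict r < b.
  not_multicover := by
    intro B C hBC h1
    have h2 := M.ncard_carrier hb B
    rw [← h1, R.ncard_trace hBC] at h2
    omega

theorem separatesPoints (R : M.Realizes Γ) (hsurj : Function.Surjective M.blockCentre)
    (B : M.partition.Block) : M.partition.SeparatesPoints Γ B := by
  intro u u' hu hu' he
  refine M.inj u u' ((M.blockOf_eq_iff.1 hu).trans (M.blockOf_eq_iff.1 hu').symm) ?_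
  ext σ
  obtain ⟨C, rfl⟩ := hsurj σ
  rw [← R.mem_blocksAt, ← R.mem_blocksAt, he]

theorem separatesBlocks [Finite V] (R : M.Realizes Γ) (B : M.partition.Block) :
    M.partition.SeparatesBlocks Γ B := by
  intro C D hC hD he
  by_contra hne
  obtain ⟨u, hu, h1, h2⟩ := M.sep _ _ _ (R.quotient_adj.1 hC) (R.quotient_adj.1 hD)
    fun h => hne (M.blockCentre_injective h)
  have h3 : u ∈ M.partition.trace Γ B C :=
    InvPartition.mem_trace.2 ⟨R.mem_blocksAt.2 h1, M.blockOf_eq_iff.2 hu⟩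
  rw [he, InvPartition.mem_trace, R.mem_blocksAt] at h3
  exact h2 h3.1

end Realizes

end IsStarModel

/-- The triple of the class `𝒢` obtained from a family of stars. -/
theorem IsStarModel.occurs {Y : Type v} {V W : Type u} [Group Y] [MulAction Y V] [MulAction Y W]
    [Finite V] [Finite W] {G : SimpleGraph W} {c : V → W} {L : V → Set W} {r b : ℕ}
    (M : IsStarModel Y G c L r) (hG : IsArcTransitive Y G 1) (hc : G.Connected)
    (hb : HasValency G b) (hb2 : 2 ≤ b) (hr1 : 1 ≤ r) (hrb : r < b)
    {InCase : ∀ (V : Type u) [MulAction Y V] (P : InvPartition Y V),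
      SimpleGraph V → P.Block → V → Prop}
    (hcase : ∀ (Γ : SimpleGraph V) (B : M.partition.Block) (u : V),
      (M.partition.carrier B).ncard * r = b * 3 →
      ((M.partition.quotientGraph Γ).neighborSet B).ncard = b →
      (M.partition.blocksAt Γ u).ncard = r →
      (∃ τ, Nonempty (M.partition.blockGroup B ≃*
        inducedPerm (MulAction.stabilizer Y τ) (G.neighborSet τ))) →
      InCase V M.partition Γ B u) : OccursAsQuotient Y G InCase := by
  obtain ⟨τ⟩ := hc.nonempty
  obtain ⟨σ, hσ⟩ := Set.nonempty_of_ncard_ne_zero (show (G.neighborSet τ).ncard ≠ 0 by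
    rw [hb]; omega)
  obtain ⟨Γ, R⟩ := M.exists_realizes hG hr1 hσ
  have hb1 : 1 ≤ b := by omega
  obtain ⟨φ, hφ⟩ := R.exists_iso hb hb1
  have hφg : ∀ (g : Y) (B : M.partition.Block), φ (g • B) = g • φ B := fun g B => by
    rw [hφ, hφ, M.blockCentre_smul]
  have hInG := R.inG hb hb2 hrb
  refine ⟨V, inferInstance, inferInstance, Γ, M.partition, hInG, fun hf => ⟨hInG, ?_, ?_⟩,
    fun B C hBC => R.ncard_trace hBC, fun B u _ => ?_, φ, hφg⟩
  · exact φ.connected_iff.2 hc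
  -- Taking centres is equivariant and onto, so elements that agree on the stars agree on G.
  · refine ⟨fun {g k} hgk => hf.eq_of_smul_eq_smul fun w => ?_⟩
    obtain ⟨B, rfl⟩ := M.blockCentre_surjective hb hb1 w
    obtain ⟨u, rfl⟩ := InvPartition.exists_blockOf B
    rw [M.blockCentre_blockOf, ← M.smul_centre, ← M.smul_centre, hgk]
  · refine hcase Γ B u (M.ncard_carrier hb B) (R.ncard_neighborSet hb hb1 B)
      (R.ncard_blocksAt hb hb1 u) ⟨φ B, ?_⟩
    obtain ⟨e⟩ := hInG.nonempty_blockGroup_mulEquiv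
      (R.separatesPoints (M.blockCentre_surjective hb hb1) B) (R.separatesBlocks B)
    obtain ⟨f⟩ := nonempty_inducedPerm_congr hInG.quot_vertexTransitive.1 hG.1.1 φ hφg B
    exact ⟨e.trans f⟩

end Quotients

/-! ### Families of stars in valency four -/

section Families

variable {Y W : Type*} [Group Y] [MulAction Y W] {G : SimpleGraph W}

/-- An invariant family of stars is a star model as soon as the conditions hold at one vertex. -/
theorem isStarModel_of_vertex (S : SubMulAction Y (W × Set W)) (hv : IsVertexTransitive Y G)
    (τ : W) {r : ℕ} (hsub : ∀ M, (τ, M) ∈ S → M ⊆ G.neighborSet τ)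
    (hcard : ∀ M, (τ, M) ∈ S → M.ncard = r)
    (hflag : ∀ M M' σ σ', (τ, M) ∈ S → (τ, M') ∈ S → σ ∈ M → σ' ∈ M' →
      ∃ g : Y, g • τ = τ ∧ g • M = M' ∧ g • σ = σ')
    (hthree : ∀ σ, G.Adj τ σ → {M | (τ, M) ∈ S ∧ σ ∈ M}.ncard = 3)
    (hsep : ∀ σ σ', G.Adj τ σ → G.Adj τ σ' → σ ≠ σ' → ∃ M, (τ, M) ∈ S ∧ σ ∈ M ∧ σ' ∉ M) :
    IsStarModel Y G (fun u : S => u.1.1) (fun u : S => u.1.2) r := by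
  -- Every star of the family is a translate of one centred at τ, so all conditions are transported
  -- from there.
  have hbase : ∀ u : S, ∃ (k : Y) (M : Set W), (τ, M) ∈ S ∧ k • τ = u.1.1 ∧ k • M = u.1.2 := by
    intro u
    obtain ⟨k, hk⟩ := hv.2 τ u.1.1
    refine ⟨k, k⁻¹ • u.1.2, ?_, hk, smul_inv_smul k _⟩
    have := S.smul_mem k⁻¹ u.2
    rwa [show k⁻¹ • u.1 = (τ, k⁻¹ • u.1.2) from Prod.ext (by rw [Prod.smul_fst, ← hk, inv_smul_smul])
      rfl] at this
  have hadj : ∀ (k : Y) (σ : W), G.Adj (k • τ) σ → G.Adj τ (k⁻¹ • σ) := fun k σ h => by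
    rw [← hv.1 k, smul_inv_smul]; exact h
  refine ⟨fun g u => rfl, fun g u => rfl, fun u u' h1 h2 => Subtype.ext (Prod.ext h1 h2), ?_, ?_, ?_,
    ?_, ?_⟩
  · intro u
    obtain ⟨k, M, hM, h1, h2⟩ := hbase u
    rw [← h1, ← h2, ← smul_neighborSet hv.1]
    exact Set.smul_set_mono (hsub M hM)
  · intro u
    obtain ⟨k, M, hM, h1, h2⟩ := hbase u
    rw [← h2, ncard_smul_set, hcard M hM]
  · intro u u' σ σ' hσ hσ'
    obtain ⟨k, M, hM, h1, h2⟩ := hbase u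
    obtain ⟨k', M', hM', h1', h2'⟩ := hbase u'
    rw [← h2] at hσ
    rw [← h2'] at hσ'
    obtain ⟨σ, hσ, rfl⟩ := hσ
    obtain ⟨σ', hσ', rfl⟩ := hσ'
    obtain ⟨g, g1, g2, g3⟩ := hflag M M' σ σ' hM hM' hσ hσ'
    refine ⟨k' * g * k⁻¹, Subtype.ext (Prod.ext ?_ ?_), ?_⟩
    · change (k' * g * k⁻¹) • u.1.1 = u'.1.1
      rw [← h1, ← h1', mul_smul, mul_smul, inv_smul_smul, g1]
    · change (k' * g * k⁻¹) • u.1.2 = u'.1.2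
      rw [← h2, ← h2', mul_smul, mul_smul, inv_smul_smul, g2]
    · change (k' * g * k⁻¹) • k • σ = k' • σ'
      rw [mul_smul, mul_smul, inv_smul_smul, g3]
  · intro τ' σ' h
    obtain ⟨k, rfl⟩ := hv.2 τ τ'
    rw [← hthree _ (hadj k σ' h)]
    refine Set.ncard_congr (fun u _ => k⁻¹ • u.1.2) ?_ ?_ ?_
    · rintro u ⟨hu1, hu2⟩
      have := S.smul_mem k⁻¹ u.2
      refine ⟨?_, Set.smul_mem_smul_set_iff.2 hu2⟩
      rwa [show k⁻¹ • u.1 = (τ, k⁻¹ • u.1.2) from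
        Prod.ext (by rw [Prod.smul_fst, hu1, inv_smul_smul]) rfl] at this
    · rintro u u' ⟨hu1, -⟩ ⟨hu1', -⟩ he
      exact Subtype.ext (Prod.ext (hu1.trans hu1'.symm) (MulAction.injective k⁻¹ he))
    · rintro M ⟨hM, hσ⟩
      refine ⟨⟨k • (τ, M), S.smul_mem k hM⟩, ⟨rfl, ?_⟩, inv_smul_smul k M⟩
      exact Set.mem_smul_set_iff_inv_smul_mem.2 hσ
  · intro τ' σ σ' h h' hne
    obtain ⟨k, rfl⟩ := hv.2 τ τ'
    obtain ⟨M, hM, h1, h2⟩ := hsep _ _ (hadj k σ h) (hadj k σ' h')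
      fun he => hne (MulAction.injective k⁻¹ he)
    exact ⟨⟨k • (τ, M), S.smul_mem k hM⟩, rfl, Set.mem_smul_set_iff_inv_smul_mem.2 h1,
      fun h3 => h2 (Set.mem_smul_set_iff_inv_smul_mem.1 h3)⟩

/-- The stars that miss exactly one neighbour of their centre. -/
def coSingletonStars (hv : IsVertexTransitive Y G) : SubMulAction Y (W × Set W) where
  carrier := {s | ∃ ρ, G.Adj s.1 ρ ∧ s.2 = G.neighborSet s.1 \ {ρ}}
  smul_mem' := by
    rintro g ⟨τ, M⟩ ⟨ρ, hρ, hM⟩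
    refine ⟨g • ρ, (hv.1 g τ ρ).2 hρ, ?_⟩
    change M = G.neighborSet τ \ {ρ} at hM
    change g • M = G.neighborSet (g • τ) \ {g • ρ}
    rw [hM, Set.smul_set_sdiff, smul_neighborSet hv.1, Set.smul_set_singleton]

theorem mem_coSingletonStars (hv : IsVertexTransitive Y G) {τ : W} {M : Set W} :
    (τ, M) ∈ coSingletonStars hv ↔ ∃ ρ, G.Adj τ ρ ∧ M = G.neighborSet τ \ {ρ} := Iff.rfl

/-- The missing neighbour, the centre and a leaf form a 2-arc, so flag-transitivity is
2-arc-transitivity. An arc lies on one star for each of the three neighbours that may be missing. -/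
theorem isStarModel_coSingletonStars [Finite W] (h : IsArcTransitive Y G 2) (hb : HasValency G 4)
    (τ : W) : IsStarModel Y G (fun u : coSingletonStars h.1 => u.1.1)
      (fun u : coSingletonStars h.1 => u.1.2) 3 := by
  have hinj : ∀ {ρ ρ'}, G.Adj τ ρ → G.neighborSet τ \ {ρ} = G.neighborSet τ \ {ρ'} → ρ = ρ' := by
    intro ρ ρ' hρ he
    by_contra hne
    have h1 : ρ ∈ G.neighborSet τ \ {ρ'} := ⟨hρ, hne⟩
    rw [← he] at h1
    exact h1.2 rfl
  refine isStarModel_of_vertex _ h.1 τ ?_ ?_ ?_ ?_ ?_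
  · intro M hM
    obtain ⟨ρ, -, rfl⟩ := (mem_coSingletonStars h.1).1 hM
    exact Set.sdiff_subset
  · intro M hM
    obtain ⟨ρ, hρ, rfl⟩ := (mem_coSingletonStars h.1).1 hM
    exact hb.ncard_sdiff hρ
  · intro M M' σ σ' hM hM' hσ hσ'
    obtain ⟨ρ, hρ, rfl⟩ := (mem_coSingletonStars h.1).1 hM
    obtain ⟨ρ', hρ', rfl⟩ := (mem_coSingletonStars h.1).1 hM'
    obtain ⟨g, g1, g2, g3⟩ := h.exists_two (a := ρ) (b := τ) (c := σ) (a' := ρ') (b' := τ)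
      (c' := σ') (SimpleGraph.Adj.symm hρ) hσ.1 (Ne.symm hσ.2) (SimpleGraph.Adj.symm hρ') hσ'.1
      (Ne.symm hσ'.2)
    refine ⟨g, g2, ?_, g3⟩
    rw [Set.smul_set_sdiff, smul_neighborSet h.1.1, Set.smul_set_singleton, g1, g2]
  · intro σ hσ
    have : {M | (τ, M) ∈ coSingletonStars h.1 ∧ σ ∈ M} =
        (fun ρ => G.neighborSet τ \ {ρ}) '' (G.neighborSet τ \ {σ}) := by
      ext M
      constructor
      · rintro ⟨hM, hσM⟩
        obtain ⟨ρ, hρ, rfl⟩ := (mem_coSingletonStars h.1).1 hM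
        exact ⟨ρ, ⟨hρ, fun he => hσM.2 (Eq.symm he)⟩, rfl⟩
      · rintro ⟨ρ, ⟨hρ, hne⟩, rfl⟩
        exact ⟨⟨ρ, hρ, rfl⟩, hσ, fun he => hne (Eq.symm he)⟩
    rw [this, Set.InjOn.ncard_image, hb.ncard_sdiff hσ]
    intro ρ hρ ρ' _ he
    exact hinj hρ.1 he
  · intro σ σ' hσ hσ' hne
    exact ⟨G.neighborSet τ \ {σ'}, ⟨σ', hσ', rfl⟩, ⟨hσ, hne⟩, fun h1 => h1.2 rfl⟩

/-- The stars with two leaves. -/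
def pairStars (hv : IsVertexTransitive Y G) : SubMulAction Y (W × Set W) where
  carrier := {s | ∃ ρ σ, G.Adj s.1 ρ ∧ G.Adj s.1 σ ∧ ρ ≠ σ ∧ s.2 = {ρ, σ}}
  smul_mem' := by
    rintro g ⟨τ, M⟩ ⟨ρ, σ, hρ, hσ, hne, rfl⟩
    refine ⟨g • ρ, g • σ, (hv.1 g τ ρ).2 hρ, (hv.1 g τ σ).2 hσ,
      fun he => hne (MulAction.injective g he), ?_⟩
    change g • ({ρ, σ} : Set W) = {g • ρ, g • σ}
    rw [Set.smul_set_insert, Set.smul_set_singleton]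

theorem mem_pairStars (hv : IsVertexTransitive Y G) {τ σ : W} {M : Set W}
    (hM : (τ, M) ∈ pairStars hv) (hσ : σ ∈ M) :
    G.Adj τ σ ∧ ∃ ρ, G.Adj τ ρ ∧ ρ ≠ σ ∧ M = {ρ, σ} := by
  obtain ⟨ρ, ρ', h1, h2, hne, rfl⟩ := hM
  rcases hσ with rfl | rfl
  · exact ⟨h1, ρ', h2, hne.symm, Set.pair_comm _ _⟩
  · exact ⟨h2, ρ, h1, hne, rfl⟩

/-- A pair with a distinguished leaf is a 2-arc, so flag-transitivity is again 2-arc-transitivity.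
An arc lies on one star for each of the three possible second leaves. -/
theorem isStarModel_pairStars [Finite W] (h : IsArcTransitive Y G 2) (hb : HasValency G 4)
    (τ : W) : IsStarModel Y G (fun u : pairStars h.1 => u.1.1)
      (fun u : pairStars h.1 => u.1.2) 2 := by
  refine isStarModel_of_vertex _ h.1 τ ?_ ?_ ?_ ?_ ?_
  · intro M hM σ hσ
    exact (mem_pairStars h.1 hM hσ).1
  · rintro M ⟨ρ, σ, -, -, hne, rfl⟩
    exact Set.ncard_pair hne
  · intro M M' σ σ' hM hM' hσ hσ'
    obtain ⟨h1, ρ, h2, hne, rfl⟩ := mem_pairStars h.1 hM hσ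
    obtain ⟨h1', ρ', h2', hne', rfl⟩ := mem_pairStars h.1 hM' hσ'
    obtain ⟨g, g1, g2, g3⟩ := h.exists_two h2.symm h1 hne h2'.symm h1' hne'
    exact ⟨g, g2, by rw [Set.smul_set_insert, Set.smul_set_singleton, g1, g3], g3⟩
  · intro σ hσ
    have : {M | (τ, M) ∈ pairStars h.1 ∧ σ ∈ M} =
        (fun ρ => ({ρ, σ} : Set W)) '' (G.neighborSet τ \ {σ}) := by
      ext M
      constructor
      · rintro ⟨hM, hσM⟩
        obtain ⟨-, ρ, h2, hne, rfl⟩ := mem_pairStars h.1 hM hσM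
        exact ⟨ρ, ⟨h2, hne⟩, rfl⟩
      · rintro ⟨ρ, ⟨hρ, hne⟩, rfl⟩
        exact ⟨⟨ρ, σ, hρ, hσ, hne, rfl⟩, Or.inr rfl⟩
    rw [this, Set.InjOn.ncard_image, hb.ncard_sdiff hσ]
    intro ρ hρ ρ' hρ' he
    have he' : ({ρ, σ} : Set W) = {ρ', σ} := he
    have h1 : ρ ∈ ({ρ', σ} : Set W) := by rw [← he']; exact Or.inl rfl
    exact h1.resolve_right hρ.2
  · intro σ σ' hσ hσ' hne
    have h1 : ({σ, σ'} : Set W).ncard < (G.neighborSet τ).ncard := by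
      rw [Set.ncard_pair hne, hb]; norm_num
    obtain ⟨ρ, hρ, hρ'⟩ := Set.exists_mem_notMem_of_ncard_lt_ncard h1
    refine ⟨{ρ, σ}, ⟨ρ, σ, hρ, hσ, fun he => hρ' (Or.inl he), rfl⟩, Or.inr rfl, ?_⟩
    rintro (he | he)
    · exact hρ' (Or.inr he.symm)
    · exact hne (Eq.symm he)

end Families

theorem occurs_caseA {Y : Type v} {W : Type u} [Group Y] [MulAction Y W] [Finite W]
    {G : SimpleGraph W} (hc : G.Connected) (hb : HasValency G 4) (h : IsArcTransitive Y G 2) :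
    OccursAsQuotient Y G (fun _ _ P => P.CaseA) := by
  obtain ⟨τ⟩ := hc.nonempty
  have h1 := h.one_of_two fun u => by rw [hb u]; norm_num
  refine (isStarModel_coSingletonStars h hb τ).occurs h1 hc hb (by norm_num) (by norm_num)
    (by norm_num) fun Γ B u h2 h3 h4 ⟨σ, ⟨e⟩⟩ => ⟨by omega, h3, h4, ?_⟩
  have hS : Nat.card (G.neighborSet σ) = 4 := by rw [Nat.card_coe_set_eq, hb σ]
  rcases degree_four_cases hS (twelve_le_card hS (h.twoTransitive σ)) with ⟨⟨f⟩, -⟩ | ⟨⟨f⟩, -⟩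
  exacts [Or.inl ⟨e.trans f⟩, Or.inr ⟨e.trans f⟩]

theorem occurs_caseB {Y : Type v} {W : Type u} [Group Y] [MulAction Y W] [Finite W]
    {G : SimpleGraph W} (hc : G.Connected) (hb : HasValency G 4) (h : IsArcTransitive Y G 2) :
    OccursAsQuotient Y G (fun _ _ P => P.CaseB) := by
  obtain ⟨τ⟩ := hc.nonempty
  have h1 := h.one_of_two fun u => by rw [hb u]; norm_num
  refine (isStarModel_pairStars h hb τ).occurs h1 hc hb (by norm_num) (by norm_num)
    (by norm_num) fun Γ B u h2 h3 h4 ⟨σ, ⟨e⟩⟩ => ⟨by omega, h3, h4, ?_⟩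
  have hS : Nat.card (G.neighborSet σ) = 4 := by rw [Nat.card_coe_set_eq, hb σ]
  rcases degree_four_cases hS (twelve_le_card hS (h.twoTransitive σ)) with ⟨⟨f⟩, -⟩ | ⟨⟨f⟩, -⟩
  exacts [Or.inl ⟨e.trans f⟩, Or.inr ⟨e.trans f⟩]

theorem exists_fanoLine_image {π : Equiv.Perm (Fin 7)} (hπ : π ∈ fanoAut) (i : Fin 7) :
    ∃ j, π '' (fanoLine i : Set (Fin 7)) = fanoLine j := by
  have h3 : ∀ i : Fin 7, (fanoLine i).card = 3 := by decide
  obtain ⟨x, y, hxy, hx, hy⟩ : ∃ x y, x ≠ y ∧ x ∈ fanoLine i ∧ y ∈ fanoLine i := by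
    revert i; decide
  obtain ⟨j, h1, h2, h4⟩ := exists_fanoLine (π x) (π y) (π.injective.ne hxy)
  refine ⟨j, Set.eq_of_subset_of_ncard_le ?_ ?_⟩
  · rintro _ ⟨z, hz, rfl⟩
    by_cases hzx : z = x
    · rwa [hzx]
    · rcases eq_or_eq_third i x y z hx hy hz hxy hzx with rfl | rfl
      · exact h2
      · rw [mem_fanoAut.1 hπ]
        exact h4
  · rw [Set.ncard_image_of_injective _ π.injective, Set.ncard_coe_finset, Set.ncard_coe_finset, h3,
      h3]

/-- The collineations are transitive on the flags. -/
theorem exists_fanoAut_flag {i j p q : Fin 7} (hp : p ∈ fanoLine i) (hq : q ∈ fanoLine j) :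
    ∃ π ∈ fanoAut, π '' (fanoLine i : Set (Fin 7)) = fanoLine j ∧ π p = q := by
  have hex : ∀ i p : Fin 7, p ∈ fanoLine i → ∃ y z, y ∈ fanoLine i ∧ p ≠ y ∧ z ≠ p ∧ z ≠ y ∧
      z ≠ third p y := by decide
  obtain ⟨y, z, hy, h1, h2, h3, h4⟩ := hex i p hp
  obtain ⟨y', z', hy', h1', h2', h3', h4'⟩ := hex j q hq
  obtain ⟨π, hπ, ha, hb, -⟩ := exists_fanoAut_triangle h1 h2 h3 h4 h1' h2' h3' h4'
  refine ⟨π, hπ, ?_, ha⟩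
  obtain ⟨k, hk⟩ := exists_fanoLine_image hπ i
  have hpk : q ∈ fanoLine k := by
    rw [← ha, ← Finset.mem_coe, ← hk]; exact ⟨p, hp, rfl⟩
  have hyk : y' ∈ fanoLine k := by
    rw [← hb, ← Finset.mem_coe, ← hk]; exact ⟨y, hy, rfl⟩
  rw [hk, fanoLine_unique k j q y' h1' hpk hyk hq hy']

/-! ### The family of Fano lines in valency seven -/

section Families

variable {Y W : Type*} [Group Y] [MulAction Y W] {G : SimpleGraph W}

/-- The local actions at the vertices of a vertex-transitive graph are isomorphic. -/
theorem IsVertexTransitive.nonempty_inducedPerm_mulEquiv (hv : IsVertexTransitive Y G) (τ σ : W) :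
    Nonempty (inducedPerm (MulAction.stabilizer Y τ) (G.neighborSet τ) ≃*
      inducedPerm (MulAction.stabilizer Y σ) (G.neighborSet σ)) := by
  obtain ⟨g, rfl⟩ := hv.2 τ σ
  let ε : G.neighborSet τ ≃ G.neighborSet (g • τ) :=
    (MulAction.toPerm g).subtypeEquiv fun x => (hv.1 g τ x).symm
  have hε : ∀ x, ((ε x : G.neighborSet (g • τ)) : W) = g • (x : W) := fun x => rfl
  have hε' : ∀ x, ((ε.symm x : G.neighborSet τ) : W) = g⁻¹ • (x : W) := fun x => by
    rw [eq_inv_smul_iff, ← hε, ε.apply_symm_apply]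
  have hmap : (inducedPerm (MulAction.stabilizer Y τ) (G.neighborSet τ)).map
      ε.permCongrHom.toMonoidHom =
      inducedPerm (MulAction.stabilizer Y (g • τ)) (G.neighborSet (g • τ)) := by
    ext π
    constructor
    · rintro ⟨ρ, ⟨k, hk, hρ⟩, rfl⟩
      refine ⟨g * k * g⁻¹, ?_, fun x => ?_⟩
      · rw [MulAction.mem_stabilizer_iff, mul_smul, mul_smul, inv_smul_smul,
          MulAction.mem_stabilizer_iff.1 hk]
      · change ((ε (ρ (ε.symm x)) : G.neighborSet (g • τ)) : W) = _
        rw [hε, hρ, hε', mul_smul, mul_smul]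
    · rintro ⟨k, hk, hπ⟩
      refine ⟨ε.symm.permCongr π, ⟨g⁻¹ * k * g, ?_, fun x => ?_⟩, ?_⟩
      · rw [MulAction.mem_stabilizer_iff, mul_smul, mul_smul, MulAction.mem_stabilizer_iff.1 hk,
          inv_smul_smul]
      · change ((ε.symm (π (ε x)) : G.neighborSet τ) : W) = _
        rw [hε', hπ, hε, mul_smul, mul_smul]
      · refine Equiv.ext fun x => ?_
        change ε (ε.symm (π (ε (ε.symm x)))) = π x
        rw [ε.apply_symm_apply, ε.apply_symm_apply]
  rw [← hmap]
  exact ⟨Subgroup.equivMapOfInjective _ _ ε.permCongrHom.injective⟩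

/-- The images of the stars `(τ, M i)`. -/
def starImages (Y : Type*) {W ι : Type*} [Group Y] [MulAction Y W] (τ : W) (M : ι → Set W) :
    SubMulAction Y (W × Set W) where
  carrier := {s | ∃ (g : Y) (i : ι), g • (τ, M i) = s}
  smul_mem' := by
    rintro k _ ⟨g, i, rfl⟩
    exact ⟨k * g, i, mul_smul k g _⟩

/-- The local group at τ determines a Fano plane on the neighbours of τ, whose lines are the leaf
sets of the stars at τ. The translates of these stars give the family at the other vertices. -/
theorem exists_isStarModel_of_psl [Finite W] (hv : IsVertexTransitive Y G) (τ : W)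
    (hb : (G.neighborSet τ).ncard = 7)
    (hp : Nonempty (inducedPerm (MulAction.stabilizer Y τ) (G.neighborSet τ) ≃*
      Matrix.ProjectiveSpecialLinearGroup (Fin 3) (ZMod 2))) :
    ∃ S : SubMulAction Y (W × Set W),
      IsStarModel Y G (fun u : S => u.1.1) (fun u : S => u.1.2) 3 := by
  obtain ⟨e, he⟩ := exists_fano_coordinates (S := G.neighborSet τ)
    (by rw [Nat.card_coe_set_eq, hb]) _ hp
  let pt : Fin 7 → W := fun x => (e.symm x : G.neighborSet τ)
  have hpt : Function.Injective pt := Subtype.val_injective.comp e.symm.injective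
  have hadj : ∀ x, G.Adj τ (pt x) := fun x => (e.symm x).2
  have hsurj : ∀ σ, G.Adj τ σ → ∃ x, pt x = σ := fun σ hσ =>
    ⟨e ⟨σ, hσ⟩, by change ((e.symm (e ⟨σ, hσ⟩) : G.neighborSet τ) : W) = σ; rw [e.symm_apply_apply]⟩
  let ln : Fin 7 → Set W := fun i => pt '' (fanoLine i : Set (Fin 7))
  have hmem : ∀ x i, pt x ∈ ln i ↔ x ∈ fanoLine i := fun x i => by
    rw [← Finset.mem_coe]; exact hpt.mem_set_image
  have hln : Function.Injective ln := fun i j hij => by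
    have h1 : (fanoLine i : Set (Fin 7)) = fanoLine j := hpt.image_injective hij
    have h2 : ∀ i j, fanoLine i = fanoLine j → i = j := by decide
    exact h2 i j (Finset.coe_injective h1)
  have hsmul : ∀ (g : Y) (π : Equiv.Perm (Fin 7)) (i : Fin 7), (∀ x, g • pt x = pt (π x)) →
      g • ln i = pt '' (π '' (fanoLine i : Set (Fin 7))) := fun g π i hg => by
    rw [Set.image_image]
    change (g • ·) '' (pt '' _) = _
    rw [Set.image_image]
    exact Set.image_congr fun x _ => hg x
  have hlift : ∀ π ∈ fanoAut, ∃ g : Y, g • τ = τ ∧ ∀ x, g • pt x = pt (π x) := by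
    intro π hπ
    rw [← he, mem_coordGroup] at hπ
    obtain ⟨ρ, ⟨g, hg, hρ⟩, h⟩ := hπ
    refine ⟨g, hg, fun x => ?_⟩
    have h1 := h (e.symm x)
    rw [e.apply_symm_apply] at h1
    change g • ((e.symm x : G.neighborSet τ) : W) = ((e.symm (π x) : G.neighborSet τ) : W)
    rw [h1, e.symm_apply_apply, hρ]
  have hdrop : ∀ g : Y, g • τ = τ → ∃ π ∈ fanoAut, ∀ x, g • pt x = pt (π x) := by
    intro g hg
    have hS := smul_mem_neighborSet hv.1 τ
    let ρ := inducedHom (MulAction.stabilizer Y τ) (G.neighborSet τ) hS ⟨g, hg⟩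
    have hρ : ρ ∈ inducedPerm (MulAction.stabilizer Y τ) (G.neighborSet τ) :=
      ⟨g, hg, fun x => rfl⟩
    refine ⟨e.permCongr ρ, ?_, fun x => ?_⟩
    · rw [← he, mem_coordGroup]
      refine ⟨ρ, hρ, fun x => ?_⟩
      rw [Equiv.permCongr_apply, e.symm_apply_apply]
    · change _ = ((e.symm (e (ρ (e.symm x))) : G.neighborSet τ) : W)
      rw [e.symm_apply_apply]
      rfl
  -- The stabilizer of τ acts by collineations, so translation produces no stars at τ other than the
  -- seven lines.
  have hS : ∀ M, (τ, M) ∈ starImages Y τ ln ↔ ∃ i, ln i = M := by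
    intro M
    constructor
    · rintro ⟨g, i, hg⟩
      obtain ⟨π, hπ, h1⟩ := hdrop g (congrArg Prod.fst hg)
      obtain ⟨j, hj⟩ := exists_fanoLine_image hπ i
      refine ⟨j, ?_⟩
      rw [← show g • ln i = M from congrArg Prod.snd hg, hsmul g π i h1, hj]
    · rintro ⟨i, rfl⟩
      exact ⟨1, i, one_smul Y _⟩
  refine ⟨starImages Y τ ln, isStarModel_of_vertex _ hv τ ?_ ?_ ?_ ?_ ?_⟩
  · intro M hM
    obtain ⟨i, rfl⟩ := (hS M).1 hM
    rintro _ ⟨x, -, rfl⟩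
    exact hadj x
  · intro M hM
    obtain ⟨i, rfl⟩ := (hS M).1 hM
    rw [Set.ncard_image_of_injective _ hpt, Set.ncard_coe_finset]
    clear hM; revert i; decide
  · intro M M' σ σ' hM hM' hσ hσ'
    obtain ⟨i, rfl⟩ := (hS M).1 hM
    obtain ⟨j, rfl⟩ := (hS M').1 hM'
    obtain ⟨p, hp, rfl⟩ := hσ
    obtain ⟨q, hq, rfl⟩ := hσ'
    obtain ⟨π, hπ, h1, h2⟩ := exists_fanoAut_flag hp hq
    obtain ⟨g, hg, h3⟩ := hlift π hπ
    exact ⟨g, hg, by rw [hsmul g π i h3, h1], by rw [h3, h2]⟩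
  · intro σ hσ
    obtain ⟨x, rfl⟩ := hsurj σ hσ
    have : {M | (τ, M) ∈ starImages Y τ ln ∧ pt x ∈ M} =
        ln '' (Finset.univ.filter fun i => x ∈ fanoLine i : Finset (Fin 7)) := by
      ext M
      constructor
      · rintro ⟨hM, hx⟩
        obtain ⟨i, rfl⟩ := (hS M).1 hM
        exact ⟨i, by simpa using (hmem x i).1 hx, rfl⟩
      · rintro ⟨i, hi, rfl⟩
        exact ⟨(hS _).2 ⟨i, rfl⟩, (hmem x i).2 (by simpa using hi)⟩
    rw [this, Set.ncard_image_of_injective _ hln, Set.ncard_coe_finset]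
    clear this hσ
    revert x; decide
  · intro σ σ' hσ hσ' hne
    obtain ⟨x, rfl⟩ := hsurj σ hσ
    obtain ⟨y, rfl⟩ := hsurj σ' hσ'
    have hex : ∀ x y : Fin 7, x ≠ y → ∃ i, x ∈ fanoLine i ∧ y ∉ fanoLine i := by decide
    obtain ⟨i, h1, h2⟩ := hex x y fun h => hne (by rw [h])
    exact ⟨ln i, (hS _).2 ⟨i, rfl⟩, (hmem x i).2 h1, fun h => h2 ((hmem y i).1 h)⟩

end Families

/-- Case (c) describes the group on the vertices of B. Two traces meet in one point, so points and
blocks are separated and the same group is induced on the neighbours of B. -/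
theorem InvPartition.InG.nonempty_nbrGroup_mulEquiv_psl {X V : Type*} [Group X] [MulAction X V]
    [Finite V] {P : InvPartition X V} {Γ : SimpleGraph V} (h : P.InG Γ)
    (hk : ∀ B C : P.Block, (P.quotientGraph Γ).Adj B C → (P.trace Γ B C).ncard = 3)
    {B : P.Block} {u : V} (hC : P.CaseC Γ B u) :
    Nonempty (P.nbrGroup Γ B ≃* Matrix.ProjectiveSpecialLinearGroup (Fin 3) (ZMod 2)) := by
  obtain ⟨hv, hb, hr, hpsl⟩ := hC
  obtain ⟨l, hl⟩ := h.exists_meetIn (h.two_arc_of_psl hk hv hb hpsl).2 B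
  obtain rfl : l = 1 := by rcases h.parameters hk hl B u with h | h | h | h <;> omega
  obtain ⟨φ⟩ := h.nonempty_blockGroup_mulEquiv
    (h.separatesPoints_of_meetIn_one hl (fun w => (h.ncard_blocksAt w u).trans hr) (by norm_num) B)
    (separatesBlocks_of_meetIn hk hl (by norm_num) B)
  obtain ⟨ψ⟩ := hpsl
  exact ⟨φ.symm.trans ψ⟩

/-- Necessity transports the local action along the equivariant isomorphism; sufficiency comes from
the stars formed by Fano lines. -/
theorem occurs_caseC_iff {Y : Type v} {W : Type u} [Group Y] [MulAction Y W] [Finite W]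
    {G : SimpleGraph W} (τ : W) (hc : G.Connected) (hb : HasValency G 7)
    (h : IsArcTransitive Y G 1) :
    OccursAsQuotient Y G (fun _ _ P => P.CaseC) ↔
      Nonempty (inducedPerm (MulAction.stabilizer Y τ) (G.neighborSet τ) ≃*
        Matrix.ProjectiveSpecialLinearGroup (Fin 3) (ZMod 2)) := by
  constructor
  · rintro ⟨V, _, _, Γ, P, hG, -, hk, hC, φ, hφ⟩
    obtain ⟨B, rfl⟩ := φ.surjective τ
    obtain ⟨u, rfl⟩ := Quotient.exists_rep B
    obtain ⟨ψ⟩ := hG.nonempty_nbrGroup_mulEquiv_psl hk (hC (P.blockOf u) u rfl)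
    obtain ⟨θ⟩ := nonempty_inducedPerm_congr hG.quot_arcTransitive.1.1 h.1.1 φ hφ (P.blockOf u)
    exact ⟨θ.symm.trans ψ⟩
  · intro hp
    obtain ⟨S, M⟩ := exists_isStarModel_of_psl h.1 τ (hb τ) hp
    refine M.occurs h hc hb (by norm_num) (by norm_num) (by norm_num)
      fun Γ B u h2 h3 h4 ⟨σ, ⟨e⟩⟩ => ⟨by omega, h3, h4, ?_⟩
    obtain ⟨f⟩ := hp
    obtain ⟨k⟩ := h.1.nonempty_inducedPerm_mulEquiv σ τ
    exact ⟨(e.trans k).trans f⟩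

end SymmQuot

theorem theorem4p1 :
    -- the characterization and the description of `Γ`
    (∀ (V : Type*) [Finite V] (X : Type*) [Group X] [MulAction X V] (Γ : SimpleGraph V)
      (P : InvPartition X V), P.InGHat Γ →
      ∀ (B C : P.Block) (u : V), (P.quotientGraph Γ).Adj B C → u ∈ P.carrier B →
        (P.trace Γ B C).ncard = 3 →
        (IsArcTransitive X (P.quotientGraph Γ) 2 ↔
          P.CaseA Γ B u ∨ P.CaseB Γ B u ∨ P.CaseC Γ B u ∨ P.CaseD Γ B u) ∧
        (P.CaseA Γ B u → P.ConclusionA Γ B) ∧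
        (P.CaseB Γ B u → P.ConclusionB Γ B) ∧
        (P.CaseC Γ B u → P.ConclusionC Γ) ∧
        (P.CaseD Γ B u → P.ConclusionD Γ)) ∧
    -- which graphs occur as quotients in the cases (a) and (b)
    (∀ (W : Type*) [Finite W] (Y : Type*) [Group Y] [MulAction Y W] (G : SimpleGraph W),
      G.Connected → HasValency G 4 → IsArcTransitive Y G 2 →
        OccursAsQuotient Y G (fun _ _ P => P.CaseA) ∧
        OccursAsQuotient Y G (fun _ _ P => P.CaseB)) ∧
    -- which graphs occur as quotients in the case (c)
    (∀ (W : Type*) [Finite W] (Y : Type*) [Group Y] [MulAction Y W] (G : SimpleGraph W)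
      (τ : W), G.Connected → HasValency G 7 → IsArcTransitive Y G 1 →
        (OccursAsQuotient Y G (fun _ _ P => P.CaseC) ↔
          Nonempty (inducedPerm (MulAction.stabilizer Y τ) (G.neighborSet τ) ≃*
            Matrix.ProjectiveSpecialLinearGroup (Fin 3) (ZMod 2)))) := by
  refine ⟨?_, ?_, ?_⟩
  · intro V _ X _ _ Γ P h B C u hBC hu hk3
    have hk : ∀ B C : P.Block, (P.quotientGraph Γ).Adj B C → (P.trace Γ B C).ncard = 3 :=
      fun B' C' h' => (h.toInG.ncard_trace h' hBC).trans hk3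
    obtain rfl : P.blockOf u = B := hu
    exact ⟨h.toInG.two_arc_iff hk _ u, h.conclusionA hk u, h.conclusionB hk u, h.conclusionC hk u,
      h.toInG.conclusionD hk _ u⟩
  · intro W _ Y _ _ G hc hb h
    exact ⟨occurs_caseA hc hb h, occurs_caseB hc hb h⟩
  · intro W _ Y _ _ G τ hc hb h
    exact occurs_caseC_iff τ hc hb h
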